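/- Let $M=(\mathbb R^3,g)$, where $g$ is a smooth Riemannian metric on $\mathbb R^3$ which equals the Euclidean metric on $\{|x|>R_0\}$ for some $R_0>0$. Let $H:=-\frac12\Delta_M$, where $\Delta_M$ is the Laplace–Beltrami operator of $g$, and let $H_0:=-\frac12\Delta$ be the Euclidean Hamiltonian. Write $\langle x\rangle=(1+|x|^2)^{1/2}$, let $L^2(M)$ be taken with respect to the Riemannian volume $dg$, and put $\|u\|_{H^{m,l}(M)}:=\|\langle x\rangle^l(1+H)^{m/2}u\|_{L^2(M)}$, $H^m(M):=H^{m,0}(M)$. For $R>0$ let $\varphi_R:\mathbb R^3\to\mathbb R$ denote a smooth bump function adapted to the scale $R$: it is supported on $\{|x|\le 2R\}$, equals $1$ on $\{|x|\le R\}$, and satisfies $|\nabla^n\varphi_R|\le A_nR^{-n}$ for all $n\ge 0$, with given constants $A_n$ independent of $R$. Let $\sigma>0$ be sufficiently small (smaller than an absolute constant). Then there is a constant $C>0$, depending only on $M$, $R_0$, $\sigma$ and $(A_n)_{n\ge0}$, such that for every $R\ge 10R_0$ and every such $\varphi_R$ there exist continuous linear operators $P_{in},P_{out}$ on the Schwartz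 space $\mathcal S(\mathbb R^3)$ (allowed to depend on $M,R_0,\sigma,(A_n),R,\varphi_R$) with $$(1-\varphi_R)H^2=(1-\varphi_R)H^2P_{in}+(1-\varphi_R)H^2P_{out}\quad\text{on }\mathcal S(\mathbb R^3),$$ and such that for every $s>0$ and every Schwartz function $f$ $$\|e^{isH_0}(1-\varphi_R)H^2P_{in}f\|_{H^{2,-8}(M)}\le C(R^2+|s|)^{-1-\sigma}\|f\|_{H^{20}(M)}$$ and $$\|\langle x\rangle^{3/2+\sigma}(1-\varphi_R)H^2P_{out}e^{isH_0}f\|_{L^2(M)}\le C(R^2+|s|)^{-1-\sigma}\|f\|_{H^{18,11}(M)}.$$ -/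

import Mathlib

open scoped SchwartzMap ENNReal ContDiff FourierTransform

noncomputable section

/-- Three-dimensional Euclidean space. -/
abbrev E3 : Type := EuclideanSpace ℝ (Fin 3)

/-- A smooth Riemannian metric on `ℝ³`, given by its matrix `(g_ij)` in the standard coordinates,
which equals the Euclidean metric outside of the ball `{|x| ≤ R₀}`. -/
structure CompactPerturbation (R₀ : ℝ) where
  g : E3 → Matrix (Fin 3) (Fin 3) ℝ
  smooth : ∀ i j, ContDiff ℝ ∞ (fun x => g x i j)
  posDef : ∀ x, (g x).PosDef
  euclidean : ∀ x, R₀ < ‖x‖ → g x = 1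

/-- The Euclidean partial derivative `∂_i u`. -/
def partialDeriv (i : Fin 3) (u : E3 → ℂ) (x : E3) : ℂ :=
  fderiv ℝ u x (EuclideanSpace.single i 1)

/-- The weight `⟨x⟩ = (1 + |x|²)^{1/2}`. -/
def japaneseBracket (x : E3) : ℝ := Real.sqrt (1 + ‖x‖ ^ 2)

namespace CompactPerturbation

variable {R₀ : ℝ} (M : CompactPerturbation R₀)

/-- The Riemannian volume density `√(det g_ij)`. -/
def density (x : E3) : ℝ := Real.sqrt (M.g x).det

/-- The Riemannian volume measure `dg = √(det g_ij) dx`. -/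
def vol : MeasureTheory.Measure E3 :=
  MeasureTheory.volume.withDensity (fun x => ENNReal.ofReal (M.density x))

/-- The Laplace-Beltrami operator
`Δ_M u = (det g)^{-1/2} ∂_i ((det g)^{1/2} g^{ij} ∂_j u)`. -/
def laplaceBeltrami (u : E3 → ℂ) (x : E3) : ℂ :=
  ((M.density x)⁻¹ : ℝ) *
    ∑ i, partialDeriv i
      (fun y => ∑ j, ((M.density y * (M.g y)⁻¹ i j : ℝ) : ℂ) * partialDeriv j u y) x

/-- The Hamiltonian `H = -½ Δ_M`. -/
def hamiltonian (u : E3 → ℂ) (x : E3) : ℂ := -(1 / 2) * M.laplaceBeltrami u x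

/-- The operator `1 + H`. -/
def onePlusH (u : E3 → ℂ) (x : E3) : ℂ := u x + M.hamiltonian u x

/-- The `L²(M)` norm, with values in `[0, ∞]`. -/
def normL2 (u : E3 → ℂ) : ℝ≥0∞ := MeasureTheory.eLpNorm u 2 M.vol

/-- The weighted Sobolev norm of even order `m = 2k`,
`‖u‖_{H^{2k,l}(M)} = ‖⟨x⟩^l (1 + H)^k u‖_{L²(M)}`, with values in `[0, ∞]`. -/
def sobolevNorm (k : ℕ) (l : ℝ) (u : E3 → ℂ) : ℝ≥0∞ :=
  M.normL2 (fun x => ((japaneseBracket x ^ l : ℝ) : ℂ) * (M.onePlusH^[k] u) x)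

end CompactPerturbation

/-- The symbol of `e^{isH₀}`, where `H₀ = -½ Δ` is the Euclidean Hamiltonian. With the
normalization `∫ e^{-2πi x·ξ} u(x) dx` of the Fourier transform, `H₀` has symbol `2π²|ξ|²`. -/
def freeSymbol (s : ℝ) (ξ : E3) : ℂ :=
  Complex.exp (((2 * Real.pi ^ 2 * s * ‖ξ‖ ^ 2 : ℝ) : ℂ) * Complex.I)

/-- The free Schrödinger propagator `e^{isH₀}`, as a Fourier multiplier. -/
def freeEvolution (s : ℝ) (u : E3 → ℂ) : E3 → ℂ :=
  𝓕⁻ (fun ξ => freeSymbol s ξ * 𝓕 u ξ)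

theorem freeSymbol_hasTemperateGrowth (s : ℝ) :
    Function.HasTemperateGrowth (freeSymbol s) := by
  have h1 : Function.HasTemperateGrowth (fun t : ℝ => Complex.exp ((t : ℂ) * Complex.I)) := by
    have hd : ∀ n : ℕ, iteratedDeriv n (fun t : ℝ => Complex.exp ((t : ℂ) * Complex.I)) =
        fun t : ℝ => Complex.I ^ n * Complex.exp ((t : ℂ) * Complex.I) := by
      intro n
      induction n with
      | zero => ext t; simp
      | succ n ih =>
        rw [iteratedDeriv_succ, ih]
        ext t
        have : HasDerivAt (fun t : ℝ => Complex.exp ((t : ℂ) * Complex.I))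
            (Complex.exp ((t : ℂ) * Complex.I) * (1 * Complex.I)) t :=
          ((Complex.ofRealCLM.hasDerivAt (x := t)).mul_const Complex.I).cexp
        rw [(this.const_mul (Complex.I ^ n)).deriv]
        ring
    refine ⟨?_, fun n => ⟨0, 1, fun t => ?_⟩⟩
    · exact Complex.contDiff_exp.comp (Complex.ofRealCLM.contDiff.mul contDiff_const)
    · rw [norm_iteratedFDeriv_eq_norm_iteratedDeriv, hd]
      simp [Complex.norm_exp_ofReal_mul_I]
  have h2 : Function.HasTemperateGrowth (fun ξ : E3 => 2 * Real.pi ^ 2 * s * ‖ξ‖ ^ 2) :=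
    (Function.HasTemperateGrowth.const _).mul (Function.hasTemperateGrowth_norm_sq E3)
  exact h1.comp h2

/-- The free Schrödinger propagator `e^{isH₀}` as an operator on the Schwartz space. -/
def freeEvolutionSchwartz (s : ℝ) : 𝓢(E3, ℂ) →L[ℂ] 𝓢(E3, ℂ) :=
  SchwartzMap.fourierMultiplierCLM ℂ (freeSymbol s)

theorem freeEvolutionSchwartz_coe (s : ℝ) (f : 𝓢(E3, ℂ)) :
    ⇑(freeEvolutionSchwartz s f) = freeEvolution s f := by
  rw [freeEvolutionSchwartz, SchwartzMap.fourierMultiplierCLM_apply, SchwartzMap.fourierInv_coe,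
    SchwartzMap.smulLeftCLM_apply (freeSymbol_hasTemperateGrowth s), SchwartzMap.fourier_coe]
  rfl

/-- `φ` is a smooth bump function which is supported on `{|x| ≤ 2R}`, equals `1` on `{|x| ≤ R}`,
and is adapted to the scale `R`: its `n`-th derivatives are at most `A n * R⁻ⁿ`. -/
structure IsBump (A : ℕ → ℝ) (R : ℝ) (φ : E3 → ℝ) : Prop where
  smooth : ContDiff ℝ ∞ φ
  eq_one : ∀ x, ‖x‖ ≤ R → φ x = 1
  eq_zero : ∀ x, 2 * R < ‖x‖ → φ x = 0
  bound : ∀ n x, ‖iteratedFDeriv ℝ n φ x‖ ≤ A n * R⁻¹ ^ n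

/-- The operator `(1 - φ) H²`. -/
def CompactPerturbation.exteriorHSq {R₀ : ℝ} (M : CompactPerturbation R₀) (φ : E3 → ℝ)
    (u : E3 → ℂ) (x : E3) : ℂ :=
  ((1 - φ x : ℝ) : ℂ) * M.hamiltonian (M.hamiltonian u) x

end

open scoped SchwartzMap ENNReal ContDiff FourierTransform

noncomputable section

open MeasureTheory Filter Topology

/-! On the support of `1 - φ` the metric is flat, so `(1 - φ) H²` equals `¼ (1 - φ) Δ²` there
(`exteriorHSq_eq`) and the two estimates concern the free evolution only; the geometry of `M` enters
through the Sobolev norms.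

The operators are a localised splitting of the spectrum of the dilation generator. Fix a smooth `w`
supported in `[-1/2, 1/2]` with `w 0 = 1`. Fourier inversion at `t = 0` of the profile `t ↦ w(t)
f(e^t y)` expresses `f(y)` as `∫∫ exp(2πiλt) w(t) f(e^t y) dt dλ`. P_in keeps `λ > 0` and P_out
keeps `λ < 0` (`halfProj 1`, `halfProj (-1)`, `halfProj_add_halfProj`). They depend on neither `R`
nor `φ`, and at `y` they use `f` only at points `e^t y` with `|t| ≤ 1/2`, hence they preserve
exterior regions up to constants. On each ray they are Fourier multipliers in the logarithmic
variable, which makes them bounded on `L²` (`exists_eLpNorm_halfProj_le`).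

Decay comes from non-stationary phase. The kernel of `e^{isH₀}` is `O(s^{-3/2})` times
`exp(-i|x-z|²/2s)`. Composed with P_in, the integral in `t` has phase `-(2πλt + |x - e^t z|²/2s)`,
whose derivative is, up to sign, `2πλ + e^{2t}|z|²/s - e^t x·z/s`. The half line of `λ` is the one
for which the first two terms reinforce each other. If `|x| ≤ |z|/4` the third cannot cancel them,
and if `|x|²` and `|z|²` are at most `s` it is bounded and harmless. Repeated integration by parts
gives `(1 + λ + |z|²/s)^{-n}`, integrable in `λ` (`exists_rayPhase_bound`,
`exists_kernel_halfProj_bound`). With P_out standing to the left of the propagator the same phase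
appears, now along the ray through the output point (`exists_halfProj_kernel_bound`). In classical
terms, `e^{isH₀}` moves incoming particles away from the origin, and turns localised data into
incoming waves.

Write `T = R² + s`. For P_in, the kernel bound is used for `|x|² ≤ T/256`; elsewhere `⟨x⟩^{-8}` is
already `O(T^{-4})` and the `L²` bound suffices (`exists_incoming_bound`). One of the derivatives in
`Δ²` is spent, through `x_k e^{isH₀} - e^{isH₀} x_k = is ∂_k e^{isH₀}`, to make the kernel square
integrable at infinity. For P_out, `f` is cut at `|z| ~ √T`. On the inner part each derivative gains
`(√T + |y|)/s` (`IsDecayOp.dX_comp`, `outgoing_weight_le`). On the outer part the weight `|y|²` is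
carried through the propagator by the operators `x_j + is∂_j`, and the growth in `s` is paid by the
weight `⟨z⟩^{11}` on `f` (`exists_outgoing_far_bound`).

Both sides give the rate `T^{-9/8}`, so any `σ < 1/8` is admissible. Finally, only six derivatives
of `f` outside a ball containing the perturbation are needed, and the outgoing bound uses `f` itself
on all of space. A weighted energy inequality shows that powers of `1 + H` control lower ones in
weighted `L²` (`integral_energy_le`, `exists_sobolevNorm_le`), and flat elliptic regularity in the
exterior turns powers of `1 + H` into derivatives (`exists_extNorm_wordSum_le_sobolevNorm`). -/

/-! ### The integral kernel of the free propagator -/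

/-- The constant in front of the kernel of the free propagator. -/
def propagatorConst (s : ℝ) : ℂ := (Real.pi / (-(2 * Real.pi ^ 2 * s : ℝ) * Complex.I)) ^ (3 / 2 : ℂ)

/-- The oscillating Gaussian `exp (-i |w|² / 2s)`. -/
def oscGaussian (s : ℝ) (w : E3) : ℂ := Complex.exp (-((‖w‖ ^ 2 / (2 * s) : ℝ) : ℂ) * Complex.I)

theorem norm_oscGaussian (s : ℝ) (w : E3) : ‖oscGaussian s w‖ = 1 := by
  rw [oscGaussian, ← Complex.ofReal_neg, Complex.norm_exp_ofReal_mul_I]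

theorem continuous_oscGaussian (s : ℝ) : Continuous (oscGaussian s) := by
  unfold oscGaussian; fun_prop

/-- The base of the power is `i / (2πs)`. As the exponent `3/2` is real, its argument does not
affect the modulus, and the factor `(2π)^{-3/2} ≤ 1` is dropped. -/
theorem norm_propagatorConst_le {s : ℝ} (hs : 0 < s) : ‖propagatorConst s‖ ≤ s ^ (-(3 / 2) : ℝ) := by
  have hpi := Real.pi_pos
  have hpi3 := Real.pi_gt_three
  have h0 : (Real.pi / (-(2 * Real.pi ^ 2 * s : ℝ) * Complex.I) : ℂ)
      = ((1 / (2 * Real.pi * s) : ℝ) : ℂ) * Complex.I := by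
    have h1 : (Real.pi : ℂ) ≠ 0 := by exact_mod_cast hpi.ne'
    have h2 : (s : ℂ) ≠ 0 := by exact_mod_cast hs.ne'
    push_cast
    field_simp
    rw [Complex.I_sq]
  have hne : (((1 / (2 * Real.pi * s) : ℝ) : ℂ) * Complex.I) ≠ 0 := by
    refine mul_ne_zero ?_ Complex.I_ne_zero
    exact_mod_cast (by positivity)
  rw [propagatorConst, h0, Complex.norm_cpow_of_ne_zero hne]
  have him : (3 / 2 : ℂ).im = 0 := by norm_num
  have hre : (3 / 2 : ℂ).re = 3 / 2 := by norm_num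
  rw [him, hre]
  simp only [norm_mul, Complex.norm_real, Complex.norm_I, mul_one, mul_zero, Real.exp_zero, div_one]
  rw [Real.norm_of_nonneg (by positivity), one_div, Real.inv_rpow (by positivity),
    ← Real.rpow_neg (by positivity)]
  apply Real.rpow_le_rpow_of_nonpos hs _ (by norm_num)
  nlinarith

/-- The Fourier transform is self-adjoint for the bilinear pairing, and the Fourier transform of a
modulated Gaussian is a Gaussian centred at `x`. Integrability requires `Re b > 0`; the propagator
is the boundary case `Re b = 0`. -/
theorem gaussian_integral_identity (u : 𝓢(E3, ℂ)) (x : E3) {b : ℂ} (hb : 0 < b.re) :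
    ∫ ξ : E3, Complex.exp (-b * ‖ξ‖ ^ 2 + 2 * Real.pi * Complex.I * (inner ℝ x ξ : ℝ)) * 𝓕 u ξ
      = ∫ z : E3, (Real.pi / b) ^ (3 / 2 : ℂ) *
          Complex.exp (-Real.pi ^ 2 * ‖x - z‖ ^ 2 / b) * u z := by
  have hint : Integrable (fun ξ : E3 =>
      Complex.exp (-b * ‖ξ‖ ^ 2 + 2 * Real.pi * Complex.I * (inner ℝ x ξ : ℝ))) :=
    GaussianFourier.integrable_cexp_neg_mul_sq_norm_add hb (2 * Real.pi * Complex.I) x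
  have h := VectorFourier.integral_fourierIntegral_smul_eq_flip (L := innerₗ E3)
    (μ := volume) (ν := volume) Real.continuous_fourierChar continuous_inner hint u.integrable
  have hfl : (innerₗ E3).flip = innerₗ E3 := flip_innerₗ E3
  rw [hfl] at h
  have h2 : ∀ w, VectorFourier.fourierIntegral Real.fourierChar volume (innerₗ E3)
      (fun ξ : E3 => Complex.exp (-b * ‖ξ‖ ^ 2 + 2 * Real.pi * Complex.I * (inner ℝ x ξ : ℝ))) w
      = (Real.pi / b) ^ (3 / 2 : ℂ) * Complex.exp (-Real.pi ^ 2 * ‖x - w‖ ^ 2 / b) := by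
    intro w
    have := fourier_gaussian_innerProductSpace' (V := E3) hb x w
    simp only [finrank_euclideanSpace, Fintype.card_fin] at this
    exact_mod_cast this
  simp only [h2, smul_eq_mul] at h
  rw [h]
  rfl

/-- The free propagator as an integral operator. -/
theorem freeEvolutionSchwartz_apply {s : ℝ} (hs : 0 < s) (u : 𝓢(E3, ℂ)) (x : E3) :
    freeEvolutionSchwartz s u x
      = propagatorConst s * ∫ z : E3, oscGaussian s (x - z) * u z := by
  rw [freeEvolutionSchwartz_coe, freeEvolution, Real.fourierInv_eq']
  -- The Schrödinger exponent `b₀` is purely imaginary, so the Gaussian identity is applied to `ε +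
  -- b₀` with `ε > 0`. Both sides converge as `ε → 0`, dominated by `‖𝓕 u‖` and by a multiple of
  -- `‖u‖`.
  set b₀ : ℂ := -(2 * Real.pi ^ 2 * s : ℝ) * Complex.I with hb₀
  have hpi := Real.pi_pos
  have hsne : (s : ℂ) ≠ 0 := by exact_mod_cast hs.ne'
  have hpine : (Real.pi : ℂ) ≠ 0 := by exact_mod_cast hpi.ne'
  have hb₀ne : b₀ ≠ 0 := by
    rw [hb₀]; push_cast
    simp [hsne, hpine]
  have hbcont : Tendsto (fun ε : ℝ => (ε : ℂ) + b₀) (𝓝[>] 0) (𝓝 b₀) := by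
    have : Tendsto (fun ε : ℝ => (ε : ℂ) + b₀) (𝓝 0) (𝓝 (((0 : ℝ) : ℂ) + b₀)) :=
      (Complex.continuous_ofReal.tendsto 0).add_const b₀
    simpa using this.mono_left nhdsWithin_le_nhds
  have hre : ∀ ε : ℝ, ((ε : ℂ) + b₀).re = ε := by
    intro ε
    rw [hb₀, Complex.add_re, Complex.ofReal_re, ← Complex.ofReal_neg, Complex.re_ofReal_mul]
    simp
  have hdivre : ∀ ε : ℝ, 0 < ε → 0 ≤ (1 / ((ε : ℂ) + b₀)).re := by
    intro ε hε
    rw [one_div, Complex.inv_re, hre]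
    exact div_nonneg hε.le (Complex.normSq_nonneg _)
  -- frequency side
  have hL : Tendsto (fun ε : ℝ => ∫ ξ : E3, Complex.exp (-((ε : ℂ) + b₀) * ‖ξ‖ ^ 2 +
      2 * Real.pi * Complex.I * (inner ℝ x ξ : ℝ)) * 𝓕 u ξ) (𝓝[>] 0)
      (𝓝 (∫ ξ : E3, Complex.exp (-b₀ * ‖ξ‖ ^ 2 +
      2 * Real.pi * Complex.I * (inner ℝ x ξ : ℝ)) * 𝓕 u ξ)) := by
    refine tendsto_integral_filter_of_dominated_convergence (fun ξ => ‖𝓕 u ξ‖) ?_ ?_ ?_ ?_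
    · refine Eventually.of_forall fun ε => Continuous.aestronglyMeasurable ?_
      have := (𝓕 u).continuous
      fun_prop
    · filter_upwards [self_mem_nhdsWithin] with ε hε
      refine Eventually.of_forall fun ξ => ?_
      rw [norm_mul, Complex.norm_exp]
      refine mul_le_of_le_one_left (norm_nonneg _) ?_
      rw [Real.exp_le_one_iff]
      have : (-((ε : ℂ) + b₀) * ‖ξ‖ ^ 2 + 2 * Real.pi * Complex.I * (inner ℝ x ξ : ℝ)).re
          = - ε * ‖ξ‖ ^ 2 := by
        simp [hb₀, ← Complex.ofReal_pow]
      rw [this]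
      have : 0 ≤ ε * ‖ξ‖ ^ 2 := mul_nonneg (le_of_lt hε) (by positivity)
      linarith
    · exact (𝓕 u).integrable.norm
    · refine Eventually.of_forall fun ξ => ?_
      refine Tendsto.mul_const _ ?_
      refine (Complex.continuous_exp.tendsto _).comp ?_
      exact (hbcont.neg.mul_const _).add_const _
  have hR : Tendsto (fun ε : ℝ => ∫ z : E3, (Real.pi / ((ε : ℂ) + b₀)) ^ (3 / 2 : ℂ) *
          Complex.exp (-Real.pi ^ 2 * ‖x - z‖ ^ 2 / ((ε : ℂ) + b₀)) * u z) (𝓝[>] 0)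
      (𝓝 (∫ z : E3, (Real.pi / b₀) ^ (3 / 2 : ℂ) *
          Complex.exp (-Real.pi ^ 2 * ‖x - z‖ ^ 2 / b₀) * u z)) := by
    have hc : Tendsto (fun ε : ℝ => (Real.pi / ((ε : ℂ) + b₀)) ^ (3 / 2 : ℂ)) (𝓝[>] 0)
        (𝓝 ((Real.pi / b₀) ^ (3 / 2 : ℂ))) := by
      have h1 : Tendsto (fun ε : ℝ => (Real.pi / ((ε : ℂ) + b₀))) (𝓝[>] 0) (𝓝 (Real.pi / b₀)) :=
        tendsto_const_nhds.div hbcont hb₀ne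
      refine Tendsto.comp (g := fun w : ℂ => w ^ (3 / 2 : ℂ)) ?_ h1
      -- The point `π / b₀` is a positive multiple of `i`, away from the branch cut of the power
      -- function.
      refine (continuousAt_cpow_const (Or.inr ?_)).tendsto
      rw [hb₀]
      have : (Real.pi : ℂ) / (-(2 * Real.pi ^ 2 * s : ℝ) * Complex.I)
          = ((1 / (2 * Real.pi * s) : ℝ) : ℂ) * Complex.I := by
        push_cast; field_simp; rw [Complex.I_sq]
      rw [this]
      simp [hs.ne', hpi.ne']
    have hbd : ∀ᶠ ε : ℝ in 𝓝[>] 0, ‖(Real.pi / ((ε : ℂ) + b₀)) ^ (3 / 2 : ℂ)‖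
        ≤ ‖((Real.pi : ℂ) / b₀) ^ (3 / 2 : ℂ)‖ + 1 :=
      (hc.norm).eventually (eventually_le_nhds (by linarith))
    refine tendsto_integral_filter_of_dominated_convergence
      (fun z => (‖((Real.pi : ℂ) / b₀) ^ (3 / 2 : ℂ)‖ + 1) * ‖u z‖) ?_ ?_ ?_ ?_
    · refine Eventually.of_forall fun ε => Continuous.aestronglyMeasurable ?_
      have := u.continuous
      fun_prop
    · filter_upwards [hbd, self_mem_nhdsWithin] with ε hε hε0
      refine Eventually.of_forall fun z => ?_
      rw [norm_mul, norm_mul]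
      refine mul_le_mul_of_nonneg_right ?_ (norm_nonneg _)
      refine (mul_le_of_le_one_right (norm_nonneg _) ?_).trans hε
      rw [Complex.norm_exp, Real.exp_le_one_iff]
      have : (-Real.pi ^ 2 * ‖x - z‖ ^ 2 / ((ε : ℂ) + b₀))
          = ((-(Real.pi ^ 2 * ‖x - z‖ ^ 2) : ℝ) : ℂ) * (1 / ((ε : ℂ) + b₀)) := by
        push_cast; ring
      rw [this, Complex.re_ofReal_mul]
      have := hdivre ε hε0
      have h3 : 0 ≤ Real.pi ^ 2 * ‖x - z‖ ^ 2 := by positivity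
      nlinarith
    · exact u.integrable.norm.const_mul _
    · refine Eventually.of_forall fun z => ?_
      refine Tendsto.mul_const _ (hc.mul ?_)
      refine (Complex.continuous_exp.tendsto _).comp ?_
      exact tendsto_const_nhds.div hbcont hb₀ne
  have hEq : (∫ ξ : E3, Complex.exp (-b₀ * ‖ξ‖ ^ 2 +
      2 * Real.pi * Complex.I * (inner ℝ x ξ : ℝ)) * 𝓕 u ξ)
      = ∫ z : E3, (Real.pi / b₀) ^ (3 / 2 : ℂ) *
          Complex.exp (-Real.pi ^ 2 * ‖x - z‖ ^ 2 / b₀) * u z := by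
    refine tendsto_nhds_unique hL (hR.congr' ?_)
    filter_upwards [self_mem_nhdsWithin] with ε hε
    exact (gaussian_integral_identity u x (by rw [hre]; exact hε)).symm
  have h1 : (∫ v : E3, Complex.exp (((2 * Real.pi * (inner ℝ v x : ℝ) : ℝ) : ℂ) * Complex.I) •
      (freeSymbol s v * 𝓕 (u : E3 → ℂ) v)) = ∫ ξ : E3, Complex.exp (-b₀ * ‖ξ‖ ^ 2 +
      2 * Real.pi * Complex.I * (inner ℝ x ξ : ℝ)) * 𝓕 u ξ := by
    refine integral_congr_ae (Eventually.of_forall fun ξ => ?_)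
    simp only [smul_eq_mul, freeSymbol, ← mul_assoc, ← Complex.exp_add]
    rw [SchwartzMap.fourier_coe]
    congr 2
    rw [hb₀, real_inner_comm]
    push_cast
    ring
  rw [h1, hEq, ← integral_const_mul]
  refine integral_congr_ae (Eventually.of_forall fun z => ?_)
  have h2 : -(Real.pi : ℂ) ^ 2 * ‖x - z‖ ^ 2 / b₀
      = -((‖x - z‖ ^ 2 / (2 * s) : ℝ) : ℂ) * Complex.I := by
    rw [div_eq_iff hb₀ne, hb₀]
    push_cast
    field_simp
    rw [Complex.I_sq]
    ring
  change (Real.pi / b₀) ^ (3 / 2 : ℂ) * Complex.exp (-(Real.pi : ℂ) ^ 2 * ‖x - z‖ ^ 2 / b₀) * u z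
    = (Real.pi / b₀) ^ (3 / 2 : ℂ) * (oscGaussian s (x - z) * u z)
  rw [h2, mul_assoc, oscGaussian]

/-! ### Partial derivatives and coordinate multiplications on the Schwartz space -/

/-- The partial derivative `∂_k` on the Schwartz space. -/
def dX (k : Fin 3) : 𝓢(E3, ℂ) →L[ℂ] 𝓢(E3, ℂ) :=
  LineDeriv.lineDerivOpCLM ℂ 𝓢(E3, ℂ) (EuclideanSpace.single k (1 : ℝ) : E3)

/-- Multiplication by a function of temperate growth on the Schwartz space. -/
abbrev mulS (g : E3 → ℂ) : 𝓢(E3, ℂ) →L[ℂ] 𝓢(E3, ℂ) := SchwartzMap.smulLeftCLM ℂ g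

/-- Multiplication by the coordinate `x_k` on the Schwartz space. -/
def mX (k : Fin 3) : 𝓢(E3, ℂ) →L[ℂ] 𝓢(E3, ℂ) := mulS (fun x => ((x k : ℝ) : ℂ))

theorem dX_apply (k : Fin 3) (u : 𝓢(E3, ℂ)) (x : E3) : dX k u x = partialDeriv k u x :=
  SchwartzMap.lineDerivOp_apply_eq_fderiv _ u x

theorem dX_coe (k : Fin 3) (u : 𝓢(E3, ℂ)) : ⇑(dX k u) = partialDeriv k u :=
  funext (dX_apply k u)

theorem coord_hasTemperateGrowth (k : Fin 3) :
    Function.HasTemperateGrowth (fun x : E3 => ((x k : ℝ) : ℂ)) := by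
  have h : Function.HasTemperateGrowth (fun x : E3 => x k) :=
    (EuclideanSpace.proj (𝕜 := ℝ) k : E3 →L[ℝ] ℝ).hasTemperateGrowth
  exact Function.HasTemperateGrowth.comp Function.Complex.hasTemperateGrowth_ofReal h

theorem mulS_apply {g : E3 → ℂ} (hg : g.HasTemperateGrowth) (u : 𝓢(E3, ℂ)) (x : E3) :
    mulS g u x = g x * u x := by
  rw [mulS, SchwartzMap.smulLeftCLM_apply_apply hg, smul_eq_mul]

theorem mX_apply (k : Fin 3) (u : 𝓢(E3, ℂ)) (x : E3) : mX k u x = (x k : ℝ) * u x :=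
  mulS_apply (coord_hasTemperateGrowth k) u x

theorem Function.HasTemperateGrowth.partialDeriv {g : E3 → ℂ} (hg : g.HasTemperateGrowth)
    (k : Fin 3) : (partialDeriv k g).HasTemperateGrowth := by
  have h : Function.HasTemperateGrowth (fderiv ℝ g) := by
    refine ⟨hg.1.fderiv_right (m := ∞) (by norm_num), fun n => ?_⟩
    obtain ⟨m, C, h⟩ := hg.2 (n + 1)
    exact ⟨m, C, fun x => by rw [norm_iteratedFDeriv_fderiv]; exact h x⟩
  have h2 := (ContinuousLinearMap.apply ℝ ℂ (EuclideanSpace.single k 1 : E3)).hasTemperateGrowth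
  exact h2.comp h

theorem partialDeriv_mul {g u : E3 → ℂ} {x : E3} (k : Fin 3) (hg : DifferentiableAt ℝ g x)
    (hu : DifferentiableAt ℝ u x) :
    partialDeriv k (fun y => g y * u y) x = g x * partialDeriv k u x + partialDeriv k g x * u x := by
  have := (hg.hasFDerivAt.mul hu.hasFDerivAt).fderiv
  unfold partialDeriv
  change (fderiv ℝ (g * u) x) _ = _
  rw [this]
  simp
  ring

theorem dX_mulS {g : E3 → ℂ} (hg : g.HasTemperateGrowth) (k : Fin 3) (u : 𝓢(E3, ℂ)) :
    dX k (mulS g u) = mulS g (dX k u) + mulS (partialDeriv k g) u := by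
  ext x
  rw [_root_.add_apply, mulS_apply hg, mulS_apply (hg.partialDeriv k), dX_apply, dX_apply]
  have : ⇑(mulS g u) = fun y => g y * u y := funext fun y => mulS_apply hg u y
  rw [this, partialDeriv_mul k (hg.1.differentiable (by simp) x) (u.differentiable x)]

theorem partialDeriv_coord (j k : Fin 3) (x : E3) :
    partialDeriv j (fun x : E3 => ((x k : ℝ) : ℂ)) x = if j = k then 1 else 0 := by
  have h : HasFDerivAt (fun x : E3 => ((x k : ℝ) : ℂ))
      (Complex.ofRealCLM.comp (EuclideanSpace.proj (𝕜 := ℝ) k : E3 →L[ℝ] ℝ)) x :=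
    (Complex.ofRealCLM.comp (EuclideanSpace.proj (𝕜 := ℝ) k : E3 →L[ℝ] ℝ)).hasFDerivAt
  rw [partialDeriv, h.fderiv]
  by_cases hjk : j = k
  · simp [hjk]
  · simp [hjk, Ne.symm hjk]

theorem dX_mX (j k : Fin 3) (u : 𝓢(E3, ℂ)) :
    dX j (mX k u) = mX k (dX j u) + if j = k then u else 0 := by
  rw [mX, dX_mulS (coord_hasTemperateGrowth k)]
  congr 1
  ext x
  rw [mulS_apply ((coord_hasTemperateGrowth k).partialDeriv j), partialDeriv_coord]
  by_cases hjk : j = k <;> simp [hjk]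

theorem dX_comm (j k : Fin 3) (u : 𝓢(E3, ℂ)) : dX j (dX k u) = dX k (dX j u) := by
  ext x
  have h2 : ContDiffAt ℝ 2 u x := (u.smooth 2).contDiffAt
  have hsymm := h2.isSymmSndFDerivAt (by simp)
  have key : ∀ v w : E3, fderiv ℝ (fun y => fderiv ℝ u y w) x v = fderiv ℝ (fderiv ℝ u) x v w := by
    intro v w
    have hd : DifferentiableAt ℝ (fderiv ℝ u) x :=
      ((u.smooth 2).fderiv_right (m := 1) (by norm_num)).differentiable (by simp) x
    rw [fderiv_clm_apply hd (differentiableAt_const _)]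
    simp
  rw [dX_apply, dX_apply, dX_coe, dX_coe]
  change fderiv ℝ (fun y => fderiv ℝ u y _) x _ = fderiv ℝ (fun y => fderiv ℝ u y _) x _
  rw [key, key]
  exact hsymm _ _

/-! ### Commutation relations of the free propagator -/

theorem fourier_dX (k : Fin 3) (u : 𝓢(E3, ℂ)) (ξ : E3) :
    𝓕 (dX k u) ξ = 2 * Real.pi * Complex.I * (ξ k : ℝ) * 𝓕 u ξ := by
  have h := SchwartzMap.fourier_lineDerivOp_eq u (EuclideanSpace.single k (1 : ℝ) : E3)
  have h2 : dX k u = LineDeriv.lineDerivOp (EuclideanSpace.single k (1 : ℝ) : E3) u := rfl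
  rw [h2, h]
  rw [_root_.smul_apply, SchwartzMap.smulLeftCLM_apply_apply (by fun_prop)]
  simp [EuclideanSpace.inner_single_right]
  ring

theorem dX_fourier (k : Fin 3) (u : 𝓢(E3, ℂ)) :
    dX k (𝓕 u) = (-(2 * Real.pi * Complex.I)) • 𝓕 (mX k u) := by
  have h := SchwartzMap.lineDerivOp_fourier_eq u (EuclideanSpace.single k (1 : ℝ) : E3)
  have h2 : dX k (𝓕 u) = LineDeriv.lineDerivOp (EuclideanSpace.single k (1 : ℝ) : E3) (𝓕 u) := rfl
  rw [h2, h, ← FourierTransform.fourier_smul]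
  congr 1
  ext x
  rw [_root_.smul_apply, _root_.smul_apply, SchwartzMap.smulLeftCLM_apply_apply (by fun_prop), mX_apply]
  simp [EuclideanSpace.inner_single_right]

theorem fourier_freeEvolutionSchwartz (s : ℝ) (u : 𝓢(E3, ℂ)) :
    𝓕 (freeEvolutionSchwartz s u) = mulS (freeSymbol s) (𝓕 u) := by
  rw [freeEvolutionSchwartz, SchwartzMap.fourierMultiplierCLM_apply,
    FourierTransform.fourier_fourierInv_eq]

theorem fourier_injective {u v : 𝓢(E3, ℂ)} (h : 𝓕 u = 𝓕 v) : u = v := by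
  have := congrArg (fun w : 𝓢(E3, ℂ) => 𝓕⁻ w) h
  simpa using this

theorem freeEvolutionSchwartz_dX (s : ℝ) (k : Fin 3) (u : 𝓢(E3, ℂ)) :
    freeEvolutionSchwartz s (dX k u) = dX k (freeEvolutionSchwartz s u) := by
  apply fourier_injective
  ext ξ
  rw [fourier_dX, fourier_freeEvolutionSchwartz, fourier_freeEvolutionSchwartz,
    mulS_apply (freeSymbol_hasTemperateGrowth s), mulS_apply (freeSymbol_hasTemperateGrowth s),
    fourier_dX]
  ring

theorem partialDeriv_freeSymbol (s : ℝ) (k : Fin 3) (ξ : E3) :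
    partialDeriv k (freeSymbol s) ξ
      = 4 * Real.pi ^ 2 * s * (ξ k : ℝ) * Complex.I * freeSymbol s ξ := by
  have h1 : HasFDerivAt (fun ξ : E3 => ‖ξ‖ ^ 2) (2 • innerSL ℝ ξ) ξ :=
    (hasStrictFDerivAt_norm_sq ξ).hasFDerivAt
  have h2 : HasFDerivAt (fun ξ : E3 => 2 * Real.pi ^ 2 * s * ‖ξ‖ ^ 2)
      ((2 * Real.pi ^ 2 * s) • (2 • innerSL ℝ ξ)) ξ := h1.const_mul _
  have h3 := ((Complex.ofRealCLM.hasFDerivAt.comp ξ h2).mul_const Complex.I).cexp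
  have h4 : partialDeriv k (freeSymbol s) ξ = _ := congrArg (fun L => L (EuclideanSpace.single k 1 : E3)) h3.fderiv
  rw [h4]
  simp [freeSymbol, EuclideanSpace.inner_single_right]
  ring

/-- `e^{isH₀} x_k = (x_k - i s ∂_k) e^{isH₀}`. -/
theorem freeEvolutionSchwartz_mX (s : ℝ) (k : Fin 3) (u : 𝓢(E3, ℂ)) :
    freeEvolutionSchwartz s (mX k u) = mX k (freeEvolutionSchwartz s u)
      - (Complex.I * s) • dX k (freeEvolutionSchwartz s u) := by
  apply fourier_injective
  set c : ℂ := -(2 * Real.pi * Complex.I) with hc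
  have hc0 : c ≠ 0 := by
    rw [hc, neg_ne_zero]
    simp [Real.pi_ne_zero]
  have hm : ∀ v : 𝓢(E3, ℂ), 𝓕 (mX k v) = c⁻¹ • dX k (𝓕 v) := by
    intro v
    rw [dX_fourier, smul_smul, inv_mul_cancel₀ hc0, one_smul]
  have hsub : ∀ v w : 𝓢(E3, ℂ), 𝓕 (v - w) = 𝓕 v - 𝓕 w :=
    fun v w => map_sub (FourierTransform.fourierCLM ℂ 𝓢(E3, ℂ)) v w
  rw [hsub, FourierTransform.fourier_smul, hm,
    fourier_freeEvolutionSchwartz, hm, fourier_freeEvolutionSchwartz,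
    dX_mulS (freeSymbol_hasTemperateGrowth s)]
  ext ξ
  simp only [_root_.sub_apply, _root_.smul_apply, _root_.add_apply, smul_eq_mul]
  simp only [fourier_dX, fourier_freeEvolutionSchwartz,
    mulS_apply (freeSymbol_hasTemperateGrowth s),
    mulS_apply ((freeSymbol_hasTemperateGrowth s).partialDeriv k), _root_.smul_apply, smul_eq_mul,
    partialDeriv_freeSymbol]
  have hpi : (Real.pi : ℂ) ≠ 0 := by exact_mod_cast Real.pi_ne_zero
  have hI : Complex.I ≠ 0 := Complex.I_ne_zero
  have hci : c⁻¹ * (4 * Real.pi ^ 2 * s * (ξ k : ℝ) * Complex.I)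
      = Complex.I * s * (2 * Real.pi * Complex.I * (ξ k : ℝ)) := by
    rw [inv_mul_eq_iff_eq_mul₀ hc0, hc]
    linear_combination (4 * Real.pi ^ 2 * s * (ξ k : ℝ) * Complex.I : ℂ) * Complex.I_sq
  linear_combination (-(freeSymbol s ξ * 𝓕 u ξ)) * hci

theorem norm_freeSymbol (s : ℝ) (ξ : E3) : ‖freeSymbol s ξ‖ = 1 := by
  rw [freeSymbol, Complex.norm_exp_ofReal_mul_I]

theorem eLpNorm_fourier {V : Type*} [NormedAddCommGroup V] [InnerProductSpace ℝ V]
    [FiniteDimensional ℝ V] [MeasurableSpace V] [BorelSpace V] (u : 𝓢(V, ℂ)) :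
    eLpNorm (𝓕 u : 𝓢(V, ℂ)) 2 volume = eLpNorm u 2 volume := by
  have h : ‖(𝓕 u).toLp 2 volume‖ = ‖u.toLp 2 volume‖ := SchwartzMap.norm_fourier_toL2_eq (H := ℂ) u
  have h1 : ‖(𝓕 u).toLp 2 volume‖ = (eLpNorm (𝓕 u : 𝓢(V, ℂ)) 2 volume).toReal :=
    SchwartzMap.norm_toLp
  have h2 : ‖u.toLp 2 volume‖ = (eLpNorm u 2 volume).toReal := SchwartzMap.norm_toLp
  rw [h1, h2] at h
  exact (ENNReal.toReal_eq_toReal_iff' ((𝓕 u).eLpNorm_lt_top 2 volume).ne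
    (u.eLpNorm_lt_top 2 volume).ne).1 h

/-- The free propagator is an isometry of `L²`. -/
theorem eLpNorm_freeEvolutionSchwartz (s : ℝ) (u : 𝓢(E3, ℂ)) :
    eLpNorm (freeEvolutionSchwartz s u) 2 volume = eLpNorm u 2 volume := by
  rw [← eLpNorm_fourier, fourier_freeEvolutionSchwartz, ← eLpNorm_fourier u]
  refine eLpNorm_congr_norm_ae (Eventually.of_forall fun ξ => ?_)
  rw [mulS_apply (freeSymbol_hasTemperateGrowth s), norm_mul, norm_freeSymbol, one_mul]

/-! ### Non-stationary phase in one variable -/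

/-- The Leibniz rule for `g * g⁻¹ = 1` can be solved for the top derivative of `g⁻¹`, with a
division by `g t` only. The constant depends on `n`, `c`, `B` alone, which keeps the later phase
estimates uniform in all parameters. -/
theorem exists_bound_iteratedDeriv_inv (n : ℕ) (c B : ℝ) (hc : 0 < c) :
    ∃ C : ℝ, 0 ≤ C ∧ ∀ (g : ℝ → ℂ) (t : ℝ), ContDiff ℝ ∞ g → c ≤ ‖g t‖ →
      (∀ k ≤ n, ‖iteratedDeriv k g t‖ ≤ B) → ∀ k ≤ n, ‖iteratedDeriv k g⁻¹ t‖ ≤ C := by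
  induction n with
  | zero =>
    refine ⟨c⁻¹, by positivity, fun g t _ h _ k hk => ?_⟩
    obtain rfl : k = 0 := by omega
    rw [iteratedDeriv_zero, Pi.inv_apply, norm_inv]
    exact inv_anti₀ hc h
  | succ n ih =>
    obtain ⟨C, hC, ih⟩ := ih
    set D : ℝ := c⁻¹ * ∑ i ∈ Finset.range (n + 1), ((n + 1).choose (i + 1) : ℝ) * |B| * C with hD
    have hD0 : 0 ≤ D := by rw [hD]; positivity
    refine ⟨C + D, by positivity, fun g t hg hgc hgB k hk => ?_⟩
    have hlow : ∀ j ≤ n, ‖iteratedDeriv j g⁻¹ t‖ ≤ C :=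
      ih g t hg hgc (fun j hj => hgB j (by omega))
    rcases Nat.lt_or_ge n k with hlt | hge
    swap
    · exact (hlow k hge).trans (by linarith)
    obtain rfl : k = n + 1 := by omega
    have hg0 : g t ≠ 0 := by
      intro h0; rw [h0, norm_zero] at hgc; linarith
    -- The product is `1` only where `g` does not vanish, hence the identity is local.
    have hev : (g * g⁻¹) =ᶠ[𝓝 t] fun _ => (1 : ℂ) := by
      filter_upwards [hg.continuous.continuousAt.eventually_ne hg0] with x hx
      simp [hx]
    have h0 : iteratedDeriv (n + 1) (g * g⁻¹) t = 0 := by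
      rw [hev.iteratedDeriv_eq]
      simp [iteratedDeriv_const]
    have hle : ((n + 1 : ℕ) : ℕ∞ω) ≤ (∞ : ℕ∞ω) := by exact_mod_cast le_top
    have hg' : ContDiffAt ℝ (n + 1 : ℕ) g t := (hg.of_le hle).contDiffAt
    rw [iteratedDeriv_mul hg' (hg'.inv hg0), Finset.sum_range_succ'] at h0
    simp only [Nat.choose_zero_right, Nat.cast_one, one_mul, iteratedDeriv_zero, Nat.sub_zero] at h0
    have h1 : g t * iteratedDeriv (n + 1) g⁻¹ t
        = - ∑ i ∈ Finset.range (n + 1), ((n + 1).choose (i + 1) : ℂ) *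
          iteratedDeriv (i + 1) g t * iteratedDeriv (n + 1 - (i + 1)) g⁻¹ t := by
      linear_combination h0
    have h2 : ‖g t‖ * ‖iteratedDeriv (n + 1) g⁻¹ t‖
        ≤ ∑ i ∈ Finset.range (n + 1), ((n + 1).choose (i + 1) : ℝ) * |B| * C := by
      rw [← norm_mul, h1, norm_neg]
      refine (norm_sum_le _ _).trans (Finset.sum_le_sum fun i hi => ?_)
      rw [norm_mul, norm_mul, Complex.norm_natCast]
      have hi' := Finset.mem_range.1 hi
      gcongr
      · exact (hgB _ (by omega)).trans (le_abs_self B)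
      · exact hlow _ (by omega)
    have h3 : c * ‖iteratedDeriv (n + 1) g⁻¹ t‖ ≤ c * D := by
      rw [hD, mul_inv_cancel_left₀ hc.ne']
      exact (mul_le_mul_of_nonneg_right hgc (norm_nonneg _)).trans h2
    have := le_of_mul_le_mul_left h3 hc
    linarith

/-- A smooth amplitude supported in `[-1/2, 1/2]` with derivatives up to order `N` bounded by `M`. -/
structure IsAmplitude (N : ℕ) (M : ℝ) (b : ℝ → ℂ) : Prop where
  smooth : ContDiff ℝ ∞ b
  eq_zero : ∀ t, 1 / 2 < |t| → b t = 0
  bound : ∀ k ≤ N, ∀ t, ‖iteratedDeriv k b t‖ ≤ M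

theorem IsAmplitude.eventually_zero {N : ℕ} {M : ℝ} {b : ℝ → ℂ} (hb : IsAmplitude N M b) {t : ℝ}
    (ht : 1 / 2 < |t|) : b =ᶠ[𝓝 t] fun _ => 0 := by
  filter_upwards [continuous_abs.continuousAt.eventually (lt_mem_nhds ht)] with x hx
  exact hb.eq_zero x hx

theorem IsAmplitude.nonneg {N : ℕ} {M : ℝ} {b : ℝ → ℂ} (hb : IsAmplitude N M b) : 0 ≤ M :=
  (norm_nonneg _).trans (hb.bound 0 (Nat.zero_le _) 0)

theorem IsAmplitude.hasCompactSupport {N : ℕ} {M : ℝ} {b : ℝ → ℂ} (hb : IsAmplitude N M b) :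
    HasCompactSupport b :=
  HasCompactSupport.intro (K := Set.Icc (-(1 / 2)) (1 / 2)) isCompact_Icc fun x hx => by
    apply hb.eq_zero
    by_contra h
    exact hx (abs_le.1 (not_lt.1 h))

theorem IsAmplitude.norm_integral_le {N : ℕ} {M : ℝ} {b : ℝ → ℂ} (hb : IsAmplitude N M b)
    {E : ℝ → ℂ} (hE : ∀ t, ‖E t‖ ≤ 1) : ‖∫ t, E t * b t‖ ≤ M := by
  have h : ∀ t ∉ Set.Icc (-(1 / 2) : ℝ) (1 / 2), E t * b t = 0 := by
    intro t ht
    rw [hb.eq_zero t, mul_zero]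
    by_contra h
    exact ht (abs_le.1 (not_lt.1 h))
  rw [← setIntegral_eq_integral_of_forall_compl_eq_zero h]
  refine (norm_setIntegral_le_of_norm_le_const (C := M) (by simp) fun t _ => ?_).trans ?_
  · rw [norm_mul]
    have := hb.bound 0 (Nat.zero_le _) t
    rw [iteratedDeriv_zero] at this
    calc ‖E t‖ * ‖b t‖ ≤ 1 * M := by gcongr; exact hE t
      _ = M := one_mul M
  · simp [Measure.real]; norm_num

/-- One integration by parts replaces the amplitude `b` by `(b/g)'`, at the cost of one derivative.
Zeros of `g` outside `(-1, 1)` are harmless since `b` vanishes off `[-1/2, 1/2]`. -/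
theorem exists_isAmplitude_deriv_mul_inv (n : ℕ) (c B : ℝ) (hc : 0 < c) :
    ∃ K : ℝ, 0 ≤ K ∧ ∀ (g : ℝ → ℂ), ContDiff ℝ ∞ g → (∀ t, |t| < 1 → c ≤ ‖g t‖) →
      (∀ k ≤ n + 1, ∀ t, |t| < 1 → ‖iteratedDeriv k g t‖ ≤ B) →
      ∀ (M : ℝ) (b : ℝ → ℂ), IsAmplitude (n + 1) M b →
        ContDiff ℝ ∞ (b * g⁻¹) ∧ IsAmplitude n (K * M) (deriv (b * g⁻¹)) := by
  obtain ⟨C, hC, hinv⟩ := exists_bound_iteratedDeriv_inv (n + 1) c B hc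
  refine ⟨2 ^ (n + 1) * C, by positivity, fun g hg hgc hgB M b hb => ?_⟩
  have hM := hb.nonneg
  have hK : 0 ≤ 2 ^ (n + 1) * C * M := by positivity
  have hz : ∀ t, 1 / 2 < |t| → (b * g⁻¹) =ᶠ[𝓝 t] fun _ => 0 := by
    intro t ht
    filter_upwards [hb.eventually_zero ht] with x hx
    simp [hx]
  have hg0 : ∀ t, |t| < 1 → g t ≠ 0 := by
    intro t ht h0
    have := hgc t ht
    rw [h0, norm_zero] at this; linarith
  have hsm : ContDiff ℝ ∞ (b * g⁻¹) := by
    rw [contDiff_iff_contDiffAt]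
    intro t
    rcases lt_or_ge (1 / 2) |t| with ht | ht
    · exact contDiffAt_const.congr_of_eventuallyEq (hz t ht)
    · exact hb.smooth.contDiffAt.mul (hg.contDiffAt.inv (hg0 t (by linarith)))
  refine ⟨hsm, ?_, fun t ht => ?_, fun k hk t => ?_⟩
  · exact ((contDiff_infty_iff_deriv (𝕜 := ℝ)).1 hsm).2
  · rw [(hz t ht).deriv_eq]; simp
  · rw [← iteratedDeriv_succ']
    rcases lt_or_ge (1 / 2) |t| with ht | ht
    · rw [(hz t ht).iteratedDeriv_eq]
      simp
      exact hK
    · have hle : ((k + 1 : ℕ) : ℕ∞ω) ≤ (∞ : ℕ∞ω) := by exact_mod_cast le_top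
      have ht1 : |t| < 1 := by linarith
      rw [iteratedDeriv_mul (hb.smooth.of_le hle).contDiffAt
        ((hg.of_le hle).contDiffAt.inv (hg0 t ht1))]
      calc _ ≤ ∑ i ∈ Finset.range (k + 1 + 1), ((k + 1).choose i : ℝ) * M * C := by
            refine (norm_sum_le _ _).trans (Finset.sum_le_sum fun i hi => ?_)
            have hi' := Finset.mem_range.1 hi
            rw [norm_mul, norm_mul, Complex.norm_natCast]
            gcongr
            · exact hb.bound i (by omega) t
            · exact hinv g t hg (hgc t ht1) (fun j hj => hgB j hj t ht1) _ (by omega)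
        _ = 2 ^ (k + 1) * C * M := by
            rw [← Finset.sum_mul, ← Finset.sum_mul]
            have := Nat.sum_range_choose (k + 1)
            have h2 : ∑ i ∈ Finset.range (k + 1 + 1), ((k + 1).choose i : ℝ) = 2 ^ (k + 1) := by
              exact_mod_cast this
            rw [h2]; ring
        _ ≤ 2 ^ (n + 1) * C * M := by
            gcongr
            · norm_num

/-- Since `E' = -iΛ g E`, the factor `E` may be replaced by `E' / (-iΛ g)` and the derivative moved
to `b/g`. Each of the `n` rounds gains `Λ⁻¹`. -/
theorem exists_nonstationary_bound (n : ℕ) (c B : ℝ) (hc : 0 < c) :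
    ∃ C : ℝ, 0 ≤ C ∧ ∀ (g E : ℝ → ℂ) (Λ : ℝ), 0 < Λ → ContDiff ℝ ∞ g →
      (∀ t, |t| < 1 → c ≤ ‖g t‖) → (∀ k ≤ n, ∀ t, |t| < 1 → ‖iteratedDeriv k g t‖ ≤ B) →
      (∀ t, HasDerivAt E (-(Complex.I * Λ) * g t * E t) t) → (∀ t, ‖E t‖ ≤ 1) →
      ∀ (M : ℝ) (b : ℝ → ℂ), IsAmplitude n M b → ‖∫ t, E t * b t‖ ≤ C * M * Λ⁻¹ ^ n := by
  induction n with
  | zero =>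
    refine ⟨1, zero_le_one, fun g E Λ _ _ _ _ _ hE M b hb => ?_⟩
    simpa using hb.norm_integral_le hE
  | succ n ih =>
    obtain ⟨C, hC, ih⟩ := ih
    obtain ⟨K, hK, hT⟩ := exists_isAmplitude_deriv_mul_inv n c B hc
    refine ⟨C * K, by positivity, fun g E Λ hΛ hg hgc hgB hE hE1 M b hb => ?_⟩
    obtain ⟨hsm, hamp⟩ := hT g hg hgc hgB M b hb
    have hΛ0 : (Λ : ℂ) ≠ 0 := by exact_mod_cast hΛ.ne'
    have hg0 : ∀ t, b t ≠ 0 → g t ≠ 0 := by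
      intro t ht h0
      have ht' : |t| ≤ 1 / 2 := by
        by_contra h
        exact ht (hb.eq_zero t (not_le.1 h))
      have := hgc t (by linarith)
      rw [h0, norm_zero] at this; linarith
    have hEc : Continuous E := continuous_iff_continuousAt.2 fun t => (hE t).continuousAt
    have hcs : HasCompactSupport (b * g⁻¹) := hb.hasCompactSupport.mul_right
    have hcs' : HasCompactSupport (deriv (b * g⁻¹)) := hcs.deriv
    have hd : ∀ t, HasDerivAt (b * g⁻¹) (deriv (b * g⁻¹) t) t := fun t =>
      (hsm.differentiable (by simp) t).hasDerivAt
    have hibp := integral_mul_deriv_eq_deriv_mul_of_integrable (u := E) (v := b * g⁻¹)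
      (u' := fun t => -(Complex.I * Λ) * g t * E t) (v' := deriv (b * g⁻¹)) (fun t _ => hE t) (fun t _ => hd t)
      ((hEc.mul hamp.smooth.continuous).integrable_of_hasCompactSupport hcs'.mul_left)
      ((((continuous_const.mul hg.continuous).mul hEc).mul hsm.continuous).integrable_of_hasCompactSupport
        hcs.mul_left)
      ((hEc.mul hsm.continuous).integrable_of_hasCompactSupport hcs.mul_left)
    have h1 : ∫ t, E t * b t = -(Complex.I * Λ)⁻¹ * ∫ t, (-(Complex.I * Λ) * g t * E t) * (b * g⁻¹) t := by
      rw [← integral_const_mul]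
      refine integral_congr_ae (Eventually.of_forall fun t => ?_)
      simp only [Pi.mul_apply, Pi.inv_apply]
      by_cases hbt : b t = 0
      · simp [hbt]
      · have := hg0 t hbt
        have hI := Complex.I_ne_zero
        field_simp
    have h2 : ∫ t, E t * b t = (Complex.I * Λ)⁻¹ * ∫ t, E t * deriv (b * g⁻¹) t := by
      rw [h1, hibp]; ring
    rw [h2, norm_mul, norm_inv, norm_mul, Complex.norm_I, one_mul, Complex.norm_real,
      Real.norm_of_nonneg hΛ.le]
    calc Λ⁻¹ * ‖∫ t, E t * deriv (b * g⁻¹) t‖ ≤ Λ⁻¹ * (C * (K * M) * Λ⁻¹ ^ n) := by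
          gcongr
          exact ih g E Λ hΛ hg hgc (fun k hk => hgB k (by omega)) hE hE1 _ _ hamp
      _ = C * K * M * Λ⁻¹ ^ (n + 1) := by ring

theorem iteratedDeriv_exp_sum (a₀ a₁ a₂ : ℂ) (k : ℕ) :
    iteratedDeriv k (fun t : ℝ => a₀ + a₁ * Complex.exp (2 * t) + a₂ * Complex.exp t)
      = fun t : ℝ => (if k = 0 then a₀ else 0) + 2 ^ k * a₁ * Complex.exp (2 * t)
        + a₂ * Complex.exp t := by
  induction k with
  | zero => simp
  | succ k ih =>
    rw [iteratedDeriv_succ, ih]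
    ext t
    have h1 : HasDerivAt (fun t : ℝ => (t : ℂ)) 1 t := Complex.ofRealCLM.hasDerivAt
    have h2 := (((h1.const_mul 2).cexp.const_mul (2 ^ k * a₁)).const_add
      (if k = 0 then a₀ else 0)).add (h1.cexp.const_mul a₂)
    refine h2.deriv.trans ?_
    simp
    ring

/-- The phase occurring when the free propagator is applied along a ray. -/
def rayPhase (l μ ν t : ℝ) : ℝ := 2 * Real.pi * l * t + μ * Real.exp (2 * t) / 2 - ν * Real.exp t

/-- The derivative of the phase is `2πl + μe^{2t} - νe^t`. If `|ν| ≤ μ/4`, then `μe^{2t} - νe^t ≥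
μe^t(e^t - 1/4)`, and `e^t > 1/4` for `|t| < 1`. If `μ ≤ 1` and `|ν| ≤ 1`, then `l + μ > 2` forces
`l > 1`, and `2πl` beats `e^t < 3`. In both cases the derivative is comparable to `l + μ`. -/
theorem exists_rayPhase_bound (n : ℕ) :
    ∃ C : ℝ, 0 ≤ C ∧ ∀ (l μ ν : ℝ), 0 ≤ l → 0 ≤ μ → (|ν| ≤ μ / 4 ∨ (μ ≤ 1 ∧ |ν| ≤ 1)) →
      ∀ (M : ℝ) (b : ℝ → ℂ), IsAmplitude n M b →
        ‖∫ t, Complex.exp (-(rayPhase l μ ν t : ℂ) * Complex.I) * b t‖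
          ≤ C * M * (1 + l + μ)⁻¹ ^ n := by
  obtain ⟨C, hC, h⟩ := exists_nonstationary_bound n (1 / 100) (7 + 2 ^ n * 9 + 3) (by norm_num)
  refine ⟨3 ^ n + C * 2 ^ n, by positivity, fun l μ ν hl hμ hν M b hb => ?_⟩
  have hM := hb.nonneg
  have hE1 : ∀ t : ℝ, ‖Complex.exp (-(rayPhase l μ ν t : ℂ) * Complex.I)‖ ≤ 1 := by
    intro t
    rw [← Complex.ofReal_neg, Complex.norm_exp_ofReal_mul_I]
  -- For `l + μ ≤ 2` nothing is to be gained: the trivial bound is enough because `1 + l + μ ≤ 3`.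
  rcases le_or_gt (l + μ) 2 with hsmall | hlarge
  · refine (hb.norm_integral_le hE1).trans ?_
    have h1 : 1 ≤ 3 ^ n * (1 + l + μ)⁻¹ ^ n := by
      rw [← mul_pow]
      apply one_le_pow₀
      rw [← div_eq_mul_inv, one_le_div (by positivity)]
      linarith
    have h2 : 0 ≤ C * 2 ^ n * M * (1 + l + μ)⁻¹ ^ n := by positivity
    calc M = M * 1 := (mul_one M).symm
      _ ≤ M * (3 ^ n * (1 + l + μ)⁻¹ ^ n) := by gcongr
      _ ≤ (3 ^ n + C * 2 ^ n) * M * (1 + l + μ)⁻¹ ^ n := by nlinarith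
  · set Λ := l + μ with hΛ
    have hΛ0 : 0 < Λ := by linarith
    have hΛne : (Λ : ℂ) ≠ 0 := by exact_mod_cast hΛ0.ne'
    have hνμ : |ν| ≤ Λ := by
      rcases hν with h1 | ⟨_, h1⟩ <;> linarith
    set g : ℝ → ℂ := fun t => ((2 * Real.pi * l / Λ : ℝ) : ℂ) + ((μ / Λ : ℝ) : ℂ) * Complex.exp (2 * t)
      + ((-ν / Λ : ℝ) : ℂ) * Complex.exp t with hg
    have hgreal : ∀ t : ℝ, g t = (((2 * Real.pi * l + μ * Real.exp (2 * t) - ν * Real.exp t) / Λ : ℝ) : ℂ) := by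
      intro t
      rw [hg]
      push_cast
      ring
    have hexp : ∀ t : ℝ, |t| < 1 → Real.exp t ≤ 2.7182818286 ∧ 0.36 ≤ Real.exp t := by
      intro t ht
      have ht' := abs_lt.1 ht
      constructor
      · exact (Real.exp_le_exp.2 ht'.2.le).trans Real.exp_one_lt_d9.le
      · have h1 : Real.exp (-1) ≤ Real.exp t := Real.exp_le_exp.2 ht'.1.le
        refine le_trans ?_ h1
        rw [Real.exp_neg, le_inv_comm₀ (by norm_num) (Real.exp_pos 1)]
        exact Real.exp_one_lt_d9.le.trans (by norm_num)
    have hpi := Real.pi_gt_three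
    have hpi4 := Real.pi_lt_d2
    have hgc : ∀ t, |t| < 1 → 1 / 100 ≤ ‖g t‖ := by
      intro t ht
      obtain ⟨he1, he2⟩ := hexp t ht
      rw [hgreal, Complex.norm_real]
      refine le_trans ?_ (le_abs_self _)
      rw [le_div_iff₀ hΛ0, two_mul t, Real.exp_add]
      set e := Real.exp t
      have hνe := abs_le.1 (le_refl |ν|)
      rcases hν with h1 | ⟨h1, h2⟩
      · have h3 : ν * e ≤ μ / 4 * e := by gcongr; linarith
        have h4 : 0.36 * 0.11 * μ ≤ (e * (e - 1 / 4)) * μ := by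
          gcongr; linarith
        nlinarith [mul_nonneg hl (by linarith : (0:ℝ) ≤ Real.pi - 3)]
      · have h3 : ν * e ≤ 1 * e := by gcongr; linarith
        have h4 : 0 ≤ μ * (e * e) := by positivity
        have h5 : 3 * l ≤ Real.pi * l := by gcongr
        linarith
    have hgB : ∀ k ≤ n, ∀ t, |t| < 1 → ‖iteratedDeriv k g t‖ ≤ 7 + 2 ^ n * 9 + 3 := by
      intro k hk t ht
      obtain ⟨he1, he2⟩ := hexp t ht
      have he0 := Real.exp_pos t
      have h1 : ‖(if k = 0 then ((2 * Real.pi * l / Λ : ℝ) : ℂ) else 0)‖ ≤ 7 := by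
        split_ifs
        · rw [Complex.norm_real, Real.norm_of_nonneg (by positivity), div_le_iff₀ hΛ0]
          nlinarith
        · simp
      have h2 : ‖(2 : ℂ) ^ k * ((μ / Λ : ℝ) : ℂ) * Complex.exp (2 * t)‖ ≤ 2 ^ n * 9 := by
        have : Complex.exp (2 * t) = ((Real.exp (2 * t) : ℝ) : ℂ) := by push_cast; rfl
        rw [norm_mul, norm_mul, this, Complex.norm_real, Complex.norm_real, norm_pow,
          Complex.norm_ofNat, Real.norm_of_nonneg (by positivity), Real.norm_of_nonneg (by positivity)]
        have h3 : μ / Λ ≤ 1 := by rw [div_le_one hΛ0]; linarith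
        have h4 : Real.exp (2 * t) ≤ 9 := by rw [two_mul, Real.exp_add]; nlinarith
        have h5 : (2 : ℝ) ^ k ≤ 2 ^ n := pow_le_pow_right₀ (by norm_num) hk
        calc (2 : ℝ) ^ k * (μ / Λ) * Real.exp (2 * t) ≤ 2 ^ n * 1 * 9 := by gcongr
          _ = 2 ^ n * 9 := by ring
      have h3 : ‖((-ν / Λ : ℝ) : ℂ) * Complex.exp t‖ ≤ 3 := by
        have : Complex.exp t = ((Real.exp t : ℝ) : ℂ) := by push_cast; rfl
        rw [norm_mul, this, Complex.norm_real, Complex.norm_real, Real.norm_eq_abs, abs_div, abs_neg,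
          abs_of_pos hΛ0, Real.norm_of_nonneg he0.le]
        have h3 : |ν| / Λ ≤ 1 := by rw [div_le_one hΛ0]; exact hνμ
        calc |ν| / Λ * Real.exp t ≤ 1 * 2.7182818286 := by gcongr
          _ ≤ 3 := by norm_num
      rw [hg, iteratedDeriv_exp_sum]
      exact (norm_add_le _ _).trans (add_le_add ((norm_add_le _ _).trans (add_le_add h1 h2)) h3)
    have hgs : ContDiff ℝ ∞ g := by
      rw [hg]
      have : ContDiff ℝ ∞ (fun t : ℝ => (t : ℂ)) := Complex.ofRealCLM.contDiff
      fun_prop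
    have hE : ∀ t : ℝ, HasDerivAt (fun t : ℝ => Complex.exp (-(rayPhase l μ ν t : ℂ) * Complex.I))
        (-(Complex.I * Λ) * g t * Complex.exp (-(rayPhase l μ ν t : ℂ) * Complex.I)) t := by
      intro t
      have h1 : HasDerivAt (rayPhase l μ ν)
          (2 * Real.pi * l + μ * Real.exp (2 * t) - ν * Real.exp t) t := by
        have e1 := (hasDerivAt_id t).const_mul (2 * Real.pi * l)
        have e2 := ((((hasDerivAt_id t).const_mul 2).exp).const_mul μ).div_const 2
        have e3 := (Real.hasDerivAt_exp t).const_mul ν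
        refine ((e1.add e2).sub e3).congr_deriv ?_
        simp; ring
      refine ((h1.ofReal_comp.neg.mul_const Complex.I).cexp).congr_deriv ?_
      have h2 : (Λ : ℂ) * g t = 2 * Real.pi * l + μ * Complex.exp (2 * t) - ν * Complex.exp t := by
        rw [hgreal]
        push_cast
        field_simp
      change Complex.exp (-(rayPhase l μ ν t : ℂ) * Complex.I) * _ = _
      push_cast
      linear_combination (Complex.exp (-(rayPhase l μ ν t : ℂ) * Complex.I) * Complex.I) * h2
    refine (h g _ Λ hΛ0 hgs hgc hgB hE hE1 M b hb).trans ?_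
    have h5 : Λ⁻¹ ≤ 2 * (1 + l + μ)⁻¹ := by
      rw [← div_eq_mul_inv, le_div_iff₀ (by positivity), inv_mul_le_iff₀ hΛ0]
      linarith
    calc C * M * Λ⁻¹ ^ n ≤ C * M * (2 * (1 + l + μ)⁻¹) ^ n := by gcongr
      _ = C * 2 ^ n * M * (1 + l + μ)⁻¹ ^ n := by rw [mul_pow]; ring
      _ ≤ (3 ^ n + C * 2 ^ n) * M * (1 + l + μ)⁻¹ ^ n := by
        have : 0 ≤ 3 ^ n * M * (1 + l + μ)⁻¹ ^ n := by positivity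
        nlinarith

/-! ### Averages over dilations -/

/-- A continuous function on `ℝ` which vanishes outside of `[-1/2, 1/2]`. -/
structure IsWeight (c : ℝ → ℂ) : Prop where
  continuous : Continuous c
  eq_zero : ∀ t, 1 / 2 < |t| → c t = 0

theorem IsWeight.hasCompactSupport {c : ℝ → ℂ} (hc : IsWeight c) : HasCompactSupport c :=
  HasCompactSupport.intro (K := Set.Icc (-(1 / 2)) (1 / 2)) isCompact_Icc fun x hx => by
    apply hc.eq_zero
    by_contra h
    exact hx (abs_le.1 (not_lt.1 h))

theorem IsWeight.mul_left {c : ℝ → ℂ} (hc : IsWeight c) {a : ℝ → ℂ} (ha : Continuous a) :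
    IsWeight (fun t => a t * c t) :=
  ⟨ha.mul hc.continuous, fun t ht => by rw [hc.eq_zero t ht, mul_zero]⟩

theorem continuous_cexp_real (a : ℝ) : Continuous (fun t : ℝ => ((Real.exp (a * t) : ℝ) : ℂ)) := by
  fun_prop

theorem IsWeight.exp_mul {c : ℝ → ℂ} (hc : IsWeight c) (a : ℝ) :
    IsWeight (fun t => ((Real.exp (a * t) : ℝ) : ℂ) * c t) :=
  hc.mul_left (continuous_cexp_real a)

section dilation

variable {F : Type} [NormedAddCommGroup F] [NormedSpace ℝ F] [NormedSpace ℂ F] [SMulCommClass ℝ ℂ F]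
  [IsScalarTower ℝ ℂ F]

/-- The average `∫ c(t) h(e^t y) dt` of dilates of `h`. -/
def dilAvg (c : ℝ → ℂ) (h : E3 → F) (y : E3) : F := ∫ t, c t • h (Real.exp t • y)

omit [NormedSpace ℝ F] [SMulCommClass ℝ ℂ F] [IsScalarTower ℝ ℂ F] in
theorem dilAvg_integrable {c : ℝ → ℂ} (hc : IsWeight c) {h : E3 → F} (hh : Continuous h) (y : E3) :
    Integrable (fun t => c t • h (Real.exp t • y)) := by
  have := hc.continuous
  exact Continuous.integrable_of_hasCompactSupport (by fun_prop) hc.hasCompactSupport.smul_right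

/-- The chain rule produces a factor `e^t`, which is absorbed into the weight. The class of dilation
averages is therefore stable under differentiation. -/
theorem hasFDerivAt_dilAvg {c : ℝ → ℂ} (hc : IsWeight c) (h : 𝓢(E3, F)) (y : E3) :
    HasFDerivAt (dilAvg c h)
      (dilAvg (fun t => ((Real.exp (1 * t) : ℝ) : ℂ) * c t) (SchwartzMap.fderivCLM ℝ E3 F h) y) y := by
  have hcc := hc.continuous
  have hh := h.continuous
  have hf := (SchwartzMap.fderivCLM ℝ E3 F h).continuous
  obtain ⟨B, hB⟩ : ∃ B, ∀ x, ‖SchwartzMap.fderivCLM ℝ E3 F h x‖ ≤ B :=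
    ⟨_, fun x => SchwartzMap.norm_le_seminorm ℝ _ x⟩
  have hc1 := hc.exp_mul 1
  refine hasFDerivAt_integral_of_dominated_of_fderiv_le (𝕜 := ℝ) (s := Set.univ)
    (F := fun y t => c t • h (Real.exp t • y))
    (F' := fun y t => (((Real.exp (1 * t) : ℝ) : ℂ) * c t) • (SchwartzMap.fderivCLM ℝ E3 F h (Real.exp t • y)))
    (bound := fun t => ‖((Real.exp (1 * t) : ℝ) : ℂ) * c t‖ * B) Filter.univ_mem ?_ ?_ ?_ ?_ ?_ ?_
  · exact Eventually.of_forall fun z => (dilAvg_integrable hc hh z).aestronglyMeasurable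
  · exact dilAvg_integrable hc hh y
  · exact (dilAvg_integrable hc1 hf y).aestronglyMeasurable
  · refine Eventually.of_forall fun t x _ => ?_
    rw [norm_smul]
    exact mul_le_mul_of_nonneg_left (hB _) (norm_nonneg _)
  · refine (Continuous.integrable_of_hasCompactSupport ?_ hc1.hasCompactSupport.norm.mul_right)
    exact hc1.continuous.norm.mul continuous_const
  · refine Eventually.of_forall fun t x _ => ?_
    have e1 : HasFDerivAt (fun x : E3 => Real.exp t • x) (Real.exp t • ContinuousLinearMap.id ℝ E3) x :=
      (hasFDerivAt_id x).const_smul (Real.exp t)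
    have e2 := ((h.hasFDerivAt (Real.exp t • x)).comp x e1).const_smul (c t)
    refine e2.congr_fderiv ?_
    ext v
    have e3 : ∀ (r : ℝ) (z : F), (r : ℂ) • z = r • z := fun r z => by
      rw [← mul_one (r : ℂ), ← Complex.real_smul, smul_assoc, one_smul]
    simp only [_root_.smul_apply, ContinuousLinearMap.comp_apply, map_smul, one_mul,
      ContinuousLinearMap.id_apply, SchwartzMap.fderivCLM_apply, mul_smul]
    rw [e3, smul_comm]

/-- The target `F` and the weight are quantified inside the induction, because its step passes from
`h` to `fderiv h`, with values in `E3 →L[ℝ] F`, and from `c` to `e^t c`. -/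
theorem contDiff_dilAvg (n : ℕ) : ∀ {F : Type} [NormedAddCommGroup F] [NormedSpace ℝ F] [NormedSpace ℂ F]
    [SMulCommClass ℝ ℂ F] [IsScalarTower ℝ ℂ F] {c : ℝ → ℂ}, IsWeight c → ∀ (h : 𝓢(E3, F)),
    ContDiff ℝ n (dilAvg c h) := by
  induction n with
  | zero =>
    intro F _ _ _ _ _ c hc h
    exact contDiff_zero.2 (continuous_iff_continuousAt.2 fun y => (hasFDerivAt_dilAvg hc h y).continuousAt)
  | succ n ih =>
    intro F _ _ _ _ _ c hc h
    push_cast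
    refine contDiff_succ_iff_fderiv.2 ⟨fun y => (hasFDerivAt_dilAvg hc h y).differentiableAt, by simp, ?_⟩
    have : fderiv ℝ (dilAvg c h) = dilAvg (fun t => ((Real.exp (1 * t) : ℝ) : ℂ) * c t)
        (SchwartzMap.fderivCLM ℝ E3 F h) := funext fun y => (hasFDerivAt_dilAvg hc h y).fderiv
    rw [this]
    exact ih (hc.exp_mul 1) _

/-- The weight is supported in `|t| ≤ 1/2`, so `|y|` and `|e^t y|` are comparable; the factor
`e^{-kt}` converts `|e^t y|^k` into `|y|^k`. -/
theorem dilAvg_decay (k n : ℕ) : ∀ {F : Type} [NormedAddCommGroup F] [NormedSpace ℝ F] [NormedSpace ℂ F]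
    [SMulCommClass ℝ ℂ F] [IsScalarTower ℝ ℂ F] {c : ℝ → ℂ}, IsWeight c → ∃ C : ℝ, 0 ≤ C ∧
    ∀ (h : 𝓢(E3, F)) (y : E3),
      ‖y‖ ^ k * ‖iteratedFDeriv ℝ n (dilAvg c h) y‖ ≤ C * SchwartzMap.seminorm ℝ k n h := by
  induction n with
  | zero =>
    intro F _ _ _ _ _ c hc
    have hci := hc.exp_mul (-k)
    refine ⟨∫ t, ‖((Real.exp (-k * t) : ℝ) : ℂ) * c t‖, by positivity, fun h y => ?_⟩
    rw [norm_iteratedFDeriv_zero]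
    have h1 : ‖y‖ ^ k * ‖dilAvg c h y‖ ≤ ∫ t, ‖y‖ ^ k * ‖c t • h (Real.exp t • y)‖ := by
      rw [integral_const_mul]
      exact mul_le_mul_of_nonneg_left (norm_integral_le_integral_norm _) (by positivity)
    refine h1.trans ?_
    rw [← integral_mul_const]
    refine integral_mono ((dilAvg_integrable hc h.continuous y).norm.const_mul _) ?_ fun t => ?_
    · exact ((hci.continuous.integrable_of_hasCompactSupport hci.hasCompactSupport).norm).mul_const _
    · have h2 := SchwartzMap.le_seminorm ℝ k 0 h (Real.exp t • y)
      rw [norm_iteratedFDeriv_zero, norm_smul, mul_pow, Real.norm_of_nonneg (Real.exp_pos t).le] at h2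
      have h3 : Real.exp (-k * t) * Real.exp t ^ k = 1 := by
        rw [← Real.exp_nat_mul, ← Real.exp_add]; simp
      simp only [norm_smul, norm_mul, Complex.norm_real, Real.norm_of_nonneg (Real.exp_pos _).le]
      calc ‖y‖ ^ k * (‖c t‖ * ‖h (Real.exp t • y)‖)
          = Real.exp (-k * t) * ‖c t‖ * (Real.exp t ^ k * ‖y‖ ^ k * ‖h (Real.exp t • y)‖) := by
            linear_combination (-(‖y‖ ^ k * (‖c t‖ * ‖h (Real.exp t • y)‖))) * h3
        _ ≤ _ := by gcongr
  | succ n ih =>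
    intro F _ _ _ _ _ c hc
    obtain ⟨C, hC, ih⟩ := ih (F := E3 →L[ℝ] F) (hc.exp_mul 1)
    refine ⟨C, hC, fun h y => ?_⟩
    have : fderiv ℝ (dilAvg c h) = dilAvg (fun t => ((Real.exp (1 * t) : ℝ) : ℂ) * c t)
        (SchwartzMap.fderivCLM ℝ E3 F h) := funext fun y => (hasFDerivAt_dilAvg hc h y).fderiv
    rw [← norm_iteratedFDeriv_fderiv, this]
    refine (ih _ y).trans (mul_le_mul_of_nonneg_left ?_ hC)
    refine SchwartzMap.seminorm_le_bound ℝ k n _ (apply_nonneg _ _) fun x => ?_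
    have : ⇑(SchwartzMap.fderivCLM ℝ E3 F h) = fderiv ℝ h := rfl
    rw [this, norm_iteratedFDeriv_fderiv]
    exact SchwartzMap.le_seminorm ℝ k (n + 1) h x

end dilation

/-- The dilation average as an operator on the Schwartz space. -/
def dilS {c : ℝ → ℂ} (hc : IsWeight c) : 𝓢(E3, ℂ) →L[ℂ] 𝓢(E3, ℂ) :=
  SchwartzMap.mkCLM (fun h => dilAvg c h)
    (fun f g x => by
      simp only [dilAvg, _root_.add_apply, smul_add]
      exact integral_add (dilAvg_integrable hc f.continuous x) (dilAvg_integrable hc g.continuous x))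
    (fun a f x => by
      simp only [dilAvg, _root_.smul_apply, RingHom.id_apply]
      rw [← integral_smul]
      refine integral_congr_ae (Eventually.of_forall fun t => ?_)
      simp only [smul_eq_mul]; ring)
    (fun f => contDiff_infty.2 fun n => contDiff_dilAvg n hc f)
    (fun n => by
      obtain ⟨C, hC, h⟩ := dilAvg_decay n.1 n.2 (F := ℂ) hc
      refine ⟨{n}, C, hC, fun f x => ?_⟩
      rw [Finset.sup_singleton]
      exact h f x)

theorem dilS_apply {c : ℝ → ℂ} (hc : IsWeight c) (h : 𝓢(E3, ℂ)) (y : E3) :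
    dilS hc h y = ∫ t, c t * h (Real.exp t • y) := rfl

theorem dX_dilS {c : ℝ → ℂ} (hc : IsWeight c) (k : Fin 3) (h : 𝓢(E3, ℂ)) :
    dX k (dilS hc h) = dilS (hc.exp_mul 1) (dX k h) := by
  ext y
  have h0 : ⇑(dilS hc h) = dilAvg c h := rfl
  rw [dX_apply, partialDeriv, h0, (hasFDerivAt_dilAvg hc h y).fderiv, dilS_apply]
  have hi := dilAvg_integrable (hc.exp_mul 1) (SchwartzMap.fderivCLM ℝ E3 ℂ h).continuous y
  rw [dilAvg, ContinuousLinearMap.integral_apply hi]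
  refine integral_congr_ae (Eventually.of_forall fun t => ?_)
  simp only [_root_.smul_apply, dX_apply, partialDeriv, smul_eq_mul]
  rfl

/-- The Euler operator `x · ∇`. -/
def eulerS : 𝓢(E3, ℂ) →L[ℂ] 𝓢(E3, ℂ) := ∑ k, (mX k).comp (dX k)

theorem eulerS_eq (h : 𝓢(E3, ℂ)) : eulerS h = ∑ k, mX k (dX k h) := by
  simp [eulerS]

theorem euclidean_sum_single (x : E3) :
    x = ∑ k, x k • (EuclideanSpace.single k 1 : E3) := by
  ext i
  simp [Finset.sum_apply, Pi.single_apply]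

theorem eulerS_apply (h : 𝓢(E3, ℂ)) (x : E3) : eulerS h x = fderiv ℝ h x x := by
  conv_rhs => rw [euclidean_sum_single x, map_sum]
  rw [eulerS_eq, ← euclidean_sum_single x]
  rw [_root_.sum_apply]
  refine Finset.sum_congr rfl fun k _ => ?_
  rw [mX_apply, dX_apply, map_smul, partialDeriv]
  simp

theorem dX_eulerS (k : Fin 3) (h : 𝓢(E3, ℂ)) :
    dX k (eulerS h) = eulerS (dX k h) + dX k h := by
  rw [eulerS_eq, eulerS_eq, map_sum]
  simp_rw [dX_mX]
  rw [Finset.sum_add_distrib]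
  congr 1
  · exact Finset.sum_congr rfl fun j _ => by rw [dX_comm]
  · simp

/-! ### Projections onto the positive and negative part of the dilation generator -/

/-- A smooth function on `ℝ` which vanishes outside of `[-1/2, 1/2]`. -/
structure IsSmoothWeight (w : ℝ → ℂ) : Prop where
  smooth : ContDiff ℝ ∞ w
  eq_zero : ∀ t, 1 / 2 < |t| → w t = 0

theorem IsSmoothWeight.isWeight {w : ℝ → ℂ} (hw : IsSmoothWeight w) : IsWeight w :=
  ⟨hw.smooth.continuous, hw.eq_zero⟩

theorem IsSmoothWeight.deriv {w : ℝ → ℂ} (hw : IsSmoothWeight w) : IsSmoothWeight (deriv w) := by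
  refine ⟨((contDiff_infty_iff_deriv (𝕜 := ℝ)).1 hw.smooth).2, fun t ht => ?_⟩
  have : w =ᶠ[𝓝 t] fun _ => 0 := by
    filter_upwards [continuous_abs.continuousAt.eventually (lt_mem_nhds ht)] with x hx
    exact hw.eq_zero x hx
  rw [this.deriv_eq]; simp

theorem IsSmoothWeight.exp_mul {w : ℝ → ℂ} (hw : IsSmoothWeight w) (a : ℝ) :
    IsSmoothWeight (fun t => ((Real.exp (a * t) : ℝ) : ℂ) * w t) := by
  refine ⟨?_, fun t ht => by rw [hw.eq_zero t ht, mul_zero]⟩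
  have h1 : ContDiff ℝ ∞ (fun t : ℝ => Real.exp (a * t)) := by fun_prop
  exact (Complex.ofRealCLM.contDiff.comp h1).mul hw.smooth

theorem IsSmoothWeight.hasDerivAt {w : ℝ → ℂ} (hw : IsSmoothWeight w) (t : ℝ) :
    HasDerivAt w (_root_.deriv w t) t := (hw.smooth.differentiable (by simp) t).hasDerivAt

theorem IsSmoothWeight.deriv_exp_mul {w : ℝ → ℂ} (hw : IsSmoothWeight w) (t : ℝ) :
    _root_.deriv (fun t => ((Real.exp (1 * t) : ℝ) : ℂ) * w t) t
      = ((Real.exp (1 * t) : ℝ) : ℂ) * (w t + _root_.deriv w t) := by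
  have h1 : HasDerivAt (fun t : ℝ => Real.exp (1 * t)) (Real.exp (1 * t)) t := by
    simpa using ((hasDerivAt_id t).const_mul 1).exp
  refine (h1.ofReal_comp.mul (hw.hasDerivAt t)).deriv.trans ?_
  ring

theorem IsSmoothWeight.deriv_deriv_exp_mul {w : ℝ → ℂ} (hw : IsSmoothWeight w) (t : ℝ) :
    _root_.deriv (_root_.deriv (fun t => ((Real.exp (1 * t) : ℝ) : ℂ) * w t)) t
      = ((Real.exp (1 * t) : ℝ) : ℂ) * (w t + 2 * _root_.deriv w t + _root_.deriv (_root_.deriv w) t) := by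
  have h0 : _root_.deriv (fun t => ((Real.exp (1 * t) : ℝ) : ℂ) * w t)
      = fun t => ((Real.exp (1 * t) : ℝ) : ℂ) * (w t + _root_.deriv w t) :=
    funext hw.deriv_exp_mul
  have h1 : HasDerivAt (fun t : ℝ => Real.exp (1 * t)) (Real.exp (1 * t)) t := by
    simpa using ((hasDerivAt_id t).const_mul 1).exp
  rw [h0]
  refine (h1.ofReal_comp.mul ((hw.hasDerivAt t).add (hw.deriv.hasDerivAt t))).deriv.trans ?_
  simp only [Pi.add_apply]
  ring

/-- The character `exp (2πi ε λ t)`. -/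
def ramp (ε l t : ℝ) : ℂ := Complex.exp (((2 * Real.pi * ε * l * t : ℝ) : ℂ) * Complex.I)

theorem norm_ramp (ε l t : ℝ) : ‖ramp ε l t‖ = 1 := by
  rw [ramp, Complex.norm_exp_ofReal_mul_I]

theorem continuous_ramp (ε : ℝ) : Continuous (fun p : ℝ × ℝ => ramp ε p.1 p.2) := by
  unfold ramp; fun_prop

/-- The resolvent factor `1 / (1 + 4π²λ²)`. -/
def resolventFactor (l : ℝ) : ℝ := (1 + (2 * Real.pi * l) ^ 2)⁻¹

theorem resolventFactor_nonneg (l : ℝ) : 0 ≤ resolventFactor l := by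
  unfold resolventFactor; positivity

theorem continuous_resolventFactor : Continuous resolventFactor := by
  unfold resolventFactor
  refine Continuous.inv₀ (by fun_prop) fun l => by positivity

theorem integrable_resolventFactor : Integrable resolventFactor :=
  integrable_inv_one_add_sq.comp_mul_left' (R := 2 * Real.pi) (by positivity)

/-- The half-line kernel `∫_0^∞ exp(2πiελt) / (1 + 4π²λ²) dλ`. -/
def halfLineKernel (ε t : ℝ) : ℂ := ∫ l in Set.Ioi (0 : ℝ), (resolventFactor l : ℂ) * ramp ε l t

theorem integrable_halfLine (ε t : ℝ) : Integrable (fun l => (resolventFactor l : ℂ) * ramp ε l t) := by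
  have h1 : Continuous (fun l => (resolventFactor l : ℂ) * ramp ε l t) := by
    have := continuous_resolventFactor
    unfold ramp; fun_prop
  refine integrable_resolventFactor.mono' h1.aestronglyMeasurable (Eventually.of_forall fun l => ?_)
  rw [norm_mul, norm_ramp, mul_one, Complex.norm_real, Real.norm_of_nonneg (resolventFactor_nonneg l)]

theorem continuous_halfLineKernel (ε : ℝ) : Continuous (halfLineKernel ε) := by
  refine continuous_of_dominated (bound := resolventFactor) ?_ ?_
    integrable_resolventFactor.integrableOn ?_
  · exact fun t => (integrable_halfLine ε t).integrableOn.aestronglyMeasurable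
  · refine fun t => Eventually.of_forall fun l => ?_
    rw [norm_mul, norm_ramp, mul_one, Complex.norm_real, Real.norm_of_nonneg (resolventFactor_nonneg l)]
  · refine Eventually.of_forall fun l => ?_
    unfold ramp; fun_prop

/-- The integral over `λ` that defines the projection is not absolutely convergent as a double
integral in `(λ, t)`. Two integrations by parts in `t` insert `1/(1 + 4π²λ²)` and replace the
profile by `(1 - ∂_t²)(w(t) h(e^t y))`. As `∂_t` of `h(e^t y)` is the Euler operator applied to `h`,
the latter expands into `h`, `eulerS h` and `eulerS (eulerS h)`. The three weights here are their
coefficients times the half-line kernel. -/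
theorem IsSmoothWeight.weight₀ {w : ℝ → ℂ} (hw : IsSmoothWeight w) (ε : ℝ) :
    IsWeight (fun t => halfLineKernel ε t * (w t - _root_.deriv (_root_.deriv w) t)) := by
  refine IsWeight.mul_left ⟨hw.smooth.continuous.sub hw.deriv.deriv.smooth.continuous, fun t ht => ?_⟩
    (continuous_halfLineKernel ε)
  rw [Pi.sub_apply, hw.eq_zero t ht, hw.deriv.deriv.eq_zero t ht, sub_zero]

theorem IsSmoothWeight.weight₁ {w : ℝ → ℂ} (hw : IsSmoothWeight w) (ε : ℝ) :
    IsWeight (fun t => halfLineKernel ε t * (-2 * _root_.deriv w t)) :=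
  (hw.deriv.isWeight.mul_left continuous_const).mul_left (continuous_halfLineKernel ε)

theorem IsSmoothWeight.weight₂ {w : ℝ → ℂ} (hw : IsSmoothWeight w) (ε : ℝ) :
    IsWeight (fun t => halfLineKernel ε t * (-1 * w t)) :=
  (hw.isWeight.mul_left continuous_const).mul_left (continuous_halfLineKernel ε)

/-- The operator `h ↦ ∫_0^∞ (∫ exp(2πiελt) w(t) h(e^t y) dt) dλ` on the Schwartz space. -/
def halfProj (ε : ℝ) {w : ℝ → ℂ} (hw : IsSmoothWeight w) : 𝓢(E3, ℂ) →L[ℂ] 𝓢(E3, ℂ) :=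
  dilS (hw.weight₀ ε) + (dilS (hw.weight₁ ε)).comp eulerS
    + (dilS (hw.weight₂ ε)).comp (eulerS.comp eulerS)

theorem halfProj_eq (ε : ℝ) {w : ℝ → ℂ} (hw : IsSmoothWeight w) (h : 𝓢(E3, ℂ)) :
    halfProj ε hw h = dilS (hw.weight₀ ε) h + dilS (hw.weight₁ ε) (eulerS h)
      + dilS (hw.weight₂ ε) (eulerS (eulerS h)) := rfl

/-- A derivative of `h(e^t y)` in `y` brings out `e^t`, so `w` becomes `e^t w`. At the level of the
three weights this amounts to matching `[∂_k, x·∇] = ∂_k` with the Leibniz rule for `e^t w`. -/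
theorem dX_halfProj (ε : ℝ) {w : ℝ → ℂ} (hw : IsSmoothWeight w) (k : Fin 3) (h : 𝓢(E3, ℂ)) :
    dX k (halfProj ε hw h) = halfProj ε (hw.exp_mul 1) (dX k h) := by
  rw [halfProj_eq, halfProj_eq, map_add, map_add, dX_dilS, dX_dilS, dX_dilS, dX_eulerS, dX_eulerS,
    dX_eulerS]
  simp only [map_add]
  ext y
  simp only [_root_.add_apply, dilS_apply]
  set g₀ := dX k h
  set g₁ := eulerS g₀
  set g₂ := eulerS g₁
  have hi : ∀ {c : ℝ → ℂ}, IsWeight c → ∀ g : 𝓢(E3, ℂ),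
      Integrable (fun t => c t * g (Real.exp t • y)) := fun hc g => dilAvg_integrable hc g.continuous y
  have a0 := hi ((hw.weight₀ ε).exp_mul 1) g₀
  have a1 := hi ((hw.weight₁ ε).exp_mul 1) g₁
  have a1' := hi ((hw.weight₁ ε).exp_mul 1) g₀
  have a2 := hi ((hw.weight₂ ε).exp_mul 1) g₂
  have a2' := hi ((hw.weight₂ ε).exp_mul 1) g₁
  have a2'' := hi ((hw.weight₂ ε).exp_mul 1) g₀
  have b0 := hi ((hw.exp_mul 1).weight₀ ε) g₀
  have b1 := hi ((hw.exp_mul 1).weight₁ ε) g₁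
  have b2 := hi ((hw.exp_mul 1).weight₂ ε) g₂
  rw [← integral_add a1 a1', ← integral_add a2 a2', ← integral_add a2' a2'',
    ← integral_add (a2.fun_add a2') (a2'.fun_add a2''), ← integral_add a0 (a1.fun_add a1'),
    ← integral_add (a0.fun_add (a1.fun_add a1')) ((a2.fun_add a2').fun_add (a2'.fun_add a2'')),
    ← integral_add b0 b1, ← integral_add (b0.fun_add b1) b2]
  refine integral_congr_ae (Eventually.of_forall fun t => ?_)
  simp only [hw.deriv_exp_mul, hw.deriv_deriv_exp_mul]
  ring

/-! ### The representation of the projections by an integral over dual variables -/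

/-- The profile `w(t) h(e^t y)` of `h` along the ray through `y`. -/
def rayProfile (w : ℝ → ℂ) (h : 𝓢(E3, ℂ)) (y : E3) (t : ℝ) : ℂ := w t * h (Real.exp t • y)

theorem hasDerivAt_ray (h : 𝓢(E3, ℂ)) (y : E3) (t : ℝ) :
    HasDerivAt (fun t : ℝ => h (Real.exp t • y)) (eulerS h (Real.exp t • y)) t := by
  rw [eulerS_apply]
  have h1 : HasDerivAt (fun t : ℝ => Real.exp t • y) (Real.exp t • y) t :=
    (Real.hasDerivAt_exp t).smul_const y
  exact (h.hasFDerivAt (Real.exp t • y)).comp_hasDerivAt t h1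

theorem contDiff_rayProfile {w : ℝ → ℂ} (hw : IsSmoothWeight w) (h : 𝓢(E3, ℂ)) (y : E3) :
    ContDiff ℝ ∞ (rayProfile w h y) := by
  have h1 : ContDiff ℝ ∞ (fun t : ℝ => Real.exp t • y) := by fun_prop
  exact hw.smooth.mul ((h.smooth ⊤).comp h1)

theorem rayProfile_hasCompactSupport {w : ℝ → ℂ} (hw : IsSmoothWeight w) (h : 𝓢(E3, ℂ)) (y : E3) :
    HasCompactSupport (rayProfile w h y) := hw.isWeight.hasCompactSupport.mul_right

theorem hasDerivAt_rayProfile {w : ℝ → ℂ} (hw : IsSmoothWeight w) (h : 𝓢(E3, ℂ)) (y : E3) (t : ℝ) :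
    HasDerivAt (rayProfile w h y) (rayProfile (deriv w) h y t + rayProfile w (eulerS h) y t) t :=
  (hw.hasDerivAt t).mul (hasDerivAt_ray h y t)

theorem hasDerivAt_ramp (ε l t : ℝ) :
    HasDerivAt (ramp ε l) ((2 * Real.pi * ε * l * Complex.I) * ramp ε l t) t := by
  have h1 : HasDerivAt (fun t : ℝ => 2 * Real.pi * ε * l * t) (2 * Real.pi * ε * l) t := by
    simpa using (hasDerivAt_id t).const_mul (2 * Real.pi * ε * l)
  refine ((h1.ofReal_comp.mul_const Complex.I).cexp).congr_deriv ?_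
  rw [ramp]
  push_cast
  ring

theorem continuous_ramp_right (ε l : ℝ) : Continuous (ramp ε l) := by
  unfold ramp; fun_prop

theorem integral_ramp_mul_deriv (ε l : ℝ) {F F' : ℝ → ℂ} (hF : ∀ t, HasDerivAt F (F' t) t)
    (hc : HasCompactSupport F) (hF' : Continuous F') :
    ∫ t, ramp ε l t * F' t = -(2 * Real.pi * ε * l * Complex.I) * ∫ t, ramp ε l t * F t := by
  have hFc : Continuous F := continuous_iff_continuousAt.2 fun t => (hF t).continuousAt
  have hF'e : F' = deriv F := funext fun t => (hF t).deriv.symm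
  have hc' : HasCompactSupport F' := hF'e ▸ hc.deriv
  have hr := continuous_ramp_right ε l
  have := integral_mul_deriv_eq_deriv_mul_of_integrable (u := ramp ε l) (v := F)
    (u' := fun t => (2 * Real.pi * ε * l * Complex.I) * ramp ε l t) (v' := F')
    (fun t _ => hasDerivAt_ramp ε l t) (fun t _ => hF t)
    ((hr.mul hF').integrable_of_hasCompactSupport hc'.mul_left)
    (((continuous_const.mul hr).mul hFc).integrable_of_hasCompactSupport hc.mul_left)
    ((hr.mul hFc).integrable_of_hasCompactSupport hc.mul_left)
  rw [this, ← integral_const_mul, ← integral_neg]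
  refine integral_congr_ae (Eventually.of_forall fun t => ?_)
  ring

/-- `w(t) h(e^t y) - ∂_t² (w(t) h(e^t y))`. -/
def rayResolvent (w : ℝ → ℂ) (h : 𝓢(E3, ℂ)) (y : E3) (t : ℝ) : ℂ :=
  rayProfile (fun t => w t - deriv (deriv w) t) h y t + rayProfile (fun t => -2 * deriv w t) (eulerS h) y t
    + rayProfile (fun t => -1 * w t) (eulerS (eulerS h)) y t

theorem continuous_rayResolvent {w : ℝ → ℂ} (hw : IsSmoothWeight w) (h : 𝓢(E3, ℂ)) (y : E3) :
    Continuous (rayResolvent w h y) := by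
  unfold rayResolvent rayProfile
  have := hw.smooth.continuous
  have := hw.deriv.smooth.continuous
  have := hw.deriv.deriv.smooth.continuous
  have := h.continuous
  have := (eulerS h).continuous
  have := (eulerS (eulerS h)).continuous
  fun_prop

theorem rayResolvent_eq_zero {w : ℝ → ℂ} (hw : IsSmoothWeight w) (h : 𝓢(E3, ℂ)) (y : E3) {t : ℝ}
    (ht : 1 / 2 < |t|) : rayResolvent w h y t = 0 := by
  simp [rayResolvent, rayProfile, hw.eq_zero t ht, hw.deriv.eq_zero t ht, hw.deriv.deriv.eq_zero t ht]

theorem rayResolvent_hasCompactSupport {w : ℝ → ℂ} (hw : IsSmoothWeight w) (h : 𝓢(E3, ℂ)) (y : E3) :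
    HasCompactSupport (rayResolvent w h y) :=
  (⟨continuous_rayResolvent hw h y, fun _ ht => rayResolvent_eq_zero hw h y ht⟩ :
    IsWeight _).hasCompactSupport

/-- Against the character, `∂_t` acts as multiplication by `-2πiελ`. Hence `1 - ∂_t²` acts as `1 +
4π²λ²`, where `ε² = 1` is used, and the resolvent factor undoes it. -/
theorem integral_ramp_rayProfile {ε : ℝ} (hε : ε ^ 2 = 1) (l : ℝ) {w : ℝ → ℂ} (hw : IsSmoothWeight w)
    (h : 𝓢(E3, ℂ)) (y : E3) :
    ∫ t, ramp ε l t * rayProfile w h y t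
      = ∫ t, (resolventFactor l : ℂ) * (ramp ε l t * rayResolvent w h y t) := by
  have hr := continuous_ramp_right ε l
  have c0 : ∀ {w : ℝ → ℂ} (_ : IsSmoothWeight w) (h : 𝓢(E3, ℂ)), Continuous (rayProfile w h y) :=
    fun hw h => (contDiff_rayProfile hw h y).continuous
  have i0 : ∀ {w : ℝ → ℂ} (_ : IsSmoothWeight w) (h : 𝓢(E3, ℂ)),
      Integrable (fun t => ramp ε l t * rayProfile w h y t) := fun hw h =>
    (hr.mul (c0 hw h)).integrable_of_hasCompactSupport (rayProfile_hasCompactSupport hw h y).mul_left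
  have key : ∀ {w : ℝ → ℂ} (hw : IsSmoothWeight w) (h : 𝓢(E3, ℂ)),
      (∫ t, ramp ε l t * rayProfile (deriv w) h y t) + ∫ t, ramp ε l t * rayProfile w (eulerS h) y t
        = -(2 * Real.pi * ε * l * Complex.I) * ∫ t, ramp ε l t * rayProfile w h y t := by
    intro w hw h
    rw [← integral_ramp_mul_deriv ε l (hasDerivAt_rayProfile hw h y) (rayProfile_hasCompactSupport hw h y)
      ((c0 hw.deriv h).add (c0 hw _)), ← integral_add (i0 hw.deriv h) (i0 hw _)]
    simp only [mul_add]
  have k1 := key hw h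
  have k2 := key hw.deriv h
  have k3 := key hw (eulerS h)
  set I0 := ∫ t, ramp ε l t * rayProfile w h y t
  set I1 := ∫ t, ramp ε l t * rayProfile (deriv w) h y t
  set I2 := ∫ t, ramp ε l t * rayProfile w (eulerS h) y t
  set I3 := ∫ t, ramp ε l t * rayProfile (deriv (deriv w)) h y t
  set I4 := ∫ t, ramp ε l t * rayProfile (deriv w) (eulerS h) y t
  set I5 := ∫ t, ramp ε l t * rayProfile w (eulerS (eulerS h)) y t
  have hsum : ∫ t, ramp ε l t * rayResolvent w h y t = I0 - I3 - 2 * I4 - I5 := by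
    have e1 := integral_sub (i0 hw h) (i0 hw.deriv.deriv h)
    have e2 := integral_sub ((i0 hw h).sub (i0 hw.deriv.deriv h)) ((i0 hw.deriv (eulerS h)).const_mul 2)
    have e3 := integral_sub (((i0 hw h).sub (i0 hw.deriv.deriv h)).sub ((i0 hw.deriv (eulerS h)).const_mul 2))
      (i0 hw (eulerS (eulerS h)))
    simp only [Pi.sub_apply] at e1 e2 e3
    rw [integral_const_mul] at e2
    rw [e2, e1] at e3
    rw [← e3]
    refine integral_congr_ae (Eventually.of_forall fun t => ?_)
    simp only [rayResolvent, rayProfile]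
    ring
  rw [integral_const_mul, hsum, resolventFactor]
  have hne : (((1 + (2 * Real.pi * l) ^ 2 : ℝ)) : ℂ) ≠ 0 := by
    exact_mod_cast (by positivity : (1 + (2 * Real.pi * l) ^ 2 : ℝ) ≠ 0)
  rw [Complex.ofReal_inv, eq_inv_mul_iff_mul_eq₀ hne]
  have hε' : (ε : ℂ) ^ 2 = 1 := by exact_mod_cast hε
  push_cast
  linear_combination k2 + k3 + (-(2 * Real.pi * ε * l * Complex.I)) * k1
    + (-(2 * Real.pi * l) ^ 2 * I0) * hε' + ((2 * Real.pi * ε * l) ^ 2 * I0) * Complex.I_sq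

theorem halfProj_apply_eq {ε : ℝ} {w : ℝ → ℂ} (hw : IsSmoothWeight w) (h : 𝓢(E3, ℂ)) (y : E3) :
    halfProj ε hw h y = ∫ t, halfLineKernel ε t * rayResolvent w h y t := by
  rw [halfProj_eq]
  simp only [_root_.add_apply, dilS_apply]
  have hi : ∀ {c : ℝ → ℂ}, IsWeight c → ∀ g : 𝓢(E3, ℂ),
      Integrable (fun t => c t * g (Real.exp t • y)) := fun hc g => dilAvg_integrable hc g.continuous y
  rw [← integral_add (hi (hw.weight₀ ε) h) (hi (hw.weight₁ ε) _),
    ← integral_add ((hi (hw.weight₀ ε) h).fun_add (hi (hw.weight₁ ε) (eulerS h))) (hi (hw.weight₂ ε) (eulerS (eulerS h)))]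
  refine integral_congr_ae (Eventually.of_forall fun t => ?_)
  simp only [rayResolvent, rayProfile]
  ring

/-- The representation of `halfProj` as an integral over the dual variable. -/
theorem halfProj_apply {ε : ℝ} (hε : ε ^ 2 = 1) {w : ℝ → ℂ} (hw : IsSmoothWeight w) (h : 𝓢(E3, ℂ)) (y : E3) :
    halfProj ε hw h y = ∫ l in Set.Ioi (0 : ℝ), ∫ t, ramp ε l t * rayProfile w h y t := by
  rw [halfProj_apply_eq]
  simp_rw [integral_ramp_rayProfile hε _ hw h y]
  -- With the resolvent factor in place the double integral converges absolutely, so Fubini applies.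
  rw [integral_integral_swap]
  · refine integral_congr_ae (Eventually.of_forall fun t => ?_)
    simp only [halfLineKernel]
    rw [← integral_mul_const]
    refine integral_congr_ae (Eventually.of_forall fun l => ?_)
    simp only
    ring
  · have hcont : Continuous (fun p : ℝ × ℝ => (resolventFactor p.1 : ℂ) * (ramp ε p.1 p.2 * rayResolvent w h y p.2)) := by
      have h1 := continuous_resolventFactor
      have h2 := continuous_ramp ε
      have h3 := continuous_rayResolvent hw h y
      fun_prop
    have hdom : Integrable (fun p : ℝ × ℝ => resolventFactor p.1 * ‖rayResolvent w h y p.2‖)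
        ((volume.restrict (Set.Ioi 0)).prod volume) :=
      (integrable_resolventFactor.integrableOn).mul_prod
        ((continuous_rayResolvent hw h y).integrable_of_hasCompactSupport
          (rayResolvent_hasCompactSupport hw h y)).norm
    refine hdom.mono' hcont.aestronglyMeasurable (Eventually.of_forall fun p => ?_)
    rw [Function.uncurry, norm_mul, norm_mul, norm_ramp, one_mul, Complex.norm_real,
      Real.norm_of_nonneg (resolventFactor_nonneg _)]

/-- This is Fourier inversion at `t = 0` for the ray profile, whose value there is `w 0 * h y = h
y`. The two signs of `ε` cover the two half lines of the dual variable. -/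
theorem halfProj_add_halfProj {w : ℝ → ℂ} (hw : IsSmoothWeight w) (hw0 : w 0 = 1) (h : 𝓢(E3, ℂ)) :
    halfProj 1 hw h + halfProj (-1) hw h = h := by
  ext y
  rw [_root_.add_apply, halfProj_apply (by norm_num), halfProj_apply (by norm_num)]
  set F : 𝓢(ℝ, ℂ) := (rayProfile_hasCompactSupport hw h y).toSchwartzMap (contDiff_rayProfile hw h y) with hF
  have hFc : ∀ t, F t = rayProfile w h y t := fun t => rfl
  have hinv : ∀ l, ∫ t, ramp 1 l t * rayProfile w h y t = (𝓕⁻ F) l := by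
    intro l
    rw [SchwartzMap.fourierInv_coe, Real.fourierInv_eq']
    refine integral_congr_ae (Eventually.of_forall fun t => ?_)
    simp only [ramp, hFc, smul_eq_mul]
    congr 4
    simp
    ring
  have hneg : ∀ l, ∫ t, ramp (-1) l t * rayProfile w h y t = (𝓕⁻ F) (-l) := by
    intro l
    rw [← hinv]
    refine integral_congr_ae (Eventually.of_forall fun t => ?_)
    simp only [ramp]
    congr 4
    ring
  simp_rw [hinv, hneg]
  rw [integral_comp_neg_Ioi (c := 0) (f := fun l => (𝓕⁻ F : 𝓢(ℝ, ℂ)) l), neg_zero, add_comm,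
    ← setIntegral_union]
  · rw [Set.Iic_union_Ioi, setIntegral_univ]
    have h1 : 𝓕 (𝓕⁻ F) = F := FourierTransform.fourier_fourierInv_eq F
    have h2 : (𝓕 (𝓕⁻ F)) 0 = ∫ l, (𝓕⁻ F) l := by
      rw [SchwartzMap.fourier_coe, Real.fourier_eq']
      simp
    rw [← h2, h1, hFc, rayProfile, hw0]
    simp
  · exact Set.Iic_disjoint_Ioi le_rfl
  · exact measurableSet_Ioi
  · exact (𝓕⁻ F).integrable.integrableOn
  · exact (𝓕⁻ F).integrable.integrableOn

/-! ### Kernel estimates for the composition of the free propagator with the projections -/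

/-- The points `x`, `z` are such that the phase `|x - e^t z|² / 2s` is either increasing for
`|t| ≤ 1`, or harmless. -/
def IsRayRegular (s : ℝ) (x z : E3) : Prop := ‖x‖ ≤ ‖z‖ / 4 ∨ (‖z‖ ^ 2 ≤ s ∧ ‖x‖ ^ 2 ≤ s)

/-- Expanding `|x - e^t z|²` yields the phase of `rayPhase` with `μ = |z|²/s` and `ν = x·z/s`. The
sign `-1` of the character is the one that makes `2πlt` and `μe^{2t}/2` grow together. -/
theorem oscGaussian_ray (s : ℝ) (x z : E3) (t l : ℝ) :
    ramp (-1) l t * oscGaussian s (x - Real.exp t • z)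
      = oscGaussian s x *
        Complex.exp (-(rayPhase l (‖z‖ ^ 2 / s) ((inner ℝ x z : ℝ) / s) t : ℂ) * Complex.I) := by
  rw [ramp, oscGaussian, oscGaussian, ← Complex.exp_add, ← Complex.exp_add]
  congr 1
  have h : ‖x - Real.exp t • z‖ ^ 2
      = ‖x‖ ^ 2 - 2 * Real.exp t * (inner ℝ x z : ℝ) + Real.exp (2 * t) * ‖z‖ ^ 2 := by
    rw [norm_sub_sq_real, inner_smul_right, norm_smul, Real.norm_of_nonneg (Real.exp_pos t).le,
      mul_pow, two_mul t, Real.exp_add]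
    ring
  rw [h, rayPhase]
  push_cast
  ring

/-- By Cauchy–Schwarz, the two alternatives of `IsRayRegular` imply the two alternatives on `(μ, ν)`
in `exists_rayPhase_bound`. -/
theorem exists_ray_integral_bound (n : ℕ) :
    ∃ C : ℝ, 0 ≤ C ∧ ∀ (s : ℝ), 0 < s → ∀ (x z : E3), IsRayRegular s x z → ∀ (l : ℝ), 0 ≤ l →
      ∀ (M : ℝ) (b : ℝ → ℂ), IsAmplitude n M b →
        ‖∫ t, ramp (-1) l t * oscGaussian s (x - Real.exp t • z) * b t‖
          ≤ C * M * (1 + l + ‖z‖ ^ 2 / s)⁻¹ ^ n := by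
  obtain ⟨C, hC, h⟩ := exists_rayPhase_bound n
  refine ⟨C, hC, fun s hs x z hxz l hl M b hb => ?_⟩
  have e : ∫ t, ramp (-1) l t * oscGaussian s (x - Real.exp t • z) * b t
      = oscGaussian s x * ∫ t, Complex.exp
        (-(rayPhase l (‖z‖ ^ 2 / s) ((inner ℝ x z : ℝ) / s) t : ℂ) * Complex.I) * b t := by
    rw [← integral_const_mul]
    refine integral_congr_ae (Eventually.of_forall fun t => ?_)
    simp only
    rw [oscGaussian_ray, mul_assoc]
  rw [e, norm_mul, norm_oscGaussian, one_mul]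
  refine h l (‖z‖ ^ 2 / s) ((inner ℝ x z : ℝ) / s) hl (by positivity) ?_ M b hb
  have hin := abs_real_inner_le_norm x z
  rw [abs_div, abs_of_pos hs]
  rcases hxz with h1 | ⟨h1, h2⟩
  · left
    rw [div_le_iff₀ hs]
    calc |(inner ℝ x z : ℝ)| ≤ ‖x‖ * ‖z‖ := hin
      _ ≤ ‖z‖ / 4 * ‖z‖ := by gcongr
      _ = ‖z‖ ^ 2 / s / 4 * s := by field_simp
  · right
    refine ⟨by rw [div_le_one hs]; exact h1, ?_⟩
    rw [div_le_one hs]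
    nlinarith [sq_nonneg (‖x‖ - ‖z‖)]

/-- Two powers pay for the convergence of the integral over `l`; the remaining `n` give decay in
`μ`. -/
theorem inv_pow_split {l μ : ℝ} (hl : 0 ≤ l) (hμ : 0 ≤ μ) (n : ℕ) :
    (1 + l + μ)⁻¹ ^ (n + 2) ≤ (1 + l ^ 2)⁻¹ * (1 + μ)⁻¹ ^ n := by
  rw [pow_add, mul_comm]
  gcongr
  · rw [inv_pow]
    gcongr
    nlinarith
  · linarith

theorem integral_Ioi_inv_one_add_sq_le : ∫ l in Set.Ioi (0 : ℝ), (1 + l ^ 2)⁻¹ ≤ 4 := by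
  have h := setIntegral_le_integral (s := Set.Ioi (0 : ℝ)) integrable_inv_one_add_sq
    (Eventually.of_forall fun l => by simp only [Pi.zero_apply]; positivity)
  rw [integral_univ_inv_one_add_sq] at h
  exact h.trans (Real.pi_lt_d2.le.trans (by norm_num))

theorem norm_integral_Ioi_le {f : ℝ → ℂ} {B : ℝ} (hf : ∀ l, 0 < l → ‖f l‖ ≤ (1 + l ^ 2)⁻¹ * B) :
    ‖∫ l in Set.Ioi (0 : ℝ), f l‖ ≤ 4 * B := by
  have hB : 0 ≤ B := by
    have := (norm_nonneg _).trans (hf 1 one_pos)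
    norm_num at this
    linarith
  have h1 : ‖∫ l in Set.Ioi (0 : ℝ), f l‖ ≤ ∫ l in Set.Ioi (0 : ℝ), (1 + l ^ 2)⁻¹ * B := by
    refine norm_integral_le_of_norm_le (integrable_inv_one_add_sq.mul_const B).integrableOn ?_
    filter_upwards [ae_restrict_mem measurableSet_Ioi] with l hl using hf l hl
  refine h1.trans ?_
  rw [integral_mul_const]
  exact mul_le_mul_of_nonneg_right integral_Ioi_inv_one_add_sq_le hB

theorem integral_comp_exp_smul (t : ℝ) (f : E3 → ℂ) :
    ∫ y, f (Real.exp t • y) = ((Real.exp (-3 * t) : ℝ) : ℂ) * ∫ z, f z := by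
  rw [Measure.integral_comp_smul volume f, finrank_euclideanSpace, Fintype.card_fin,
    ← Real.exp_nat_mul, ← Real.exp_neg, abs_of_pos (Real.exp_pos _), Complex.real_smul]
  congr 3
  push_cast; ring

theorem integrable_dil_prod {c : ℝ → ℂ} (hc : IsWeight c) (g : 𝓢(E3, ℂ)) :
    Integrable (fun p : E3 × ℝ => c p.2 * g (Real.exp p.2 • p.1)) (volume.prod volume) := by
  have hcont : Continuous (fun p : E3 × ℝ => c p.2 * g (Real.exp p.2 • p.1)) := by
    have := hc.continuous; have := g.continuous; fun_prop
  rw [integrable_prod_iff' hcont.aestronglyMeasurable]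
  refine ⟨Eventually.of_forall fun t => ?_, ?_⟩
  · exact ((g.integrable (μ := volume)).comp_smul (Real.exp_pos t).ne').const_mul (c t)
  · have h1 : ∀ t : ℝ, ∫ y : E3, ‖c t * g (Real.exp t • y)‖
        = ‖c t‖ * (Real.exp (-3 * t) * ∫ z, ‖g z‖) := by
      intro t
      simp_rw [norm_mul]
      rw [integral_const_mul, Measure.integral_comp_smul volume (fun z => ‖g z‖), finrank_euclideanSpace,
        Fintype.card_fin, ← Real.exp_nat_mul, ← Real.exp_neg, abs_of_pos (Real.exp_pos _), smul_eq_mul]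
      congr 3
      push_cast; ring
    simp_rw [h1]
    have hcc := hc.continuous
    exact Continuous.integrable_of_hasCompactSupport (by fun_prop) hc.hasCompactSupport.norm.mul_right

theorem integrable_rayResolvent_prod {w : ℝ → ℂ} (hw : IsSmoothWeight w) (h : 𝓢(E3, ℂ)) :
    Integrable (fun p : E3 × ℝ => rayResolvent w h p.1 p.2) (volume.prod volume) := by
  have c0 : IsWeight (fun t => w t - deriv (deriv w) t) :=
    ⟨hw.smooth.continuous.sub hw.deriv.deriv.smooth.continuous, fun t ht => by
      rw [hw.eq_zero t ht, hw.deriv.deriv.eq_zero t ht, sub_zero]⟩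
  have c1 : IsWeight (fun t => -2 * deriv w t) := hw.deriv.isWeight.mul_left continuous_const
  have c2 : IsWeight (fun t => -1 * w t) := hw.isWeight.mul_left continuous_const
  exact ((integrable_dil_prod c0 h).add (integrable_dil_prod c1 _)).add (integrable_dil_prod c2 _)

/-- The oscillation is in the kernel, while `h` is arbitrary and should not be differentiated. The
dilation is therefore moved from `h` to the kernel, after which the integral in `t` has a smooth
amplitude made of `w`, the Jacobian and `A`. The five derivatives of the amplitude split as two for
the integral over `λ` and three for the decay in `|z|²/s`. -/
theorem exists_kernel_halfProj_bound :
    ∃ C : ℝ, 0 ≤ C ∧ ∀ (s : ℝ), 0 < s → ∀ (w : ℝ → ℂ) (hw : IsSmoothWeight w) (A : E3 → ℂ),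
      Continuous A → (∃ B, ∀ y, ‖A y‖ ≤ B) → ∀ (x : E3) (M : E3 → ℝ), Measurable M → (∃ B, ∀ z, M z ≤ B) →
      (∀ z, IsAmplitude 5 (M z) (fun t => w (-t) * ((Real.exp (3 * t) : ℝ) : ℂ) * A (Real.exp t • z))) →
      (∀ z, M z ≠ 0 → IsRayRegular s x z) → ∀ h : 𝓢(E3, ℂ),
      ‖∫ y, oscGaussian s (x - y) * (A y * halfProj 1 hw h y)‖
        ≤ C * ∫ z, M z * (1 + ‖z‖ ^ 2 / s)⁻¹ ^ 3 * ‖h z‖ := by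
  obtain ⟨C, hC, hray⟩ := exists_ray_integral_bound 5
  refine ⟨4 * C, by positivity, ?_⟩
  rintro s hs w hw A hA ⟨BA, hBA⟩ x M hM ⟨BM, hBM⟩ hamp hreg h
  set Ψ : E3 → ℂ := fun y => oscGaussian s (x - y) * A y with hΨ
  have hΨc : Continuous Ψ := by
    have := continuous_oscGaussian s; fun_prop
  have hΨB : ∀ y, ‖Ψ y‖ ≤ BA := fun y => by
    rw [hΨ]; simp only [norm_mul, norm_oscGaussian, one_mul]; exact hBA y
  have hM0 : ∀ z, 0 ≤ M z := fun z => (hamp z).nonneg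
  have hwc := hw.smooth.continuous
  have hhc := h.continuous
  -- the representation of the left-hand side as an integral over the dual variable
  have hJ : ∫ y, oscGaussian s (x - y) * (A y * halfProj 1 hw h y)
      = ∫ l in Set.Ioi (0 : ℝ), ∫ y, Ψ y * ∫ t, ramp 1 l t * rayProfile w h y t := by
    rw [← integral_integral_swap]
    · refine integral_congr_ae (Eventually.of_forall fun y => ?_)
      simp only
      rw [integral_const_mul, halfProj_apply (by norm_num), hΨ]
      ring
    · have hG : ∀ l y, ‖∫ t, ramp 1 l t * rayProfile w h y t‖
          ≤ resolventFactor l * ∫ t, ‖rayResolvent w h y t‖ := by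
        intro l y
        rw [integral_ramp_rayProfile (by norm_num) l hw, integral_const_mul, norm_mul, Complex.norm_real,
          Real.norm_of_nonneg (resolventFactor_nonneg l)]
        refine mul_le_mul_of_nonneg_left ((norm_integral_le_integral_norm _).trans_eq ?_)
          (resolventFactor_nonneg l)
        simp only [norm_mul, norm_ramp, one_mul]
      have hdom : Integrable (fun p : E3 × ℝ => (BA * ∫ t, ‖rayResolvent w h p.1 t‖) * resolventFactor p.2)
          (volume.prod (volume.restrict (Set.Ioi 0))) :=
        (((integrable_rayResolvent_prod hw h).integral_norm_prod_left).const_mul BA).mul_prod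
          integrable_resolventFactor.integrableOn
      refine hdom.mono' ?_ (Eventually.of_forall fun p => ?_)
      · have hsm : StronglyMeasurable (fun p : E3 × ℝ => ∫ t, ramp 1 p.2 t * rayProfile w h p.1 t) := by
          have hc : Continuous (fun q : (E3 × ℝ) × ℝ => ramp 1 q.1.2 q.2 * rayProfile w h q.1.1 q.2) := by
            unfold rayProfile ramp
            fun_prop
          exact hc.stronglyMeasurable.integral_prod_right
        exact ((hΨc.comp continuous_fst).stronglyMeasurable.mul hsm).aestronglyMeasurable
      · rw [Function.uncurry, norm_mul]
        calc ‖Ψ p.1‖ * ‖∫ t, ramp 1 p.2 t * rayProfile w h p.1 t‖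
            ≤ BA * (resolventFactor p.2 * ∫ t, ‖rayResolvent w h p.1 t‖) := by
              gcongr
              · exact (norm_nonneg _).trans (hΨB p.1)
              · exact hΨB p.1
              · exact hG p.2 p.1
          _ = _ := by ring
  -- Substituting `z = e^t y` costs `e^{-3t}`; reflecting `t` then turns this into `e^{3t}`, `w(t)`
  -- into `w(-t)`, and the character of sign `1` into that of sign `-1`.
  have hinner : ∀ l, ∫ y, Ψ y * ∫ t, ramp 1 l t * rayProfile w h y t
      = ∫ z, h z * ∫ t, ramp (-1) l t * oscGaussian s (x - Real.exp t • z) *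
          (w (-t) * ((Real.exp (3 * t) : ℝ) : ℂ) * A (Real.exp t • z)) := by
    intro l
    have hr := continuous_ramp_right 1 l
    have hΨb : ∀ p : E3 × ℝ, ‖Ψ p.1 * ramp 1 l p.2‖ ≤ BA := fun p => by
      rw [norm_mul, norm_ramp, mul_one]; exact hΨB p.1
    calc ∫ y, Ψ y * ∫ t, ramp 1 l t * rayProfile w h y t
        = ∫ y, ∫ t, Ψ y * ramp 1 l t * (w t * h (Real.exp t • y)) := by
          refine integral_congr_ae (Eventually.of_forall fun y => ?_)
          simp only
          rw [← integral_const_mul]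
          refine integral_congr_ae (Eventually.of_forall fun t => ?_)
          simp only [rayProfile]; ring
      _ = ∫ t, ∫ y, Ψ y * ramp 1 l t * (w t * h (Real.exp t • y)) := by
          rw [integral_integral_swap]
          refine (integrable_dil_prod hw.isWeight h).bdd_mul (c := BA) ?_ (Eventually.of_forall hΨb)
          exact Continuous.aestronglyMeasurable (by fun_prop)
      _ = ∫ t, ∫ z, ramp 1 l t * w t * ((Real.exp (-3 * t) : ℝ) : ℂ) * (Ψ (Real.exp (-t) • z) * h z) := by
          refine integral_congr_ae (Eventually.of_forall fun t => ?_)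
          simp only
          have h1 := integral_comp_exp_smul t (fun z => Ψ (Real.exp (-t) • z) * h z)
          have h2 : ∀ y : E3, Real.exp (-t) • Real.exp t • y = y := fun y => by
            rw [smul_smul, ← Real.exp_add]; simp
          simp only [h2] at h1
          rw [integral_const_mul, mul_assoc, ← h1, ← integral_const_mul]
          refine integral_congr_ae (Eventually.of_forall fun y => ?_)
          simp only; ring
      _ = ∫ z, ∫ t, ramp 1 l t * w t * ((Real.exp (-3 * t) : ℝ) : ℂ) * (Ψ (Real.exp (-t) • z) * h z) := by
          rw [integral_integral_swap]
          have hw3 := hw.isWeight.exp_mul (-3)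
          have hw3c := hw3.continuous
          have hint : Integrable (fun p : ℝ × E3 => (((Real.exp (-3 * p.1) : ℝ) : ℂ) * w p.1) * h p.2)
              (volume.prod volume) :=
            (hw3c.integrable_of_hasCompactSupport hw3.hasCompactSupport).mul_prod h.integrable
          have hb : ∀ p : ℝ × E3, ‖ramp 1 l p.1 * Ψ (Real.exp (-p.1) • p.2)‖ ≤ BA := fun p => by
            rw [norm_mul, norm_ramp, one_mul]; exact hΨB _
          refine (hint.bdd_mul (c := BA) (f := fun p : ℝ × E3 => ramp 1 l p.1 * Ψ (Real.exp (-p.1) • p.2)) ?_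
            (Eventually.of_forall hb)).congr (Eventually.of_forall fun p => ?_)
          · exact Continuous.aestronglyMeasurable (by fun_prop)
          · simp only [Function.uncurry]; ring
      _ = _ := by
          refine integral_congr_ae (Eventually.of_forall fun z => ?_)
          simp only
          rw [← integral_const_mul, ← integral_neg_eq_self]
          refine integral_congr_ae (Eventually.of_forall fun t => ?_)
          have e1 : ramp 1 l (-t) = ramp (-1) l t := by
            simp only [ramp]; congr 3; ring
          have e2 : -3 * -t = 3 * t := by ring
          simp only [hΨ, e1, e2, neg_neg]
          ring
  rw [hJ]
  simp_rw [hinner]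
  rw [mul_assoc]
  have hgood : ∀ l, 0 < l → ∀ z, ‖∫ t, ramp (-1) l t * oscGaussian s (x - Real.exp t • z) *
          (w (-t) * ((Real.exp (3 * t) : ℝ) : ℂ) * A (Real.exp t • z))‖
        ≤ (1 + l ^ 2)⁻¹ * (C * (M z * (1 + ‖z‖ ^ 2 / s)⁻¹ ^ 3)) := by
    intro l hl z
    have hMz := hM0 z
    -- Where the bound `M z` vanishes so does the amplitude, and no regularity of the pair `(x, z)`
    -- is available or needed.
    by_cases hz : M z = 0
    · have hzero : ∀ t, w (-t) * ((Real.exp (3 * t) : ℝ) : ℂ) * A (Real.exp t • z) = 0 := by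
        intro t
        have := (hamp z).bound 0 (Nat.zero_le _) t
        rw [iteratedDeriv_zero, hz] at this
        exact norm_le_zero_iff.1 this
      simp only [hzero, mul_zero, integral_zero, norm_zero]
      positivity
    · refine (hray s hs x z (hreg z hz) l hl.le _ _ (hamp z)).trans ?_
      have := inv_pow_split hl.le (by positivity : 0 ≤ ‖z‖ ^ 2 / s) 3
      calc C * M z * (1 + l + ‖z‖ ^ 2 / s)⁻¹ ^ 5
          ≤ C * M z * ((1 + l ^ 2)⁻¹ * (1 + ‖z‖ ^ 2 / s)⁻¹ ^ 3) := by gcongr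
        _ = _ := by ring
  have hfac : ∀ z : E3, (1 + ‖z‖ ^ 2 / s)⁻¹ ^ 3 ≤ 1 := fun z => by
    apply pow_le_one₀ (by positivity)
    apply inv_le_one_of_one_le₀
    have : 0 ≤ ‖z‖ ^ 2 / s := by positivity
    linarith
  have hintM : Integrable (fun z => M z * (1 + ‖z‖ ^ 2 / s)⁻¹ ^ 3 * ‖h z‖) := by
    refine h.integrable.norm.bdd_mul (c := BM) ?_ (Eventually.of_forall fun z => ?_)
    · exact (hM.mul (by fun_prop)).aestronglyMeasurable
    · have := hM0 z
      rw [Real.norm_of_nonneg (by positivity)]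
      exact (mul_le_of_le_one_right (hM0 z) (hfac z)).trans (hBM z)
  refine norm_integral_Ioi_le fun l hl => ?_
  refine (norm_integral_le_of_norm_le (hintM.const_mul ((1 + l ^ 2)⁻¹ * C))
    (Eventually.of_forall fun z => ?_)).trans_eq ?_
  · rw [norm_mul]
    calc _ ≤ ‖h z‖ * ((1 + l ^ 2)⁻¹ * (C * (M z * (1 + ‖z‖ ^ 2 / s)⁻¹ ^ 3))) := by
          gcongr; exact hgood l hl z
      _ = _ := by ring
  · rw [integral_const_mul]; ring

/-- Here the projection acts on the output of the propagator, so the dilation already falls on the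
oscillating kernel and no substitution is needed. The sign `-1` is directly the favourable one, with
the ray taken through the output point `y`. Eight derivatives leave six powers of `(1 + |y|²/s)⁻¹`,
later needed to absorb four derivatives and the weight `|y|²`. -/
theorem exists_halfProj_kernel_bound :
    ∃ C : ℝ, 0 ≤ C ∧ ∀ (s : ℝ), 0 < s → ∀ (w : ℝ → ℂ) (hw : IsSmoothWeight w) (v g : 𝓢(E3, ℂ)) (K : ℂ)
      (Q : E3 → ℂ), Continuous Q → (∀ x, v x = K * ∫ z, Q (x - z) * oscGaussian s (x - z) * g z) →
      ∀ (y : E3) (M : ℝ), (∀ z, g z ≠ 0 → IsAmplitude 8 M (fun t => w t * Q (Real.exp t • y - z)) ∧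
        IsRayRegular s z y) →
      (∀ z, ∀ t, ‖w t * Q (Real.exp t • y - z) * g z‖ ≤ M * ‖g z‖) → 0 ≤ M →
      ‖halfProj (-1) hw v y‖ ≤ C * M * ‖K‖ * (1 + ‖y‖ ^ 2 / s)⁻¹ ^ 6 * ∫ z, ‖g z‖ := by
  obtain ⟨C, hC, hray⟩ := exists_ray_integral_bound 8
  refine ⟨4 * C, by positivity, ?_⟩
  rintro s hs w hw v g K Q hQ hv y M hamp hbd hM
  have hwc := hw.smooth.continuous
  have hgc := g.continuous
  have hosc := continuous_oscGaussian s
  rw [halfProj_apply (by norm_num)]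
  have hinner : ∀ l, ∫ t, ramp (-1) l t * rayProfile w v y t
      = K * ∫ z, g z * ∫ t, ramp (-1) l t * oscGaussian s (z - Real.exp t • y) *
          (w t * Q (Real.exp t • y - z)) := by
    intro l
    have hr := continuous_ramp_right (-1) l
    have hsymm : ∀ a b : E3, oscGaussian s (a - b) = oscGaussian s (b - a) := fun a b => by
      rw [oscGaussian, oscGaussian, norm_sub_rev]
    calc ∫ t, ramp (-1) l t * rayProfile w v y t
        = K * ∫ t, ∫ z, g z * (ramp (-1) l t * oscGaussian s (z - Real.exp t • y) *
          (w t * Q (Real.exp t • y - z))) := by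
          rw [← integral_const_mul]
          refine integral_congr_ae (Eventually.of_forall fun t => ?_)
          simp only [rayProfile, hv]
          rw [show ramp (-1) l t * (w t * (K * ∫ z, Q (Real.exp t • y - z) *
            oscGaussian s (Real.exp t • y - z) * g z)) = K * ((ramp (-1) l t * w t) * ∫ z, Q (Real.exp t • y - z) *
            oscGaussian s (Real.exp t • y - z) * g z) by ring, ← integral_const_mul]
          congr 1
          refine integral_congr_ae (Eventually.of_forall fun z => ?_)
          simp only [hsymm (Real.exp t • y) z]
          ring
      _ = _ := by
          congr 1
          rw [integral_integral_swap]
          · refine integral_congr_ae (Eventually.of_forall fun z => ?_)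
            simp only
            rw [integral_const_mul]
          · have hdom : Integrable (fun p : ℝ × E3 => (Set.Icc (-(1 / 2) : ℝ) (1 / 2)).indicator (fun _ => M) p.1 * ‖g p.2‖)
                (volume.prod volume) := by
              refine Integrable.mul_prod ?_ g.integrable.norm
              exact (integrable_indicator_iff measurableSet_Icc).2 (integrableOn_const (by simp))
            refine hdom.mono' (Continuous.aestronglyMeasurable ?_) (Eventually.of_forall fun p => ?_)
            · unfold Function.uncurry; fun_prop
            · simp only [Function.uncurry]
              have e1 : ‖g p.2 * (ramp (-1) l p.1 * oscGaussian s (p.2 - Real.exp p.1 • y) *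
                  (w p.1 * Q (Real.exp p.1 • y - p.2)))‖ = ‖w p.1 * Q (Real.exp p.1 • y - p.2) * g p.2‖ := by
                simp only [norm_mul, norm_ramp, norm_oscGaussian]; ring
              rw [e1]
              by_cases ht : p.1 ∈ Set.Icc (-(1 / 2) : ℝ) (1 / 2)
              · rw [Set.indicator_of_mem ht]; exact hbd p.2 p.1
              · rw [Set.indicator_of_notMem ht, hw.eq_zero, zero_mul, zero_mul, zero_mul, norm_zero]
                by_contra hcon
                exact ht (abs_le.1 (not_lt.1 hcon))
  simp_rw [hinner]
  rw [integral_const_mul, norm_mul]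
  have hgood : ∀ l, 0 < l → ∀ z, ‖g z * ∫ t, ramp (-1) l t * oscGaussian s (z - Real.exp t • y) *
          (w t * Q (Real.exp t • y - z))‖ ≤ (1 + l ^ 2)⁻¹ * (C * (M * (1 + ‖y‖ ^ 2 / s)⁻¹ ^ 6)) * ‖g z‖ := by
    intro l hl z
    by_cases hz : g z = 0
    · simp [hz]
    · obtain ⟨ha, hr⟩ := hamp z hz
      rw [norm_mul, mul_comm]
      gcongr
      refine (hray s hs z y hr l hl.le _ _ ha).trans ?_
      have := inv_pow_split hl.le (by positivity : 0 ≤ ‖y‖ ^ 2 / s) 6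
      calc C * M * (1 + l + ‖y‖ ^ 2 / s)⁻¹ ^ 8
          ≤ C * M * ((1 + l ^ 2)⁻¹ * (1 + ‖y‖ ^ 2 / s)⁻¹ ^ 6) := by gcongr
        _ = _ := by ring
  have hfin : ‖∫ l in Set.Ioi (0 : ℝ), ∫ z, g z * ∫ t, ramp (-1) l t * oscGaussian s (z - Real.exp t • y) *
          (w t * Q (Real.exp t • y - z))‖ ≤ 4 * (C * (M * (1 + ‖y‖ ^ 2 / s)⁻¹ ^ 6) * ∫ z, ‖g z‖) := by
    refine norm_integral_Ioi_le fun l hl => ?_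
    refine (norm_integral_le_of_norm_le (g.integrable.norm.const_mul _)
      (Eventually.of_forall fun z => hgood l hl z)).trans_eq ?_
    rw [integral_const_mul]; ring
  calc _ ≤ ‖K‖ * (4 * (C * (M * (1 + ‖y‖ ^ 2 / s)⁻¹ ^ 6) * ∫ z, ‖g z‖)) := by gcongr
    _ = _ := by ring

/-! ### Boundedness of the projections on `L²` -/

theorem eLpNorm_two_sq {α : Type*} {F : Type*} [NormedAddCommGroup F] {m : MeasurableSpace α}
    {μ : Measure α} (f : α → F) : eLpNorm f 2 μ ^ 2 = ∫⁻ x, ‖f x‖ₑ ^ 2 ∂μ := by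
  rw [eLpNorm_eq_lintegral_rpow_enorm_toReal (by norm_num) (by norm_num), ← ENNReal.rpow_natCast,
    ← ENNReal.rpow_mul]
  norm_num

theorem eLpNorm_two_le_iff {α β : Type*} {F G : Type*} [NormedAddCommGroup F] [NormedAddCommGroup G]
    {m : MeasurableSpace α} {m' : MeasurableSpace β} {μ : Measure α} {ν : Measure β} {f : α → F}
    {g : β → G} {B : ℝ≥0∞} :
    eLpNorm f 2 μ ≤ B * eLpNorm g 2 ν ↔ ∫⁻ x, ‖f x‖ₑ ^ 2 ∂μ ≤ B ^ 2 * ∫⁻ x, ‖g x‖ₑ ^ 2 ∂ν := by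
  rw [← eLpNorm_two_sq, ← eLpNorm_two_sq, ← mul_pow]
  exact (ENNReal.pow_le_pow_left_iff two_ne_zero).symm

theorem ramp_add (ε l t t' : ℝ) : ramp ε l (t + t') = ramp ε l t * ramp ε l t' := by
  rw [ramp, ramp, ramp, ← Complex.exp_add]
  congr 1
  push_cast; ring

theorem schwartz_fourier_inversion (G : 𝓢(ℝ, ℂ)) (x : ℝ) :
    G x = ∫ ξ, ramp 1 ξ x * (𝓕 G : 𝓢(ℝ, ℂ)) ξ := by
  have h : (𝓕⁻ (𝓕 G : 𝓢(ℝ, ℂ)) : 𝓢(ℝ, ℂ)) x = G x := by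
    rw [FourierTransform.fourierInv_fourier_eq]
  rw [← h, SchwartzMap.fourierInv_coe, Real.fourierInv_eq']
  refine integral_congr_ae (Eventually.of_forall fun ξ => ?_)
  simp only [smul_eq_mul, ramp]
  congr 3
  simp only [RCLike.inner_apply, conj_trivial]
  push_cast; ring

theorem integral_ramp_mul_ramp_mul (ε l ξ : ℝ) (W : 𝓢(ℝ, ℂ)) :
    ∫ t, ramp ε l t * W t * ramp 1 ξ t = (𝓕 W : 𝓢(ℝ, ℂ)) (-ξ - ε * l) := by
  rw [SchwartzMap.fourier_coe, Real.fourier_eq']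
  refine integral_congr_ae (Eventually.of_forall fun t => ?_)
  simp only [smul_eq_mul, ramp]
  rw [mul_right_comm, ← Complex.exp_add]
  congr 2
  simp only [RCLike.inner_apply, conj_trivial]
  push_cast; ring

/-- The Fourier multiplier of the one-dimensional model of the projections. -/
def rayMultiplier (ε : ℝ) (V : 𝓢(ℝ, ℂ)) (ξ : ℝ) : ℂ := ∫ l in Set.Ioi (0 : ℝ), V (-ξ - ε * l)

theorem integrable_comp_affine {ε : ℝ} (hε : ε ^ 2 = 1) (V : 𝓢(ℝ, ℂ)) (ξ : ℝ) :
    Integrable (fun l => V (-ξ - ε * l)) := by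
  have h0 : -ε ≠ 0 := by rintro h; rw [neg_eq_zero] at h; rw [h] at hε; norm_num at hε
  have h1 : Integrable (fun l => V (-ξ + l)) := (V.integrable (μ := volume)).comp_add_left (-ξ)
  refine (h1.comp_mul_left' h0).congr (Eventually.of_forall fun l => ?_)
  simp only; congr 1; ring

theorem integral_norm_comp_affine_le {ε : ℝ} (hε : ε ^ 2 = 1) (V : 𝓢(ℝ, ℂ)) (ξ : ℝ) :
    ∫ l in Set.Ioi (0 : ℝ), ‖V (-ξ - ε * l)‖ ≤ ∫ x, ‖V x‖ := by
  have hε1 : |(-ε)⁻¹| = 1 := by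
    rcases sq_eq_one_iff.1 hε with h | h <;> simp [h]
  calc ∫ l in Set.Ioi (0 : ℝ), ‖V (-ξ - ε * l)‖ ≤ ∫ l, ‖V (-ξ - ε * l)‖ :=
        setIntegral_le_integral (integrable_comp_affine hε V ξ).norm
          (Eventually.of_forall fun _ => norm_nonneg _)
    _ = ∫ l, (fun x => ‖V (-ξ + x)‖) (-ε * l) := by
        refine integral_congr_ae (Eventually.of_forall fun l => ?_)
        simp only; congr 2; ring
    _ = ∫ x, ‖V (-ξ + x)‖ := by
        rw [Measure.integral_comp_mul_left (fun x => ‖V (-ξ + x)‖), hε1, one_smul]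
    _ = _ := integral_add_left_eq_self (fun x => ‖V x‖) (-ξ)

theorem norm_rayMultiplier_le {ε : ℝ} (hε : ε ^ 2 = 1) (V : 𝓢(ℝ, ℂ)) (ξ : ℝ) :
    ‖rayMultiplier ε V ξ‖ ≤ ∫ x, ‖V x‖ :=
  (norm_integral_le_integral_norm _).trans (integral_norm_comp_affine_le hε V ξ)

theorem rayMultiplier_eq {ε : ℝ} (hε : ε ^ 2 = 1) (V : 𝓢(ℝ, ℂ)) (ξ : ℝ) :
    rayMultiplier ε V ξ = rayMultiplier ε V 0 - ∫ x in (0 : ℝ)..(ε * ξ), V (-ε * x) := by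
  have hV : Integrable (fun x => V (-ε * x)) := by
    simpa [neg_mul] using integrable_comp_affine hε V 0
  have h1 : ∀ ξ, rayMultiplier ε V ξ = ∫ x in Set.Ioi (ε * ξ), V (-ε * x) := by
    intro ξ
    rw [rayMultiplier, ← (measurePreserving_add_right volume (ε * ξ)).setIntegral_preimage_emb
      (MeasurableEquiv.addRight (ε * ξ)).measurableEmbedding (fun x => V (-ε * x)) (Set.Ioi (ε * ξ))]
    have : (fun x => x + ε * ξ) ⁻¹' Set.Ioi (ε * ξ) = Set.Ioi 0 := by
      ext x; simp
    rw [this]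
    refine integral_congr_ae (Eventually.of_forall fun l => ?_)
    simp only
    congr 1
    linear_combination ξ * hε
  rw [h1, h1 0, mul_zero, ← intervalIntegral.integral_interval_add_Ioi (a := 0) (b := ε * ξ)
    hV.integrableOn hV.integrableOn]
  ring

/-- By `rayMultiplier_eq` the multiplier is a constant minus a primitive of a Schwartz function: it
is bounded, with Schwartz derivative. It thus acts on the Schwartz space and Plancherel can be
applied there. -/
theorem hasTemperateGrowth_rayMultiplier {ε : ℝ} (hε : ε ^ 2 = 1) (V : 𝓢(ℝ, ℂ)) :
    Function.HasTemperateGrowth (rayMultiplier ε V) := by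
  have hd : ∀ ξ, HasDerivAt (rayMultiplier ε V) (-(ε : ℂ) * V (-ξ)) ξ := by
    intro ξ
    have hc : Continuous (fun x => V (-ε * x)) := by have := V.continuous; fun_prop
    have h1 : HasDerivAt (fun u => ∫ x in (0 : ℝ)..u, V (-ε * x)) (V (-ε * (ε * ξ))) (ε * ξ) :=
      intervalIntegral.integral_hasDerivAt_right (hc.intervalIntegrable _ _)
        (hc.stronglyMeasurableAtFilter _ _) hc.continuousAt
    have h2 : HasDerivAt (fun ξ : ℝ => ε * ξ) ε ξ := by simpa using (hasDerivAt_id ξ).const_mul ε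
    have h3 := (h1.scomp ξ h2).const_sub (rayMultiplier ε V 0)
    have e : -(ε : ℂ) * V (-ξ) = -(ε • V (-ε * (ε * ξ))) := by
      rw [show -ε * (ε * ξ) = -ξ by linear_combination -ξ * hε, Complex.real_smul]; ring
    rw [e]
    refine h3.congr_of_eventuallyEq (Eventually.of_forall fun x => ?_)
    exact rayMultiplier_eq hε V x
  refine Function.HasTemperateGrowth.of_fderiv (k := 0) (C := ∫ x, ‖V x‖) ?_
    (fun ξ => (hd ξ).differentiableAt) (fun ξ => by simpa using norm_rayMultiplier_le hε V ξ)
  have hf : fderiv ℝ (rayMultiplier ε V) = fun ξ =>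
      (ContinuousLinearMap.toSpanSingletonCLE : ℂ ≃L[ℝ] (ℝ →L[ℝ] ℂ)) (-(ε : ℂ) * V (-ξ)) := by
    ext1 ξ
    exact (hd ξ).hasFDerivAt.fderiv
  rw [hf]
  have h1 : Function.HasTemperateGrowth (fun ξ : ℝ => V (-ξ)) :=
    V.hasTemperateGrowth.comp (-ContinuousLinearMap.id ℝ ℝ).hasTemperateGrowth
  exact (ContinuousLinearMap.toSpanSingletonCLE : ℂ ≃L[ℝ] (ℝ →L[ℝ] ℂ)).toContinuousLinearMap.hasTemperateGrowth.comp
    ((Function.HasTemperateGrowth.const _).mul h1)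

/-- In the logarithmic variable `τ` dilations become translations, so the half-line operator
commutes with translations and is a Fourier multiplier. Its symbol is the integral of the transform
of `W` over a half line. -/
theorem rayTransform_eq {ε : ℝ} (hε : ε ^ 2 = 1) (W G : 𝓢(ℝ, ℂ)) (τ : ℝ) :
    ∫ l in Set.Ioi (0 : ℝ), ∫ t, ramp ε l t * (W t * G (τ + t))
      = ∫ ξ, ramp 1 ξ τ * (rayMultiplier ε (𝓕 W) ξ * (𝓕 G : 𝓢(ℝ, ℂ)) ξ) := by
  set V : 𝓢(ℝ, ℂ) := 𝓕 W
  set g : 𝓢(ℝ, ℂ) := 𝓕 G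
  have hVc := V.continuous
  have hgc := g.continuous
  have hWc := W.continuous
  have hr : ∀ τ, Continuous (fun ξ => ramp 1 ξ τ) := fun τ => by unfold ramp; fun_prop
  have hinner : ∀ l, ∫ t, ramp ε l t * (W t * G (τ + t)) = ∫ ξ, ramp 1 ξ τ * g ξ * V (-ξ - ε * l) := by
    intro l
    calc ∫ t, ramp ε l t * (W t * G (τ + t))
        = ∫ t, ∫ ξ, ramp ε l t * W t * (ramp 1 ξ (τ + t) * g ξ) := by
          refine integral_congr_ae (Eventually.of_forall fun t => ?_)
          simp only
          rw [schwartz_fourier_inversion G, integral_const_mul, mul_assoc]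
      _ = ∫ ξ, ∫ t, ramp ε l t * W t * (ramp 1 ξ (τ + t) * g ξ) := by
          rw [integral_integral_swap]
          have hb : ∀ p : ℝ × ℝ, ‖ramp ε l p.1 * ramp 1 p.2 (τ + p.1)‖ ≤ 1 := fun p => by
            rw [norm_mul, norm_ramp, norm_ramp, one_mul]
          refine ((W.integrable.mul_prod g.integrable).bdd_mul (c := 1) ?_ (Eventually.of_forall hb)).congr
            (Eventually.of_forall fun p => ?_)
          · refine Continuous.aestronglyMeasurable ?_
            unfold ramp; fun_prop
          · simp only [Function.uncurry]; ring
      _ = _ := by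
          refine integral_congr_ae (Eventually.of_forall fun ξ => ?_)
          simp only
          rw [← integral_ramp_mul_ramp_mul, ← integral_const_mul]
          refine integral_congr_ae (Eventually.of_forall fun t => ?_)
          simp only [ramp_add]; ring
  simp_rw [hinner]
  rw [integral_integral_swap]
  · refine integral_congr_ae (Eventually.of_forall fun ξ => ?_)
    simp only
    rw [integral_const_mul, rayMultiplier]; ring
  · have hm : Continuous (Function.uncurry fun (l ξ : ℝ) => ramp 1 ξ τ * g ξ * V (-ξ - ε * l)) := by
      unfold Function.uncurry ramp; fun_prop
    rw [integrable_prod_iff' hm.aestronglyMeasurable]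
    refine ⟨Eventually.of_forall fun ξ => ?_, ?_⟩
    · exact ((integrable_comp_affine hε V ξ).const_mul (ramp 1 ξ τ * g ξ)).integrableOn
    · refine (g.integrable.norm.mul_const (∫ x, ‖V x‖)).mono' ?_ (Eventually.of_forall fun ξ => ?_)
      · exact (hm.norm.stronglyMeasurable.integral_prod_left).aestronglyMeasurable
      · rw [Real.norm_of_nonneg (integral_nonneg fun _ => norm_nonneg _)]
        simp only [Function.uncurry, norm_mul, norm_ramp, one_mul]
        rw [integral_const_mul]
        gcongr
        exact integral_norm_comp_affine_le hε V ξ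

/-- Plancherel on the line: the multiplier is bounded by the `L¹` norm of the Fourier transform of
`W`. -/
theorem lintegral_rayTransform_le {ε : ℝ} (hε : ε ^ 2 = 1) (W G : 𝓢(ℝ, ℂ)) :
    ∫⁻ τ, ‖∫ l in Set.Ioi (0 : ℝ), ∫ t, ramp ε l t * (W t * G (τ + t))‖ₑ ^ 2
      ≤ ENNReal.ofReal (∫ x, ‖(𝓕 W : 𝓢(ℝ, ℂ)) x‖) ^ 2 * ∫⁻ τ, ‖G τ‖ₑ ^ 2 := by
  have hm := hasTemperateGrowth_rayMultiplier hε (𝓕 W)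
  set J : 𝓢(ℝ, ℂ) := SchwartzMap.smulLeftCLM ℂ (rayMultiplier ε (𝓕 W)) (𝓕 G) with hJ
  have hJa : ∀ ξ, J ξ = rayMultiplier ε (𝓕 W) ξ * (𝓕 G : 𝓢(ℝ, ℂ)) ξ := fun ξ => by
    rw [hJ, SchwartzMap.smulLeftCLM_apply_apply hm, smul_eq_mul]
  have h1 : ∀ τ, ∫ l in Set.Ioi (0 : ℝ), ∫ t, ramp ε l t * (W t * G (τ + t)) = (𝓕⁻ J : 𝓢(ℝ, ℂ)) τ := by
    intro τ
    rw [rayTransform_eq hε, schwartz_fourier_inversion, FourierTransform.fourier_fourierInv_eq]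
    simp_rw [hJa]
  simp_rw [h1]
  rw [← eLpNorm_two_le_iff, ← eLpNorm_fourier (𝓕⁻ J), FourierTransform.fourier_fourierInv_eq, ← eLpNorm_fourier G]
  refine eLpNorm_le_mul_eLpNorm_of_ae_le_mul (Eventually.of_forall fun ξ => ?_) 2
  rw [hJa, norm_mul]
  exact mul_le_mul_of_nonneg_right (norm_rayMultiplier_le hε _ ξ) (norm_nonneg _)

/-- The exterior region `{|x| ≥ r}`. -/
def ext (r : ℝ) : Set E3 := {x | r ≤ ‖x‖}

theorem measurableSet_ext (r : ℝ) : MeasurableSet (ext r) := measurableSet_le measurable_const measurable_norm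

theorem ext_mono {r r' : ℝ} (h : r ≤ r') : ext r' ⊆ ext r := fun _ hx => h.trans hx

theorem lintegral_ext_comp_exp_smul (τ r : ℝ) {f : E3 → ℝ≥0∞} (hf : Measurable f) :
    ∫⁻ y in ext r, f (Real.exp τ • y) = ENNReal.ofReal (Real.exp (-3 * τ)) * ∫⁻ z in ext (Real.exp τ * r), f z := by
  have hpos := Real.exp_pos τ
  have h1 : Measure.map (fun y : E3 => Real.exp τ • y) volume = ENNReal.ofReal (Real.exp (-3 * τ)) • volume := by
    rw [Measure.map_addHaar_smul volume hpos.ne', finrank_euclideanSpace, Fintype.card_fin,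
      ← Real.exp_nat_mul, ← Real.exp_neg, abs_of_pos (Real.exp_pos _)]
    congr 3
    push_cast; ring
  rw [← lintegral_indicator (measurableSet_ext _), ← lintegral_indicator (measurableSet_ext _),
    ← smul_eq_mul, ← lintegral_smul_measure, ← h1,
    lintegral_map (hf.indicator (measurableSet_ext _)) (measurable_const_smul _)]
  refine lintegral_congr fun y => ?_
  have hiff : Real.exp τ • y ∈ ext (Real.exp τ * r) ↔ y ∈ ext r := by
    simp only [ext, Set.mem_ofPred_eq, norm_smul, Real.norm_of_nonneg hpos.le]
    exact mul_le_mul_iff_right₀ hpos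
  by_cases hy : y ∈ ext r
  · rw [Set.indicator_of_mem hy, Set.indicator_of_mem (hiff.2 hy)]
  · rw [Set.indicator_of_notMem hy, Set.indicator_of_notMem (mt hiff.1 hy)]

/-- The function `τ ↦ h(e^τ y)` tends to `h 0` as `τ → -∞` and so need not be square integrable. As
`w` restricts `t` to `[-1/2, 1/2]`, values with `|τ| ≤ 1/4` involve only `|τ + t| ≤ 3/4`, and a
cutoff can be inserted for free. -/
theorem exists_lintegral_halfProj_ray_le {ε : ℝ} (hε : ε ^ 2 = 1) {w : ℝ → ℂ} (hw : IsSmoothWeight w) :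
    ∃ B : ℝ, 0 ≤ B ∧ ∀ (y : E3) (h : 𝓢(E3, ℂ)),
      ∫⁻ τ in Set.Icc (-(1 / 4) : ℝ) (1 / 4), ‖halfProj ε hw h (Real.exp τ • y)‖ₑ ^ 2
        ≤ ENNReal.ofReal B ^ 2 * ∫⁻ τ in Set.Icc (-1 : ℝ) 1, ‖h (Real.exp τ • y)‖ₑ ^ 2 := by
  set W : 𝓢(ℝ, ℂ) := hw.isWeight.hasCompactSupport.toSchwartzMap hw.smooth with hW
  have hWa : ∀ t, W t = w t := fun t => rfl
  set B₀ : ℝ := ∫ x, ‖(𝓕 W : 𝓢(ℝ, ℂ)) x‖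
  have hB₀ : 0 ≤ B₀ := integral_nonneg fun _ => norm_nonneg _
  let χ : ContDiffBump (0 : ℝ) := ⟨3 / 4, 1, by norm_num, by norm_num⟩
  refine ⟨B₀, hB₀, fun y h => ?_⟩
  have hsm : ContDiff ℝ ∞ (fun τ => ((χ τ : ℝ) : ℂ) * h (Real.exp τ • y)) :=
    (Complex.ofRealCLM.contDiff.comp χ.contDiff).mul
      ((h.smooth ⊤).comp (Real.contDiff_exp.smul contDiff_const))
  have hcs : HasCompactSupport (fun τ => ((χ τ : ℝ) : ℂ) * h (Real.exp τ • y)) :=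
    (χ.hasCompactSupport.comp_left Complex.ofReal_zero).mul_right
  set G : 𝓢(ℝ, ℂ) := hcs.toSchwartzMap hsm
  have hG : ∀ τ, G τ = ((χ τ : ℝ) : ℂ) * h (Real.exp τ • y) := fun τ => rfl
  calc ∫⁻ τ in Set.Icc (-(1 / 4) : ℝ) (1 / 4), ‖halfProj ε hw h (Real.exp τ • y)‖ₑ ^ 2
      = ∫⁻ τ in Set.Icc (-(1 / 4) : ℝ) (1 / 4),
          ‖∫ l in Set.Ioi (0 : ℝ), ∫ t, ramp ε l t * (W t * G (τ + t))‖ₑ ^ 2 := by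
        refine setLIntegral_congr_fun measurableSet_Icc fun τ hτ => ?_
        rw [halfProj_apply hε]
        congr 3
        ext1 l
        refine integral_congr_ae (Eventually.of_forall fun t => ?_)
        simp only [rayProfile, hWa]
        by_cases ht : 1 / 2 < |t|
        · rw [hw.eq_zero t ht]; ring
        · rw [hG, χ.one_of_mem_closedBall, Complex.ofReal_one, one_mul, smul_smul, ← Real.exp_add,
            add_comm t τ]
          rw [Metric.mem_closedBall, dist_zero_right, Real.norm_eq_abs]
          have h1 := abs_le.1 (not_lt.1 ht)
          have h2 : χ.rIn = 3 / 4 := rfl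
          rw [h2]
          exact abs_le.2 ⟨by linarith [hτ.1], by linarith [hτ.2]⟩
    _ ≤ _ := setLIntegral_le_lintegral _ _
    _ ≤ ENNReal.ofReal B₀ ^ 2 * ∫⁻ τ, ‖G τ‖ₑ ^ 2 := lintegral_rayTransform_le hε W G
    _ ≤ _ := by
        refine mul_le_mul' le_rfl ?_
        rw [← lintegral_indicator measurableSet_Icc]
        refine lintegral_mono fun τ => ?_
        by_cases hτ : τ ∈ Set.Icc (-1 : ℝ) 1
        · rw [Set.indicator_of_mem hτ]
          gcongr
          rw [hG, ← ofReal_norm, ← ofReal_norm]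
          refine ENNReal.ofReal_le_ofReal ?_
          rw [norm_mul, Complex.norm_real, Real.norm_of_nonneg χ.nonneg]
          exact mul_le_of_le_one_left (norm_nonneg _) χ.le_one
        · rw [Set.indicator_of_notMem hτ, hG, χ.zero_of_le_dist, Complex.ofReal_zero, zero_mul]
          · simp
          · rw [dist_zero_right, Real.norm_eq_abs]
            by_contra hcon
            exact hτ (abs_le.1 (not_le.1 hcon).le)

/-- Dilating by `e^τ` with `|τ| ≤ 1/4` changes the measure and the region by bounded factors.
Averaging over `τ` makes room for the one-dimensional estimate along each ray without polar
coordinates. -/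
theorem lintegral_ext_le_average {f : E3 → ℝ≥0∞} (hf : Measurable f) {r : ℝ} (hr : 0 ≤ r) :
    ∫⁻ y in ext r, f y ≤ ENNReal.ofReal (2 * Real.exp (3 / 4)) *
      ∫⁻ τ in Set.Icc (-(1 / 4) : ℝ) (1 / 4), ∫⁻ y in ext (Real.exp (-(1 / 4)) * r), f (Real.exp τ • y) := by
  have s1 : ∀ τ ∈ Set.Icc (-(1 / 4) : ℝ) (1 / 4), ∫⁻ y in ext r, f y ≤ ENNReal.ofReal (Real.exp (3 / 4)) *
      ∫⁻ y in ext (Real.exp (-(1 / 4)) * r), f (Real.exp τ • y) := by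
    intro τ hτ
    rw [lintegral_ext_comp_exp_smul τ _ hf, ← mul_assoc, ← ENNReal.ofReal_mul (Real.exp_pos _).le,
      ← Real.exp_add]
    calc ∫⁻ y in ext r, f y ≤ ∫⁻ y in ext (Real.exp τ * (Real.exp (-(1 / 4)) * r)), f y := by
          refine lintegral_mono_set (ext_mono ?_)
          rw [← mul_assoc, ← Real.exp_add]
          exact mul_le_of_le_one_left hr (Real.exp_le_one_iff.2 (by linarith [hτ.2]))
      _ ≤ _ := by
          refine le_mul_of_one_le_left zero_le ?_
          rw [ENNReal.one_le_ofReal]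
          exact Real.one_le_exp (by linarith [hτ.2])
  have h1 := setLIntegral_mono' (μ := volume) measurableSet_Icc s1
  rw [lintegral_const, Measure.restrict_apply_univ, Real.volume_Icc, lintegral_const_mul'
    _ _ ENNReal.ofReal_ne_top] at h1
  calc ∫⁻ y in ext r, f y
      = ENNReal.ofReal 2 * ((∫⁻ y in ext r, f y) * ENNReal.ofReal (1 / 4 - -(1 / 4))) := by
        rw [mul_comm (∫⁻ y in ext r, f y), ← mul_assoc, ← ENNReal.ofReal_mul (by norm_num)]
        norm_num
    _ ≤ ENNReal.ofReal 2 * _ := mul_le_mul' le_rfl h1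
    _ = _ := by rw [ENNReal.ofReal_mul (by norm_num), mul_assoc]

/-- The region shrinks to `r/4` because `e^{-5/4} ≥ 1/4`: a quarter is lost in the averaging and one
in the cutoff along the ray. -/
theorem lintegral_average_ext_le {f : E3 → ℝ≥0∞} (hf : Measurable f) {r : ℝ} (hr : 0 ≤ r) :
    ∫⁻ τ in Set.Icc (-1 : ℝ) 1, ∫⁻ y in ext (Real.exp (-(1 / 4)) * r), f (Real.exp τ • y)
      ≤ ENNReal.ofReal (2 * Real.exp 3) * ∫⁻ z in ext (r / 4), f z := by
  have h1 : ∀ τ ∈ Set.Icc (-1 : ℝ) 1, ∫⁻ y in ext (Real.exp (-(1 / 4)) * r), f (Real.exp τ • y)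
      ≤ ENNReal.ofReal (Real.exp 3) * ∫⁻ z in ext (r / 4), f z := by
    intro τ hτ
    rw [lintegral_ext_comp_exp_smul τ _ hf]
    refine mul_le_mul' (ENNReal.ofReal_le_ofReal (Real.exp_le_exp.2 (by linarith [hτ.1])))
      (lintegral_mono_set (ext_mono ?_))
    rw [← mul_assoc, ← Real.exp_add, div_eq_inv_mul]
    refine mul_le_mul_of_nonneg_right ?_ hr
    calc (4 : ℝ)⁻¹ ≤ Real.exp (-(5 / 4)) := by
          rw [Real.exp_neg]
          refine inv_anti₀ (Real.exp_pos _) ?_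
          have e1 : Real.exp (5 / 4) = Real.exp 1 * Real.exp (1 / 4) := by rw [← Real.exp_add]; norm_num
          have e2 : Real.exp (1 / 4) ≤ 4 / 3 := by
            have := Real.exp_bound_div_one_sub_of_interval' (x := 1 / 4) (by norm_num) (by norm_num)
            norm_num at this ⊢
            linarith
          have := Real.exp_one_lt_d9
          rw [e1]
          nlinarith [Real.exp_pos (1 / 4)]
      _ ≤ _ := Real.exp_le_exp.2 (by linarith [hτ.1])
  refine (setLIntegral_mono' measurableSet_Icc h1).trans_eq ?_
  rw [lintegral_const, Measure.restrict_apply_univ, Real.volume_Icc, mul_right_comm,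
    ← ENNReal.ofReal_mul (Real.exp_pos _).le]
  congr 2
  ring

/-- The projections are bounded on `L²` of an exterior region, up to shrinking the region. -/
theorem exists_eLpNorm_halfProj_le {ε : ℝ} (hε : ε ^ 2 = 1) {w : ℝ → ℂ} (hw : IsSmoothWeight w) :
    ∃ B : ℝ, 0 ≤ B ∧ ∀ (r : ℝ), 0 ≤ r → ∀ h : 𝓢(E3, ℂ),
      eLpNorm (halfProj ε hw h) 2 (volume.restrict (ext r))
        ≤ ENNReal.ofReal B * eLpNorm h 2 (volume.restrict (ext (r / 4))) := by
  obtain ⟨B₀, hB₀, key⟩ := exists_lintegral_halfProj_ray_le hε hw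
  refine ⟨Real.sqrt (2 * Real.exp (3 / 4) * (B₀ ^ 2 * (2 * Real.exp 3))), by positivity, fun r hr h => ?_⟩
  rw [eLpNorm_two_le_iff, ← ENNReal.ofReal_pow (by positivity), Real.sq_sqrt (by positivity),
    ENNReal.ofReal_mul (p := 2 * Real.exp (3 / 4)) (by positivity),
    ENNReal.ofReal_mul (p := B₀ ^ 2) (by positivity), mul_assoc, mul_assoc]
  have hmeas : ∀ u : 𝓢(E3, ℂ), Measurable fun y => ‖u y‖ₑ ^ 2 := fun u => by
    have := u.continuous; fun_prop
  have hmeas2 : ∀ u : 𝓢(E3, ℂ), Measurable fun p : ℝ × E3 => ‖u (Real.exp p.1 • p.2)‖ₑ ^ 2 := fun u => by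
    have := u.continuous
    exact Continuous.measurable (by fun_prop)
  refine (lintegral_ext_le_average (hmeas (halfProj ε hw h)) hr).trans (mul_le_mul' le_rfl ?_)
  refine le_trans ?_ (mul_le_mul' le_rfl (lintegral_average_ext_le (hmeas h) hr))
  have sw : ∀ (u : 𝓢(E3, ℂ)) (I : Set ℝ) (X : Set E3), ∫⁻ τ in I, ∫⁻ y in X, ‖u (Real.exp τ • y)‖ₑ ^ 2
      = ∫⁻ y in X, ∫⁻ τ in I, ‖u (Real.exp τ • y)‖ₑ ^ 2 := fun u I X =>
    lintegral_lintegral_swap (hmeas2 u).aemeasurable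
  rw [sw, sw, ← lintegral_const_mul' _ _ ENNReal.ofReal_ne_top, ENNReal.ofReal_pow hB₀]
  exact lintegral_mono fun y => key y h

/-! ### Symbols supported in an exterior region -/

/-- `A` is a symbol of order `-m` which vanishes on `{|y| < R}`, with seminorms up to order `N`
bounded by `B`. -/
structure IsSymbol (m N : ℕ) (B R : ℝ) (A : E3 → ℂ) : Prop where
  temperate : A.HasTemperateGrowth
  eq_zero : ∀ y, ‖y‖ < R → A y = 0
  bound : ∀ n ≤ N, ∀ y, ‖y‖ ^ (n + m) * ‖iteratedFDeriv ℝ n A y‖ ≤ B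

theorem IsSymbol.nonneg {m N : ℕ} {B R : ℝ} {A : E3 → ℂ} (hA : IsSymbol m N B R A) : 0 ≤ B :=
  le_trans (by positivity) (hA.bound 0 (Nat.zero_le _) 0)

theorem IsSymbol.iteratedFDeriv_eq_zero {m N : ℕ} {B R : ℝ} {A : E3 → ℂ} (hA : IsSymbol m N B R A)
    (n : ℕ) {y : E3} (hy : ‖y‖ < R) : iteratedFDeriv ℝ n A y = 0 := by
  have h : A =ᶠ[𝓝 y] fun _ => 0 := by
    filter_upwards [continuous_norm.continuousAt.eventually (gt_mem_nhds hy)] with x hx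
    exact hA.eq_zero x hx
  rw [(h.iteratedFDeriv (𝕜 := ℝ) n).eq_of_nhds, iteratedFDeriv_fun_zero]
  rfl

theorem norm_iteratedFDeriv_partialDeriv_le {A : E3 → ℂ} (hA : ContDiff ℝ ∞ A) (k : Fin 3) (n : ℕ) (y : E3) :
    ‖iteratedFDeriv ℝ n (partialDeriv k A) y‖ ≤ ‖iteratedFDeriv ℝ (n + 1) A y‖ := by
  have h1 : partialDeriv k A = (ContinuousLinearMap.apply ℝ ℂ (EuclideanSpace.single k (1 : ℝ) : E3)) ∘ fderiv ℝ A := rfl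
  have h2 : ContDiff ℝ ∞ (fderiv ℝ A) := hA.fderiv_right (m := ∞) (by norm_num)
  rw [h1, ContinuousLinearMap.iteratedFDeriv_comp_left _ (h2.contDiffAt) (i := n) (by exact_mod_cast le_top),
    ← norm_iteratedFDeriv_fderiv]
  refine (ContinuousLinearMap.norm_compContinuousMultilinearMap_le _ _).trans ?_
  refine mul_le_of_le_one_left (norm_nonneg _) ?_
  refine ContinuousLinearMap.opNorm_le_bound _ zero_le_one fun L => ?_
  rw [ContinuousLinearMap.apply_apply, one_mul]
  refine (L.le_opNorm _).trans ?_
  simp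

theorem IsSymbol.partialDeriv {m N : ℕ} {B R : ℝ} {A : E3 → ℂ} (hA : IsSymbol m (N + 1) B R A) (k : Fin 3) :
    IsSymbol (m + 1) N B R (partialDeriv k A) := by
  refine ⟨hA.temperate.partialDeriv k, fun y hy => ?_, fun n hn y => ?_⟩
  · have h1 := hA.iteratedFDeriv_eq_zero 1 hy
    have h2 := norm_iteratedFDeriv_partialDeriv_le hA.temperate.1 k 0 y
    rw [h1, norm_zero, norm_iteratedFDeriv_zero] at h2
    exact norm_le_zero_iff.1 h2
  · have := hA.bound (n + 1) (by omega) y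
    rw [show n + 1 + m = n + (m + 1) by ring] at this
    refine le_trans ?_ this
    gcongr
    exact norm_iteratedFDeriv_partialDeriv_le hA.temperate.1 k n y

/-- On the support `|y| ≥ R`, so one power of decay may be traded for a factor `1/R`. -/
theorem IsSymbol.of_succ {m N : ℕ} {B R : ℝ} {A : E3 → ℂ} (hR : 0 < R) (hA : IsSymbol (m + 1) N B R A) :
    IsSymbol m N (B / R) R A := by
  refine ⟨hA.temperate, hA.eq_zero, fun n hn y => ?_⟩
  by_cases hy : ‖y‖ < R
  · rw [hA.iteratedFDeriv_eq_zero n hy, norm_zero, mul_zero]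
    exact div_nonneg hA.nonneg hR.le
  · rw [le_div_iff₀ hR]
    refine le_trans ?_ (hA.bound n hn y)
    rw [← add_assoc, pow_succ, mul_right_comm]
    gcongr
    exact not_lt.1 hy

theorem IsSymbol.mono {m N N' : ℕ} {B B' R : ℝ} {A : E3 → ℂ} (hA : IsSymbol m N B R A) (hN : N' ≤ N)
    (hB : B ≤ B') : IsSymbol m N' B' R A :=
  ⟨hA.temperate, hA.eq_zero, fun n hn y => (hA.bound n (hn.trans hN) y).trans hB⟩

theorem iteratedDeriv_exp_smul (n : ℕ) (v : E3) :
    iteratedDeriv n (fun t : ℝ => Real.exp t • v) = fun t => Real.exp t • v := by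
  induction n with
  | zero => exact iteratedDeriv_zero
  | succ n ih =>
    rw [iteratedDeriv_succ, ih]
    ext1 t
    exact ((Real.hasDerivAt_exp t).smul_const v).deriv

theorem exp_half_lt_two {t : ℝ} (ht : t ≤ 1 / 2) : Real.exp t < 2 := by
  have h1 := Real.exp_one_lt_d9
  have h2 : Real.exp (1 / 2) ^ 2 = Real.exp 1 := by rw [← Real.exp_nat_mul]; norm_num
  have h3 : Real.exp t ≤ Real.exp (1 / 2) := Real.exp_le_exp.2 ht
  have h4 : 0 < Real.exp (1 / 2) := Real.exp_pos _
  nlinarith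

theorem half_lt_exp {t : ℝ} (ht : -(1 / 2) ≤ t) : 1 / 2 < Real.exp t := by
  have h := exp_half_lt_two (t := -t) (by linarith)
  rw [Real.exp_neg] at h
  rw [one_div]
  exact inv_lt_of_inv_lt₀ (Real.exp_pos t) h

/-- Symbol bounds are scale invariant. After rescaling by `|z|` the curve `e^t z/|z|` has
derivatives of norm at most `2`, and the Faà di Bruno estimate applies with constants that do not
depend on `z`. -/
theorem IsSymbol.norm_iteratedDeriv_ray_le {m N : ℕ} {B R : ℝ} {A : E3 → ℂ} (hA : IsSymbol m N B R A)
    {z : E3} (hz : z ≠ 0) {t : ℝ} (ht : |t| ≤ 1 / 2) {k : ℕ} (hk : k ≤ N) :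
    ‖iteratedDeriv k (fun t => A (Real.exp t • z)) t‖
      ≤ (N.factorial * 2 ^ (N + m) * 2 ^ N) * (B * ‖z‖⁻¹ ^ m) := by
  have hB := hA.nonneg
  have hz0 : 0 < ‖z‖ := norm_pos_iff.2 hz
  obtain ⟨ht1, ht2⟩ := abs_le.1 ht
  have he2 := exp_half_lt_two ht2
  have he1 := half_lt_exp ht1
  let L : E3 →L[ℝ] E3 := ‖z‖ • ContinuousLinearMap.id ℝ E3
  have hL : ‖L‖ ≤ ‖z‖ := by
    refine ContinuousLinearMap.opNorm_le_bound _ hz0.le fun x => ?_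
    simp [L, norm_smul]
  have hAc : ContDiff ℝ ∞ (A ∘ L) := hA.temperate.1.comp L.contDiff
  have hf : ContDiff ℝ ∞ (fun t : ℝ => Real.exp t • (‖z‖⁻¹ • z)) := Real.contDiff_exp.smul contDiff_const
  have hcomp : (fun t => A (Real.exp t • z)) = (A ∘ L) ∘ (fun t : ℝ => Real.exp t • (‖z‖⁻¹ • z)) := by
    ext1 t
    simp only [Function.comp_apply, L, smul_apply, ContinuousLinearMap.id_apply]
    congr 1
    rw [smul_smul, smul_smul, mul_comm ‖z‖, mul_assoc, mul_inv_cancel₀ hz0.ne', mul_one]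
  have hLv : L (Real.exp t • (‖z‖⁻¹ • z)) = Real.exp t • z := by
    simp only [L, smul_apply, ContinuousLinearMap.id_apply]
    rw [smul_smul, smul_smul, mul_comm ‖z‖, mul_assoc, mul_inv_cancel₀ hz0.ne', mul_one]
  rw [← norm_iteratedFDeriv_eq_norm_iteratedDeriv, hcomp]
  have key := norm_iteratedFDeriv_comp_le (n := k) hAc hf (by exact_mod_cast le_top) t
    (C := 2 ^ (N + m) * (B * ‖z‖⁻¹ ^ m)) (D := 2) ?_ ?_
  · refine key.trans ?_
    have h1 : (k.factorial : ℝ) ≤ N.factorial := by exact_mod_cast Nat.factorial_le hk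
    have h2 : (2 : ℝ) ^ k ≤ 2 ^ N := pow_le_pow_right₀ (by norm_num) hk
    calc (k.factorial : ℝ) * (2 ^ (N + m) * (B * ‖z‖⁻¹ ^ m)) * 2 ^ k
        ≤ N.factorial * (2 ^ (N + m) * (B * ‖z‖⁻¹ ^ m)) * 2 ^ N := by gcongr
      _ = _ := by ring
  · intro i hi
    rw [ContinuousLinearMap.iteratedFDeriv_comp_right L hA.temperate.1 _ (i := i) (by exact_mod_cast le_top), hLv]
    refine (ContinuousMultilinearMap.norm_compContinuousLinearMap_le _ _).trans ?_
    rw [Finset.prod_const, Finset.card_univ, Fintype.card_fin]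
    set D := ‖iteratedFDeriv ℝ i A (Real.exp t • z)‖
    have hD : 0 ≤ D := norm_nonneg _
    have hb := hA.bound i (hi.trans hk) (Real.exp t • z)
    rw [norm_smul, Real.norm_of_nonneg (Real.exp_pos t).le, mul_pow] at hb
    have h3 : (1 / 2 : ℝ) ^ (N + m) ≤ Real.exp t ^ (i + m) := by
      calc (1 / 2 : ℝ) ^ (N + m) ≤ (1 / 2) ^ (i + m) :=
            pow_le_pow_of_le_one (by norm_num) (by norm_num) (by omega)
        _ ≤ _ := by gcongr
    have h4 : (1 / 2 : ℝ) ^ (N + m) * (‖z‖ ^ (i + m) * D) ≤ B := by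
      refine le_trans ?_ hb
      rw [mul_assoc]
      gcongr
    calc D * ‖L‖ ^ i ≤ D * ‖z‖ ^ i := by gcongr
      _ = 2 ^ (N + m) * (((1 / 2 : ℝ) ^ (N + m) * (‖z‖ ^ (i + m) * D)) * ‖z‖⁻¹ ^ m) := by
          have e1 : (2 : ℝ) ^ (N + m) * (1 / 2) ^ (N + m) = 1 := by rw [← mul_pow]; norm_num
          have e2 : ‖z‖ ^ m * ‖z‖⁻¹ ^ m = 1 := by rw [← mul_pow, mul_inv_cancel₀ hz0.ne', one_pow]
          rw [pow_add]
          linear_combination (-D * ‖z‖ ^ i) * e1 + (-D * ‖z‖ ^ i * 2 ^ (N + m) * (1 / 2) ^ (N + m)) * e2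
      _ ≤ _ := by gcongr
  · intro i hi1 hi
    rw [norm_iteratedFDeriv_eq_norm_iteratedDeriv, iteratedDeriv_exp_smul, norm_smul, norm_smul,
      norm_inv, norm_norm, inv_mul_cancel₀ hz0.ne', mul_one, Real.norm_of_nonneg (Real.exp_pos t).le]
    calc Real.exp t ≤ 2 := he2.le
      _ = 2 ^ 1 := (pow_one _).symm
      _ ≤ 2 ^ i := pow_le_pow_right₀ (by norm_num) hi1

theorem IsSmoothWeight.exists_bound {w : ℝ → ℂ} (hw : IsSmoothWeight w) (N : ℕ) :
    ∃ K, 0 ≤ K ∧ ∀ k ≤ N, ∀ t, ‖iteratedDeriv k w t‖ ≤ K := by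
  have h1 : ∀ k : ℕ, ∃ K, ∀ t, ‖iteratedDeriv k w t‖ ≤ K := fun k => by
    have hW := (hw.isWeight.hasCompactSupport.toSchwartzMap hw.smooth).decay 0 k
    obtain ⟨K, -, hK⟩ := hW
    refine ⟨K, fun t => ?_⟩
    have := hK t
    rwa [pow_zero, one_mul, norm_iteratedFDeriv_eq_norm_iteratedDeriv] at this
  choose K hK using h1
  refine ⟨∑ k ∈ Finset.range (N + 1), |K k|, Finset.sum_nonneg fun _ _ => abs_nonneg _, fun k hk t => ?_⟩
  exact ((hK k t).trans (le_abs_self _)).trans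
    (Finset.single_le_sum (f := fun k => |K k|) (fun _ _ => abs_nonneg _) (Finset.mem_range.2 (by omega)))

theorem IsSmoothWeight.reflect {w : ℝ → ℂ} (hw : IsSmoothWeight w) : IsSmoothWeight (fun t => w (-t)) :=
  ⟨hw.smooth.comp contDiff_neg, fun t ht => hw.eq_zero _ (by rwa [abs_neg])⟩

/-- The size of a symbol of order `-m` along rays. -/
def symbolSize (m : ℕ) (r : ℝ) (z : E3) : ℝ := (ext r).indicator (fun z => ‖z‖⁻¹ ^ m) z

/-- Since `1/2 < e^t < 2` for `|t| ≤ 1/2`, the amplitude vanishes identically unless `|z| ≥ R/2`,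
and there `|e^t z|` is comparable to `|z|`. -/
theorem exists_isAmplitude_symbol (m N : ℕ) {c : ℝ → ℂ} (hc : IsSmoothWeight c) :
    ∃ C : ℝ, 0 ≤ C ∧ ∀ (B R : ℝ) (A : E3 → ℂ), 0 < R → IsSymbol m N B R A → ∀ z : E3,
      IsAmplitude N (C * B * symbolSize m (R / 2) z) (fun t => c t * A (Real.exp t • z)) := by
  obtain ⟨K, hK, hcK⟩ := hc.exists_bound N
  refine ⟨2 ^ N * K * (N.factorial * 2 ^ (N + m) * 2 ^ N), by positivity, fun B R A hR hA z => ?_⟩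
  have hB := hA.nonneg
  have hsm : ContDiff ℝ ∞ (fun t => A (Real.exp t • z)) :=
    hA.temperate.1.comp (Real.contDiff_exp.smul contDiff_const)
  have hS : 0 ≤ symbolSize m (R / 2) z := Set.indicator_nonneg (fun z _ => by positivity) z
  have hz0 : ∀ t, 1 / 2 < |t| → c t * A (Real.exp t • z) = 0 := fun t ht => by
    rw [hc.eq_zero t ht, zero_mul]
  refine ⟨hc.smooth.mul hsm, hz0, fun k hk t => ?_⟩
  by_cases ht : 1 / 2 < |t|
  · have h : (fun t => c t * A (Real.exp t • z)) =ᶠ[𝓝 t] fun _ => 0 := by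
      filter_upwards [continuous_abs.continuousAt.eventually (lt_mem_nhds ht)] with x hx
      exact hz0 x hx
    rw [(h.iteratedDeriv_eq k), iteratedDeriv_const]
    simp only [ite_self, norm_zero]
    positivity
  have ht' := not_lt.1 ht
  by_cases hz : z ∈ ext (R / 2)
  · have hzz : R / 2 ≤ ‖z‖ := hz
    have hz1 : z ≠ 0 := norm_pos_iff.1 (lt_of_lt_of_le (by positivity) hzz)
    rw [symbolSize, Set.indicator_of_mem hz, ← norm_iteratedFDeriv_eq_norm_iteratedDeriv]
    refine (norm_iteratedFDeriv_mul_le hc.smooth hsm t (n := k) (by exact_mod_cast le_top)).trans ?_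
    calc ∑ i ∈ Finset.range (k + 1), (k.choose i : ℝ) * ‖iteratedFDeriv ℝ i c t‖ *
          ‖iteratedFDeriv ℝ (k - i) (fun t => A (Real.exp t • z)) t‖
        ≤ ∑ i ∈ Finset.range (k + 1), (k.choose i : ℝ) * (K * ((N.factorial * 2 ^ (N + m) * 2 ^ N) *
            (B * ‖z‖⁻¹ ^ m))) := by
          refine Finset.sum_le_sum fun i hi => ?_
          rw [Finset.mem_range] at hi
          rw [mul_assoc, norm_iteratedFDeriv_eq_norm_iteratedDeriv, norm_iteratedFDeriv_eq_norm_iteratedDeriv]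
          gcongr
          · exact hcK i (by omega) t
          · exact hA.norm_iteratedDeriv_ray_le hz1 ht' (by omega)
      _ = 2 ^ k * (K * ((N.factorial * 2 ^ (N + m) * 2 ^ N) * (B * ‖z‖⁻¹ ^ m))) := by
          rw [← Finset.sum_mul]
          congr 1
          exact_mod_cast Nat.sum_range_choose k
      _ ≤ 2 ^ N * (K * ((N.factorial * 2 ^ (N + m) * 2 ^ N) * (B * ‖z‖⁻¹ ^ m))) := by
          gcongr
          norm_num
      _ = _ := by ring
  · have hall : (fun t => c t * A (Real.exp t • z)) = fun _ => 0 := by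
      ext1 t
      by_cases ht : 1 / 2 < |t|
      · exact hz0 t ht
      · rw [hA.eq_zero, mul_zero]
        have hzz : ‖z‖ < R / 2 := not_le.1 hz
        rw [norm_smul, Real.norm_of_nonneg (Real.exp_pos t).le]
        have := exp_half_lt_two (abs_le.1 (not_lt.1 ht)).2
        nlinarith [norm_nonneg z, Real.exp_pos t]
    rw [hall, iteratedDeriv_const]
    simp only [ite_self, norm_zero]
    positivity

/-! ### Local decay for incoming waves -/

/-- The coordinate `y_k` is `e^{-t}` times the coordinate of `e^t y`, so multiplication passes
through the projection at the price of a factor `e^{-t}` in the weight. -/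
theorem mX_halfProj {ε : ℝ} (hε : ε ^ 2 = 1) {w : ℝ → ℂ} (hw : IsSmoothWeight w) (k : Fin 3) (h : 𝓢(E3, ℂ)) :
    mX k (halfProj ε hw h) = halfProj ε (hw.exp_mul (-1)) (mX k h) := by
  ext y
  rw [mX_apply, halfProj_apply hε, halfProj_apply hε, ← integral_const_mul]
  congr 1
  ext1 l
  rw [← integral_const_mul]
  congr 1
  ext1 t
  have h1 : ((Real.exp (-1 * t) : ℝ) : ℂ) * ((Real.exp t : ℝ) : ℂ) = 1 := by
    rw [← Complex.ofReal_mul, ← Real.exp_add]; simp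
  simp only [rayProfile, mX_apply, PiLp.smul_apply, smul_eq_mul, Complex.ofReal_mul]
  linear_combination (-((y k : ℝ) : ℂ) * ramp ε l t * w t * h (Real.exp t • y)) * h1

theorem norm_coord_le (x : E3) (k : Fin 3) : ‖((x k : ℝ) : ℂ)‖ ≤ ‖x‖ := by
  rw [Complex.norm_real]
  exact PiLp.norm_apply_le x k

theorem measurable_symbolSize (m : ℕ) (r : ℝ) : Measurable (symbolSize m r) :=
  Measurable.indicator (by fun_prop) (measurableSet_ext r)

/-- If `|x| > |z|/4`, then `|z|² ≤ 16|x|² ≤ (R² + s)/16`. Together with `R² ≤ 4|z|²` this gives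
`|z|² ≤ s/12`, and the second alternative holds. -/
theorem isRayRegular_of_mem_ext {R s : ℝ} (hR : 0 < R) {x z : E3} (hx : ‖x‖ ^ 2 ≤ (R ^ 2 + s) / 256)
    (hz : z ∈ ext (R / 2)) : IsRayRegular s x z := by
  have hz' : R / 2 ≤ ‖z‖ := hz
  by_cases h : ‖x‖ ≤ ‖z‖ / 4
  · exact Or.inl h
  · have h' := not_le.1 h
    have h1 := norm_nonneg z
    have h2 : ‖z‖ ^ 2 ≤ 16 * ‖x‖ ^ 2 := by nlinarith
    have h3 : R ^ 2 ≤ 4 * ‖z‖ ^ 2 := by nlinarith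
    exact Or.inr ⟨by nlinarith, by nlinarith⟩

/-- The kernel controlling incoming waves. -/
def incomingKernel (m : ℕ) (s : ℝ) (z : E3) : ℝ :=
  s ^ (-(3 / 2) : ℝ) * (‖z‖⁻¹ ^ m * (1 + ‖z‖ ^ 2 / s)⁻¹ ^ 3)

theorem exists_norm_freeEvolution_symbol_halfProj_le (m : ℕ) {w : ℝ → ℂ} (hw : IsSmoothWeight w) :
    ∃ C : ℝ, 0 ≤ C ∧ ∀ (B R s : ℝ) (A : E3 → ℂ), 0 < R → 0 < s → IsSymbol m 5 B R A →
      ∀ x : E3, ‖x‖ ^ 2 ≤ (R ^ 2 + s) / 256 → ∀ h : 𝓢(E3, ℂ),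
      ‖freeEvolutionSchwartz s (mulS A (halfProj 1 hw h)) x‖
        ≤ C * B * ∫ z in ext (R / 2), incomingKernel m s z * ‖h z‖ := by
  obtain ⟨C₁, hC₁, hker⟩ := exists_kernel_halfProj_bound
  obtain ⟨C₂, hC₂, hamp⟩ := exists_isAmplitude_symbol m 5 (hw.reflect.exp_mul 3)
  refine ⟨C₁ * C₂, by positivity, fun B R s A hR hs hA x hx h => ?_⟩
  have hB := hA.nonneg
  rw [freeEvolutionSchwartz_apply hs]
  have e1 : ∀ y, mulS A (halfProj 1 hw h) y = A y * halfProj 1 hw h y := mulS_apply hA.temperate _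
  simp_rw [e1]
  have hbA : ∀ y, ‖A y‖ ≤ B / R ^ m := fun y => by
    by_cases hy : ‖y‖ < R
    · rw [hA.eq_zero y hy, norm_zero]; positivity
    · rw [le_div_iff₀ (by positivity)]
      have := hA.bound 0 (Nat.zero_le _) y
      rw [norm_iteratedFDeriv_zero, zero_add] at this
      refine le_trans ?_ this
      rw [mul_comm]
      gcongr
      exact not_lt.1 hy
  have hS : ∀ z, symbolSize m (R / 2) z ≤ (R / 2)⁻¹ ^ m := fun z => by
    by_cases hz : z ∈ ext (R / 2)
    · have : R / 2 ≤ ‖z‖ := hz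
      rw [symbolSize, Set.indicator_of_mem hz]
      gcongr
    · rw [symbolSize, Set.indicator_of_notMem hz]
      positivity
  have key := hker s hs w hw A hA.temperate.1.continuous ⟨_, hbA⟩ x
    (fun z => C₂ * B * symbolSize m (R / 2) z) ((measurable_symbolSize m (R / 2)).const_mul _)
    ⟨C₂ * B * (R / 2)⁻¹ ^ m, fun z => by have := hS z; gcongr⟩
    (fun z => by
      have := hamp B R A hR hA z
      refine ⟨?_, ?_, ?_⟩
      · convert this.smooth using 2 with t
        ring
      · intro t ht
        rw [← this.eq_zero t ht]; ring
      · intro k hk t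
        rw [← (show (fun t => ((Real.exp (3 * t) : ℝ) : ℂ) * w (-t) * A (Real.exp t • z))
          = fun t => w (-t) * ((Real.exp (3 * t) : ℝ) : ℂ) * A (Real.exp t • z) from by ext1 t; ring)]
        exact this.bound k hk t)
    (fun z hz => by
      refine isRayRegular_of_mem_ext hR hx ?_
      by_contra hcon
      exact hz (by rw [symbolSize, Set.indicator_of_notMem hcon, mul_zero])) h
  rw [norm_mul]
  calc ‖propagatorConst s‖ * _
      ≤ s ^ (-(3 / 2) : ℝ) * (C₁ * ∫ z, C₂ * B * symbolSize m (R / 2) z * (1 + ‖z‖ ^ 2 / s)⁻¹ ^ 3 * ‖h z‖) := by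
        gcongr
        exact norm_propagatorConst_le hs
    _ = C₁ * C₂ * B * ∫ z, (ext (R / 2)).indicator (fun z => incomingKernel m s z * ‖h z‖) z := by
        have i1 : (fun z => C₂ * B * symbolSize m (R / 2) z * (1 + ‖z‖ ^ 2 / s)⁻¹ ^ 3 * ‖h z‖)
            = fun z => C₂ * B * (symbolSize m (R / 2) z * (1 + ‖z‖ ^ 2 / s)⁻¹ ^ 3 * ‖h z‖) := by
          ext1 z; ring
        have i2 : (ext (R / 2)).indicator (fun z => incomingKernel m s z * ‖h z‖)
            = fun z => s ^ (-(3 / 2) : ℝ) * (symbolSize m (R / 2) z * (1 + ‖z‖ ^ 2 / s)⁻¹ ^ 3 * ‖h z‖) := by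
          ext1 z
          rw [symbolSize]
          by_cases hz : z ∈ ext (R / 2)
          · rw [Set.indicator_of_mem hz, Set.indicator_of_mem hz, incomingKernel]; ring
          · rw [Set.indicator_of_notMem hz, Set.indicator_of_notMem hz]; ring
        rw [i1, i2, integral_const_mul, integral_const_mul]
        ring
    _ = _ := by rw [integral_indicator (measurableSet_ext _)]

/-- With `p = s + |z|²` one has `(1 + |z|²/s)⁻¹ = s/p`, so the three powers turn `s^{-3/2}` into
`s^{3/2} p^{-3} ≤ p^{-3/2}`, uniformly for small `s`. Out of the powers of `p`, `9/8` is reserved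
for `R² + s ≤ 5p`, the rest for `|z|² ≤ p`. An extra `|z|⁻¹`, or an extra `√p/s`, is what raises the
decay in `z` to `7/4`, which is square integrable at infinity in dimension three. -/
theorem incomingKernel_le {R s : ℝ} (hR : 0 < R) (hs : 0 < s) {z : E3} (hz : z ∈ ext (R / 2)) :
    incomingKernel 1 s z ≤ 25 * (R ^ 2 + s) ^ (-(9 / 8) : ℝ) * ‖z‖ ^ (-(7 / 4) : ℝ) ∧
    s⁻¹ * (Real.sqrt (R ^ 2 + s) + ‖z‖) * incomingKernel 0 s z
      ≤ 100 * (R ^ 2 + s) ^ (-(9 / 8) : ℝ) * ‖z‖ ^ (-(7 / 4) : ℝ) := by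
  have hz' : R / 2 ≤ ‖z‖ := hz
  have hz0 : 0 < ‖z‖ := lt_of_lt_of_le (by positivity) hz'
  set p : ℝ := s + ‖z‖ ^ 2 with hp
  set T : ℝ := R ^ 2 + s with hT
  have hp0 : 0 < p := by positivity
  have hT0 : 0 < T := by positivity
  have hpT : T / 5 ≤ p := by rw [hp, hT]; nlinarith
  have hpz : ‖z‖ ^ 2 ≤ p := by rw [hp]; linarith
  have hps : s ≤ p := by rw [hp]; nlinarith
  have hfac : (1 + ‖z‖ ^ 2 / s)⁻¹ = s / p := by rw [hp]; field_simp
  have hz2 : ∀ a : ℝ, 0 ≤ a → p ^ (-a) ≤ ‖z‖ ^ (-(2 * a)) := fun a ha => by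
    have : ‖z‖ ^ (-(2 * a)) = (‖z‖ ^ 2) ^ (-a) := by
      rw [← Real.rpow_natCast, ← Real.rpow_mul hz0.le]; congr 1; push_cast; ring
    rw [this]
    exact Real.rpow_le_rpow_of_nonpos (by positivity) hpz (by linarith)
  have hTp : p ^ (-(9 / 8) : ℝ) ≤ 25 * T ^ (-(9 / 8) : ℝ) := by
    calc p ^ (-(9 / 8) : ℝ) ≤ (T / 5) ^ (-(9 / 8) : ℝ) :=
          Real.rpow_le_rpow_of_nonpos (by positivity) hpT (by norm_num)
      _ = 5 ^ (9 / 8 : ℝ) * T ^ (-(9 / 8) : ℝ) := by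
          rw [Real.div_rpow hT0.le (by norm_num), Real.rpow_neg (by norm_num : (0 : ℝ) ≤ 5)]
          field_simp
      _ ≤ 5 ^ (2 : ℝ) * T ^ (-(9 / 8) : ℝ) := by
          gcongr
          · norm_num
          · norm_num
      _ = _ := by norm_num
  have e3 : s ^ (-(3 / 2) : ℝ) * (s / p) ^ 3 = s ^ (3 / 2 : ℝ) * p ^ (-3 : ℝ) := by
    have h1 : s ^ 3 = s ^ (3 : ℝ) := by norm_cast
    have h2 : (p ^ 3)⁻¹ = p ^ (-3 : ℝ) := by rw [Real.rpow_neg hp0.le]; norm_cast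
    rw [div_pow, div_eq_mul_inv (s ^ 3), h1, h2, ← mul_assoc, ← Real.rpow_add hs]
    norm_num
  constructor
  · calc incomingKernel 1 s z = ‖z‖⁻¹ * (s ^ (3 / 2 : ℝ) * p ^ (-3 : ℝ)) := by
          rw [incomingKernel, hfac, ← e3]; ring
      _ ≤ ‖z‖⁻¹ * (p ^ (3 / 2 : ℝ) * p ^ (-3 : ℝ)) := by gcongr
      _ = ‖z‖⁻¹ * (p ^ (-(9 / 8) : ℝ) * p ^ (-(3 / 8) : ℝ)) := by
          rw [← Real.rpow_add hp0, ← Real.rpow_add hp0]; norm_num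
      _ ≤ ‖z‖⁻¹ * (25 * T ^ (-(9 / 8) : ℝ) * ‖z‖ ^ (-(2 * (3 / 8)) : ℝ)) := by
          gcongr
          exact hz2 _ (by norm_num)
      _ = 25 * T ^ (-(9 / 8) : ℝ) * (‖z‖ ^ (-1 : ℝ) * ‖z‖ ^ (-(2 * (3 / 8)) : ℝ)) := by
          rw [Real.rpow_neg_one]; ring
      _ = _ := by rw [← Real.rpow_add hz0]; norm_num
  · have h1 : Real.sqrt T + ‖z‖ ≤ 4 * p ^ (1 / 2 : ℝ) := by
      rw [← Real.sqrt_eq_rpow]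
      have a1 : Real.sqrt T ≤ 3 * Real.sqrt p := by
        rw [Real.sqrt_le_left (by positivity), mul_pow, Real.sq_sqrt hp0.le]
        linarith
      have a2 : ‖z‖ ≤ Real.sqrt p := Real.le_sqrt_of_sq_le hpz
      linarith
    calc s⁻¹ * (Real.sqrt T + ‖z‖) * incomingKernel 0 s z
        = (Real.sqrt T + ‖z‖) * (s ^ (-1 : ℝ) * (s ^ (3 / 2 : ℝ) * p ^ (-3 : ℝ))) := by
          rw [incomingKernel, hfac, ← e3, Real.rpow_neg_one]; ring
      _ = (Real.sqrt T + ‖z‖) * (s ^ (1 / 2 : ℝ) * p ^ (-3 : ℝ)) := by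
          rw [← mul_assoc (s ^ (-1 : ℝ)), ← Real.rpow_add hs]; norm_num
      _ ≤ (4 * p ^ (1 / 2 : ℝ)) * (p ^ (1 / 2 : ℝ) * p ^ (-3 : ℝ)) := by gcongr
      _ = 4 * (p ^ (-(9 / 8) : ℝ) * p ^ (-(7 / 8) : ℝ)) := by
          rw [mul_assoc, ← Real.rpow_add hp0, ← Real.rpow_add hp0, ← Real.rpow_add hp0]; norm_num
      _ ≤ 4 * (25 * T ^ (-(9 / 8) : ℝ) * ‖z‖ ^ (-(2 * (7 / 8)) : ℝ)) := by
          gcongr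
          exact hz2 _ (by norm_num)
      _ = _ := by norm_num; ring

theorem integrable_ext_rpow_mul {r : ℝ} (hr : 0 < r) (h : 𝓢(E3, ℂ)) :
    IntegrableOn (fun z => ‖z‖ ^ (-(7 / 4) : ℝ) * ‖h z‖) (ext r) := by
  refine (h.integrable.norm.integrableOn (s := ext r)).bdd_mul (c := r ^ (-(7 / 4) : ℝ)) ?_ ?_
  · exact (Measurable.pow_const measurable_norm _).aestronglyMeasurable
  · filter_upwards [ae_restrict_mem (measurableSet_ext r)] with z hz
    have hz' : r ≤ ‖z‖ := hz
    rw [Real.norm_of_nonneg (by positivity)]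
    exact Real.rpow_le_rpow_of_nonpos hr hz' (by norm_num)

theorem setIntegral_ext_le {r c : ℝ} (hr : 0 < r) (h : 𝓢(E3, ℂ)) {f : E3 → ℝ}
    (hf0 : ∀ z ∈ ext r, 0 ≤ f z) (hf : ∀ z ∈ ext r, f z ≤ c * (‖z‖ ^ (-(7 / 4) : ℝ) * ‖h z‖)) :
    ∫ z in ext r, f z ≤ c * ∫ z in ext r, ‖z‖ ^ (-(7 / 4) : ℝ) * ‖h z‖ := by
  rw [← integral_const_mul]
  refine integral_mono_of_nonneg ?_ ((integrable_ext_rpow_mul hr h).const_mul c) ?_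
  · filter_upwards [ae_restrict_mem (measurableSet_ext r)] with z hz using hf0 z hz
  · filter_upwards [ae_restrict_mem (measurableSet_ext r)] with z hz using hf z hz

theorem incomingKernel_nonneg (m : ℕ) {s : ℝ} (hs : 0 < s) (z : E3) : 0 ≤ incomingKernel m s z := by
  unfold incomingKernel; positivity

theorem mulS_comm_mX {A : E3 → ℂ} (hA : A.HasTemperateGrowth) (k : Fin 3) (u : 𝓢(E3, ℂ)) :
    mX k (mulS A u) = mulS A (mX k u) := by
  ext x
  rw [mX_apply, mulS_apply hA, mulS_apply hA, mX_apply]; ring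

/-- The commutation rule `e^{isH₀} x_k = (x_k - is∂_k) e^{isH₀}`, solved for the derivative,
exchanges `∂_k` for coordinate factors divided by `s`. -/
theorem norm_dX_freeEvolution_le {s : ℝ} (hs : 0 < s) (k : Fin 3) (u : 𝓢(E3, ℂ)) (x : E3) :
    ‖dX k (freeEvolutionSchwartz s u) x‖
      ≤ s⁻¹ * (‖x‖ * ‖freeEvolutionSchwartz s u x‖ + ‖freeEvolutionSchwartz s (mX k u) x‖) := by
  have h1 := congrArg (fun v : 𝓢(E3, ℂ) => v x) (freeEvolutionSchwartz_mX s k u)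
  simp only [sub_apply, smul_apply, smul_eq_mul, mX_apply] at h1
  have h2 : Complex.I * s * dX k (freeEvolutionSchwartz s u) x
      = (x k : ℝ) * freeEvolutionSchwartz s u x - freeEvolutionSchwartz s (mX k u) x := by
    rw [h1]; ring
  have h3 : s * ‖dX k (freeEvolutionSchwartz s u) x‖
      ≤ ‖x‖ * ‖freeEvolutionSchwartz s u x‖ + ‖freeEvolutionSchwartz s (mX k u) x‖ := by
    have h4 := congrArg norm h2
    rw [norm_mul, norm_mul, Complex.norm_I, one_mul, Complex.norm_real, Real.norm_of_nonneg hs.le] at h4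
    rw [h4]
    refine (norm_sub_le _ _).trans ?_
    rw [norm_mul]
    gcongr
    exact norm_coord_le x k
  rw [inv_mul_eq_div, le_div_iff₀ hs, mul_comm]
  exact h3

/-- At the rate `9/8`, the kernel without a derivative would decay only like `|z|^{-3/4}`. The
derivative is either moved outside the propagator, where it gains a coordinate over `s`, or falls on
`A`, which then gains one order of decay. -/
theorem exists_norm_incoming_near_le {w : ℝ → ℂ} (hw : IsSmoothWeight w) :
    ∃ C : ℝ, 0 ≤ C ∧ ∀ (B R s : ℝ) (A : E3 → ℂ) (k : Fin 3), 0 < R → 0 < s → IsSymbol 0 6 B R A →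
      ∀ (h : 𝓢(E3, ℂ)) (x : E3), ‖x‖ ^ 2 ≤ (R ^ 2 + s) / 256 →
      ‖freeEvolutionSchwartz s (mulS A (dX k (halfProj 1 hw h))) x‖
        ≤ C * B * (R ^ 2 + s) ^ (-(9 / 8) : ℝ) * ∫ z in ext (R / 2), ‖z‖ ^ (-(7 / 4) : ℝ) * ‖h z‖ := by
  obtain ⟨C₀, hC₀, b0⟩ := exists_norm_freeEvolution_symbol_halfProj_le 0 hw
  obtain ⟨C₁, hC₁, b1⟩ := exists_norm_freeEvolution_symbol_halfProj_le 1 hw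
  obtain ⟨C₂, hC₂, b2⟩ := exists_norm_freeEvolution_symbol_halfProj_le 0 (hw.exp_mul (-1))
  refine ⟨100 * C₀ + 100 * C₂ + 25 * C₁, by positivity, fun B R s A k hR hs hA h x hx => ?_⟩
  have hB := hA.nonneg
  have hA0 : IsSymbol 0 5 B R A := hA.mono (by norm_num) le_rfl
  set T := R ^ 2 + s with hT
  have hT0 : 0 < T := by positivity
  set I := ∫ z in ext (R / 2), ‖z‖ ^ (-(7 / 4) : ℝ) * ‖h z‖ with hI
  set u := mulS A (halfProj 1 hw h) with hu
  have hR2 : 0 < R / 2 := by positivity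
  have hxT : ‖x‖ ≤ Real.sqrt T := Real.le_sqrt_of_sq_le (by linarith)
  have split : mulS A (dX k (halfProj 1 hw h)) = dX k u - mulS (partialDeriv k A) (halfProj 1 hw h) := by
    rw [hu, dX_mulS hA.temperate, add_sub_cancel_right]
  have hmXu : mX k u = mulS A (halfProj 1 (hw.exp_mul (-1)) (mX k h)) := by
    rw [hu, mulS_comm_mX hA.temperate, mX_halfProj (by norm_num)]
  have e0 : s⁻¹ * (‖x‖ * ‖freeEvolutionSchwartz s u x‖) ≤ 100 * C₀ * B * T ^ (-(9 / 8) : ℝ) * I := by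
    calc s⁻¹ * (‖x‖ * ‖freeEvolutionSchwartz s u x‖)
        ≤ s⁻¹ * (Real.sqrt T * (C₀ * B * ∫ z in ext (R / 2), incomingKernel 0 s z * ‖h z‖)) := by
          gcongr
          exact b0 B R s A hR hs hA0 x hx h
      _ = C₀ * B * ∫ z in ext (R / 2), s⁻¹ * Real.sqrt T * (incomingKernel 0 s z * ‖h z‖) := by
          rw [integral_const_mul]; ring
      _ ≤ C₀ * B * ((100 * T ^ (-(9 / 8) : ℝ)) * I) := by
          gcongr
          refine setIntegral_ext_le hR2 h (fun z _ => ?_) (fun z hz => ?_)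
          · have := incomingKernel_nonneg 0 hs z; positivity
          · have h1 := (incomingKernel_le hR hs hz).2
            have h2 := incomingKernel_nonneg 0 hs z
            calc s⁻¹ * Real.sqrt T * (incomingKernel 0 s z * ‖h z‖)
                ≤ (s⁻¹ * (Real.sqrt T + ‖z‖) * incomingKernel 0 s z) * ‖h z‖ := by
                  rw [← mul_assoc]
                  gcongr
                  linarith [norm_nonneg z]
              _ ≤ (100 * T ^ (-(9 / 8) : ℝ) * ‖z‖ ^ (-(7 / 4) : ℝ)) * ‖h z‖ := by gcongr
              _ = _ := by ring
      _ = _ := by ring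
  have e2 : s⁻¹ * ‖freeEvolutionSchwartz s (mX k u) x‖ ≤ 100 * C₂ * B * T ^ (-(9 / 8) : ℝ) * I := by
    calc s⁻¹ * ‖freeEvolutionSchwartz s (mX k u) x‖
        ≤ s⁻¹ * (C₂ * B * ∫ z in ext (R / 2), incomingKernel 0 s z * ‖mX k h z‖) := by
          rw [hmXu]
          gcongr
          exact b2 B R s A hR hs hA0 x hx (mX k h)
      _ = C₂ * B * ∫ z in ext (R / 2), s⁻¹ * (incomingKernel 0 s z * ‖mX k h z‖) := by
          rw [integral_const_mul]; ring
      _ ≤ C₂ * B * ((100 * T ^ (-(9 / 8) : ℝ)) * I) := by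
          gcongr
          refine setIntegral_ext_le hR2 h (fun z _ => ?_) (fun z hz => ?_)
          · have := incomingKernel_nonneg 0 hs z; positivity
          · have h1 := (incomingKernel_le hR hs hz).2
            have h2 := incomingKernel_nonneg 0 hs z
            calc s⁻¹ * (incomingKernel 0 s z * ‖mX k h z‖)
                ≤ s⁻¹ * (incomingKernel 0 s z * ((Real.sqrt T + ‖z‖) * ‖h z‖)) := by
                  rw [mX_apply, norm_mul]
                  gcongr
                  refine (norm_coord_le z k).trans ?_
                  linarith [Real.sqrt_nonneg T]
              _ = (s⁻¹ * (Real.sqrt T + ‖z‖) * incomingKernel 0 s z) * ‖h z‖ := by ring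
              _ ≤ (100 * T ^ (-(9 / 8) : ℝ) * ‖z‖ ^ (-(7 / 4) : ℝ)) * ‖h z‖ := by gcongr
              _ = _ := by ring
      _ = _ := by ring
  have e1 : ‖freeEvolutionSchwartz s (mulS (partialDeriv k A) (halfProj 1 hw h)) x‖
      ≤ 25 * C₁ * B * T ^ (-(9 / 8) : ℝ) * I := by
    calc _ ≤ C₁ * B * ∫ z in ext (R / 2), incomingKernel 1 s z * ‖h z‖ :=
          b1 B R s _ hR hs (hA.partialDeriv k) x hx h
      _ ≤ C₁ * B * ((25 * T ^ (-(9 / 8) : ℝ)) * I) := by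
          gcongr
          refine setIntegral_ext_le hR2 h (fun z _ => ?_) (fun z hz => ?_)
          · have := incomingKernel_nonneg 1 hs z; positivity
          · have h1 := (incomingKernel_le hR hs hz).1
            calc incomingKernel 1 s z * ‖h z‖ ≤ (25 * T ^ (-(9 / 8) : ℝ) * ‖z‖ ^ (-(7 / 4) : ℝ)) * ‖h z‖ := by
                  gcongr
              _ = _ := by ring
      _ = _ := by ring
  calc ‖freeEvolutionSchwartz s (mulS A (dX k (halfProj 1 hw h))) x‖
      ≤ ‖dX k (freeEvolutionSchwartz s u) x‖
        + ‖freeEvolutionSchwartz s (mulS (partialDeriv k A) (halfProj 1 hw h)) x‖ := by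
        rw [split, map_sub, freeEvolutionSchwartz_dX, sub_apply]
        exact norm_sub_le _ _
    _ ≤ (s⁻¹ * (‖x‖ * ‖freeEvolutionSchwartz s u x‖) + s⁻¹ * ‖freeEvolutionSchwartz s (mX k u) x‖)
        + ‖freeEvolutionSchwartz s (mulS (partialDeriv k A) (halfProj 1 hw h)) x‖ := by
        rw [← mul_add]
        gcongr
        exact norm_dX_freeEvolution_le hs k u x
    _ ≤ (100 * C₀ * B * T ^ (-(9 / 8) : ℝ) * I + 100 * C₂ * B * T ^ (-(9 / 8) : ℝ) * I)
        + 25 * C₁ * B * T ^ (-(9 / 8) : ℝ) * I := by gcongr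
    _ = _ := by ring

/-! ### Cauchy–Schwarz and square integrable weights -/

theorem ofReal_integral_mul_le {α : Type*} {m : MeasurableSpace α} {μ : Measure α} {f g : α → ℝ}
    (hf : AEStronglyMeasurable f μ) (hg : AEStronglyMeasurable g μ) :
    ENNReal.ofReal (∫ x, f x * g x ∂μ) ≤ eLpNorm f 2 μ * eLpNorm g 2 μ := by
  calc ENNReal.ofReal (∫ x, f x * g x ∂μ) ≤ ‖∫ x, f x * g x ∂μ‖ₑ := by
        rw [← ofReal_norm]; exact ENNReal.ofReal_le_ofReal (le_abs_self _)
    _ ≤ ∫⁻ x, ‖f x * g x‖ₑ ∂μ := enorm_integral_le_lintegral_enorm _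
    _ = eLpNorm (f • g) 1 μ := by rw [eLpNorm_one_eq_lintegral_enorm]; rfl
    _ ≤ _ := eLpNorm_smul_le_mul_eLpNorm hg hf

/-- The exponent `7/4` is admissible because `2 · 7/4 > 3`. -/
theorem eLpNorm_two_lt_top_of_decay {μ : Measure E3} (hμ : μ ≤ volume) {f : E3 → ℝ} {C : ℝ}
    (hf : ∀ᵐ x ∂μ, ‖f x‖ ≤ C * ‖(1 + ‖x‖) ^ (-(7 / 4) : ℝ)‖) : eLpNorm f 2 μ < ⊤ := by
  have h1 : MemLp (fun x : E3 => (1 + ‖x‖) ^ (-(7 / 4) : ℝ)) 2 volume := by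
    have hm : AEStronglyMeasurable (fun x : E3 => (1 + ‖x‖) ^ (-(7 / 4) : ℝ)) volume :=
      (Measurable.pow_const (by fun_prop) _).aestronglyMeasurable
    rw [memLp_two_iff_integrable_sq hm]
    refine (integrable_one_add_norm (r := 7 / 2) (by rw [finrank_euclideanSpace, Fintype.card_fin]; norm_num)).congr
      (Eventually.of_forall fun x => ?_)
    have h0 : 0 ≤ 1 + ‖x‖ := by positivity
    simp only
    rw [← Real.rpow_natCast, ← Real.rpow_mul h0]
    norm_num
  calc eLpNorm f 2 μ ≤ ENNReal.ofReal C * eLpNorm (fun x : E3 => (1 + ‖x‖) ^ (-(7 / 4) : ℝ)) 2 μ :=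
        eLpNorm_le_mul_eLpNorm_of_ae_le_mul hf 2
    _ ≤ ENNReal.ofReal C * eLpNorm (fun x : E3 => (1 + ‖x‖) ^ (-(7 / 4) : ℝ)) 2 volume := by
        gcongr
    _ < ⊤ := ENNReal.mul_lt_top ENNReal.ofReal_lt_top h1.2

theorem one_le_japaneseBracket (x : E3) : 1 ≤ japaneseBracket x := by
  rw [japaneseBracket, Real.one_le_sqrt]
  nlinarith [sq_nonneg ‖x‖]

theorem japaneseBracket_pos (x : E3) : 0 < japaneseBracket x := one_pos.trans_le (one_le_japaneseBracket x)

theorem continuous_japaneseBracket : Continuous japaneseBracket := by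
  unfold japaneseBracket; fun_prop

theorem norm_le_japaneseBracket (x : E3) : ‖x‖ ≤ japaneseBracket x :=
  Real.le_sqrt_of_sq_le (by linarith)

theorem eLpNorm_japaneseBracket_lt_top {a : ℝ} (ha : 2 ≤ a) :
    eLpNorm (fun x => japaneseBracket x ^ (-a)) 2 volume < ⊤ := by
  refine eLpNorm_two_lt_top_of_decay le_rfl (C := 2 ^ (7 / 4 : ℝ)) (Eventually.of_forall fun x => ?_)
  have hj := one_le_japaneseBracket x
  have hj0 := japaneseBracket_pos x
  have hn := norm_le_japaneseBracket x
  rw [Real.norm_of_nonneg (by positivity), Real.norm_of_nonneg (by positivity)]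
  calc japaneseBracket x ^ (-a) ≤ japaneseBracket x ^ (-(7 / 4) : ℝ) :=
        Real.rpow_le_rpow_of_exponent_le hj (by linarith)
    _ ≤ ((1 + ‖x‖) / 2) ^ (-(7 / 4) : ℝ) :=
        Real.rpow_le_rpow_of_nonpos (by positivity) (by linarith) (by norm_num)
    _ = _ := by
        rw [Real.div_rpow (by positivity) (by norm_num), Real.rpow_neg (by norm_num : (0 : ℝ) ≤ 2), div_inv_eq_mul]
        ring

theorem eLpNorm_ext_rpow_lt_top {r : ℝ} (hr : 0 < r) :
    eLpNorm (fun z : E3 => ‖z‖ ^ (-(7 / 4) : ℝ)) 2 (volume.restrict (ext r)) < ⊤ := by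
  refine eLpNorm_two_lt_top_of_decay Measure.restrict_le_self (C := (r / (1 + r)) ^ (-(7 / 4) : ℝ)) ?_
  filter_upwards [ae_restrict_mem (measurableSet_ext r)] with z hz
  have hz' : r ≤ ‖z‖ := hz
  rw [Real.norm_of_nonneg (by positivity), Real.norm_of_nonneg (by positivity),
    ← Real.mul_rpow (by positivity) (by positivity)]
  refine Real.rpow_le_rpow_of_nonpos (by positivity) ?_ (by norm_num)
  rw [div_mul_eq_mul_div, div_le_iff₀ (by positivity)]
  nlinarith

theorem IsSymbol.eLpNorm_mulS_le {N : ℕ} {B R : ℝ} {A : E3 → ℂ} (hA : IsSymbol 0 N B R A) (u : 𝓢(E3, ℂ)) :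
    eLpNorm (mulS A u) 2 volume ≤ ENNReal.ofReal B * eLpNorm u 2 (volume.restrict (ext R)) := by
  rw [← eLpNorm_indicator_eq_eLpNorm_restrict (measurableSet_ext R)]
  refine eLpNorm_le_mul_eLpNorm_of_ae_le_mul (Eventually.of_forall fun y => ?_) 2
  rw [mulS_apply hA.temperate]
  by_cases hy : y ∈ ext R
  · rw [Set.indicator_of_mem hy, norm_mul]
    have := hA.bound 0 (Nat.zero_le _) y
    rw [norm_iteratedFDeriv_zero, pow_zero, one_mul] at this
    gcongr
  · rw [hA.eq_zero y (not_le.1 hy), zero_mul, norm_zero]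
    exact mul_nonneg hA.nonneg (norm_nonneg _)

/-- Near the origin, meaning `|x|² ≤ T/256` with `T = R² + s`, the pointwise kernel bound is
combined with Cauchy–Schwarz in `z`. Farther out the weight `⟨x⟩^{-8}` supplies the decay, and
unitarity together with the `L²` bound for the projection does the rest. The lower bound `ρ` on `R`
makes the constants uniform. -/
theorem exists_incoming_bound {ρ : ℝ} (hρ : 0 < ρ) {w : ℝ → ℂ} (hw : IsSmoothWeight w) :
    ∃ C : ℝ, 0 ≤ C ∧ ∀ (B R s : ℝ) (A : E3 → ℂ) (k : Fin 3), ρ ≤ R → 0 < s → IsSymbol 0 6 B R A →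
      ∀ h : 𝓢(E3, ℂ),
      eLpNorm (fun x => ((japaneseBracket x ^ (-8 : ℝ) : ℝ) : ℂ) *
          freeEvolutionSchwartz s (mulS A (dX k (halfProj 1 hw h))) x) 2 volume
        ≤ ENNReal.ofReal (C * B * (R ^ 2 + s) ^ (-(9 / 8) : ℝ)) *
          (eLpNorm h 2 (volume.restrict (ext (R / 4))) + eLpNorm (dX k h) 2 (volume.restrict (ext (R / 4)))) := by
  obtain ⟨C₁, hC₁, near⟩ := exists_norm_incoming_near_le hw
  obtain ⟨C₂, hC₂, hL2⟩ := exists_eLpNorm_halfProj_le (ε := 1) (by norm_num) (hw.exp_mul 1)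
  set J₁ := eLpNorm (fun x => japaneseBracket x ^ (-8 : ℝ)) 2 volume with hJ₁
  set J₂ := eLpNorm (fun z : E3 => ‖z‖ ^ (-(7 / 4) : ℝ)) 2 (volume.restrict (ext (ρ / 2))) with hJ₂
  have hJ₁f : J₁ < ⊤ := eLpNorm_japaneseBracket_lt_top (by norm_num)
  have hJ₂f : J₂ < ⊤ := eLpNorm_ext_rpow_lt_top (by positivity)
  set D : ℝ := 256 ^ 4 * (ρ ^ 2) ^ (-(23 / 8) : ℝ) with hD
  refine ⟨C₁ * J₂.toReal * J₁.toReal + D * C₂, by positivity, fun B R s A k hRρ hs hA h => ?_⟩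
  have hR : 0 < R := hρ.trans_le hRρ
  have hB := hA.nonneg
  set T := R ^ 2 + s with hT
  have hT0 : 0 < T := by positivity
  set τ := T ^ (-(9 / 8) : ℝ) with hτ
  have hτ0 : 0 ≤ τ := by positivity
  set I := ∫ z in ext (R / 2), ‖z‖ ^ (-(7 / 4) : ℝ) * ‖h z‖ with hI
  have hI0 : 0 ≤ I := integral_nonneg fun z => by positivity
  set v := freeEvolutionSchwartz s (mulS A (dX k (halfProj 1 hw h))) with hv
  set N₀ := eLpNorm h 2 (volume.restrict (ext (R / 4)))
  set N₁ := eLpNorm (dX k h) 2 (volume.restrict (ext (R / 4)))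
  have pw : ∀ x, ‖((japaneseBracket x ^ (-8 : ℝ) : ℝ) : ℂ) * v x‖
      ≤ ((C₁ * B * τ * I) • (fun x => japaneseBracket x ^ (-8 : ℝ)) + (D * τ) • fun x => ‖v x‖) x := by
    intro x
    have hj := japaneseBracket_pos x
    rw [norm_mul, Complex.norm_real, Real.norm_of_nonneg (by positivity)]
    simp only [Pi.add_apply, Pi.smul_apply, smul_eq_mul]
    by_cases hx : ‖x‖ ^ 2 ≤ T / 256
    · have := near B R s A k hR hs hA h x hx
      calc japaneseBracket x ^ (-8 : ℝ) * ‖v x‖ ≤ japaneseBracket x ^ (-8 : ℝ) * (C₁ * B * τ * I) := by gcongr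
        _ = C₁ * B * τ * I * japaneseBracket x ^ (-8 : ℝ) + 0 := by ring
        _ ≤ _ := by gcongr; positivity
    -- Here `⟨x⟩^{-8} ≤ (T/256)^{-4}`; of the four powers of `T`, `9/8` are kept and the other
    -- `23/8` are bounded by means of `T ≥ ρ²`.
    · have h1 : T / 256 ≤ japaneseBracket x ^ 2 :=
        (not_le.1 hx).le.trans (pow_le_pow_left₀ (norm_nonneg _) (norm_le_japaneseBracket x) 2)
      have h2 : japaneseBracket x ^ (-8 : ℝ) ≤ D * τ := by
        calc japaneseBracket x ^ (-8 : ℝ) = (japaneseBracket x ^ 2) ^ (-4 : ℝ) := by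
              rw [← Real.rpow_natCast, ← Real.rpow_mul hj.le]; norm_num
          _ ≤ (T / 256) ^ (-4 : ℝ) := Real.rpow_le_rpow_of_nonpos (by positivity) h1 (by norm_num)
          _ = 256 ^ 4 * (T ^ (-(23 / 8) : ℝ) * τ) := by
              have a1 : T ^ (-(23 / 8) : ℝ) * τ = (T ^ 4)⁻¹ := by
                rw [hτ, ← Real.rpow_add hT0, ← Real.rpow_natCast T 4, ← Real.rpow_neg hT0.le]
                norm_num
              have a2 : (T / 256) ^ (-4 : ℝ) = ((T / 256) ^ 4)⁻¹ := by
                rw [← Real.rpow_natCast (T / 256) 4, ← Real.rpow_neg (by positivity)]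
                norm_num
              rw [a1, a2, div_pow, inv_div, div_eq_mul_inv]
          _ ≤ 256 ^ 4 * ((ρ ^ 2) ^ (-(23 / 8) : ℝ) * τ) := by
              gcongr ?_ * (?_ * ?_)
              refine Real.rpow_le_rpow_of_nonpos (by positivity) ?_ (by norm_num)
              nlinarith
          _ = _ := by rw [hD]; ring
      calc japaneseBracket x ^ (-8 : ℝ) * ‖v x‖ ≤ 0 + D * τ * ‖v x‖ := by rw [zero_add]; gcongr
        _ ≤ _ := by gcongr; positivity
  have hI2 : ENNReal.ofReal I ≤ J₂ * N₀ := by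
    refine (ofReal_integral_mul_le ?_ ?_).trans ?_
    · exact (Measurable.pow_const measurable_norm _).aestronglyMeasurable
    · exact h.continuous.norm.aestronglyMeasurable
    · rw [eLpNorm_norm]
      refine mul_le_mul' (eLpNorm_mono_measure _ ?_) (eLpNorm_mono_measure _ ?_)
      · exact Measure.restrict_mono (ext_mono (by linarith)) le_rfl
      · exact Measure.restrict_mono (ext_mono (by linarith)) le_rfl
  have hv2 : eLpNorm v 2 volume ≤ ENNReal.ofReal (B * C₂) * N₁ := by
    rw [hv, eLpNorm_freeEvolutionSchwartz, dX_halfProj]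
    refine (hA.eLpNorm_mulS_le _).trans ?_
    rw [ENNReal.ofReal_mul hB, mul_assoc]
    gcongr
    exact hL2 R hR.le (dX k h)
  have hjm : AEStronglyMeasurable (fun x => japaneseBracket x ^ (-8 : ℝ)) volume :=
    (continuous_japaneseBracket.measurable.pow_const _).aestronglyMeasurable
  calc _ ≤ _ := eLpNorm_mono_real pw
    _ ≤ _ := eLpNorm_add_le (hjm.const_smul _) (v.continuous.norm.aestronglyMeasurable.const_smul _) (by norm_num)
    _ = ENNReal.ofReal (C₁ * B * τ) * ENNReal.ofReal I * J₁ + ENNReal.ofReal (D * τ) * eLpNorm v 2 volume := by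
        rw [eLpNorm_const_smul, eLpNorm_const_smul, eLpNorm_norm, Real.enorm_of_nonneg (by positivity),
          Real.enorm_of_nonneg (by positivity), ← ENNReal.ofReal_mul (p := C₁ * B * τ) (by positivity)]
    _ ≤ ENNReal.ofReal (C₁ * B * τ) * (J₂ * N₀) * J₁ + ENNReal.ofReal (D * τ) * (ENNReal.ofReal (B * C₂) * N₁) := by
        gcongr
    _ = ENNReal.ofReal (C₁ * J₂.toReal * J₁.toReal * B * τ) * N₀ + ENNReal.ofReal (D * C₂ * B * τ) * N₁ := by
        have a1 : ENNReal.ofReal (C₁ * J₂.toReal * J₁.toReal * B * τ)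
            = ENNReal.ofReal (C₁ * B * τ) * J₂ * J₁ := by
          rw [show C₁ * J₂.toReal * J₁.toReal * B * τ = C₁ * B * τ * J₂.toReal * J₁.toReal by ring,
            ENNReal.ofReal_mul (by positivity), ENNReal.ofReal_mul (by positivity),
            ENNReal.ofReal_toReal hJ₂f.ne, ENNReal.ofReal_toReal hJ₁f.ne]
        have a2 : ENNReal.ofReal (D * C₂ * B * τ) = ENNReal.ofReal (D * τ) * ENNReal.ofReal (B * C₂) := by
          rw [← ENNReal.ofReal_mul (by positivity)]; congr 1; ring
        rw [a1, a2]; ring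
    _ ≤ ENNReal.ofReal ((C₁ * J₂.toReal * J₁.toReal + D * C₂) * B * τ) * N₀
        + ENNReal.ofReal ((C₁ * J₂.toReal * J₁.toReal + D * C₂) * B * τ) * N₁ := by
        have b1 : 0 ≤ C₁ * J₂.toReal * J₁.toReal := by positivity
        have b2 : 0 ≤ D * C₂ := by positivity
        gcongr <;> linarith
    _ = _ := by rw [mul_add]

/-! ### Decay of the outgoing part of the evolution of localized data -/

theorem halfProj_congr {ε : ℝ} {w w' : ℝ → ℂ} (hw : IsSmoothWeight w) (hw' : IsSmoothWeight w')
    (h : ∀ t, w t = w' t) (u : 𝓢(E3, ℂ)) : halfProj ε hw u = halfProj ε hw' u := by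
  obtain rfl : w = w' := funext h
  rfl

theorem halfProj_mX {ε : ℝ} (hε : ε ^ 2 = 1) {w : ℝ → ℂ} (hw : IsSmoothWeight w) (k : Fin 3) (u : 𝓢(E3, ℂ)) :
    halfProj ε hw (mX k u) = mX k (halfProj ε (hw.exp_mul 1) u) := by
  rw [mX_halfProj hε]
  refine halfProj_congr _ _ (fun t => ?_) _
  rw [← mul_assoc, ← Complex.ofReal_mul, ← Real.exp_add]
  simp

theorem freeEvolutionSchwartz_dX_eq {s : ℝ} (hs : 0 < s) (k : Fin 3) (u : 𝓢(E3, ℂ)) :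
    freeEvolutionSchwartz s (dX k u) = (Complex.I * s)⁻¹ •
      (mX k (freeEvolutionSchwartz s u) - freeEvolutionSchwartz s (mX k u)) := by
  have h0 : (Complex.I * s : ℂ) ≠ 0 := mul_ne_zero Complex.I_ne_zero (by exact_mod_cast hs.ne')
  rw [freeEvolutionSchwartz_mX, sub_sub_cancel, smul_smul, inv_mul_cancel₀ h0, one_smul,
    freeEvolutionSchwartz_dX]

/-- The size of the outgoing part at `y` of the evolution of data localized to `|z| ≲ (R² + s)^{1/2}`. -/
def outgoingKernel (s : ℝ) (y : E3) : ℝ := s ^ (-(3 / 2) : ℝ) * (1 + ‖y‖ ^ 2 / s)⁻¹ ^ 6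

/-- The gain from one derivative. -/
def derivGain (R s : ℝ) (y : E3) : ℝ := (Real.sqrt (R ^ 2 + s) + ‖y‖) / s

theorem derivGain_pos {R s : ℝ} (hR : 0 < R) (hs : 0 < s) (y : E3) : 0 < derivGain R s y := by
  unfold derivGain; positivity

theorem outgoingKernel_pos {s : ℝ} (hs : 0 < s) (y : E3) : 0 < outgoingKernel s y := by
  unfold outgoingKernel; positivity

/-- The operator `L` behaves like a differential operator of order `n` on the outgoing part of the
evolution of localized data. -/
def IsDecayOp (n : ℤ) (L : 𝓢(E3, ℂ) →L[ℂ] 𝓢(E3, ℂ)) : Prop :=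
  ∀ (w : ℝ → ℂ) (hw : IsSmoothWeight w), ∃ C : ℝ, 0 ≤ C ∧ ∀ (R s : ℝ) (g : 𝓢(E3, ℂ)) (y : E3),
    0 < R → 0 < s → (∀ z, g z ≠ 0 → ‖z‖ ^ 2 ≤ (R ^ 2 + s) / 36) → R ≤ ‖y‖ →
    ‖halfProj (-1) hw (freeEvolutionSchwartz s (L g)) y‖
      ≤ C * (derivGain R s y ^ n * outgoingKernel s y * ∫ z, ‖g z‖)

theorem IsDecayOp.zero (n : ℤ) : IsDecayOp n 0 := fun w hw =>
  ⟨0, le_rfl, fun R s g y _ _ _ _ => by simp⟩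

theorem IsDecayOp.add {n : ℤ} {L L' : 𝓢(E3, ℂ) →L[ℂ] 𝓢(E3, ℂ)} (hL : IsDecayOp n L) (hL' : IsDecayOp n L') :
    IsDecayOp n (L + L') := fun w hw => by
  obtain ⟨C, hC, h⟩ := hL w hw
  obtain ⟨C', hC', h'⟩ := hL' w hw
  refine ⟨C + C', by positivity, fun R s g y hR hs hg hy => ?_⟩
  rw [add_apply, map_add, map_add, add_apply, add_mul]
  exact (norm_add_le _ _).trans (add_le_add (h R s g y hR hs hg hy) (h' R s g y hR hs hg hy))

theorem IsDecayOp.const_smul {n : ℤ} {L : 𝓢(E3, ℂ) →L[ℂ] 𝓢(E3, ℂ)} (hL : IsDecayOp n L) (c : ℂ) :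
    IsDecayOp n (c • L) := fun w hw => by
  obtain ⟨C, hC, h⟩ := hL w hw
  refine ⟨‖c‖ * C, by positivity, fun R s g y hR hs hg hy => ?_⟩
  rw [smul_apply, map_smul, map_smul, smul_apply, norm_smul, mul_assoc]
  exact mul_le_mul_of_nonneg_left (h R s g y hR hs hg hy) (norm_nonneg c)

theorem IsDecayOp.sum {ι : Type*} {n : ℤ} {L : ι → 𝓢(E3, ℂ) →L[ℂ] 𝓢(E3, ℂ)} (I : Finset ι)
    (hL : ∀ i, IsDecayOp n (L i)) : IsDecayOp n (∑ i ∈ I, L i) := by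
  classical
  induction I using Finset.induction_on with
  | empty => exact IsDecayOp.zero n
  | insert i I hi ih => rw [Finset.sum_insert hi]; exact (hL i).add ih

/-- If `|z| > |y|/4`, then `|y|² ≤ (16/36)(R² + s)` with `R² ≤ |y|²`, which forces `|y|² ≤ s` and
then `|z|² ≤ s`. The fraction `1/36` is matched by the outer radius `1/6` of the cutoff `unitBump`.
-/
theorem isRayRegular_of_localized {R s : ℝ} (hR : 0 < R) {y z : E3} (hz : ‖z‖ ^ 2 ≤ (R ^ 2 + s) / 36)
    (hs : 0 < s) (hy : R ≤ ‖y‖) : IsRayRegular s z y := by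
  by_cases h : ‖z‖ ≤ ‖y‖ / 4
  · exact Or.inl h
  · have h' := not_le.1 h
    have h1 := norm_nonneg y
    have h2 : ‖y‖ ^ 2 ≤ 16 * ‖z‖ ^ 2 := by nlinarith
    have h3 : R ^ 2 ≤ ‖y‖ ^ 2 := by nlinarith
    exact Or.inr ⟨by nlinarith, by nlinarith⟩

theorem isDecayOp_id : IsDecayOp 0 (ContinuousLinearMap.id ℂ 𝓢(E3, ℂ)) := fun w hw => by
  obtain ⟨C, hC, key⟩ := exists_halfProj_kernel_bound
  obtain ⟨K, hK, hwK⟩ := hw.exists_bound 8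
  refine ⟨C * K, by positivity, fun R s g y hR hs hg hy => ?_⟩
  have h1 := key s hs w hw (freeEvolutionSchwartz s g) g (propagatorConst s) (fun _ => 1) continuous_const
    (fun x => by simp_rw [one_mul]; exact freeEvolutionSchwartz_apply hs g x) y K
    (fun z hz => ⟨⟨by simpa using hw.smooth, fun t ht => by rw [hw.eq_zero t ht, zero_mul],
      fun k hk t => by simpa using hwK k hk t⟩, isRayRegular_of_localized hR (hg z hz) hs hy⟩)
    (fun z t => by
      rw [mul_one, norm_mul]
      gcongr
      simpa using hwK 0 (by norm_num) t) hK
  have h2 := norm_propagatorConst_le hs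
  have h3 : 0 ≤ ∫ z, ‖g z‖ := integral_nonneg fun _ => norm_nonneg _
  rw [ContinuousLinearMap.id_apply, zpow_zero, one_mul, outgoingKernel]
  calc _ ≤ _ := h1
    _ ≤ C * K * s ^ (-(3 / 2) : ℝ) * (1 + ‖y‖ ^ 2 / s)⁻¹ ^ 6 * ∫ z, ‖g z‖ := by gcongr
    _ = _ := by ring

/-- A derivative of the propagated wave equals `(is)⁻¹` times the commutator with `x_k`. The outer
coordinate contributes `|y|/s`; the inner one contributes `√(R² + s)/s` when it lands on the
localised `g`. Commuting it past `L` leaves `Cm`, of order one less but with a free factor `s⁻¹`. -/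
theorem IsDecayOp.dX_comp {n : ℤ} {L Cm : 𝓢(E3, ℂ) →L[ℂ] 𝓢(E3, ℂ)} (hL : IsDecayOp n L)
    (hCm : IsDecayOp (n - 1) Cm) (k : Fin 3) (hcomm : ∀ g, mX k (L g) = L (mX k g) + Cm g) :
    IsDecayOp (n + 1) (dX k ∘L L) := fun w hw => by
  obtain ⟨C₁, hC₁, h1⟩ := hL _ (hw.exp_mul 1)
  obtain ⟨C₂, hC₂, h2⟩ := hL _ hw
  obtain ⟨C₃, hC₃, h3⟩ := hCm _ hw
  refine ⟨C₁ + C₂ + C₃, by positivity, fun R s g y hR hs hg hy => ?_⟩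
  have hT : 0 < R ^ 2 + s := by positivity
  set Φ := derivGain R s y with hΦ
  have hΦ0 : 0 < Φ := derivGain_pos hR hs y
  set K := outgoingKernel s y with hK
  have hK0 : 0 < K := outgoingKernel_pos hs y
  set G := ∫ z, ‖g z‖ with hG
  have hG0 : 0 ≤ G := integral_nonneg fun _ => norm_nonneg _
  have hmg : ∀ z, mX k g z ≠ 0 → ‖z‖ ^ 2 ≤ (R ^ 2 + s) / 36 := fun z hz => hg z fun h0 => hz (by
    rw [mX_apply, h0, mul_zero])
  have hG2 : ∫ z, ‖mX k g z‖ ≤ Real.sqrt (R ^ 2 + s) * G := by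
    rw [hG, ← integral_const_mul]
    refine integral_mono (mX k g).integrable.norm (g.integrable.norm.const_mul _) fun z => ?_
    simp only
    rw [mX_apply, norm_mul]
    by_cases hz : g z = 0
    · simp [hz]
    · gcongr
      refine (norm_coord_le z k).trans (Real.le_sqrt_of_sq_le ?_)
      have := hg z hz
      linarith
  have b1 := h1 R s g y hR hs hg hy
  have b2 := h2 R s (mX k g) y hR hs hmg hy
  have b3 := h3 R s g y hR hs hg hy
  have hsplit : s⁻¹ * Real.sqrt (R ^ 2 + s) + s⁻¹ * ‖y‖ = Φ := by
    rw [hΦ, derivGain]; ring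
  have hy0 := norm_nonneg y
  have hsq := Real.sqrt_nonneg (R ^ 2 + s)
  have hs0 : 0 < s⁻¹ := inv_pos.2 hs
  have c1 : s⁻¹ * ‖y‖ ≤ Φ := by
    have : 0 ≤ s⁻¹ * Real.sqrt (R ^ 2 + s) := by positivity
    linarith
  have c2 : s⁻¹ * Real.sqrt (R ^ 2 + s) ≤ Φ := by
    have : 0 ≤ s⁻¹ * ‖y‖ := by positivity
    linarith
  -- A bare `s⁻¹` is worth two derivatives: `s⁻¹ ≤ s⁻²(R² + s) ≤ Φ²`. This is why a commutator of
  -- order `n - 1` is admissible.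
  have c3 : s⁻¹ ≤ Φ * Φ := by
    calc s⁻¹ = s⁻¹ * (s⁻¹ * s) := by rw [inv_mul_cancel₀ hs.ne', mul_one]
      _ ≤ s⁻¹ * (s⁻¹ * (R ^ 2 + s)) := by gcongr; nlinarith
      _ = (s⁻¹ * Real.sqrt (R ^ 2 + s)) * (s⁻¹ * Real.sqrt (R ^ 2 + s)) := by
          nth_rewrite 1 [← Real.mul_self_sqrt hT.le]; ring
      _ ≤ Φ * Φ := by gcongr
  have e1 : Φ ^ (n + 1) = Φ ^ n * Φ := zpow_add_one₀ hΦ0.ne' n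
  have e3 : Φ ^ (n + 1) = Φ ^ (n - 1) * (Φ * Φ) := by
    rw [zpow_sub_one₀ hΦ0.ne', e1]; field_simp
  have hn : 0 < Φ ^ n := zpow_pos hΦ0 n
  have hn1 : 0 < Φ ^ (n - 1) := zpow_pos hΦ0 _
  rw [ContinuousLinearMap.comp_apply, freeEvolutionSchwartz_dX_eq hs, hcomm, map_smul, map_sub, map_add, map_add,
    halfProj_mX (by norm_num), smul_apply, sub_apply, add_apply, mX_apply, smul_eq_mul, norm_mul, norm_inv,
    norm_mul, Complex.norm_I, one_mul, Complex.norm_real, Real.norm_of_nonneg hs.le]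
  calc _ ≤ s⁻¹ * (‖y‖ * ‖halfProj (-1) (hw.exp_mul 1) (freeEvolutionSchwartz s (L g)) y‖
        + (‖halfProj (-1) hw (freeEvolutionSchwartz s (L (mX k g))) y‖
          + ‖halfProj (-1) hw (freeEvolutionSchwartz s (Cm g)) y‖)) := by
        gcongr
        refine (norm_sub_le _ _).trans (add_le_add ?_ (norm_add_le _ _))
        rw [norm_mul]
        gcongr
        exact norm_coord_le y k
    _ ≤ s⁻¹ * (‖y‖ * (C₁ * (Φ ^ n * K * G)) + (C₂ * (Φ ^ n * K * (Real.sqrt (R ^ 2 + s) * G))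
          + C₃ * (Φ ^ (n - 1) * K * G))) := by
        gcongr
        refine b2.trans ?_
        gcongr
    _ = (s⁻¹ * ‖y‖) * (C₁ * (Φ ^ n * K * G)) + (s⁻¹ * Real.sqrt (R ^ 2 + s)) * (C₂ * (Φ ^ n * K * G))
          + s⁻¹ * (C₃ * (Φ ^ (n - 1) * K * G)) := by ring
    _ ≤ Φ * (C₁ * (Φ ^ n * K * G)) + Φ * (C₂ * (Φ ^ n * K * G))
          + (Φ * Φ) * (C₃ * (Φ ^ (n - 1) * K * G)) := by gcongr
    _ = C₁ * (Φ ^ (n + 1) * K * G) + C₂ * (Φ ^ (n + 1) * K * G) + C₃ * (Φ ^ (n + 1) * K * G) := by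
        nth_rewrite 3 [e3]
        rw [e1]; ring
    _ = _ := by ring

/-- The Laplacian on the Schwartz space. -/
def lapS : 𝓢(E3, ℂ) →L[ℂ] 𝓢(E3, ℂ) := ∑ k, dX k ∘L dX k

theorem lapS_apply (u : 𝓢(E3, ℂ)) : lapS u = ∑ k, dX k (dX k u) := by
  simp [lapS]

theorem dX_lapS (k : Fin 3) (u : 𝓢(E3, ℂ)) : dX k (lapS u) = lapS (dX k u) := by
  rw [lapS_apply, lapS_apply, map_sum]
  exact Finset.sum_congr rfl fun j _ => by rw [dX_comm k j, dX_comm k j]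

theorem mX_dX (j k : Fin 3) (u : 𝓢(E3, ℂ)) :
    mX k (dX j u) = dX j (mX k u) - if j = k then u else 0 := by
  rw [dX_mX, add_sub_cancel_right]

theorem mX_lapS (k : Fin 3) (u : 𝓢(E3, ℂ)) : mX k (lapS u) = lapS (mX k u) + (-2 : ℂ) • dX k u := by
  rw [lapS_apply, lapS_apply, map_sum]
  have h : ∀ j, mX k (dX j (dX j u)) = dX j (dX j (mX k u)) + if j = k then (-2 : ℂ) • dX k u else 0 := by
    intro j
    rw [mX_dX, mX_dX, map_sub]
    by_cases hjk : j = k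
    · subst hjk
      simp only [if_true, neg_smul, two_smul]
      abel
    · simp [hjk]
  simp_rw [h]
  rw [Finset.sum_add_distrib]
  simp

theorem isDecayOp_dX (k : Fin 3) : IsDecayOp 1 (dX k) := by
  have := isDecayOp_id.dX_comp (IsDecayOp.zero _) k (fun g => by simp)
  simpa using this

theorem isDecayOp_dX_dX (j k : Fin 3) : IsDecayOp 2 (dX j ∘L dX k) := by
  have h2 : (1 : ℤ) + 1 = 2 := by norm_num
  by_cases hkj : k = j
  · have h0 : IsDecayOp (1 - 1) ((-1 : ℂ) • ContinuousLinearMap.id ℂ 𝓢(E3, ℂ)) := by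
      rw [sub_self]; exact isDecayOp_id.const_smul (-1)
    rw [← h2]
    refine (isDecayOp_dX k).dX_comp h0 j (fun g => ?_)
    rw [mX_dX, if_pos hkj, sub_eq_add_neg, smul_apply, neg_smul, one_smul]
    rfl
  · rw [← h2]
    refine (isDecayOp_dX k).dX_comp (IsDecayOp.zero _) j (fun g => ?_)
    rw [mX_dX, if_neg hkj, sub_zero, zero_apply, add_zero]

theorem isDecayOp_lapS : IsDecayOp 2 lapS := IsDecayOp.sum _ fun k => isDecayOp_dX_dX k k

theorem isDecayOp_dX_lapS (k : Fin 3) : IsDecayOp 3 (dX k ∘L lapS) := by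
  have h0 : IsDecayOp (2 - 1) ((-2 : ℂ) • dX k) := by simpa using (isDecayOp_dX k).const_smul (-2)
  have := isDecayOp_lapS.dX_comp h0 k (fun g => by rw [mX_lapS]; rfl)
  simpa using this

theorem isDecayOp_lapS_lapS : IsDecayOp 4 (lapS ∘L lapS) := by
  have h4 : ∀ k, IsDecayOp 4 (dX k ∘L (dX k ∘L lapS)) := by
    intro k
    have h0 : IsDecayOp (3 - 1) ((-2 : ℂ) • (dX k ∘L dX k) + (-1 : ℂ) • lapS) := by
      simpa using ((isDecayOp_dX_dX k k).const_smul (-2)).add (isDecayOp_lapS.const_smul (-1))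
    have := (isDecayOp_dX_lapS k).dX_comp h0 k (fun g => by
      simp only [ContinuousLinearMap.comp_apply, add_apply, smul_apply]
      rw [mX_dX, mX_lapS, map_add, map_smul]
      simp only [if_true, neg_smul, one_smul]
      abel)
    simpa using this
  have e : lapS ∘L lapS = ∑ k, dX k ∘L (dX k ∘L lapS) := by
    ext1 u
    rw [ContinuousLinearMap.comp_apply, lapS_apply (lapS u)]
    simp
  rw [e]
  exact IsDecayOp.sum _ h4

theorem lapS_halfProj (ε : ℝ) {w : ℝ → ℂ} (hw : IsSmoothWeight w) (h : 𝓢(E3, ℂ)) :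
    lapS (halfProj ε hw h) = halfProj ε ((hw.exp_mul 1).exp_mul 1) (lapS h) := by
  simp only [lapS_apply, dX_halfProj, map_sum]

/-- With `p = s + |y|²`, the left side is at most `16 s^{1/2} p^{-3} ≤ 16 p^{-5/2}`. The six powers
of `s/p` outweigh `s^{-4}` from four derivatives and `s^{-3/2}` from the kernel, so that no negative
power of `s` remains. Then `p^{-5/2}` splits into the rate `p^{-9/8}` and `p^{-11/8} ≤
R⁻¹|y|^{-7/4}`. -/
theorem outgoing_weight_le {R s : ℝ} (hR : 0 < R) (hs : 0 < s) {y : E3} (hy : R ≤ ‖y‖) :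
    ‖y‖ ^ 2 * (derivGain R s y ^ (4 : ℤ) * outgoingKernel s y)
      ≤ 256 * R⁻¹ * (R ^ 2 + s) ^ (-(9 / 8) : ℝ) * ‖y‖ ^ (-(7 / 4) : ℝ) := by
  have hy0 : 0 < ‖y‖ := hR.trans_le hy
  set p : ℝ := s + ‖y‖ ^ 2 with hp
  set T : ℝ := R ^ 2 + s with hT
  have hp0 : 0 < p := by positivity
  have hT0 : 0 < T := by positivity
  have hTp : T ≤ p := by rw [hp, hT]; nlinarith
  have hyp : ‖y‖ ^ 2 ≤ p := by rw [hp]; linarith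
  have hsp : s ≤ p := by rw [hp]; nlinarith
  have hfac : (1 + ‖y‖ ^ 2 / s)⁻¹ = s / p := by rw [hp]; field_simp
  have h1 : (Real.sqrt T + ‖y‖) ^ 4 ≤ 16 * p ^ 2 := by
    have a1 : Real.sqrt T ≤ Real.sqrt p := Real.sqrt_le_sqrt hTp
    have a2 : ‖y‖ ≤ Real.sqrt p := Real.le_sqrt_of_sq_le hyp
    calc (Real.sqrt T + ‖y‖) ^ 4 ≤ (Real.sqrt p + Real.sqrt p) ^ 4 := by gcongr
      _ = 16 * (Real.sqrt p ^ 2) ^ 2 := by ring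
      _ = _ := by rw [Real.sq_sqrt hp0.le]
  have h2 : p ^ (-(11 / 8) : ℝ) ≤ R⁻¹ * ‖y‖ ^ (-(7 / 4) : ℝ) := by
    have e1 : ‖y‖ ^ (-(11 / 4) : ℝ) = (‖y‖ ^ 2) ^ (-(11 / 8) : ℝ) := by
      rw [← Real.rpow_natCast, ← Real.rpow_mul hy0.le]; norm_num
    calc p ^ (-(11 / 8) : ℝ) ≤ (‖y‖ ^ 2) ^ (-(11 / 8) : ℝ) :=
          Real.rpow_le_rpow_of_nonpos (by positivity) hyp (by norm_num)
      _ = ‖y‖⁻¹ * ‖y‖ ^ (-(7 / 4) : ℝ) := by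
          rw [← e1, ← Real.rpow_neg_one, ← Real.rpow_add hy0]; norm_num
      _ ≤ _ := by gcongr
  have e2 : s ^ (-(3 / 2) : ℝ) * (s ^ 2 * (p ^ 3)⁻¹) = s ^ (1 / 2 : ℝ) * p ^ (-3 : ℝ) := by
    have a1 : s ^ 2 = s ^ (2 : ℝ) := by norm_cast
    have a2 : (p ^ 3)⁻¹ = p ^ (-3 : ℝ) := by rw [Real.rpow_neg hp0.le]; norm_cast
    rw [a1, a2, ← mul_assoc, ← Real.rpow_add hs]
    norm_num
  have e3 : derivGain R s y ^ (4 : ℤ) = (Real.sqrt T + ‖y‖) ^ 4 / s ^ 4 := by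
    rw [derivGain, ← div_pow]; norm_cast
  calc ‖y‖ ^ 2 * (derivGain R s y ^ (4 : ℤ) * outgoingKernel s y)
      ≤ p * ((16 * p ^ 2) / s ^ 4 * (s ^ (-(3 / 2) : ℝ) * (s / p) ^ 6)) := by
        rw [e3, outgoingKernel, hfac]
        gcongr
    _ = 16 * (s ^ (-(3 / 2) : ℝ) * (s ^ 2 * (p ^ 3)⁻¹)) := by
        field_simp
    _ = 16 * (s ^ (1 / 2 : ℝ) * p ^ (-3 : ℝ)) := by rw [e2]
    _ ≤ 16 * (p ^ (1 / 2 : ℝ) * p ^ (-3 : ℝ)) := by gcongr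
    _ = 16 * (p ^ (-(9 / 8) : ℝ) * p ^ (-(11 / 8) : ℝ)) := by
        rw [← Real.rpow_add hp0, ← Real.rpow_add hp0]; norm_num
    _ ≤ 16 * (T ^ (-(9 / 8) : ℝ) * (R⁻¹ * ‖y‖ ^ (-(7 / 4) : ℝ))) := by
        gcongr 16 * (?_ * ?_)
        exact Real.rpow_le_rpow_of_nonpos hT0 hTp (by norm_num)
    _ = 16 * (R⁻¹ * T ^ (-(9 / 8) : ℝ) * ‖y‖ ^ (-(7 / 4) : ℝ)) := by ring
    _ ≤ 256 * (R⁻¹ * T ^ (-(9 / 8) : ℝ) * ‖y‖ ^ (-(7 / 4) : ℝ)) := by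
        gcongr; norm_num
    _ = _ := by ring

/-! ### Sums over all derivatives up to a given order -/

theorem ContDiff.partialDeriv {u : E3 → ℂ} (hu : ContDiff ℝ ∞ u) (k : Fin 3) :
    ContDiff ℝ ∞ (partialDeriv k u) :=
  (hu.fderiv_right (m := ∞) (by norm_num)).clm_apply contDiff_const

/-- The sum of the absolute values of all iterated partial derivatives of order at most `n`. -/
def wordSum : ℕ → (E3 → ℂ) → E3 → ℝ
  | 0, u, x => ‖u x‖
  | n + 1, u, x => ‖u x‖ + ∑ k, wordSum n (partialDeriv k u) x

theorem wordSum_nonneg (n : ℕ) : ∀ (u : E3 → ℂ) (x : E3), 0 ≤ wordSum n u x := by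
  induction n with
  | zero => exact fun u x => norm_nonneg _
  | succ n ih => exact fun u x => add_nonneg (norm_nonneg _) (Finset.sum_nonneg fun k _ => ih _ x)

theorem norm_le_wordSum (n : ℕ) (u : E3 → ℂ) (x : E3) : ‖u x‖ ≤ wordSum n u x := by
  cases n with
  | zero => exact le_rfl
  | succ n => exact le_add_of_nonneg_right (Finset.sum_nonneg fun k _ => wordSum_nonneg n _ x)

theorem wordSum_le_succ (n : ℕ) : ∀ (u : E3 → ℂ) (x : E3), wordSum n u x ≤ wordSum (n + 1) u x := by
  induction n with
  | zero => exact fun u x => norm_le_wordSum 1 u x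
  | succ n ih =>
    intro u x
    exact add_le_add le_rfl (Finset.sum_le_sum fun k _ => ih _ x)

theorem wordSum_mono {m n : ℕ} (h : m ≤ n) (u : E3 → ℂ) (x : E3) : wordSum m u x ≤ wordSum n u x := by
  induction n, h using Nat.le_induction with
  | base => exact le_rfl
  | succ n _ ih => exact ih.trans (wordSum_le_succ n u x)

theorem wordSum_partialDeriv_le (n : ℕ) (k : Fin 3) (u : E3 → ℂ) (x : E3) :
    wordSum n (partialDeriv k u) x ≤ wordSum (n + 1) u x := by
  have h : wordSum n (partialDeriv k u) x ≤ ∑ k, wordSum n (partialDeriv k u) x :=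
    Finset.single_le_sum (f := fun k => wordSum n (partialDeriv k u) x) (fun k _ => wordSum_nonneg n _ x)
      (Finset.mem_univ k)
  exact h.trans (le_add_of_nonneg_left (norm_nonneg _))

theorem continuous_wordSum (n : ℕ) : ∀ {u : E3 → ℂ}, ContDiff ℝ ∞ u → Continuous (wordSum n u) := by
  induction n with
  | zero => exact fun hu => hu.continuous.norm
  | succ n ih =>
    exact fun hu => hu.continuous.norm.add (continuous_finsetSum _ fun k _ => ih (hu.partialDeriv k))

theorem partialDeriv_add {u v : E3 → ℂ} (hu : ContDiff ℝ ∞ u) (hv : ContDiff ℝ ∞ v) (k : Fin 3) :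
    partialDeriv k (fun y => u y + v y) = fun y => partialDeriv k u y + partialDeriv k v y := by
  ext1 x
  have h1 := (hu.differentiable (by simp)) x
  have h2 := (hv.differentiable (by simp)) x
  unfold _root_.partialDeriv
  rw [fderiv_fun_add h1 h2]
  rfl

theorem wordSum_add_le (n : ℕ) : ∀ {u v : E3 → ℂ}, ContDiff ℝ ∞ u → ContDiff ℝ ∞ v → ∀ x,
    wordSum n (fun y => u y + v y) x ≤ wordSum n u x + wordSum n v x := by
  induction n with
  | zero => exact fun _ _ x => norm_add_le _ _
  | succ n ih =>
    intro u v hu hv x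
    calc wordSum (n + 1) (fun y => u y + v y) x
        = ‖u x + v x‖ + ∑ k, wordSum n (fun y => partialDeriv k u y + partialDeriv k v y) x := by
          simp only [wordSum, partialDeriv_add hu hv]
      _ ≤ (‖u x‖ + ‖v x‖) + ∑ k, (wordSum n (partialDeriv k u) x + wordSum n (partialDeriv k v) x) :=
          add_le_add (norm_add_le _ _) (Finset.sum_le_sum fun k _ => ih (hu.partialDeriv k) (hv.partialDeriv k) x)
      _ = _ := by
          rw [Finset.sum_add_distrib]; simp only [wordSum]; ring

theorem wordSum_const_mul (n : ℕ) (c : ℂ) : ∀ {u : E3 → ℂ}, ContDiff ℝ ∞ u → ∀ x,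
    wordSum n (fun y => c * u y) x = ‖c‖ * wordSum n u x := by
  induction n with
  | zero => exact fun _ x => norm_mul _ _
  | succ n ih =>
    intro u hu x
    have h : ∀ k, partialDeriv k (fun y => c * u y) = fun y => c * partialDeriv k u y := fun k => by
      ext1 x
      unfold _root_.partialDeriv
      rw [fderiv_const_mul ((hu.differentiable (by simp)) x)]
      rfl
    simp only [wordSum, h, norm_mul]
    rw [mul_add, Finset.mul_sum]
    congr 1
    exact Finset.sum_congr rfl fun k _ => ih (hu.partialDeriv k) x

theorem partialDeriv_congr_nhds {u v : E3 → ℂ} {x : E3} (h : u =ᶠ[𝓝 x] v) (k : Fin 3) :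
    partialDeriv k u =ᶠ[𝓝 x] partialDeriv k v := by
  filter_upwards [h.fderiv (𝕜 := ℝ)] with y hy
  unfold _root_.partialDeriv
  rw [hy]

theorem wordSum_congr_nhds (n : ℕ) : ∀ {u v : E3 → ℂ} {x : E3}, u =ᶠ[𝓝 x] v → wordSum n u x = wordSum n v x := by
  induction n with
  | zero => exact fun h => by simp only [wordSum, h.eq_of_nhds]
  | succ n ih =>
    intro u v x h
    simp only [wordSum, h.eq_of_nhds]
    congr 1
    exact Finset.sum_congr rfl fun k _ => ih (partialDeriv_congr_nhds h k)

theorem partialDeriv_const (k : Fin 3) (c : ℂ) : partialDeriv k (fun _ => c) = fun _ => 0 := by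
  ext1 x
  simp [_root_.partialDeriv]

theorem wordSum_zero_fun (n : ℕ) (x : E3) : wordSum n (fun _ => 0) x = 0 := by
  induction n with
  | zero => simp [wordSum]
  | succ n ih => simp [wordSum, partialDeriv_const, ih]

theorem wordSum_const (n : ℕ) (c : ℂ) (x : E3) : wordSum n (fun _ => c) x = ‖c‖ := by
  cases n with
  | zero => rfl
  | succ n => simp [wordSum, partialDeriv_const, wordSum_zero_fun]

theorem partialDeriv_fun_mul {a u : E3 → ℂ} (ha : ContDiff ℝ ∞ a) (hu : ContDiff ℝ ∞ u) (k : Fin 3) :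
    partialDeriv k (fun y => a y * u y) = fun y => a y * partialDeriv k u y + partialDeriv k a y * u y := by
  ext1 x
  exact partialDeriv_mul k ((ha.differentiable (by simp)) x) ((hu.differentiable (by simp)) x)

theorem exists_wordSum_mul_le (n : ℕ) : ∃ C : ℝ, 0 ≤ C ∧ ∀ {a u : E3 → ℂ}, ContDiff ℝ ∞ a → ContDiff ℝ ∞ u → ∀ x,
    wordSum n (fun y => a y * u y) x ≤ C * wordSum n a x * wordSum n u x := by
  induction n with
  | zero => exact ⟨1, zero_le_one, fun _ _ x => by rw [one_mul]; exact norm_mul_le _ _⟩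
  | succ n ih =>
    obtain ⟨C, hC, h⟩ := ih
    refine ⟨1 + ∑ _k : Fin 3, (C + C), by positivity, fun {a u} ha hu x => ?_⟩
    have ha0 := wordSum_nonneg (n + 1) a x
    have hu0 := wordSum_nonneg (n + 1) u x
    have hb : ∀ k, wordSum n (partialDeriv k (fun y => a y * u y)) x
        ≤ (C + C) * (wordSum (n + 1) a x * wordSum (n + 1) u x) := by
      intro k
      rw [partialDeriv_fun_mul ha hu]
      calc _ ≤ C * wordSum n a x * wordSum n (partialDeriv k u) x
            + C * wordSum n (partialDeriv k a) x * wordSum n u x :=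
            (wordSum_add_le n (ha.mul (hu.partialDeriv k)) ((ha.partialDeriv k).mul hu) x).trans
              (add_le_add (h ha (hu.partialDeriv k) x) (h (ha.partialDeriv k) hu x))
        _ ≤ C * wordSum (n + 1) a x * wordSum (n + 1) u x + C * wordSum (n + 1) a x * wordSum (n + 1) u x := by
            have := wordSum_nonneg n a x
            have := wordSum_nonneg n u x
            have := wordSum_nonneg n (partialDeriv k a) x
            have := wordSum_nonneg n (partialDeriv k u) x
            gcongr
            · exact wordSum_le_succ n a x
            · exact wordSum_partialDeriv_le n k u x
            · exact wordSum_partialDeriv_le n k a x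
            · exact wordSum_le_succ n u x
        _ = _ := by ring
    calc wordSum (n + 1) (fun y => a y * u y) x
        ≤ wordSum (n + 1) a x * wordSum (n + 1) u x
          + ∑ _k : Fin 3, (C + C) * (wordSum (n + 1) a x * wordSum (n + 1) u x) := by
          refine add_le_add ?_ (Finset.sum_le_sum fun k _ => hb k)
          rw [norm_mul]
          exact mul_le_mul (norm_le_wordSum _ _ _) (norm_le_wordSum _ _ _) (norm_nonneg _) ha0
      _ = _ := by rw [← Finset.sum_mul]; ring

theorem exists_wordSum_le_iteratedFDeriv (n : ℕ) : ∃ C : ℝ, 0 ≤ C ∧ ∀ {a : E3 → ℂ}, ContDiff ℝ ∞ a → ∀ x,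
    wordSum n a x ≤ C * ∑ i ∈ Finset.range (n + 1), ‖iteratedFDeriv ℝ i a x‖ := by
  induction n with
  | zero => exact ⟨1, zero_le_one, fun ha x => by simp [wordSum]⟩
  | succ n ih =>
    obtain ⟨C, hC, h⟩ := ih
    refine ⟨1 + ∑ _k : Fin 3, C, by positivity, fun {a} ha x => ?_⟩
    set S := ∑ i ∈ Finset.range (n + 1 + 1), ‖iteratedFDeriv ℝ i a x‖ with hS
    have h0 : ‖a x‖ ≤ S := by
      rw [← norm_iteratedFDeriv_zero (𝕜 := ℝ)]
      exact Finset.single_le_sum (f := fun i => ‖iteratedFDeriv ℝ i a x‖) (fun _ _ => norm_nonneg _)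
        (Finset.mem_range.2 (by omega))
    have h1 : ∀ k, wordSum n (partialDeriv k a) x ≤ C * S := by
      intro k
      refine (h (ha.partialDeriv k) x).trans ?_
      gcongr
      rw [hS, Finset.sum_range_succ' (fun i => ‖iteratedFDeriv ℝ i a x‖) (n + 1)]
      refine le_trans (Finset.sum_le_sum fun i _ => norm_iteratedFDeriv_partialDeriv_le ha k i x) ?_
      exact le_add_of_nonneg_right (norm_nonneg _)
    calc wordSum (n + 1) a x ≤ S + ∑ _k : Fin 3, C * S := add_le_add h0 (Finset.sum_le_sum fun k _ => h1 k)
      _ = _ := by rw [← Finset.sum_mul]; ring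

theorem wordSum_dX_le (n : ℕ) (k : Fin 3) (u : 𝓢(E3, ℂ)) (x : E3) : wordSum n (dX k u) x ≤ wordSum (n + 1) u x := by
  rw [dX_coe]
  exact wordSum_partialDeriv_le n k u x

theorem wordSum_lapS_le (n : ℕ) (u : 𝓢(E3, ℂ)) (x : E3) : wordSum n (lapS u) x ≤ 3 * wordSum (n + 2) u x := by
  have h1 : ∀ k, wordSum n (dX k (dX k u)) x ≤ wordSum (n + 2) u x := fun k =>
    (wordSum_dX_le n k _ x).trans (wordSum_dX_le (n + 1) k u x)
  have hs := fun v : 𝓢(E3, ℂ) => v.smooth (⊤ : ℕ∞)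
  have e : ⇑(lapS u) = fun y => (dX 0 (dX 0 u) y + dX 1 (dX 1 u) y) + dX 2 (dX 2 u) y := by
    ext1 y
    rw [lapS_apply, Fin.sum_univ_three]
    rfl
  rw [e]
  have a1 := wordSum_add_le n ((hs (dX 0 (dX 0 u))).add (hs (dX 1 (dX 1 u)))) (hs (dX 2 (dX 2 u))) x
  have a2 := wordSum_add_le n (hs (dX 0 (dX 0 u))) (hs (dX 1 (dX 1 u))) x
  have := h1 0; have := h1 1; have := h1 2
  linarith

/-! ### Words of derivatives -/

/-- Iterated partial derivatives. -/
def dWord : List (Fin 3) → 𝓢(E3, ℂ) →L[ℂ] 𝓢(E3, ℂ)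
  | [] => ContinuousLinearMap.id ℂ _
  | k :: β => dX k ∘L dWord β

theorem dWord_cons (k : Fin 3) (β : List (Fin 3)) (u : 𝓢(E3, ℂ)) : dWord (k :: β) u = dX k (dWord β u) := rfl

theorem dWord_dX (β : List (Fin 3)) (k : Fin 3) (u : 𝓢(E3, ℂ)) : dWord β (dX k u) = dX k (dWord β u) := by
  induction β with
  | nil => rfl
  | cons j β ih => rw [dWord_cons, dWord_cons, ih, dX_comm]

theorem norm_dWord_le (β : List (Fin 3)) : ∀ (u : 𝓢(E3, ℂ)) (x : E3), ‖dWord β u x‖ ≤ wordSum β.length u x := by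
  induction β with
  | nil => exact fun u x => le_rfl
  | cons k β ih =>
    intro u x
    rw [dWord_cons, ← dWord_dX]
    exact (ih _ x).trans (wordSum_dX_le _ k u x)

theorem exists_dWord_halfProj (ε : ℝ) (β : List (Fin 3)) {w : ℝ → ℂ} (hw : IsSmoothWeight w) :
    ∃ (w' : ℝ → ℂ) (hw' : IsSmoothWeight w'), ∀ u, dWord β (halfProj ε hw u) = halfProj ε hw' (dWord β u) := by
  induction β with
  | nil => exact ⟨w, hw, fun u => rfl⟩
  | cons k β ih =>
    obtain ⟨w', hw', h⟩ := ih
    exact ⟨_, hw'.exp_mul 1, fun u => by rw [dWord_cons, h, dX_halfProj, dWord_cons]⟩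

/-- An additional derivative commutes with the propagator, and then either lengthens the word or
hits the symbol `A`. In the second case `∂_j A` has order `-1` and is again a symbol of order `0`,
with constant `B/R ≤ B/ρ`. The word is non-empty because the basic estimate consumes one derivative.
-/
theorem exists_incoming_word_bound {ρ : ℝ} (hρ : 0 < ρ) (n : ℕ) : ∀ (k : Fin 3) (β : List (Fin 3)) {w : ℝ → ℂ}
    (hw : IsSmoothWeight w), ∃ C : ℝ, 0 ≤ C ∧ ∀ (B R s : ℝ) (A : E3 → ℂ), ρ ≤ R → 0 < s →
      IsSymbol 0 (6 + n) B R A → ∀ f : 𝓢(E3, ℂ),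
      eLpNorm (fun x => japaneseBracket x ^ (-8 : ℝ) *
          wordSum n (freeEvolutionSchwartz s (mulS A (dWord (k :: β) (halfProj 1 hw f)))) x) 2 volume
        ≤ ENNReal.ofReal (C * B * (R ^ 2 + s) ^ (-(9 / 8) : ℝ)) *
          eLpNorm (wordSum ((k :: β).length + n) f) 2 (volume.restrict (ext (R / 4))) := by
  have hpow : AEStronglyMeasurable (fun x => japaneseBracket x ^ (-8 : ℝ)) volume :=
    (continuous_japaneseBracket.measurable.pow_const _).aestronglyMeasurable
  have mono : ∀ (v : 𝓢(E3, ℂ)) (f : 𝓢(E3, ℂ)) (N : ℕ) (r : ℝ), (∀ x, ‖v x‖ ≤ wordSum N f x) →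
      eLpNorm v 2 (volume.restrict (ext r)) ≤ eLpNorm (wordSum N f) 2 (volume.restrict (ext r)) :=
    fun v f N r h => eLpNorm_mono_real h
  have base : ∀ (k : Fin 3) (β : List (Fin 3)) {w : ℝ → ℂ} (hw : IsSmoothWeight w), ∃ C : ℝ, 0 ≤ C ∧
      ∀ (B R s : ℝ) (A : E3 → ℂ), ρ ≤ R → 0 < s → IsSymbol 0 6 B R A → ∀ f : 𝓢(E3, ℂ),
      eLpNorm (fun x => japaneseBracket x ^ (-8 : ℝ) *
          ‖freeEvolutionSchwartz s (mulS A (dWord (k :: β) (halfProj 1 hw f))) x‖) 2 volume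
        ≤ ENNReal.ofReal (C * B * (R ^ 2 + s) ^ (-(9 / 8) : ℝ)) *
          eLpNorm (wordSum (k :: β).length f) 2 (volume.restrict (ext (R / 4))) := by
    intro k β w hw
    obtain ⟨w', hw', hcomm⟩ := exists_dWord_halfProj 1 β hw
    obtain ⟨C, hC, h⟩ := exists_incoming_bound hρ hw'
    refine ⟨2 * C, by positivity, fun B R s A hR hs hA f => ?_⟩
    have h1 := h B R s A k hR hs hA (dWord β f)
    have hB := hA.nonneg
    rw [← hcomm, ← dWord_cons, ← dWord_cons] at h1
    calc _ = eLpNorm (fun x => ((japaneseBracket x ^ (-8 : ℝ) : ℝ) : ℂ) *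
          freeEvolutionSchwartz s (mulS A (dWord (k :: β) (halfProj 1 hw f))) x) 2 volume := by
          refine eLpNorm_congr_norm_ae (Eventually.of_forall fun x => ?_)
          rw [norm_mul, norm_mul, Complex.norm_real, norm_norm]
      _ ≤ _ := h1
      _ ≤ ENNReal.ofReal (C * B * (R ^ 2 + s) ^ (-(9 / 8) : ℝ)) *
          (eLpNorm (wordSum (k :: β).length f) 2 (volume.restrict (ext (R / 4)))
            + eLpNorm (wordSum (k :: β).length f) 2 (volume.restrict (ext (R / 4)))) := by
          gcongr
          · exact mono _ _ _ _ fun x => (norm_dWord_le β f x).trans (wordSum_le_succ _ _ _)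
          · exact mono _ _ _ _ fun x => norm_dWord_le (k :: β) f x
      _ = _ := by
          have e2 : ENNReal.ofReal (2 * C * B * (R ^ 2 + s) ^ (-(9 / 8) : ℝ))
              = 2 * ENNReal.ofReal (C * B * (R ^ 2 + s) ^ (-(9 / 8) : ℝ)) := by
            rw [mul_assoc, mul_assoc, ENNReal.ofReal_mul (by norm_num), ← mul_assoc]
            norm_num
          rw [← two_mul, e2]; ring
  induction n with
  | zero => exact fun k β w hw => base k β hw
  | succ n ih =>
    intro k β w hw
    obtain ⟨C₀, hC₀, h0⟩ := base k β hw
    have ih1 := fun j => ih j (k :: β) hw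
    choose C₁ hC₁ h1 using ih1
    obtain ⟨C₂, hC₂, h2⟩ := ih k β hw
    refine ⟨C₀ + ∑ j, (C₁ j + C₂ * ρ⁻¹), add_nonneg hC₀ (Finset.sum_nonneg fun j _ => by
      have := hC₁ j; positivity), fun B R s A hR hs hA f => ?_⟩
    have hB := hA.nonneg
    have hR0 : 0 < R := hρ.trans_le hR
    set v := freeEvolutionSchwartz s (mulS A (dWord (k :: β) (halfProj 1 hw f))) with hv
    set τ := (R ^ 2 + s) ^ (-(9 / 8) : ℝ) with hτ
    have hτ0 : 0 ≤ τ := by positivity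
    set N := eLpNorm (wordSum ((k :: β).length + (n + 1)) f) 2 (volume.restrict (ext (R / 4))) with hN
    have up : ∀ m, m ≤ (k :: β).length + (n + 1) →
        eLpNorm (wordSum m f) 2 (volume.restrict (ext (R / 4))) ≤ N := fun m hm => by
      refine eLpNorm_mono_real fun x => ?_
      rw [Real.norm_of_nonneg (wordSum_nonneg _ _ _)]
      exact wordSum_mono hm f x
    let a : Fin 3 → 𝓢(E3, ℂ) := fun j => freeEvolutionSchwartz s (mulS A (dWord (j :: k :: β) (halfProj 1 hw f)))
    let b : Fin 3 → 𝓢(E3, ℂ) := fun j =>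
      freeEvolutionSchwartz s (mulS (partialDeriv j A) (dWord (k :: β) (halfProj 1 hw f)))
    have hsplit : ∀ j, partialDeriv j v = fun x => a j x + b j x := by
      intro j
      rw [← dX_coe, hv, ← freeEvolutionSchwartz_dX, dX_mulS hA.temperate, map_add]
      rfl
    have sm := fun u : 𝓢(E3, ℂ) => u.smooth (⊤ : ℕ∞)
    have ms : ∀ (m : ℕ) (u : 𝓢(E3, ℂ)),
        AEStronglyMeasurable (fun x => japaneseBracket x ^ (-8 : ℝ) * wordSum m u x) volume := fun m u =>
      hpow.mul (continuous_wordSum m (sm u)).aestronglyMeasurable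
    have hv0 := h0 B R s A hR hs (hA.mono (by omega) le_rfl) f
    have ha : ∀ j, eLpNorm (fun x => japaneseBracket x ^ (-8 : ℝ) * wordSum n (a j) x) 2 volume
        ≤ ENNReal.ofReal (C₁ j * B * τ) * N := fun j => by
      refine (h1 j B R s A hR hs (hA.mono (by omega) le_rfl) f).trans ?_
      gcongr
      exact up _ (by simp only [List.length_cons]; omega)
    have hb : ∀ j, eLpNorm (fun x => japaneseBracket x ^ (-8 : ℝ) * wordSum n (b j) x) 2 volume
        ≤ ENNReal.ofReal (C₂ * ρ⁻¹ * B * τ) * N := fun j => by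
      have hA' : IsSymbol 0 (6 + n) (B / R) R (partialDeriv j A) := (hA.partialDeriv j).of_succ hR0
      refine (h2 (B / R) R s _ hR hs hA' f).trans ?_
      have e1 : C₂ * (B / R) * τ ≤ C₂ * ρ⁻¹ * B * τ := by
        rw [div_eq_inv_mul, ← mul_assoc]
        gcongr
      refine mul_le_mul' (ENNReal.ofReal_le_ofReal e1) (up _ (by omega))
    have pw : ∀ x, ‖japaneseBracket x ^ (-8 : ℝ) * wordSum (n + 1) v x‖
        ≤ ((fun x => japaneseBracket x ^ (-8 : ℝ) * ‖v x‖) + ∑ j, ((fun x => japaneseBracket x ^ (-8 : ℝ) *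
            wordSum n (a j) x) + fun x => japaneseBracket x ^ (-8 : ℝ) * wordSum n (b j) x)) x := by
      intro x
      have hj := japaneseBracket_pos x
      have hw0 := wordSum_nonneg (n + 1) v x
      rw [Real.norm_of_nonneg (by positivity)]
      simp only [Pi.add_apply, Finset.sum_apply, wordSum]
      rw [mul_add, Finset.mul_sum]
      gcongr with j
      rw [hsplit j, ← mul_add]
      gcongr
      exact wordSum_add_le n (sm (a j)) (sm (b j)) x
    have m0 : AEStronglyMeasurable (fun x => japaneseBracket x ^ (-8 : ℝ) * ‖v x‖) volume := ms 0 v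
    calc _ ≤ _ := eLpNorm_mono_real pw
      _ ≤ eLpNorm (fun x => japaneseBracket x ^ (-8 : ℝ) * ‖v x‖) 2 volume
          + ∑ j, (eLpNorm (fun x => japaneseBracket x ^ (-8 : ℝ) * wordSum n (a j) x) 2 volume
            + eLpNorm (fun x => japaneseBracket x ^ (-8 : ℝ) * wordSum n (b j) x) 2 volume) := by
          refine (eLpNorm_add_le m0 (Finset.aestronglyMeasurable_sum _ fun j _ => (ms n (a j)).add (ms n (b j)))
            (by norm_num)).trans (add_le_add le_rfl ?_)
          refine (eLpNorm_sum_le (fun j _ => (ms n (a j)).add (ms n (b j))) (by norm_num)).trans ?_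
          exact Finset.sum_le_sum fun j _ => eLpNorm_add_le (ms n (a j)) (ms n (b j)) (by norm_num)
      _ ≤ ENNReal.ofReal (C₀ * B * τ) * N + ∑ j, (ENNReal.ofReal (C₁ j * B * τ) * N
            + ENNReal.ofReal (C₂ * ρ⁻¹ * B * τ) * N) := by
          refine add_le_add (hv0.trans (mul_le_mul' le_rfl (up _ (by omega)))) (Finset.sum_le_sum fun j _ =>
            add_le_add (ha j) (hb j))
      _ = _ := by
          have hp : ∀ j, 0 ≤ C₁ j * B * τ := fun j => by have := hC₁ j; positivity
          have hp' : ∀ j, 0 ≤ C₁ j * B * τ + C₂ * ρ⁻¹ * B * τ := fun j => add_nonneg (hp j) (by positivity)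
          simp_rw [← add_mul]
          rw [← Finset.sum_mul, ← add_mul]
          congr 1
          have : ∀ j, ENNReal.ofReal (C₁ j * B * τ) + ENNReal.ofReal (C₂ * ρ⁻¹ * B * τ)
              = ENNReal.ofReal (C₁ j * B * τ + C₂ * ρ⁻¹ * B * τ) := fun j =>
            (ENNReal.ofReal_add (hp j) (by positivity)).symm
          simp_rw [this]
          rw [← ENNReal.ofReal_sum_of_nonneg (fun j _ => hp' j), ← ENNReal.ofReal_add (by positivity)
            (Finset.sum_nonneg fun j _ => hp' j)]
          congr 1
          rw [add_mul, add_mul, Finset.sum_mul, Finset.sum_mul]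
          congr 1
          exact Finset.sum_congr rfl fun j _ => by ring

/-! ### The weighted estimate for outgoing waves -/

/-- A smooth cutoff to the unit scale. -/
def unitBump : ContDiffBump (0 : E3) := ⟨1 / 8, 1 / 6, by norm_num, by norm_num⟩

/-- A smooth cutoff at scale `r`. -/
def scaledBump (r : ℝ) (z : E3) : ℂ := ((unitBump (r⁻¹ • z) : ℝ) : ℂ)

theorem norm_inv_smul {r : ℝ} (hr : 0 < r) (z : E3) : ‖r⁻¹ • z‖ = ‖z‖ / r := by
  rw [norm_smul, norm_inv, Real.norm_of_nonneg hr.le]; ring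

theorem scaledBump_eq_one {r : ℝ} (hr : 0 < r) {z : E3} (hz : ‖z‖ ≤ r / 8) : scaledBump r z = 1 := by
  rw [scaledBump, unitBump.one_of_mem_closedBall, Complex.ofReal_one]
  rw [Metric.mem_closedBall, dist_zero_right, norm_inv_smul hr, div_le_iff₀ hr]
  change ‖z‖ ≤ 1 / 8 * r
  linarith

theorem scaledBump_eq_zero {r : ℝ} (hr : 0 < r) {z : E3} (hz : r / 6 ≤ ‖z‖) : scaledBump r z = 0 := by
  rw [scaledBump, unitBump.zero_of_le_dist, Complex.ofReal_zero]
  rw [dist_zero_right, norm_inv_smul hr, le_div_iff₀ hr]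
  change 1 / 6 * r ≤ ‖z‖
  linarith

theorem norm_scaledBump_le (r : ℝ) (z : E3) : ‖scaledBump r z‖ ≤ 1 := by
  rw [scaledBump, Complex.norm_real, Real.norm_of_nonneg unitBump.nonneg]
  exact unitBump.le_one

theorem contDiff_unitBump : ContDiff ℝ ∞ (fun z => ((unitBump z : ℝ) : ℂ)) :=
  Complex.ofRealCLM.contDiff.comp unitBump.contDiff

theorem contDiff_scaledBump (r : ℝ) : ContDiff ℝ ∞ (scaledBump r) :=
  contDiff_unitBump.comp (contDiff_const_smul _)

theorem hasTemperateGrowth_scaledBump (r : ℝ) : (scaledBump r).HasTemperateGrowth := by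
  have h1 : Function.HasTemperateGrowth (fun z => ((unitBump z : ℝ) : ℂ)) :=
    (unitBump.hasCompactSupport.comp_left Complex.ofReal_zero).hasTemperateGrowth contDiff_unitBump
  exact h1.comp (r⁻¹ • ContinuousLinearMap.id ℝ E3).hasTemperateGrowth

theorem exists_wordSum_scaledBump_le (n : ℕ) {ρ : ℝ} (hρ : 0 < ρ) :
    ∃ C : ℝ, 0 ≤ C ∧ ∀ r, ρ ≤ r → ∀ x, wordSum n (fun z => 1 - scaledBump r z) x ≤ C := by
  obtain ⟨C₀, hC₀, h0⟩ := exists_wordSum_le_iteratedFDeriv n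
  have hb : ∀ i : ℕ, ∃ K, ∀ z, ‖iteratedFDeriv ℝ i (fun z => ((unitBump z : ℝ) : ℂ)) z‖ ≤ K := fun i => by
    obtain ⟨K, -, hK⟩ := ((unitBump.hasCompactSupport.comp_left Complex.ofReal_zero).toSchwartzMap
      contDiff_unitBump).decay 0 i
    exact ⟨K, fun z => by have := hK z; rwa [pow_zero, one_mul] at this⟩
  choose K hK using hb
  have hK0 : ∀ i, 0 ≤ K i := fun i => (norm_nonneg _).trans (hK i 0)
  refine ⟨1 + C₀ * ∑ i ∈ Finset.range (n + 1), K i * ρ⁻¹ ^ i, add_nonneg zero_le_one (mul_nonneg hC₀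
    (Finset.sum_nonneg fun i _ => mul_nonneg (hK0 i) (by positivity))), fun r hr x => ?_⟩
  have hr0 : 0 < r := hρ.trans_le hr
  have hd : ∀ i : ℕ, ‖iteratedFDeriv ℝ i (scaledBump r) x‖ ≤ K i * ρ⁻¹ ^ i := by
    intro i
    have e : scaledBump r = (fun z => ((unitBump z : ℝ) : ℂ)) ∘ (r⁻¹ • ContinuousLinearMap.id ℝ E3) := rfl
    rw [e, ContinuousLinearMap.iteratedFDeriv_comp_right _ contDiff_unitBump _ (i := i) (by exact_mod_cast le_top)]
    refine (ContinuousMultilinearMap.norm_compContinuousLinearMap_le _ _).trans ?_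
    rw [Finset.prod_const, Finset.card_univ, Fintype.card_fin]
    have hn : ‖r⁻¹ • ContinuousLinearMap.id ℝ E3‖ ≤ ρ⁻¹ := by
      refine ContinuousLinearMap.opNorm_le_bound _ (by positivity) fun z => ?_
      rw [smul_apply, ContinuousLinearMap.id_apply, norm_smul, norm_inv, Real.norm_of_nonneg hr0.le]
      gcongr
    have := hK0 i
    gcongr
    exact hK i _
  have e1 : (fun z => 1 - scaledBump r z) = fun z => (fun _ => (1 : ℂ)) z + (fun z => (-1 : ℂ) * scaledBump r z) z := by
    ext1 z; ring
  rw [e1]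
  refine (wordSum_add_le n contDiff_const (contDiff_const.mul (contDiff_scaledBump r)) x).trans ?_
  rw [wordSum_const, wordSum_const_mul n _ (contDiff_scaledBump r), norm_neg, norm_one, one_mul]
  gcongr
  refine (h0 (contDiff_scaledBump r) x).trans ?_
  gcongr with i
  exact hd i

theorem norm_sq_eq_sum_coord (y : E3) : ((‖y‖ ^ 2 : ℝ) : ℂ) = ∑ j, ((y j : ℝ) : ℂ) * ((y j : ℝ) : ℂ) := by
  rw [EuclideanSpace.norm_sq_eq]
  push_cast
  exact Finset.sum_congr rfl fun j _ => by
    rw [Real.norm_eq_abs]; norm_cast; rw [sq_abs, sq]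

/-- The operator `x_j + i s ∂_j`, which is conjugate to `x_j` under the free evolution. -/
def galilei (s : ℝ) (j : Fin 3) : 𝓢(E3, ℂ) →L[ℂ] 𝓢(E3, ℂ) := mX j + (Complex.I * s) • dX j

theorem mX_freeEvolutionSchwartz (s : ℝ) (j : Fin 3) (u : 𝓢(E3, ℂ)) :
    mX j (freeEvolutionSchwartz s u) = freeEvolutionSchwartz s (galilei s j u) := by
  rw [galilei, add_apply, smul_apply, map_add, map_smul, freeEvolutionSchwartz_mX, freeEvolutionSchwartz_dX,
    sub_add_cancel]

theorem norm_galilei_galilei_le {s : ℝ} (hs : 0 < s) (j : Fin 3) (u : 𝓢(E3, ℂ)) (z : E3) :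
    ‖galilei s j (galilei s j u) z‖ ≤ (‖z‖ ^ 2 + 2 * s * ‖z‖ + s + s ^ 2) * wordSum 2 u z := by
  have e : galilei s j (galilei s j u) z = (z j : ℝ) * ((z j : ℝ) * u z) + 2 * (Complex.I * s) * ((z j : ℝ) * dX j u z)
      + Complex.I * s * u z + (Complex.I * s) * ((Complex.I * s) * dX j (dX j u) z) := by
    simp only [galilei, add_apply, smul_apply, map_add, map_smul, dX_mX, mX_apply, if_true, smul_eq_mul]
    ring
  have hz := norm_coord_le z j
  have w0 : ‖u z‖ ≤ wordSum 2 u z := norm_le_wordSum _ _ _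
  have w1 : ‖dX j u z‖ ≤ wordSum 2 u z := (norm_le_wordSum 1 _ _).trans (wordSum_dX_le 1 j u z)
  have w2 : ‖dX j (dX j u) z‖ ≤ wordSum 2 u z := (norm_le_wordSum 0 _ _).trans
    ((wordSum_dX_le 0 j _ z).trans (wordSum_dX_le 1 j u z))
  have hw := wordSum_nonneg 2 u z
  have hI : ‖(Complex.I * s : ℂ)‖ = s := by
    rw [norm_mul, Complex.norm_I, one_mul, Complex.norm_real, Real.norm_of_nonneg hs.le]
  rw [e]
  calc _ ≤ ‖z‖ * (‖z‖ * wordSum 2 u z) + 2 * s * (‖z‖ * wordSum 2 u z) + s * wordSum 2 u z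
        + s * (s * wordSum 2 u z) := by
        refine (norm_add_le _ _).trans (add_le_add ((norm_add_le _ _).trans (add_le_add
          ((norm_add_le _ _).trans (add_le_add ?_ ?_)) ?_)) ?_)
        · rw [norm_mul, norm_mul]; gcongr
        · rw [norm_mul, norm_mul 2, hI, Complex.norm_two, norm_mul]; gcongr
        · rw [norm_mul, hI]; gcongr
        · rw [norm_mul, norm_mul (Complex.I * s : ℂ), hI]; gcongr
    _ = _ := by ring

/-- Writing `|y|²` as the sum of `y_j²` and passing each coordinate through the projection reduces
the weighted bound to the unweighted one. -/
theorem eLpNorm_sq_mul_halfProj_le {ε : ℝ} (hε : ε ^ 2 = 1) {w : ℝ → ℂ} (hw : IsSmoothWeight w) :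
    ∃ C : ℝ, 0 ≤ C ∧ ∀ (r : ℝ), 0 ≤ r → ∀ u : 𝓢(E3, ℂ),
      eLpNorm (fun y => ((‖y‖ ^ 2 : ℝ) : ℂ) * halfProj ε hw u y) 2 (volume.restrict (ext r))
        ≤ ENNReal.ofReal C * ∑ j, eLpNorm (mX j (mX j u)) 2 volume := by
  obtain ⟨C, hC, h⟩ := exists_eLpNorm_halfProj_le hε ((hw.exp_mul (-1)).exp_mul (-1))
  refine ⟨C, hC, fun r hr u => ?_⟩
  have e : (fun y => ((‖y‖ ^ 2 : ℝ) : ℂ) * halfProj ε hw u y)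
      = ∑ j, ⇑(halfProj ε ((hw.exp_mul (-1)).exp_mul (-1)) (mX j (mX j u))) := by
    ext1 y
    rw [Finset.sum_apply, norm_sq_eq_sum_coord, Finset.sum_mul]
    refine Finset.sum_congr rfl fun j _ => ?_
    rw [← mX_halfProj hε (hw.exp_mul (-1)), ← mX_halfProj hε hw, mX_apply, mX_apply, mul_assoc]
  rw [e, Finset.mul_sum]
  refine (eLpNorm_sum_le (fun j _ => (SchwartzMap.continuous _).aestronglyMeasurable) (by norm_num)).trans ?_
  refine Finset.sum_le_sum fun j _ => (h r hr _).trans ?_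
  gcongr
  exact Measure.restrict_le_self

theorem exists_outgoing_near_bound {ρ : ℝ} (hρ : 0 < ρ) {w : ℝ → ℂ} (hw : IsSmoothWeight w) :
    ∃ C : ℝ, 0 ≤ C ∧ ∀ (R s : ℝ), ρ ≤ R → 0 < s → ∀ f : 𝓢(E3, ℂ),
      eLpNorm (fun y => ((‖y‖ ^ 2 : ℝ) : ℂ) * halfProj (-1) hw (freeEvolutionSchwartz s (lapS (lapS
          (mulS (scaledBump (Real.sqrt (R ^ 2 + s))) f)))) y) 2 (volume.restrict (ext R))
        ≤ ENNReal.ofReal (C * (R ^ 2 + s) ^ (-(9 / 8) : ℝ)) *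
          eLpNorm (fun z => japaneseBracket z ^ (11 : ℝ) * ‖f z‖) 2 volume := by
  obtain ⟨C, hC, h⟩ := isDecayOp_lapS_lapS w hw
  set J₁ := eLpNorm (fun x => japaneseBracket x ^ (-11 : ℝ)) 2 volume with hJ₁
  set J₂ := eLpNorm (fun z : E3 => ‖z‖ ^ (-(7 / 4) : ℝ)) 2 (volume.restrict (ext ρ)) with hJ₂
  have hJ₁f : J₁ < ⊤ := eLpNorm_japaneseBracket_lt_top (by norm_num)
  have hJ₂f : J₂ < ⊤ := eLpNorm_ext_rpow_lt_top hρ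
  refine ⟨C * 256 * ρ⁻¹ * J₁.toReal * J₂.toReal, by positivity, fun R s hR hs f => ?_⟩
  have hR0 : 0 < R := hρ.trans_le hR
  have hT0 : 0 < R ^ 2 + s := by positivity
  set τ := (R ^ 2 + s) ^ (-(9 / 8) : ℝ) with hτ
  have hτ0 : 0 ≤ τ := by positivity
  have hsq : 0 < Real.sqrt (R ^ 2 + s) := Real.sqrt_pos.2 hT0
  set g := mulS (scaledBump (Real.sqrt (R ^ 2 + s))) f with hg
  have hgz : ∀ z, g z = scaledBump (Real.sqrt (R ^ 2 + s)) z * f z := mulS_apply (hasTemperateGrowth_scaledBump _) f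
  set F := ∫ z, ‖f z‖ with hF
  have hF0 : 0 ≤ F := integral_nonneg fun _ => norm_nonneg _
  have hGF : ∫ z, ‖g z‖ ≤ F := by
    refine integral_mono g.integrable.norm f.integrable.norm fun z => ?_
    simp only
    rw [hgz, norm_mul]
    exact mul_le_of_le_one_left (norm_nonneg _) (norm_scaledBump_le _ z)
  have hsupp : ∀ z, g z ≠ 0 → ‖z‖ ^ 2 ≤ (R ^ 2 + s) / 36 := fun z hz => by
    by_contra hcon
    refine hz ?_
    rw [hgz, scaledBump_eq_zero hsq, zero_mul]
    have h1 : (Real.sqrt (R ^ 2 + s) / 6) ^ 2 ≤ ‖z‖ ^ 2 := by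
      rw [div_pow, Real.sq_sqrt hT0.le]
      linarith [not_le.1 hcon]
    exact (pow_le_pow_iff_left₀ (by positivity) (norm_nonneg _) two_ne_zero).1 h1
  -- The kernel bound asks for the `L¹` norm of `f`; Cauchy–Schwarz against the square integrable
  -- `⟨z⟩^{-11}` brings it back to the weighted `L²` norm.
  have hFJ : ENNReal.ofReal F ≤ J₁ * eLpNorm (fun z => japaneseBracket z ^ (11 : ℝ) * ‖f z‖) 2 volume := by
    have e : F = ∫ z, japaneseBracket z ^ (-11 : ℝ) * (japaneseBracket z ^ (11 : ℝ) * ‖f z‖) := by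
      rw [hF]
      refine integral_congr_ae (Eventually.of_forall fun z => ?_)
      simp only
      rw [← mul_assoc, ← Real.rpow_add (japaneseBracket_pos z)]
      norm_num
    rw [e]
    exact ofReal_integral_mul_le (continuous_japaneseBracket.measurable.pow_const _).aestronglyMeasurable
      ((continuous_japaneseBracket.measurable.pow_const _).mul f.continuous.norm.measurable).aestronglyMeasurable
  calc _ ≤ ENNReal.ofReal (C * 256 * ρ⁻¹ * τ * F) *
          eLpNorm (fun z : E3 => ‖z‖ ^ (-(7 / 4) : ℝ)) 2 (volume.restrict (ext R)) := by
        refine eLpNorm_le_mul_eLpNorm_of_ae_le_mul ?_ 2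
        filter_upwards [ae_restrict_mem (measurableSet_ext R)] with y hy
        have hy' : R ≤ ‖y‖ := hy
        have h1 := h R s g y hR0 hs hsupp hy'
        have h2 := outgoing_weight_le hR0 hs hy'
        rw [ContinuousLinearMap.comp_apply] at h1
        have hk := mul_pos (zpow_pos (derivGain_pos hR0 hs y) 4) (outgoingKernel_pos hs y)
        rw [norm_mul, Complex.norm_real, Real.norm_of_nonneg (by positivity), Real.norm_of_nonneg (by positivity)]
        calc _ ≤ ‖y‖ ^ 2 * (C * (derivGain R s y ^ (4 : ℤ) * outgoingKernel s y * F)) := by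
              gcongr
              refine h1.trans ?_
              gcongr
          _ = C * (‖y‖ ^ 2 * (derivGain R s y ^ (4 : ℤ) * outgoingKernel s y)) * F := by ring
          _ ≤ C * (256 * R⁻¹ * τ * ‖y‖ ^ (-(7 / 4) : ℝ)) * F := by gcongr
          _ ≤ C * (256 * ρ⁻¹ * τ * ‖y‖ ^ (-(7 / 4) : ℝ)) * F := by gcongr
          _ = _ := by ring
    _ ≤ ENNReal.ofReal (C * 256 * ρ⁻¹ * τ * F) * J₂ := by
        gcongr
        exact eLpNorm_mono_measure _ (Measure.restrict_mono (ext_mono hR) le_rfl)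
    _ = ENNReal.ofReal (C * 256 * ρ⁻¹ * τ) * ENNReal.ofReal F * J₂ := by
        rw [← ENNReal.ofReal_mul (by positivity)]
    _ ≤ ENNReal.ofReal (C * 256 * ρ⁻¹ * τ) *
          (J₁ * eLpNorm (fun z => japaneseBracket z ^ (11 : ℝ) * ‖f z‖) 2 volume) * J₂ := by gcongr
    _ = _ := by
        have e : ENNReal.ofReal (C * 256 * ρ⁻¹ * J₁.toReal * J₂.toReal * τ)
            = ENNReal.ofReal (C * 256 * ρ⁻¹ * τ) * J₁ * J₂ := by
          rw [show C * 256 * ρ⁻¹ * J₁.toReal * J₂.toReal * τ = C * 256 * ρ⁻¹ * τ * J₁.toReal * J₂.toReal by ring,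
            ENNReal.ofReal_mul (q := J₂.toReal) (by positivity),
            ENNReal.ofReal_mul (q := J₁.toReal) (by positivity),
            ENNReal.ofReal_toReal hJ₁f.ne, ENNReal.ofReal_toReal hJ₂f.ne]
        rw [e]
        ring

/-- The data live on `|z| ≥ √T/8`, where `s ≤ T ≤ 64⟨z⟩²`. Conjugating `y_j²` through the propagator
gives `(z_j + is∂_j)²`, of size `⟨z⟩⁴` on this set. The rate `T^{-9/8}` costs another `⟨z⟩^{9/4}`,
and `4 + 9/4 ≤ 11`. Derivatives add up to six: four from `Δ²` and two from the conjugated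
coordinates. -/
theorem exists_outgoing_far_bound {ρ : ℝ} (hρ : 0 < ρ) {w : ℝ → ℂ} (hw : IsSmoothWeight w) :
    ∃ C : ℝ, 0 ≤ C ∧ ∀ (R s : ℝ), ρ ≤ R → 0 < s → ∀ f : 𝓢(E3, ℂ),
      eLpNorm (fun y => ((‖y‖ ^ 2 : ℝ) : ℂ) * halfProj (-1) hw (freeEvolutionSchwartz s (lapS (lapS
          (mulS (fun z => 1 - scaledBump (Real.sqrt (R ^ 2 + s)) z) f)))) y) 2 (volume.restrict (ext R))
        ≤ ENNReal.ofReal (C * (R ^ 2 + s) ^ (-(9 / 8) : ℝ)) *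
          eLpNorm (fun z => japaneseBracket z ^ (11 : ℝ) * wordSum 6 f z) 2 (volume.restrict (ext (ρ / 8))) := by
  obtain ⟨C₀, hC₀, h0⟩ := eLpNorm_sq_mul_halfProj_le (ε := -1) (by norm_num) hw
  obtain ⟨C₁, hC₁, h1⟩ := exists_wordSum_scaledBump_le 6 hρ
  obtain ⟨C₂, hC₂, h2⟩ := exists_wordSum_mul_le 6
  set D : ℝ := 5000 * 64 ^ (9 / 8 : ℝ) * (9 * (C₂ * C₁)) with hD
  refine ⟨C₀ * (3 * D), by positivity, fun R s hR hs f => ?_⟩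
  have hR0 : 0 < R := hρ.trans_le hR
  have hT0 : 0 < R ^ 2 + s := by positivity
  set T := R ^ 2 + s with hT
  set τ := T ^ (-(9 / 8) : ℝ) with hτ
  have hτ0 : 0 ≤ τ := by positivity
  have hsq : 0 < Real.sqrt T := Real.sqrt_pos.2 hT0
  have hρT : ρ ≤ Real.sqrt T := hR.trans (Real.le_sqrt_of_sq_le (by rw [hT]; linarith))
  have hψ : Function.HasTemperateGrowth (fun z => 1 - scaledBump (Real.sqrt T) z) :=
    (Function.HasTemperateGrowth.const 1).sub (hasTemperateGrowth_scaledBump _)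
  set g := mulS (fun z => 1 - scaledBump (Real.sqrt T) z) f with hg
  have hgz : ⇑g = fun z => (1 - scaledBump (Real.sqrt T) z) * f z := funext (mulS_apply hψ f)
  set N := eLpNorm (fun z => japaneseBracket z ^ (11 : ℝ) * wordSum 6 f z) 2 (volume.restrict (ext (ρ / 8))) with hN
  have pw : ∀ j z, ‖galilei s j (galilei s j (lapS (lapS g))) z‖ ≤ D * τ *
      ‖(ext (ρ / 8)).indicator (fun z => japaneseBracket z ^ (11 : ℝ) * wordSum 6 f z) z‖ := by
    intro j z
    have hw4 : wordSum 2 (lapS (lapS g)) z ≤ 9 * wordSum 6 g z := by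
      have a1 := wordSum_lapS_le 2 (lapS g) z
      have a2 := wordSum_lapS_le 4 g z
      linarith
    have hg6 := wordSum_nonneg 6 g z
    have hf6 := wordSum_nonneg 6 f z
    have hz0 := norm_nonneg z
    have b1 : ‖galilei s j (galilei s j (lapS (lapS g))) z‖
        ≤ (‖z‖ ^ 2 + 2 * s * ‖z‖ + s + s ^ 2) * (9 * wordSum 6 g z) := by
      refine (norm_galilei_galilei_le hs j _ z).trans ?_
      gcongr
    by_cases hz : ‖z‖ < Real.sqrt T / 8
    · have hzero : wordSum 6 g z = 0 := by
        have : ⇑g =ᶠ[𝓝 z] fun _ => 0 := by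
          filter_upwards [continuous_norm.continuousAt.eventually (gt_mem_nhds hz)] with y hy
          rw [hgz]
          simp only
          rw [scaledBump_eq_one hsq hy.le, sub_self, zero_mul]
        rw [wordSum_congr_nhds 6 this, wordSum_zero_fun]
      rw [hzero, mul_zero, mul_zero] at b1
      exact b1.trans (by positivity)
    · have hz' : Real.sqrt T / 8 ≤ ‖z‖ := not_lt.1 hz
      have hmem : z ∈ ext (ρ / 8) := le_trans (by gcongr) hz'
      have hTz : T ≤ 64 * ‖z‖ ^ 2 := by
        have := pow_le_pow_left₀ (by positivity) hz' 2
        rw [div_pow, Real.sq_sqrt hT0.le] at this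
        linarith
      have hj1 := one_le_japaneseBracket z
      have hjz := norm_le_japaneseBracket z
      set J := japaneseBracket z with hJ
      have hJ0 : 0 < J := japaneseBracket_pos z
      have hTJ : T ≤ 64 * J ^ 2 := hTz.trans (by gcongr)
      have hsJ : s ≤ 64 * J ^ 2 := le_trans (by rw [hT]; nlinarith) hTJ
      have hg6f : wordSum 6 g z ≤ C₂ * C₁ * wordSum 6 f z := by
        rw [hgz]
        refine (h2 (contDiff_const.sub (contDiff_scaledBump _)) (f.smooth ⊤) z).trans ?_
        gcongr
        exact h1 _ hρT z
      -- The individual bounds add up to `1 + 128 + 64 + 4096 = 4289`, rounded up to `5000`.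
      have c1 : ‖z‖ ^ 2 + 2 * s * ‖z‖ + s + s ^ 2 ≤ 5000 * J ^ 4 := by
        have d1 : ‖z‖ ^ 2 ≤ J ^ 4 := (pow_le_pow_left₀ hz0 hjz 2).trans (pow_le_pow_right₀ hj1 (by norm_num))
        have d2 : s * ‖z‖ ≤ 64 * J ^ 4 := by
          calc s * ‖z‖ ≤ 64 * J ^ 2 * J := by gcongr
            _ = 64 * J ^ 3 := by ring
            _ ≤ 64 * J ^ 4 := by gcongr; norm_num
        have d3 : s ≤ 64 * J ^ 4 := hsJ.trans (by gcongr; norm_num)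
        have d4 : s ^ 2 ≤ 4096 * J ^ 4 := by
          calc s ^ 2 ≤ (64 * J ^ 2) ^ 2 := by gcongr
            _ = _ := by ring
        nlinarith [pow_pos hJ0 4]
      have c2 : 1 ≤ 64 ^ (9 / 8 : ℝ) * τ * J ^ (9 / 4 : ℝ) := by
        have e1 : J ^ (9 / 4 : ℝ) = (J ^ 2) ^ (9 / 8 : ℝ) := by
          rw [← Real.rpow_natCast, ← Real.rpow_mul hJ0.le]; norm_num
        rw [hτ, Real.rpow_neg hT0.le, e1, mul_right_comm, ← Real.mul_rpow (by norm_num) (by positivity),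
          ← div_eq_mul_inv, one_le_div (by positivity)]
        exact Real.rpow_le_rpow hT0.le hTJ (by norm_num)
      have c3 : J ^ 4 * J ^ (9 / 4 : ℝ) ≤ J ^ (11 : ℝ) := by
        rw [← Real.rpow_natCast, ← Real.rpow_add hJ0]
        exact Real.rpow_le_rpow_of_exponent_le hj1 (by norm_num)
      rw [Set.indicator_of_mem hmem, Real.norm_of_nonneg (by positivity)]
      calc _ ≤ _ := b1
        _ ≤ 5000 * J ^ 4 * (9 * (C₂ * C₁ * wordSum 6 f z)) := by gcongr
        _ ≤ 5000 * J ^ 4 * (9 * (C₂ * C₁ * wordSum 6 f z)) * (64 ^ (9 / 8 : ℝ) * τ * J ^ (9 / 4 : ℝ)) :=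
            le_mul_of_one_le_right (by positivity) c2
        _ = D * τ * ((J ^ 4 * J ^ (9 / 4 : ℝ)) * wordSum 6 f z) := by rw [hD]; ring
        _ ≤ _ := by gcongr
  have hj : ∀ j, eLpNorm (mX j (mX j (freeEvolutionSchwartz s (lapS (lapS g))))) 2 volume
      ≤ ENNReal.ofReal (D * τ) * N := by
    intro j
    rw [mX_freeEvolutionSchwartz, mX_freeEvolutionSchwartz, eLpNorm_freeEvolutionSchwartz, hN,
      ← eLpNorm_indicator_eq_eLpNorm_restrict (measurableSet_ext _)]
    exact eLpNorm_le_mul_eLpNorm_of_ae_le_mul (Eventually.of_forall (pw j)) 2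
  refine (h0 R hR0.le _).trans ?_
  calc _ ≤ ENNReal.ofReal C₀ * ∑ _j : Fin 3, ENNReal.ofReal (D * τ) * N := by
        gcongr with j
        exact hj j
    _ = _ := by
        have e3 : ENNReal.ofReal (C₀ * (3 * D) * τ) = ENNReal.ofReal C₀ * (3 * ENNReal.ofReal (D * τ)) := by
          rw [show C₀ * (3 * D) * τ = C₀ * (3 * (D * τ)) by ring, ENNReal.ofReal_mul hC₀,
            ENNReal.ofReal_mul (by norm_num)]
          norm_num
        rw [e3, Finset.sum_const, Finset.card_univ, Fintype.card_fin, nsmul_eq_mul]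
        push_cast
        ring

/-- Both Laplacians are moved through the projection, which multiplies `w` by `e^{4t}`, and through
the propagator. The data are then split at scale `√(R² + s)`, and the near and far bounds are added.
-/
theorem exists_outgoing_bound {ρ : ℝ} (hρ : 0 < ρ) {w : ℝ → ℂ} (hw : IsSmoothWeight w) :
    ∃ C : ℝ, 0 ≤ C ∧ ∀ (R s : ℝ), ρ ≤ R → 0 < s → ∀ f : 𝓢(E3, ℂ),
      eLpNorm (fun y => ((‖y‖ ^ 2 : ℝ) : ℂ) * lapS (lapS (halfProj (-1) hw (freeEvolutionSchwartz s f))) y) 2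
          (volume.restrict (ext R))
        ≤ ENNReal.ofReal (C * (R ^ 2 + s) ^ (-(9 / 8) : ℝ)) *
          (eLpNorm (fun z => japaneseBracket z ^ (11 : ℝ) * ‖f z‖) 2 volume
            + eLpNorm (fun z => japaneseBracket z ^ (11 : ℝ) * wordSum 6 f z) 2 (volume.restrict (ext (ρ / 8)))) := by
  have hw4 := (((hw.exp_mul 1).exp_mul 1).exp_mul 1).exp_mul 1
  obtain ⟨C₁, hC₁, h1⟩ := exists_outgoing_near_bound hρ hw4
  obtain ⟨C₂, hC₂, h2⟩ := exists_outgoing_far_bound hρ hw4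
  refine ⟨C₁ + C₂, by positivity, fun R s hR hs f => ?_⟩
  have hR0 : 0 < R := hρ.trans_le hR
  have n1 := h1 R s hR hs f
  have n2 := h2 R s hR hs f
  set g₁ := mulS (scaledBump (Real.sqrt (R ^ 2 + s))) f with hg₁
  set g₂ := mulS (fun z => 1 - scaledBump (Real.sqrt (R ^ 2 + s)) z) f with hg₂
  have hψ : Function.HasTemperateGrowth (fun z => 1 - scaledBump (Real.sqrt (R ^ 2 + s)) z) :=
    (Function.HasTemperateGrowth.const 1).sub (hasTemperateGrowth_scaledBump _)
  have hf : f = g₁ + g₂ := by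
    ext z
    rw [add_apply, hg₁, hg₂, mulS_apply (hasTemperateGrowth_scaledBump _), mulS_apply hψ]
    ring
  have lapE : ∀ u, lapS (freeEvolutionSchwartz s u) = freeEvolutionSchwartz s (lapS u) := fun u => by
    simp only [lapS_apply, map_sum, freeEvolutionSchwartz_dX]
  have e : (fun y => ((‖y‖ ^ 2 : ℝ) : ℂ) * lapS (lapS (halfProj (-1) hw (freeEvolutionSchwartz s f))) y)
      = (fun y => ((‖y‖ ^ 2 : ℝ) : ℂ) * halfProj (-1) hw4 (freeEvolutionSchwartz s (lapS (lapS g₁))) y)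
        + fun y => ((‖y‖ ^ 2 : ℝ) : ℂ) * halfProj (-1) hw4 (freeEvolutionSchwartz s (lapS (lapS g₂))) y := by
    ext1 y
    rw [Pi.add_apply, ← mul_add, ← add_apply, ← map_add, ← map_add, ← map_add, ← map_add, ← hf,
      lapS_halfProj, lapS_halfProj, lapE, lapE]
  have hc : ∀ u : 𝓢(E3, ℂ), AEStronglyMeasurable (fun y => ((‖y‖ ^ 2 : ℝ) : ℂ) * u y) (volume.restrict (ext R)) :=
    fun u => by
      have := u.continuous
      exact Continuous.aestronglyMeasurable (by fun_prop)
  rw [e]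
  have hτ0 : 0 ≤ (R ^ 2 + s) ^ (-(9 / 8) : ℝ) := by positivity
  refine (eLpNorm_add_le (hc _) (hc _) (by norm_num)).trans ((add_le_add n1 n2).trans ?_)
  rw [mul_add]
  gcongr <;> linarith

/-! ### The Hamiltonian of a compactly perturbed metric on Schwartz functions -/

theorem hasTemperateGrowth_of_eq_const {f : E3 → ℂ} (hf : ContDiff ℝ ∞ f) {r : ℝ} {c : ℂ}
    (h : ∀ x, r < ‖x‖ → f x = c) : f.HasTemperateGrowth := by
  have hc : HasCompactSupport (fun x => f x - c) := by
    refine HasCompactSupport.intro (isCompact_closedBall 0 r) fun x hx => ?_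
    rw [h x (by simpa using hx), sub_self]
  have := (hc.hasTemperateGrowth (hf.sub contDiff_const)).add (Function.HasTemperateGrowth.const c)
  convert this using 1
  ext x
  simp

theorem exists_norm_le_of_eq_const {F : Type*} [NormedAddCommGroup F] {f : E3 → F} (hf : Continuous f) {r : ℝ} {c : F}
    (h : ∀ x, r < ‖x‖ → f x = c) : ∃ C : ℝ, 0 < C ∧ ∀ x, ‖f x‖ ≤ C := by
  obtain ⟨C, hC⟩ := (isCompact_closedBall (0 : E3) r).exists_bound_of_continuousOn hf.continuousOn
  refine ⟨max (max C ‖c‖) 1, lt_max_of_lt_right one_pos, fun x => ?_⟩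
  by_cases hx : r < ‖x‖
  · rw [h x hx]; exact (le_max_right _ _).trans (le_max_left _ _)
  · exact (hC x (by simpa using hx)).trans ((le_max_left _ _).trans (le_max_left _ _))

namespace CompactPerturbation

variable {R₀ : ℝ} (M : CompactPerturbation R₀)

theorem contDiff_det : ContDiff ℝ ∞ fun x => (M.g x).det := by
  have h := M.smooth
  simp only [Matrix.det_fin_three]
  fun_prop

theorem det_pos (x : E3) : 0 < (M.g x).det := (M.posDef x).det_pos

theorem density_pos (x : E3) : 0 < M.density x := Real.sqrt_pos.2 (M.det_pos x)

theorem contDiff_density : ContDiff ℝ ∞ M.density := M.contDiff_det.sqrt fun x => (M.det_pos x).ne'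

theorem density_eq_one {x : E3} (hx : R₀ < ‖x‖) : M.density x = 1 := by
  rw [density, M.euclidean x hx, Matrix.det_one, Real.sqrt_one]

theorem contDiff_inv (i j : Fin 3) : ContDiff ℝ ∞ fun x => (M.g x)⁻¹ i j := by
  have h := M.smooth
  have hd : ContDiff ℝ ∞ fun x => ((M.g x).det)⁻¹ := M.contDiff_det.inv fun x => (M.det_pos x).ne'
  simp only [Matrix.inv_def, Ring.inverse_eq_inv', Matrix.smul_apply, smul_eq_mul]
  refine hd.mul ?_
  simp only [Matrix.adjugate_fin_three]
  fin_cases i <;> fin_cases j <;> simp <;> fun_prop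

/-- The coefficients `√(det g) g^{ij}` of the Laplace–Beltrami operator. -/
def coeff (i j : Fin 3) (x : E3) : ℝ := M.density x * (M.g x)⁻¹ i j

theorem contDiff_coeff (i j : Fin 3) : ContDiff ℝ ∞ (M.coeff i j) := M.contDiff_density.mul (M.contDiff_inv i j)

theorem coeff_eq {i j : Fin 3} {x : E3} (hx : R₀ < ‖x‖) : M.coeff i j x = if i = j then 1 else 0 := by
  rw [coeff, M.density_eq_one hx, M.euclidean x hx, inv_one, Matrix.one_apply, one_mul]

theorem hasTemperateGrowth_coeff (i j : Fin 3) : (fun x => (M.coeff i j x : ℂ)).HasTemperateGrowth :=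
  hasTemperateGrowth_of_eq_const (Complex.ofRealCLM.contDiff.comp (M.contDiff_coeff i j))
    (c := ((if i = j then 1 else 0 : ℝ) : ℂ)) fun x hx => by rw [M.coeff_eq hx]

theorem hasTemperateGrowth_density : (fun x => (M.density x : ℂ)).HasTemperateGrowth :=
  hasTemperateGrowth_of_eq_const (Complex.ofRealCLM.contDiff.comp M.contDiff_density)
    (c := 1) fun x hx => by rw [M.density_eq_one hx, Complex.ofReal_one]

theorem hasTemperateGrowth_density_inv : (fun x => ((M.density x)⁻¹ : ℂ)).HasTemperateGrowth := by
  have h : ContDiff ℝ ∞ fun x => ((M.density x)⁻¹) := M.contDiff_density.inv fun x => (M.density_pos x).ne'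
  have h2 : ContDiff ℝ ∞ fun x => (((M.density x)⁻¹ : ℝ) : ℂ) := Complex.ofRealCLM.contDiff.comp h
  push_cast at h2
  exact hasTemperateGrowth_of_eq_const h2 (c := 1) fun x hx => by
    rw [M.density_eq_one hx, Complex.ofReal_one, inv_one]

/-- The divergence form operator `∂_i (√(det g) g^{ij} ∂_j u)`. -/
def divS : 𝓢(E3, ℂ) →L[ℂ] 𝓢(E3, ℂ) :=
  ∑ i, dX i ∘SL ∑ j, mulS (fun x => (M.coeff i j x : ℂ)) ∘SL dX j

theorem divS_apply (u : 𝓢(E3, ℂ)) : M.divS u = ∑ i, dX i (∑ j, mulS (fun x => (M.coeff i j x : ℂ)) (dX j u)) := by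
  simp [divS]

/-- The Hamiltonian as an operator on the Schwartz space. -/
def hamS : 𝓢(E3, ℂ) →L[ℂ] 𝓢(E3, ℂ) :=
  (-(1 / 2 : ℂ)) • (mulS (fun x => ((M.density x)⁻¹ : ℂ)) ∘SL M.divS)

theorem hamS_coe (u : 𝓢(E3, ℂ)) : ⇑(M.hamS u) = M.hamiltonian u := by
  ext x
  rw [hamS, smul_apply, ContinuousLinearMap.comp_apply, smul_apply, mulS_apply M.hasTemperateGrowth_density_inv, divS_apply,
    hamiltonian, laplaceBeltrami, smul_eq_mul, sum_apply]
  push_cast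
  congr 2
  refine Finset.sum_congr rfl fun i _ => ?_
  rw [dX_apply]
  congr 1
  ext y
  rw [sum_apply]
  refine Finset.sum_congr rfl fun j _ => ?_
  rw [mulS_apply (M.hasTemperateGrowth_coeff i j), dX_apply]
  simp [coeff]

/-- The operator `1 + H` on the Schwartz space. -/
def onePlusS : 𝓢(E3, ℂ) →L[ℂ] 𝓢(E3, ℂ) := ContinuousLinearMap.id ℂ _ + M.hamS

theorem onePlusS_apply (u : 𝓢(E3, ℂ)) : M.onePlusS u = u + M.hamS u := rfl

theorem onePlusS_coe (u : 𝓢(E3, ℂ)) : ⇑(M.onePlusS u) = M.onePlusH u := by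
  ext x
  rw [onePlusS_apply, add_apply, hamS_coe]
  rfl

theorem onePlusS_iterate_coe (k : ℕ) (u : 𝓢(E3, ℂ)) : ⇑(M.onePlusS^[k] u) = M.onePlusH^[k] u := by
  induction k generalizing u with
  | zero => rfl
  | succ k ih => rw [Function.iterate_succ_apply, Function.iterate_succ_apply, ih, onePlusS_coe]

theorem sobolevNorm_eq (k : ℕ) (l : ℝ) (u : 𝓢(E3, ℂ)) : M.sobolevNorm k l u =
    eLpNorm (fun x => ((japaneseBracket x ^ l : ℝ) : ℂ) * (M.onePlusS^[k] u) x) 2 M.vol := by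
  rw [onePlusS_iterate_coe]; rfl

theorem sobolevNorm_succ (k : ℕ) (l : ℝ) (u : 𝓢(E3, ℂ)) :
    M.sobolevNorm (k + 1) l u = M.sobolevNorm k l (M.onePlusS u) := by
  rw [sobolevNorm_eq, sobolevNorm_eq, Function.iterate_succ_apply]

theorem hamS_eq_lapS (u : 𝓢(E3, ℂ)) {x : E3} (hx : R₀ < ‖x‖) : M.hamS u x = -(1 / 2) * lapS u x := by
  have hnhds : ∀ᶠ y in 𝓝 x, R₀ < ‖y‖ := continuous_norm.continuousAt.eventually (lt_mem_nhds hx)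
  rw [hamS, smul_apply, ContinuousLinearMap.comp_apply, smul_apply, mulS_apply M.hasTemperateGrowth_density_inv, divS_apply,
    M.density_eq_one hx, smul_eq_mul, sum_apply, lapS_apply, sum_apply]
  simp only [Complex.ofReal_one, inv_one, one_mul]
  congr 1
  refine Finset.sum_congr rfl fun i _ => ?_
  rw [dX_apply, dX_apply]
  refine (partialDeriv_congr_nhds ?_ i).eq_of_nhds
  filter_upwards [hnhds] with y hy
  rw [sum_apply]
  simp [mulS_apply (M.hasTemperateGrowth_coeff i _), M.coeff_eq hy, apply_ite Complex.ofReal]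

/-! ### Comparison of the Riemannian and the Euclidean volume -/

theorem exists_density_le : ∃ C : ℝ, 0 < C ∧ ∀ x, M.density x ≤ C := by
  obtain ⟨C, hC, h⟩ := exists_norm_le_of_eq_const M.contDiff_density.continuous fun x hx => M.density_eq_one hx
  exact ⟨C, hC, fun x => (le_abs_self _).trans (h x)⟩

theorem exists_le_density : ∃ c : ℝ, 0 < c ∧ ∀ x, c ≤ M.density x := by
  have h : Continuous fun x => (M.density x)⁻¹ := M.contDiff_density.continuous.inv₀ fun x => (M.density_pos x).ne'
  obtain ⟨C, hC, h⟩ := exists_norm_le_of_eq_const h (r := R₀) (c := 1) fun x hx => by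
    rw [M.density_eq_one hx, inv_one]
  refine ⟨C⁻¹, by positivity, fun x => ?_⟩
  have := (le_abs_self _).trans (h x)
  exact (inv_le_comm₀ hC (M.density_pos x)).2 this

theorem exists_eLpNorm_vol_le : ∃ C : ℝ, 0 < C ∧ ∀ u : E3 → ℂ,
    eLpNorm u 2 M.vol ≤ ENNReal.ofReal C * eLpNorm u 2 volume := by
  obtain ⟨C, hC, h⟩ := M.exists_density_le
  refine ⟨C ^ (1 / 2 : ℝ), by positivity, fun u => ?_⟩
  have h1 : M.vol ≤ ENNReal.ofReal C • volume := by
    rw [← withDensity_const]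
    exact withDensity_mono (Eventually.of_forall fun x => ENNReal.ofReal_le_ofReal (h x))
  refine (eLpNorm_mono_measure u h1).trans_eq ?_
  rw [eLpNorm_smul_measure_of_ne_top (by norm_num), smul_eq_mul, ENNReal.ofReal_rpow_of_pos hC]
  norm_num

theorem exists_eLpNorm_le_vol : ∃ C : ℝ, 0 < C ∧ ∀ u : E3 → ℂ,
    eLpNorm u 2 volume ≤ ENNReal.ofReal C * eLpNorm u 2 M.vol := by
  obtain ⟨c, hc, h⟩ := M.exists_le_density
  refine ⟨c⁻¹ ^ (1 / 2 : ℝ), by positivity, fun u => ?_⟩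
  have h1 : volume ≤ ENNReal.ofReal c⁻¹ • M.vol := by
    have hm : Measurable fun x => ENNReal.ofReal (M.density x) :=
      ENNReal.measurable_ofReal.comp M.contDiff_density.continuous.measurable
    rw [vol, ← withDensity_smul _ hm]
    conv_lhs => rw [← withDensity_one (μ := (volume : Measure E3))]
    refine withDensity_mono (Eventually.of_forall fun x => ?_)
    rw [Pi.smul_apply, smul_eq_mul, ← ENNReal.ofReal_mul (by positivity), Pi.one_apply, ENNReal.one_le_ofReal,
      inv_mul_eq_div, one_le_div hc]
    exact h x
  refine (eLpNorm_mono_measure u h1).trans_eq ?_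
  rw [eLpNorm_smul_measure_of_ne_top (by norm_num), smul_eq_mul, ENNReal.ofReal_rpow_of_pos (by positivity)]
  norm_num

end CompactPerturbation

/-! ### Weights -/

/-- The weight `(1 + ε² |x|²)^a`. -/
def weight (ε a : ℝ) (x : E3) : ℝ := (1 + ε ^ 2 * ‖x‖ ^ 2) ^ a

theorem weight_pos (ε a : ℝ) (x : E3) : 0 < weight ε a x := by unfold weight; positivity

theorem weight_mul (ε a b : ℝ) (x : E3) : weight ε a x * weight ε b x = weight ε (a + b) x :=
  (Real.rpow_add (by positivity) _ _).symm

theorem weight_one (ε : ℝ) (x : E3) : weight ε 1 x = 1 + ε ^ 2 * ‖x‖ ^ 2 := Real.rpow_one _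

theorem hasTemperateGrowth_weight (ε a : ℝ) : (fun x => (weight ε a x : ℂ)).HasTemperateGrowth := by
  have h1 : (fun x : E3 => (1 + ‖x‖ ^ 2) ^ a).HasTemperateGrowth := Function.hasTemperateGrowth_one_add_norm_sq_rpow E3 a
  have h2 : (fun x : E3 => ε • x).HasTemperateGrowth := (ε • ContinuousLinearMap.id ℝ E3).hasTemperateGrowth
  have h3 := (Complex.ofRealCLM.hasTemperateGrowth).comp (h1.comp h2)
  convert h3 using 1
  ext x
  simp [weight, norm_smul, mul_pow]

theorem partialDeriv_ofReal {f : E3 → ℝ} {f' : E3 →L[ℝ] ℝ} {x : E3} (hf : HasFDerivAt f f' x) (k : Fin 3) :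
    partialDeriv k (fun y => (f y : ℂ)) x = (f' (EuclideanSpace.single k 1) : ℝ) := by
  have h : HasFDerivAt (fun y => (f y : ℂ)) (Complex.ofRealCLM.comp f') x :=
    Complex.ofRealCLM.hasFDerivAt.comp x hf
  rw [partialDeriv, h.fderiv]
  rfl

theorem partialDeriv_weight (ε a : ℝ) (k : Fin 3) (x : E3) :
    partialDeriv k (fun y => (weight ε a y : ℂ)) x = ((2 * a * ε ^ 2 * x k * weight ε (a - 1) x : ℝ) : ℂ) := by
  have h0 : HasFDerivAt (fun y : E3 => 1 + ε ^ 2 * ‖y‖ ^ 2) (ε ^ 2 • (2 • (innerSL ℝ x))) x :=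
    ((hasStrictFDerivAt_norm_sq x).hasFDerivAt.const_mul (ε ^ 2)).const_add 1
  have h1 := h0.rpow_const (p := a) (Or.inl (by positivity))
  have h2 := partialDeriv_ofReal h1 k
  unfold weight
  rw [h2]
  congr 1
  simp [EuclideanSpace.inner_single_right]
  ring

theorem sum_sq_partialDeriv_weight_le (ε a : ℝ) (x : E3) :
    ∑ k : Fin 3, (2 * a * ε ^ 2 * x k * weight ε (a - 1) x) ^ 2 ≤ 4 * a ^ 2 * ε ^ 2 * weight ε a x ^ 2 := by
  have h1 : ∑ k : Fin 3, (2 * a * ε ^ 2 * x k * weight ε (a - 1) x) ^ 2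
      = 4 * a ^ 2 * ε ^ 2 * ((ε ^ 2 * ‖x‖ ^ 2) * weight ε (a - 1) x ^ 2) := by
    rw [EuclideanSpace.real_norm_sq_eq]
    simp only [Fin.sum_univ_three]
    ring
  have h2 : weight ε a x = (1 + ε ^ 2 * ‖x‖ ^ 2) * weight ε (a - 1) x := by
    rw [← weight_one, weight_mul]; congr 1; ring
  rw [h1, h2, mul_pow]
  have : 0 ≤ ε ^ 2 * ‖x‖ ^ 2 := by positivity
  gcongr
  nlinarith

theorem japaneseBracket_rpow (l : ℝ) (x : E3) : japaneseBracket x ^ l = weight 1 (l / 2) x := by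
  rw [japaneseBracket, weight, Real.sqrt_eq_rpow, ← Real.rpow_mul (by positivity)]
  congr 1
  · ring
  · ring

theorem weight_le_japaneseBracket_rpow {ε l : ℝ} (hε : 0 < ε) (hε1 : ε ≤ 1) (hl : 0 ≤ l) (x : E3) :
    weight ε (l / 2) x ≤ japaneseBracket x ^ l := by
  rw [japaneseBracket_rpow]
  unfold weight
  gcongr

theorem japaneseBracket_rpow_le_weight {ε l : ℝ} (hε : 0 < ε) (hε1 : ε ≤ 1) (hl : 0 ≤ l) (x : E3) :
    japaneseBracket x ^ l ≤ (ε ^ 2)⁻¹ ^ (l / 2) * weight ε (l / 2) x := by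
  rw [japaneseBracket_rpow]
  unfold weight
  rw [← Real.mul_rpow (by positivity) (by positivity)]
  gcongr
  have h1 : ε ^ 2 ≤ 1 := pow_le_one₀ hε.le hε1
  have h2 : 1 ≤ (ε ^ 2)⁻¹ := (one_le_inv₀ (by positivity)).2 h1
  rw [mul_add, ← mul_assoc, inv_mul_cancel₀ (by positivity)]
  linarith

/-! ### The weighted energy inequality -/

theorem integral_dX (k : Fin 3) (u : 𝓢(E3, ℂ)) : ∫ x, dX k u x = 0 := by
  have h := fourier_dX k u 0
  rw [SchwartzMap.fourier_coe, Real.fourier_eq] at h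
  simpa using h

theorem partialDeriv_conj (k : Fin 3) (u : 𝓢(E3, ℂ)) (x : E3) :
    partialDeriv k (fun y => (starRingEnd ℂ) (u y)) x = (starRingEnd ℂ) (dX k u x) := by
  have h : HasFDerivAt (fun y => (starRingEnd ℂ) (u y)) ((Complex.conjCLE : ℂ →L[ℝ] ℂ).comp (fderiv ℝ u x)) x :=
    (Complex.conjCLE : ℂ →L[ℝ] ℂ).hasFDerivAt.comp x (u.differentiable x).hasFDerivAt
  rw [partialDeriv, h.fderiv]
  rfl

theorem hasTemperateGrowth_conj (u : 𝓢(E3, ℂ)) : (fun y => (starRingEnd ℂ) (u y)).HasTemperateGrowth :=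
  (Complex.conjCLE : ℂ →L[ℝ] ℂ).hasTemperateGrowth.comp u.hasTemperateGrowth

theorem integrable_mul_sq_norm {g : E3 → ℂ} (hg : g.HasTemperateGrowth) (v : 𝓢(E3, ℂ)) :
    Integrable (fun x => ‖g x‖ * ‖v x‖ ^ 2) := by
  have h := (mulS (fun x => g x * v x) v).integrable (μ := volume) |>.norm
  refine h.congr (Eventually.of_forall fun x => ?_)
  simp only
  rw [mulS_apply (g := fun x => g x * v x) (hg.mul v.hasTemperateGrowth), norm_mul, norm_mul]
  ring

/-- Positivity of the form at the vector `o q + p d` is, after expansion, this inequality: the cross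
term is absorbed by completing the square. -/
theorem quadForm_energy_le {b : Fin 3 → Fin 3 → ℝ} (hs : ∀ i j, b i j = b j i)
    (hb : ∀ v : Fin 3 → ℝ, 0 ≤ ∑ i, ∑ j, b i j * v i * v j) (o p : ℝ) (d q : Fin 3 → ℝ) :
    -(p ^ 2 * ∑ i, ∑ j, b i j * d i * d j) ≤ ∑ i, (o ^ 2 * q i + 2 * o * d i * p) * ∑ j, b i j * q j := by
  have h := hb fun i => o * q i + p * d i
  have h01 := hs 0 1
  have h02 := hs 0 2
  have h12 := hs 1 2
  simp only [Fin.sum_univ_three] at h ⊢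
  rw [← h01, ← h02, ← h12] at h ⊢
  nlinarith

namespace CompactPerturbation

variable {R₀ : ℝ} (M : CompactPerturbation R₀)

theorem coeff_symm (i j : Fin 3) (x : E3) : M.coeff i j x = M.coeff j i x := by
  have h := (M.posDef x).inv.isHermitian.apply i j
  rw [coeff, coeff, ← h]
  simp

theorem coeff_quadForm_nonneg (x : E3) (v : Fin 3 → ℝ) : 0 ≤ ∑ i, ∑ j, M.coeff i j x * v i * v j := by
  have h := (M.posDef x).inv.posSemidef.dotProduct_mulVec_nonneg v
  have e : ∑ i, ∑ j, M.coeff i j x * v i * v j = M.density x * (star v ⬝ᵥ ((M.g x)⁻¹).mulVec v) := by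
    simp only [coeff, dotProduct, Matrix.mulVec, Finset.mul_sum, Pi.star_apply, star_trivial]
    refine Finset.sum_congr rfl fun i _ => Finset.sum_congr rfl fun j _ => ?_
    ring
  rw [e]
  exact mul_nonneg (M.density_pos x).le h

theorem exists_coeff_quadForm_le : ∃ C : ℝ, 0 < C ∧ ∀ x (v : Fin 3 → ℝ),
    ∑ i, ∑ j, M.coeff i j x * v i * v j ≤ C * ∑ i, v i ^ 2 := by
  have h : ∀ i j, ∃ C : ℝ, 0 < C ∧ ∀ x, ‖M.coeff i j x‖ ≤ C := fun i j =>
    exists_norm_le_of_eq_const (M.contDiff_coeff i j).continuous fun x hx => M.coeff_eq hx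
  choose C hC h using h
  refine ⟨∑ i, ∑ j, C i j, Finset.sum_pos (fun i _ => Finset.sum_pos (fun j _ => hC i j) Finset.univ_nonempty)
    Finset.univ_nonempty, fun x v => ?_⟩
  rw [Finset.sum_mul]
  refine Finset.sum_le_sum fun i _ => ?_
  rw [Finset.sum_mul]
  refine Finset.sum_le_sum fun j _ => ?_
  have h1 : |v i * v j| ≤ ∑ k, v k ^ 2 := by
    have hi : v i ^ 2 ≤ ∑ k, v k ^ 2 := Finset.single_le_sum (f := fun k => v k ^ 2) (fun _ _ => sq_nonneg _) (Finset.mem_univ i)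
    have hj : v j ^ 2 ≤ ∑ k, v k ^ 2 := Finset.single_le_sum (f := fun k => v k ^ 2) (fun _ _ => sq_nonneg _) (Finset.mem_univ j)
    rw [abs_le]
    constructor <;> nlinarith [sq_nonneg (v i - v j), sq_nonneg (v i + v j)]
  calc _ ≤ |M.coeff i j x * v i * v j| := le_abs_self _
    _ = |M.coeff i j x| * |v i * v j| := by rw [mul_assoc, abs_mul]
    _ ≤ _ := mul_le_mul (h i j x) h1 (abs_nonneg _) (hC i j).le

/-- The equation `(1 + H) u = h` is tested against `θ² ū`. Completing the square in the gradient
term leaves an error `|u|²` times the form evaluated at `∇θ`, which `hb` bounds by `ρ θ² |u|²`, with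
`ρ` the density. The zeroth order term has coefficient `2`, so one copy survives, and `2 Re(ū h) ≤
|u|²/2 + 2|h|²` gives the factor `4`. -/
theorem integral_energy_le {θ : E3 → ℝ} {d : Fin 3 → E3 → ℝ} (hθ : (fun x => (θ x : ℂ)).HasTemperateGrowth)
    (hd : ∀ k x, partialDeriv k (fun x => (θ x : ℂ)) x = (d k x : ℂ))
    (hb : ∀ x, ∑ i, ∑ j, M.coeff i j x * d i x * d j x ≤ M.density x * θ x ^ 2) (u : 𝓢(E3, ℂ)) :
    ∫ x, M.density x * ‖mulS (fun x => (θ x : ℂ)) u x‖ ^ 2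
      ≤ 4 * ∫ x, M.density x * ‖mulS (fun x => (θ x : ℂ)) (M.onePlusS u) x‖ ^ 2 := by
  set F : Fin 3 → 𝓢(E3, ℂ) := fun i => ∑ j, mulS (fun x => (M.coeff i j x : ℂ)) (dX j u) with hF
  have hG0 : (fun x => (θ x : ℂ) * θ x).HasTemperateGrowth := hθ.mul hθ
  set G : E3 → ℂ := fun x => ((θ x : ℂ) * θ x) * (starRingEnd ℂ) (u x) with hG
  have hGt : G.HasTemperateGrowth := hG0.mul (hasTemperateGrowth_conj u)
  have hGd : ∀ k x, partialDeriv k G x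
      = ((θ x : ℂ) * θ x) * (starRingEnd ℂ) (dX k u x) + 2 * (θ x * d k x) * (starRingEnd ℂ) (u x) := by
    intro k x
    have e1 : DifferentiableAt ℝ (fun x => (θ x : ℂ)) x := hθ.1.differentiable (by simp) x
    rw [hG, partialDeriv_mul k (hG0.1.differentiable (by simp) x)
      ((hasTemperateGrowth_conj u).1.differentiable (by simp) x), partialDeriv_conj, partialDeriv_mul k e1 e1, hd]
    ring
  have hZ : ∀ i x, dX i (mulS G (F i)) x = G x * dX i (F i) x + partialDeriv i G x * F i x := by
    intro i x
    rw [dX_mulS hGt, add_apply, mulS_apply hGt, mulS_apply (hGt.partialDeriv i)]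
  -- `Z` is the divergence of `θ² ū` times the flux; its integral is zero, which replaces an
  -- explicit integration by parts.
  set Z : 𝓢(E3, ℂ) := ∑ i, dX i (mulS G (F i)) with hZdef
  have hZ0 : ∫ x, (Z x).re = 0 := by
    have h1 : ∫ x, Z x = 0 := by
      simp only [hZdef, sum_apply]
      rw [integral_finsetSum _ fun i _ => (dX i (mulS G (F i))).integrable]
      simp [integral_dX]
    have h2 := Complex.reCLM.integral_comp_comm (Z.integrable (μ := volume))
    simp only [Complex.reCLM_apply] at h2
    rw [h2, h1, Complex.zero_re]
  have hi : ∀ v : 𝓢(E3, ℂ), Integrable (fun x => M.density x * ‖mulS (fun x => (θ x : ℂ)) v x‖ ^ 2) := by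
    intro v
    refine (integrable_mul_sq_norm M.hasTemperateGrowth_density (mulS (fun x => (θ x : ℂ)) v)).congr
      (Eventually.of_forall fun x => ?_)
    simp only [Complex.norm_real, Real.norm_of_nonneg (M.density_pos x).le]
  have hre : Integrable fun x => (Z x).re := Complex.reCLM.integrable_comp (Z.integrable (μ := volume))
  have key : ∀ x, M.density x * ‖mulS (fun x => (θ x : ℂ)) u x‖ ^ 2
      ≤ 4 * (M.density x * ‖mulS (fun x => (θ x : ℂ)) (M.onePlusS u) x‖ ^ 2) + 2 * (Z x).re := by
    intro x
    have hρ := M.density_pos x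
    set h := M.onePlusS u x with hh
    have e1 : M.divS u x = 2 * (M.density x : ℂ) * (u x - h) := by
      have hρ' : (M.density x : ℂ) ≠ 0 := by exact_mod_cast hρ.ne'
      rw [hh, onePlusS_apply, add_apply, hamS, smul_apply, ContinuousLinearMap.comp_apply, smul_apply,
        mulS_apply M.hasTemperateGrowth_density_inv, smul_eq_mul]
      field_simp
      ring
    have e2 : Z x = G x * M.divS u x + ∑ i, partialDeriv i G x * F i x := by
      have e : M.divS u = ∑ i, dX i (F i) := M.divS_apply u
      rw [e, hZdef, sum_apply, sum_apply, Finset.mul_sum, ← Finset.sum_add_distrib]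
      exact Finset.sum_congr rfl fun i _ => hZ i x
    have e3 : (∑ i, partialDeriv i G x * F i x).re
        = (∑ i, (θ x ^ 2 * (dX i u x).re + 2 * θ x * d i x * (u x).re) * ∑ j, M.coeff i j x * (dX j u x).re)
          + ∑ i, (θ x ^ 2 * (dX i u x).im + 2 * θ x * d i x * (u x).im) * ∑ j, M.coeff i j x * (dX j u x).im := by
      have hFx : ∀ i, F i x = ∑ j, (M.coeff i j x : ℂ) * dX j u x := fun i => by
        simp only [hF, sum_apply, mulS_apply (M.hasTemperateGrowth_coeff i _)]
      rw [Complex.re_sum, ← Finset.sum_add_distrib]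
      refine Finset.sum_congr rfl fun i _ => ?_
      rw [hGd, hFx, Complex.mul_re]
      simp only [Complex.add_re, Complex.add_im, Complex.mul_re, Complex.mul_im, Complex.conj_re, Complex.conj_im,
        Complex.ofReal_re, Complex.ofReal_im, Complex.re_sum, Complex.im_sum, Complex.re_ofNat, Complex.im_ofNat]
      simp only [zero_mul, mul_zero, sub_zero, add_zero]
      ring
    have q1 := quadForm_energy_le (fun i j => M.coeff_symm i j x) (M.coeff_quadForm_nonneg x) (θ x) (u x).re
      (fun i => d i x) fun i => (dX i u x).re
    have q2 := quadForm_energy_le (fun i j => M.coeff_symm i j x) (M.coeff_quadForm_nonneg x) (θ x) (u x).im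
      (fun i => d i x) fun i => (dX i u x).im
    have e4 : (G x * M.divS u x).re = 2 * M.density x * θ x ^ 2 *
        ((u x).re * ((u x).re - h.re) + (u x).im * ((u x).im - h.im)) := by
      rw [e1, hG]
      simp only [Complex.sub_re, Complex.sub_im, Complex.mul_re, Complex.mul_im, Complex.conj_re, Complex.conj_im,
        Complex.ofReal_re, Complex.ofReal_im, Complex.re_ofNat, Complex.im_ofNat]
      ring
    have n1 : ∀ z : ℂ, ‖(θ x : ℂ) * z‖ ^ 2 = θ x ^ 2 * (z.re ^ 2 + z.im ^ 2) := fun z => by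
      rw [norm_mul, mul_pow, Complex.norm_real, Real.norm_eq_abs, sq_abs, Complex.sq_norm, Complex.normSq_apply]
      ring
    rw [mulS_apply hθ, mulS_apply hθ, n1, n1, e2, Complex.add_re, e3, e4]
    have hb' := mul_le_mul_of_nonneg_left (hb x) (add_nonneg (sq_nonneg (u x).re) (sq_nonneg (u x).im))
    have hsq : 0 ≤ M.density x * θ x ^ 2 * (((u x).re - 2 * h.re) ^ 2 + ((u x).im - 2 * h.im) ^ 2) := by positivity
    nlinarith
  calc _ ≤ ∫ x, (4 * (M.density x * ‖mulS (fun x => (θ x : ℂ)) (M.onePlusS u) x‖ ^ 2) + 2 * (Z x).re) :=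
        integral_mono (hi u) (((hi _).const_mul 4).add (hre.const_mul 2)) key
    _ = _ := by
        rw [integral_add ((hi _).const_mul 4) (hre.const_mul 2), integral_const_mul, integral_const_mul, hZ0]
        ring

theorem eLpNorm_vol_sq (v : 𝓢(E3, ℂ)) :
    eLpNorm v 2 M.vol ^ 2 = ENNReal.ofReal (∫ x, M.density x * ‖v x‖ ^ 2) := by
  have hm : Measurable fun x => ENNReal.ofReal (M.density x) :=
    ENNReal.measurable_ofReal.comp M.contDiff_density.continuous.measurable
  have hi : Integrable (fun x => M.density x * ‖v x‖ ^ 2) := by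
    refine (integrable_mul_sq_norm M.hasTemperateGrowth_density v).congr (Eventually.of_forall fun x => ?_)
    simp only [Complex.norm_real, Real.norm_of_nonneg (M.density_pos x).le]
  rw [eLpNorm_two_sq, vol, lintegral_withDensity_eq_lintegral_mul _ hm (by fun_prop),
    ofReal_integral_eq_lintegral_ofReal hi (Eventually.of_forall fun x => mul_nonneg (M.density_pos x).le (sq_nonneg _))]
  refine lintegral_congr fun x => ?_
  rw [Pi.mul_apply, ENNReal.ofReal_mul (M.density_pos x).le, ENNReal.ofReal_pow (norm_nonneg _), ofReal_norm]

/-- The weight `⟨x⟩^l` may vary too fast for the energy inequality. The slower weight `(1 +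
ε²|x|²)^{l/2}` satisfies `|∇θ| ≤ l ε θ`, and is comparable to `⟨x⟩^l` for fixed `ε`. -/
theorem exists_sobolevNorm_zero_le {l : ℝ} (hl : 0 ≤ l) : ∃ C : ℝ, 0 ≤ C ∧ ∀ u : 𝓢(E3, ℂ),
    M.sobolevNorm 0 l u ≤ ENNReal.ofReal C * M.sobolevNorm 0 l (M.onePlusS u) := by
  obtain ⟨c, hc, hρ⟩ := M.exists_le_density
  obtain ⟨Λ, hΛ, hq⟩ := M.exists_coeff_quadForm_le
  set a := l / 2 with ha
  -- This choice gives `4Λa²ε² ≤ c`, which is the smallness asked of `∇θ`, and at the same time `ε ≤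
  -- 1`.
  set ε := Real.sqrt (c / (c + Λ * (4 * a ^ 2))) with hε
  have hε2 : ε ^ 2 = c / (c + Λ * (4 * a ^ 2)) := Real.sq_sqrt (by positivity)
  have hε0 : 0 < ε := Real.sqrt_pos.2 (by positivity)
  have hε1 : ε ≤ 1 := Real.sqrt_le_one.2 ((div_le_one (by positivity)).2 (by nlinarith [sq_nonneg a]))
  have hsmall : Λ * (4 * a ^ 2) * ε ^ 2 ≤ c := by
    rw [hε2, mul_div_assoc', div_le_iff₀ (by positivity)]
    nlinarith [mul_pos hc hc]
  set θ := weight ε a with hθ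
  have hb : ∀ x, ∑ i, ∑ j, M.coeff i j x * (2 * a * ε ^ 2 * x i * weight ε (a - 1) x)
      * (2 * a * ε ^ 2 * x j * weight ε (a - 1) x) ≤ M.density x * θ x ^ 2 := by
    intro x
    refine (hq x _).trans ?_
    calc _ ≤ Λ * (4 * a ^ 2 * ε ^ 2 * weight ε a x ^ 2) := by
          gcongr
          exact sum_sq_partialDeriv_weight_le ε a x
      _ = (Λ * (4 * a ^ 2) * ε ^ 2) * θ x ^ 2 := by rw [hθ]; ring
      _ ≤ M.density x * θ x ^ 2 := by
          gcongr
          exact hsmall.trans (hρ x)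
  have hθt := hasTemperateGrowth_weight ε a
  have main : ∀ u : 𝓢(E3, ℂ), eLpNorm (mulS (fun x => (θ x : ℂ)) u) 2 M.vol
      ≤ 2 * eLpNorm (mulS (fun x => (θ x : ℂ)) (M.onePlusS u)) 2 M.vol := by
    intro u
    have h := M.integral_energy_le hθt (fun k x => partialDeriv_weight ε a k x) hb u
    have h2 := ENNReal.ofReal_le_ofReal h
    rw [ENNReal.ofReal_mul (by norm_num), ← eLpNorm_vol_sq, ← eLpNorm_vol_sq] at h2
    refine (ENNReal.pow_le_pow_left_iff two_ne_zero).1 ?_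
    rw [mul_pow]
    convert h2 using 2
    norm_num
  refine ⟨(ε ^ 2)⁻¹ ^ a * 2, by positivity, fun u => ?_⟩
  have hw : ∀ x, 0 < θ x := weight_pos ε a
  have hj : ∀ x, 0 < japaneseBracket x ^ l := fun x => Real.rpow_pos_of_pos (japaneseBracket_pos x) _
  calc M.sobolevNorm 0 l u ≤ ENNReal.ofReal ((ε ^ 2)⁻¹ ^ a) * eLpNorm (mulS (fun x => (θ x : ℂ)) u) 2 M.vol := by
        rw [sobolevNorm_eq]
        refine eLpNorm_le_mul_eLpNorm_of_ae_le_mul (Eventually.of_forall fun x => ?_) 2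
        rw [mulS_apply hθt, norm_mul, norm_mul, Complex.norm_real, Complex.norm_real, Real.norm_of_nonneg (hj x).le,
          Real.norm_of_nonneg (hw x).le, ← mul_assoc]
        exact mul_le_mul_of_nonneg_right (japaneseBracket_rpow_le_weight hε0 hε1 hl x) (norm_nonneg _)
    _ ≤ ENNReal.ofReal ((ε ^ 2)⁻¹ ^ a) * (2 * eLpNorm (mulS (fun x => (θ x : ℂ)) (M.onePlusS u)) 2 M.vol) := by
        gcongr
        exact main u
    _ ≤ ENNReal.ofReal ((ε ^ 2)⁻¹ ^ a) * (2 * M.sobolevNorm 0 l (M.onePlusS u)) := by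
        gcongr
        rw [sobolevNorm_eq]
        refine eLpNorm_mono fun x => ?_
        rw [mulS_apply hθt, norm_mul, norm_mul, Complex.norm_real, Complex.norm_real, Real.norm_of_nonneg (hj x).le,
          Real.norm_of_nonneg (hw x).le]
        exact mul_le_mul_of_nonneg_right (weight_le_japaneseBracket_rpow hε0 hε1 hl x) (norm_nonneg _)
    _ = _ := by
        rw [ENNReal.ofReal_mul (by positivity), mul_assoc]
        norm_num

theorem exists_sobolevNorm_le {l : ℝ} (hl : 0 ≤ l) {j k : ℕ} (hjk : j ≤ k) : ∃ C : ℝ, 0 ≤ C ∧ ∀ u : 𝓢(E3, ℂ),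
    M.sobolevNorm j l u ≤ ENNReal.ofReal C * M.sobolevNorm k l u := by
  obtain ⟨C, hC, h⟩ := M.exists_sobolevNorm_zero_le hl
  induction k, hjk using Nat.le_induction with
  | base => exact ⟨1, zero_le_one, fun u => by simp⟩
  | succ k _ ih =>
    obtain ⟨D, hD, ih⟩ := ih
    refine ⟨D * C, by positivity, fun u => (ih u).trans ?_⟩
    have e : ∀ (n : ℕ) (v : 𝓢(E3, ℂ)), M.sobolevNorm n l v = M.sobolevNorm 0 l (M.onePlusS^[n] v) := fun n v => by
      rw [sobolevNorm_eq, sobolevNorm_eq]; rfl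
    rw [ENNReal.ofReal_mul hD, mul_assoc, e k, e (k + 1), Function.iterate_succ_apply']
    gcongr
    exact h _

end CompactPerturbation

/-! ### Elliptic estimates on the Fourier side -/

theorem norm_fourier_dX_le (k : Fin 3) (u : 𝓢(E3, ℂ)) (ξ : E3) :
    ‖𝓕 (dX k u) ξ‖ ≤ 2 * Real.pi * ‖ξ‖ * ‖𝓕 u ξ‖ := by
  rw [fourier_dX, norm_mul, norm_mul, norm_mul, norm_mul, Complex.norm_I, Complex.norm_two, Complex.norm_real,
    Real.norm_of_nonneg Real.pi_pos.le, mul_one]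
  gcongr
  exact norm_coord_le ξ k

theorem fourier_lapS (u : 𝓢(E3, ℂ)) (ξ : E3) :
    𝓕 (lapS u) ξ = -(((2 * Real.pi * ‖ξ‖) ^ 2 : ℝ) : ℂ) * 𝓕 u ξ := by
  have h : 𝓕 (lapS u) = ∑ k, 𝓕 (dX k (dX k u)) := by
    rw [lapS_apply]
    exact map_sum (FourierTransform.fourierCLM ℂ 𝓢(E3, ℂ)) _ _
  rw [h, sum_apply, mul_pow, EuclideanSpace.real_norm_sq_eq]
  simp only [fourier_dX, Fin.sum_univ_three]
  push_cast
  linear_combination (4 * (Real.pi : ℂ) ^ 2 * 𝓕 u ξ * ((ξ 0 : ℂ) ^ 2 + (ξ 1 : ℂ) ^ 2 + (ξ 2 : ℂ) ^ 2)) * Complex.I_sq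

theorem eLpNorm_dX_dX_le (j k : Fin 3) (v : 𝓢(E3, ℂ)) :
    eLpNorm (dX j (dX k v)) 2 volume ≤ eLpNorm (lapS v) 2 volume := by
  rw [← eLpNorm_fourier (dX j (dX k v)), ← eLpNorm_fourier (lapS v)]
  refine eLpNorm_mono fun ξ => ?_
  rw [fourier_lapS, norm_mul, norm_neg, Complex.norm_real, Real.norm_of_nonneg (by positivity)]
  refine (norm_fourier_dX_le _ _ _).trans ?_
  calc _ ≤ 2 * Real.pi * ‖ξ‖ * (2 * Real.pi * ‖ξ‖ * ‖𝓕 v ξ‖) := by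
        gcongr
        exact norm_fourier_dX_le _ _ _
    _ = _ := by ring

/-- With `t = 2π|ξ|` the relevant multipliers are `t/(1 + t²)` and `t²/(1 + t²)`, both at most `1`.
Sources in divergence form are thus admitted without any derivative falling on them. -/
theorem eLpNorm_dX_le_of_resolvent {v F : 𝓢(E3, ℂ)} {G : Fin 3 → 𝓢(E3, ℂ)} (h : v - lapS v = F + ∑ j, dX j (G j))
    (i : Fin 3) : eLpNorm (dX i v) 2 volume ≤ eLpNorm F 2 volume + ∑ j, eLpNorm (G j) 2 volume := by
  have hf : ∀ ξ, (1 + ((2 * Real.pi * ‖ξ‖) ^ 2 : ℝ) : ℂ) * 𝓕 v ξ = 𝓕 F ξ + ∑ j, 𝓕 (dX j (G j)) ξ := by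
    intro ξ
    have h1 := congrArg (fun u : 𝓢(E3, ℂ) => FourierTransform.fourierCLM ℂ 𝓢(E3, ℂ) u ξ) h
    simp only [map_sub, map_add, map_sum, sub_apply, add_apply, sum_apply, FourierTransform.fourierCLM_apply,
      fourier_lapS] at h1
    rw [← h1]
    ring
  have hp : ∀ ξ, ‖𝓕 (dX i v) ξ‖ ≤ ‖𝓕 F ξ‖ + ∑ j, ‖𝓕 (G j) ξ‖ := by
    intro ξ
    set t := 2 * Real.pi * ‖ξ‖ with ht
    have ht0 : 0 ≤ t := by positivity
    set a := ‖𝓕 F ξ‖ with ha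
    set b := ∑ j, ‖𝓕 (G j) ξ‖ with hb
    have ha0 : 0 ≤ a := norm_nonneg _
    have hb0 : 0 ≤ b := Finset.sum_nonneg fun _ _ => norm_nonneg _
    have h1 : (1 + t ^ 2) * ‖𝓕 v ξ‖ ≤ a + t * b := by
      have h2 := congrArg norm (hf ξ)
      have h3 : ‖(1 + (t ^ 2 : ℝ) : ℂ)‖ = 1 + t ^ 2 := by
        rw [← Complex.ofReal_one, ← Complex.ofReal_add, Complex.norm_real, Real.norm_of_nonneg (by positivity)]
      rw [norm_mul, h3] at h2
      rw [h2, hb, Finset.mul_sum]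
      refine (norm_add_le _ _).trans (add_le_add le_rfl ((norm_sum_le _ _).trans ?_))
      exact Finset.sum_le_sum fun j _ => norm_fourier_dX_le _ _ _
    have h4 : ‖𝓕 (dX i v) ξ‖ ≤ t * ‖𝓕 v ξ‖ := norm_fourier_dX_le _ _ _
    refine h4.trans ?_
    have h5 : t * ((1 + t ^ 2) * ‖𝓕 v ξ‖) ≤ t * (a + t * b) := by gcongr
    have h6 : t * (a + t * b) ≤ (1 + t ^ 2) * (a + b) := by nlinarith [mul_nonneg ha0 (sq_nonneg (t - 1)), mul_nonneg ha0 ht0]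
    have h7 : (1 + t ^ 2) * (t * ‖𝓕 v ξ‖) ≤ (1 + t ^ 2) * (a + b) := by linarith
    exact le_of_mul_le_mul_left h7 (by positivity)
  have hc : ∀ u : 𝓢(E3, ℂ), AEStronglyMeasurable (fun ξ => ‖𝓕 u ξ‖) volume := fun u =>
    (𝓕 u : 𝓢(E3, ℂ)).continuous.norm.aestronglyMeasurable
  rw [← eLpNorm_fourier (dX i v), ← eLpNorm_fourier F]
  simp only [← eLpNorm_fourier (G _)]
  calc eLpNorm (𝓕 (dX i v) : 𝓢(E3, ℂ)) 2 volume
      ≤ eLpNorm ((fun ξ => ‖𝓕 F ξ‖) + ∑ j, fun ξ => ‖𝓕 (G j) ξ‖) 2 volume := by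
        refine eLpNorm_mono_real fun ξ => (hp ξ).trans_eq ?_
        rw [Pi.add_apply, Finset.sum_apply]
    _ ≤ eLpNorm (fun ξ => ‖𝓕 F ξ‖) 2 volume + ∑ j, eLpNorm (fun ξ => ‖𝓕 (G j) ξ‖) 2 volume := by
        refine (eLpNorm_add_le (hc F) (Finset.aestronglyMeasurable_sum _ fun j _ => hc _) (by norm_num)).trans ?_
        gcongr
        exact eLpNorm_sum_le (fun j _ => hc _) (by norm_num)
    _ = _ := by simp only [eLpNorm_norm]

/-! ### Weighted norms in exterior regions -/

/-- The `L²` norm of `(1 + |x|²)^a g` over `{r ≤ |x|}`. -/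
def extNorm (a r : ℝ) (g : E3 → ℝ) : ℝ≥0∞ := eLpNorm (fun x => weight 1 a x * g x) 2 (volume.restrict (ext r))

theorem extNorm_anti {a r r' : ℝ} (h : r ≤ r') (g : E3 → ℝ) : extNorm a r' g ≤ extNorm a r g :=
  eLpNorm_mono_measure _ (Measure.restrict_mono (ext_mono h) le_rfl)

theorem extNorm_le_mul {a r C : ℝ} {g h : E3 → ℝ} (hg : ∀ x ∈ ext r, |g x| ≤ C * |h x|) :
    extNorm a r g ≤ ENNReal.ofReal C * extNorm a r h := by
  refine eLpNorm_le_mul_eLpNorm_of_ae_le_mul ?_ 2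
  filter_upwards [ae_restrict_mem (measurableSet_ext r)] with x hx
  rw [norm_mul, norm_mul, mul_left_comm]
  exact mul_le_mul_of_nonneg_left (hg x hx) (norm_nonneg _)

theorem extNorm_mono {a r : ℝ} {g h : E3 → ℝ} (hg : ∀ x, |g x| ≤ |h x|) : extNorm a r g ≤ extNorm a r h := by
  simpa using extNorm_le_mul (a := a) (r := r) (C := 1) (g := g) (h := h) fun x _ => by rw [one_mul]; exact hg x

theorem continuous_weight (ε a : ℝ) : Continuous (weight ε a) := by
  unfold weight
  exact Continuous.rpow_const (by fun_prop) fun x => Or.inl (by positivity)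

theorem extNorm_add_le (a r : ℝ) {g h : E3 → ℝ} (hg : Continuous g) (hh : Continuous h) :
    extNorm a r (fun x => g x + h x) ≤ extNorm a r g + extNorm a r h := by
  have := continuous_weight 1 a
  refine (eLpNorm_add_le (f := fun x => weight 1 a x * g x) (g := fun x => weight 1 a x * h x)
    (by fun_prop : Continuous _).aestronglyMeasurable (by fun_prop : Continuous _).aestronglyMeasurable
    (by norm_num)).trans_eq' ?_
  rw [extNorm]
  congr 1
  ext x
  simp [mul_add]

theorem extNorm_sum_le {ι : Type*} (s : Finset ι) (a r : ℝ) {g : ι → E3 → ℝ} (hg : ∀ i, Continuous (g i)) :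
    extNorm a r (fun x => ∑ i ∈ s, g i x) ≤ ∑ i ∈ s, extNorm a r (g i) := by
  have := continuous_weight 1 a
  refine (eLpNorm_sum_le (s := s) (f := fun i x => weight 1 a x * g i x)
    (fun i _ => ((continuous_weight 1 a).mul (hg i)).aestronglyMeasurable) (by norm_num)).trans_eq' ?_
  rw [extNorm]
  congr 1
  ext x
  simp [Finset.mul_sum, Finset.sum_apply]

theorem eLpNorm_le_extNorm {a r C : ℝ} {v : E3 → ℂ} {g : E3 → ℝ} (h0 : ∀ x, ‖x‖ < r → v x = 0)
    (h : ∀ x, ‖v x‖ ≤ C * (weight 1 a x * |g x|)) : eLpNorm v 2 volume ≤ ENNReal.ofReal C * extNorm a r g := by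
  rw [extNorm, ← eLpNorm_indicator_eq_eLpNorm_restrict (measurableSet_ext r)]
  refine eLpNorm_le_mul_eLpNorm_of_ae_le_mul (Eventually.of_forall fun x => ?_) 2
  by_cases hx : x ∈ ext r
  · rw [Set.indicator_of_mem hx, norm_mul, Real.norm_of_nonneg (weight_pos _ _ _).le]
    exact h x
  · rw [Set.indicator_of_notMem hx, h0 x (not_le.1 hx)]
    simp

/-! ### Exterior cutoffs of the weights -/

theorem exists_wordSum_weight_le (a : ℝ) : ∃ C : ℝ, 0 ≤ C ∧ ∀ x,
    wordSum 2 (fun y => (weight 1 a y : ℂ)) x ≤ C * weight 1 a x := by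
  have hw : ∀ (b : ℝ) (k : Fin 3) (x : E3), |2 * b * x k * weight 1 (b - 1) x| ≤ 2 * |b| * weight 1 (b - 1 / 2) x := by
    intro b k x
    rw [abs_mul, abs_mul, abs_mul, abs_two, abs_of_pos (weight_pos _ _ _)]
    have h1 : |x k| ≤ weight 1 (1 / 2) x := by
      refine (PiLp.norm_apply_le x k).trans ((norm_le_japaneseBracket x).trans_eq ?_)
      have := japaneseBracket_rpow 1 x
      rwa [Real.rpow_one] at this
    have h2 : weight 1 (1 / 2) x * weight 1 (b - 1) x = weight 1 (b - 1 / 2) x := by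
      rw [weight_mul]; congr 1; ring
    rw [← h2, mul_assoc (2 * |b|)]
    have := weight_pos 1 (b - 1) x
    gcongr
  have hmono : ∀ (b c : ℝ) (x : E3), b ≤ c → weight 1 b x ≤ weight 1 c x := fun b c x hbc =>
    Real.rpow_le_rpow_of_exponent_le (by nlinarith [sq_nonneg ‖x‖]) hbc
  have hd : ∀ (b : ℝ) (k : Fin 3), partialDeriv k (fun y => (weight 1 b y : ℂ))
      = fun y => (((2 * b : ℝ) : ℂ) * ((y k : ℝ) : ℂ)) * (weight 1 (b - 1) y : ℂ) := fun b k => by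
    ext x
    rw [partialDeriv_weight]
    push_cast
    ring
  have h1 : ∀ (b : ℝ) (k : Fin 3) (x : E3), ‖partialDeriv k (fun y => (weight 1 b y : ℂ)) x‖
      ≤ 2 * |b| * weight 1 (b - 1 / 2) x := fun b k x => by
    rw [partialDeriv_weight, Complex.norm_real, Real.norm_eq_abs]
    simpa using hw b k x
  have h2 : ∀ (j k : Fin 3) (x : E3), ‖partialDeriv j (partialDeriv k (fun y => (weight 1 a y : ℂ))) x‖
      ≤ (2 * |a| * (2 * |a - 1|) + 2 * |a|) * weight 1 a x := by
    intro j k x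
    have hx : ContDiff ℝ ∞ fun y : E3 => ((2 * a : ℝ) : ℂ) * ((y k : ℝ) : ℂ) :=
      contDiff_const.mul (coord_hasTemperateGrowth k).1
    have hx2 : ‖partialDeriv j (fun y : E3 => ((2 * a : ℝ) : ℂ) * ((y k : ℝ) : ℂ)) x‖ ≤ 2 * |a| := by
      rw [partialDeriv_fun_mul contDiff_const (coord_hasTemperateGrowth k).1]
      simp only [partialDeriv_const, zero_mul, add_zero]
      rw [partialDeriv_coord, norm_mul, Complex.norm_real, Real.norm_eq_abs, abs_mul, abs_two]
      refine mul_le_of_le_one_right (by positivity) ?_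
      split_ifs <;> simp
    rw [hd, partialDeriv_fun_mul hx (hasTemperateGrowth_weight 1 (a - 1)).1]
    refine (norm_add_le _ _).trans ?_
    rw [norm_mul, norm_mul, norm_mul, Complex.norm_real, Complex.norm_real, Complex.norm_real,
      Real.norm_eq_abs, abs_mul, abs_two, Real.norm_of_nonneg (weight_pos _ _ _).le, add_mul]
    have hk : ‖x k‖ ≤ weight 1 (1 / 2) x := by
      refine (PiLp.norm_apply_le x k).trans ((norm_le_japaneseBracket x).trans_eq ?_)
      have := japaneseBracket_rpow 1 x
      rwa [Real.rpow_one] at this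
    refine add_le_add ?_ ?_
    · calc 2 * |a| * ‖x k‖ * ‖partialDeriv j (fun y => (weight 1 (a - 1) y : ℂ)) x‖
          ≤ 2 * |a| * weight 1 (1 / 2) x * (2 * |a - 1| * weight 1 (a - 1 - 1 / 2) x) := by
            have := weight_pos 1 (1 / 2) x
            gcongr
            exact h1 (a - 1) j x
        _ = 2 * |a| * (2 * |a - 1|) * (weight 1 (1 / 2) x * weight 1 (a - 1 - 1 / 2) x) := by ring
        _ ≤ _ := by
            rw [weight_mul]
            gcongr
            exact hmono _ _ _ (by linarith)
    · exact mul_le_mul hx2 (hmono _ _ _ (by linarith)) (weight_pos _ _ _).le (by positivity)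
  refine ⟨1 + ∑ _k : Fin 3, (2 * |a| + ∑ _j : Fin 3, (2 * |a| * (2 * |a - 1|) + 2 * |a|)), by positivity, fun x => ?_⟩
  have h0 := weight_pos 1 a x
  simp only [wordSum]
  rw [add_mul, Finset.sum_mul, Complex.norm_real, Real.norm_of_nonneg h0.le, one_mul]
  refine add_le_add le_rfl (Finset.sum_le_sum fun k _ => ?_)
  rw [add_mul, Finset.sum_mul]
  refine add_le_add ((h1 a k x).trans ?_) (Finset.sum_le_sum fun j _ => h2 j k x)
  gcongr
  exact hmono _ _ _ (by linarith)

/-- A single multiplier `θ` serves as cutoff between `r` and `r'` and as weight beyond `r'`. Its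
derivatives up to order two remain bounded by the weight itself. -/
theorem exists_exterior_weight (a : ℝ) {r r' : ℝ} (hr : 0 < r) (hrr : r < r') :
    ∃ (C : ℝ) (θ : E3 → ℂ), 0 ≤ C ∧ θ.HasTemperateGrowth ∧ (∀ x, r' ≤ ‖x‖ → θ x = weight 1 a x) ∧
      (∀ x, ‖x‖ < r → wordSum 2 θ x = 0) ∧ ∀ x, wordSum 2 θ x ≤ C * weight 1 a x := by
  obtain ⟨C₁, hC₁, h1⟩ := exists_wordSum_weight_le a
  obtain ⟨C₂, hC₂, h2⟩ := exists_wordSum_mul_le 2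
  set β : ContDiffBump (0 : E3) := ⟨r, r', hr, hrr⟩ with hβ
  set ζ : E3 → ℂ := fun x => ((1 - β x : ℝ) : ℂ) with hζ
  have hζs : ContDiff ℝ ∞ ζ := Complex.ofRealCLM.contDiff.comp (contDiff_const.sub β.contDiff)
  have hζ1 : ∀ x, r' ≤ ‖x‖ → ζ x = 1 := fun x hx => by
    rw [hζ]
    simp only
    rw [β.zero_of_le_dist (by simpa using hx)]
    simp
  have hζ0 : ∀ x, ‖x‖ < r → ζ x = 0 := fun x hx => by
    rw [hζ]
    simp only
    rw [β.one_of_mem_closedBall (by simpa using hx.le)]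
    simp
  have hζt : ζ.HasTemperateGrowth := hasTemperateGrowth_of_eq_const hζs fun x hx => hζ1 x hx.le
  obtain ⟨C₃, hC₃, h3⟩ := exists_norm_le_of_eq_const (continuous_wordSum 2 hζs) (r := r') (c := (1 : ℝ)) fun x hx => by
    have : ζ =ᶠ[𝓝 x] fun _ => 1 := by
      filter_upwards [continuous_norm.continuousAt.eventually (lt_mem_nhds hx)] with y hy using hζ1 y hy.le
    rw [wordSum_congr_nhds 2 this, wordSum_const, norm_one]
  refine ⟨C₂ * C₃ * C₁, fun x => ζ x * (weight 1 a x : ℂ), by positivity, hζt.mul (hasTemperateGrowth_weight 1 a),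
    fun x hx => by simp only [hζ1 x hx, one_mul], fun x hx => ?_, fun x => ?_⟩
  · have : (fun x => ζ x * (weight 1 a x : ℂ)) =ᶠ[𝓝 x] fun _ => 0 := by
      filter_upwards [continuous_norm.continuousAt.eventually (gt_mem_nhds hx)] with y hy
      rw [hζ0 y hy, zero_mul]
    rw [wordSum_congr_nhds 2 this, wordSum_zero_fun]
  · refine (h2 hζs (hasTemperateGrowth_weight 1 a).1 x).trans ?_
    have h4 := (le_abs_self _).trans (h3 x)
    have h5 := wordSum_nonneg 2 (fun x => (weight 1 a x : ℂ)) x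
    calc _ ≤ C₂ * C₃ * (C₁ * weight 1 a x) := by
          gcongr
          exact h1 x
      _ = _ := by ring

/-! ### Exterior elliptic regularity -/

theorem lapS_mulS {θ : E3 → ℂ} (hθ : θ.HasTemperateGrowth) (u : 𝓢(E3, ℂ)) (x : E3) :
    lapS (mulS θ u) x = θ x * lapS u x + 2 * ∑ k, partialDeriv k θ x * dX k u x
      + (∑ k, partialDeriv k (partialDeriv k θ) x) * u x := by
  rw [lapS_apply, lapS_apply, sum_apply, sum_apply, Finset.mul_sum, Finset.mul_sum, Finset.sum_mul,
    ← Finset.sum_add_distrib, ← Finset.sum_add_distrib]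
  refine Finset.sum_congr rfl fun k _ => ?_
  rw [dX_mulS hθ, map_add, dX_mulS hθ, dX_mulS (hθ.partialDeriv k)]
  simp only [add_apply, mulS_apply hθ, mulS_apply (hθ.partialDeriv k), mulS_apply ((hθ.partialDeriv k).partialDeriv k)]
  ring

theorem norm_partialDeriv_le_wordSum (k : Fin 3) (θ : E3 → ℂ) (x : E3) : ‖partialDeriv k θ x‖ ≤ wordSum 2 θ x :=
  (norm_le_wordSum 1 _ x).trans (wordSum_partialDeriv_le 1 k θ x)

theorem norm_partialDeriv_partialDeriv_le_wordSum (j k : Fin 3) (θ : E3 → ℂ) (x : E3) :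
    ‖partialDeriv j (partialDeriv k θ) x‖ ≤ wordSum 2 θ x :=
  (wordSum_partialDeriv_le 0 j _ x).trans (wordSum_partialDeriv_le 1 k θ x)

/-- The resolvent bound is applied to `θu`. The commutator `-2∇θ·∇u` contains the very derivatives
to be estimated, so it is written as the divergence of `-2u∇θ` plus `2uΔθ`; then only `u` and `Δu`
occur on the right. -/
theorem exists_extNorm_dX_le (a : ℝ) {r r' : ℝ} (hr : 0 < r) (hrr : r < r') : ∃ C : ℝ, 0 ≤ C ∧ ∀ (u : 𝓢(E3, ℂ)) (i : Fin 3),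
    extNorm a r' (fun x => ‖dX i u x‖) ≤ ENNReal.ofReal C * extNorm a r (fun x => ‖lapS u x‖ + ‖u x‖) := by
  obtain ⟨C, θ, hC, hθ, hθ1, hθ0, hθb⟩ := exists_exterior_weight a hr hrr
  refine ⟨14 * C, by positivity, fun u i => ?_⟩
  set h : E3 → ℝ := fun x => ‖lapS u x‖ + ‖u x‖ with hh
  have hh0 : ∀ x, 0 ≤ h x := fun x => by positivity
  have hu : ∀ x, ‖u x‖ ≤ h x := fun x => le_add_of_nonneg_left (norm_nonneg _)
  have hl : ∀ x, ‖lapS u x‖ ≤ h x := fun x => le_add_of_nonneg_right (norm_nonneg _)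
  have hθz : ∀ x, ‖x‖ < r → θ x = 0 := fun x hx => norm_le_zero_iff.1 ((norm_le_wordSum 2 θ x).trans_eq (hθ0 x hx))
  have hθkz : ∀ k x, ‖x‖ < r → partialDeriv k θ x = 0 := fun k x hx =>
    norm_le_zero_iff.1 ((norm_partialDeriv_le_wordSum k θ x).trans_eq (hθ0 x hx))
  set L : E3 → ℂ := fun x => ∑ k, partialDeriv k (partialDeriv k θ) x with hL
  have hLt : L.HasTemperateGrowth := by
    have := fun k => (hθ.partialDeriv k).partialDeriv k
    rw [hL]
    simp only [Fin.sum_univ_three]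
    exact ((this 0).add (this 1)).add (this 2)
  have hLb : ∀ x, ‖L x‖ ≤ 3 * wordSum 2 θ x := fun x => by
    refine (norm_sum_le _ _).trans ((Finset.sum_le_sum fun k _ =>
      norm_partialDeriv_partialDeriv_le_wordSum k k θ x).trans_eq ?_)
    simp
  set F : 𝓢(E3, ℂ) := mulS θ u - mulS θ (lapS u) + mulS L u with hF
  set G : Fin 3 → 𝓢(E3, ℂ) := fun k => (-2 : ℂ) • mulS (partialDeriv k θ) u with hG
  have hres : mulS θ u - lapS (mulS θ u) = F + ∑ k, dX k (G k) := by
    ext x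
    have e : ∀ k, dX k (G k) x = -2 * (partialDeriv k θ x * dX k u x + partialDeriv k (partialDeriv k θ) x * u x) := by
      intro k
      rw [hG]
      simp only [map_smul, smul_apply, smul_eq_mul]
      rw [dX_mulS (hθ.partialDeriv k), add_apply, mulS_apply (hθ.partialDeriv k),
        mulS_apply ((hθ.partialDeriv k).partialDeriv k)]
    rw [sub_apply, lapS_mulS hθ, add_apply, hF, add_apply, sub_apply, mulS_apply hθ, mulS_apply hθ, mulS_apply hLt,
      sum_apply]
    simp only [e]
    rw [← Finset.mul_sum, Finset.sum_add_distrib, ← Finset.sum_mul, hL]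
    ring
  have hFb : eLpNorm F 2 volume ≤ ENNReal.ofReal (5 * C) * extNorm a r h := by
    have e : ∀ x, F x = θ x * u x - θ x * lapS u x + L x * u x := fun x => by
      rw [hF, add_apply, sub_apply, mulS_apply hθ, mulS_apply hθ, mulS_apply hLt]
    refine eLpNorm_le_extNorm (fun x hx => ?_) fun x => ?_
    · have hLz : L x = 0 := norm_le_zero_iff.1 ((hLb x).trans_eq (by rw [hθ0 x hx, mul_zero]))
      rw [e, hθz x hx, hLz]
      ring
    · rw [e, abs_of_nonneg (hh0 x)]
      have hn := norm_le_wordSum 2 θ x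
      have hw := wordSum_nonneg 2 θ x
      calc _ ≤ ‖θ x‖ * ‖u x‖ + ‖θ x‖ * ‖lapS u x‖ + ‖L x‖ * ‖u x‖ := by
            rw [← norm_mul, ← norm_mul, ← norm_mul]
            exact (norm_add_le _ _).trans (add_le_add (norm_sub_le _ _) le_rfl)
        _ ≤ wordSum 2 θ x * h x + wordSum 2 θ x * h x + 3 * wordSum 2 θ x * h x := by
            gcongr
            exacts [hu x, hl x, hLb x, hu x]
        _ = 5 * wordSum 2 θ x * h x := by ring
        _ ≤ 5 * (C * weight 1 a x) * h x := by
            gcongr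
            exact hθb x
        _ = _ := by ring
  have hGb : ∀ k, eLpNorm (G k) 2 volume ≤ ENNReal.ofReal (2 * C) * extNorm a r h := by
    intro k
    have e : ∀ x, G k x = -2 * (partialDeriv k θ x * u x) := fun x => by
      rw [hG]
      simp only [smul_apply, smul_eq_mul]
      rw [mulS_apply (hθ.partialDeriv k)]
    refine eLpNorm_le_extNorm (fun x hx => by rw [e, hθkz k x hx]; ring) fun x => ?_
    rw [e, abs_of_nonneg (hh0 x), norm_mul, norm_mul, norm_neg, Complex.norm_two]
    calc _ ≤ 2 * (C * weight 1 a x * h x) := by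
          gcongr
          · exact mul_nonneg hC (weight_pos _ _ _).le
          · exact (norm_partialDeriv_le_wordSum k θ x).trans (hθb x)
          · exact hu x
      _ = _ := by ring
  have hK : eLpNorm (mulS (partialDeriv i θ) u) 2 volume ≤ ENNReal.ofReal C * extNorm a r h := by
    refine eLpNorm_le_extNorm (fun x hx => by rw [mulS_apply (hθ.partialDeriv i), hθkz i x hx, zero_mul]) fun x => ?_
    rw [mulS_apply (hθ.partialDeriv i), abs_of_nonneg (hh0 x), norm_mul, ← mul_assoc]
    gcongr
    · exact mul_nonneg hC (weight_pos _ _ _).le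
    · exact (norm_partialDeriv_le_wordSum i θ x).trans (hθb x)
    · exact hu x
  have hmain := eLpNorm_dX_le_of_resolvent hres i
  calc extNorm a r' (fun x => ‖dX i u x‖) ≤ eLpNorm (mulS θ (dX i u)) 2 (volume.restrict (ext r')) := by
        refine eLpNorm_mono_ae ?_
        filter_upwards [ae_restrict_mem (measurableSet_ext r')] with x hx
        rw [mulS_apply hθ, hθ1 x hx, norm_mul, norm_mul, Complex.norm_real, norm_norm]
    _ ≤ eLpNorm (mulS θ (dX i u)) 2 volume := eLpNorm_mono_measure _ Measure.restrict_le_self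
    _ = eLpNorm (⇑(dX i (mulS θ u)) - ⇑(mulS (partialDeriv i θ) u)) 2 volume := by
        congr 1
        rw [dX_mulS hθ]
        ext x
        simp
    _ ≤ eLpNorm (dX i (mulS θ u)) 2 volume + eLpNorm (mulS (partialDeriv i θ) u) 2 volume :=
        eLpNorm_sub_le (SchwartzMap.continuous _).aestronglyMeasurable (SchwartzMap.continuous _).aestronglyMeasurable
          (by norm_num)
    _ ≤ (ENNReal.ofReal (5 * C) * extNorm a r h + ∑ _k : Fin 3, ENNReal.ofReal (2 * C) * extNorm a r h)
          + ENNReal.ofReal C * extNorm a r h := by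
        refine add_le_add (hmain.trans (add_le_add hFb (Finset.sum_le_sum fun k _ => hGb k))) hK
    _ = (ENNReal.ofReal (5 * C) + ∑ _k : Fin 3, ENNReal.ofReal (2 * C) + ENNReal.ofReal C) * extNorm a r h := by
        rw [← Finset.sum_mul]; ring
    _ ≤ _ := by
        gcongr
        rw [← ENNReal.ofReal_sum_of_nonneg (fun _ _ => by positivity), ← ENNReal.ofReal_add (by positivity) (by positivity),
          ← ENNReal.ofReal_add (by positivity) (by positivity)]
        refine ENNReal.ofReal_le_ofReal ?_
        simp only [Finset.sum_const, Finset.card_univ, Fintype.card_fin, nsmul_eq_mul]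
        push_cast
        linarith

/-- Second derivatives of `θu` are bounded in `L²` by `Δ(θu)`. The commutators now contain at most
first derivatives of `u`, already under control on a slightly larger region. -/
theorem exists_extNorm_dX_dX_le (a : ℝ) {r r' : ℝ} (hr : 0 < r) (hrr : r < r') : ∃ C : ℝ, 0 ≤ C ∧
    ∀ (u : 𝓢(E3, ℂ)) (i j : Fin 3), extNorm a r' (fun x => ‖dX i (dX j u) x‖)
      ≤ ENNReal.ofReal C * extNorm a r (fun x => ‖lapS u x‖ + wordSum 1 u x) := by
  obtain ⟨C, θ, hC, hθ, hθ1, hθ0, hθb⟩ := exists_exterior_weight a hr hrr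
  refine ⟨13 * C, by positivity, fun u i j => ?_⟩
  set h : E3 → ℝ := fun x => ‖lapS u x‖ + wordSum 1 u x with hh
  have hw1 := fun x => wordSum_nonneg 1 u x
  have hh0 : ∀ x, 0 ≤ h x := fun x => add_nonneg (norm_nonneg _) (hw1 x)
  have hu : ∀ x, ‖u x‖ ≤ h x := fun x => (norm_le_wordSum 1 u x).trans (le_add_of_nonneg_left (norm_nonneg _))
  have hd : ∀ k x, ‖dX k u x‖ ≤ h x := fun k x =>
    (wordSum_dX_le 0 k u x).trans (le_add_of_nonneg_left (norm_nonneg _))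
  have hl : ∀ x, ‖lapS u x‖ ≤ h x := fun x => le_add_of_nonneg_right (hw1 x)
  have hθn : ∀ x, ‖θ x‖ ≤ wordSum 2 θ x := norm_le_wordSum 2 θ
  have hθk : ∀ k x, ‖partialDeriv k θ x‖ ≤ wordSum 2 θ x := fun k => norm_partialDeriv_le_wordSum k θ
  have hθkk : ∀ j k x, ‖partialDeriv j (partialDeriv k θ) x‖ ≤ wordSum 2 θ x := fun j k =>
    norm_partialDeriv_partialDeriv_le_wordSum j k θ
  have hθw : ∀ x, 0 ≤ wordSum 2 θ x := wordSum_nonneg 2 θ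
  have hbound : ∀ {v : E3 → ℂ} {c : ℝ}, 0 ≤ c → (∀ x, ‖v x‖ ≤ c * (wordSum 2 θ x * h x)) →
      eLpNorm v 2 volume ≤ ENNReal.ofReal (c * C) * extNorm a r h := by
    intro v c hc hv
    refine eLpNorm_le_extNorm (fun x hx => ?_) fun x => ?_
    · refine norm_le_zero_iff.1 ((hv x).trans_eq ?_)
      rw [hθ0 x hx, zero_mul, mul_zero]
    · rw [abs_of_nonneg (hh0 x), mul_assoc, ← mul_assoc C]
      refine (hv x).trans ?_
      gcongr
      exacts [hh0 x, hθb x]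
  have hlap : eLpNorm (lapS (mulS θ u)) 2 volume ≤ ENNReal.ofReal (10 * C) * extNorm a r h := by
    refine hbound (by norm_num) fun x => ?_
    rw [lapS_mulS hθ, Fin.sum_univ_three, Fin.sum_univ_three]
    have s1 : ‖θ x * lapS u x‖ ≤ wordSum 2 θ x * h x := by
      rw [norm_mul]; exact mul_le_mul (hθn x) (hl x) (norm_nonneg _) (hθw x)
    have s2 : ∀ k, ‖partialDeriv k θ x * dX k u x‖ ≤ wordSum 2 θ x * h x := fun k => by
      rw [norm_mul]; exact mul_le_mul (hθk k x) (hd k x) (norm_nonneg _) (hθw x)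
    have s3 : ∀ k, ‖partialDeriv k (partialDeriv k θ) x * u x‖ ≤ wordSum 2 θ x * h x := fun k => by
      rw [norm_mul]; exact mul_le_mul (hθkk k k x) (hu x) (norm_nonneg _) (hθw x)
    refine (norm_add₃_le).trans ?_
    rw [norm_mul 2, Complex.norm_two, add_mul, add_mul]
    have t1 := (norm_add₃_le (a := partialDeriv 0 θ x * dX 0 u x) (b := partialDeriv 1 θ x * dX 1 u x)
      (c := partialDeriv 2 θ x * dX 2 u x))
    have t2 := (norm_add₃_le (a := partialDeriv 0 (partialDeriv 0 θ) x * u x)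
      (b := partialDeriv 1 (partialDeriv 1 θ) x * u x) (c := partialDeriv 2 (partialDeriv 2 θ) x * u x))
    linarith [s2 0, s2 1, s2 2, s3 0, s3 1, s3 2]
  set K : 𝓢(E3, ℂ) := mulS (partialDeriv j θ) (dX i u) + mulS (partialDeriv i θ) (dX j u)
    + mulS (partialDeriv i (partialDeriv j θ)) u with hK
  have hKb : eLpNorm K 2 volume ≤ ENNReal.ofReal (3 * C) * extNorm a r h := by
    refine hbound (by norm_num) fun x => ?_
    rw [hK, add_apply, add_apply, mulS_apply (hθ.partialDeriv j), mulS_apply (hθ.partialDeriv i),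
      mulS_apply ((hθ.partialDeriv j).partialDeriv i)]
    refine (norm_add₃_le).trans ?_
    rw [norm_mul, norm_mul, norm_mul]
    linarith [mul_le_mul (hθk j x) (hd i x) (norm_nonneg _) (hθw x), mul_le_mul (hθk i x) (hd j x) (norm_nonneg _) (hθw x),
      mul_le_mul (hθkk i j x) (hu x) (norm_nonneg _) (hθw x)]
  have e : mulS θ (dX i (dX j u)) = dX i (dX j (mulS θ u)) - K := by
    rw [hK, dX_mulS hθ, map_add, dX_mulS hθ, dX_mulS (hθ.partialDeriv j)]
    abel
  calc extNorm a r' (fun x => ‖dX i (dX j u) x‖) ≤ eLpNorm (mulS θ (dX i (dX j u))) 2 (volume.restrict (ext r')) := by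
        refine eLpNorm_mono_ae ?_
        filter_upwards [ae_restrict_mem (measurableSet_ext r')] with x hx
        rw [mulS_apply hθ, hθ1 x hx, norm_mul, norm_mul, Complex.norm_real, norm_norm]
    _ ≤ eLpNorm (mulS θ (dX i (dX j u))) 2 volume := eLpNorm_mono_measure _ Measure.restrict_le_self
    _ = eLpNorm (⇑(dX i (dX j (mulS θ u))) - ⇑K) 2 volume := by
        rw [e]
        rfl
    _ ≤ eLpNorm (dX i (dX j (mulS θ u))) 2 volume + eLpNorm K 2 volume :=
        eLpNorm_sub_le (SchwartzMap.continuous _).aestronglyMeasurable (SchwartzMap.continuous _).aestronglyMeasurable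
          (by norm_num)
    _ ≤ ENNReal.ofReal (10 * C) * extNorm a r h + ENNReal.ofReal (3 * C) * extNorm a r h :=
        add_le_add ((eLpNorm_dX_dX_le i j _).trans hlap) hKb
    _ = _ := by
        rw [← add_mul, ← ENNReal.ofReal_add (by positivity) (by positivity)]
        congr 2
        ring

theorem continuous_wordSum_schwartz (n : ℕ) (u : 𝓢(E3, ℂ)) : Continuous (wordSum n u) :=
  continuous_wordSum n (u.smooth ⊤)

theorem extNorm_le_extNorm {a r : ℝ} {g h : E3 → ℝ} (hg0 : ∀ x, 0 ≤ g x) (hg : ∀ x, g x ≤ h x) :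
    extNorm a r g ≤ extNorm a r h :=
  extNorm_mono fun x => abs_le_abs_of_nonneg (hg0 x) (hg x)

/-- The region is shrunk twice, through the intermediate radius `(r + r')/2`: first for the
gradient, then for the second derivatives. -/
theorem exists_extNorm_wordSum_two_le (a : ℝ) {r r' : ℝ} (hr : 0 < r) (hrr : r < r') : ∃ C : ℝ, 0 ≤ C ∧
    ∀ u : 𝓢(E3, ℂ), extNorm a r' (wordSum 2 u) ≤ ENNReal.ofReal C * extNorm a r (fun x => ‖lapS u x‖ + ‖u x‖) := by
  obtain ⟨C₁, hC₁, h1⟩ := exists_extNorm_dX_le a hr (show r < (r + r') / 2 by linarith)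
  obtain ⟨C₂, hC₂, h2⟩ := exists_extNorm_dX_dX_le a (show 0 < (r + r') / 2 by linarith) (show (r + r') / 2 < r' by linarith)
  set m := (r + r') / 2 with hm
  refine ⟨(1 + 3 * C₁) + 9 * (C₂ * (1 + 3 * C₁)), by positivity, fun u => ?_⟩
  set X := extNorm a r (fun x => ‖lapS u x‖ + ‖u x‖) with hX
  have hc : ∀ v : 𝓢(E3, ℂ), Continuous fun x => ‖v x‖ := fun v => v.continuous.norm
  have e1 : ∀ v : 𝓢(E3, ℂ), wordSum 1 v = fun x => ‖v x‖ + ∑ k, ‖dX k v x‖ := fun v => by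
    ext x
    simp only [wordSum, dX_apply]
  have g1 : ∀ r₁, m ≤ r₁ → ∀ h : E3 → ℝ, Continuous h → extNorm a m h ≤ X →
      extNorm a r₁ (fun x => h x + ∑ k, ‖dX k u x‖) ≤ ENNReal.ofReal (1 + 3 * C₁) * X := by
    intro r₁ hr₁ h hh hhX
    calc _ ≤ extNorm a m (fun x => h x + ∑ k, ‖dX k u x‖) := extNorm_anti hr₁ _
      _ ≤ extNorm a m h + ∑ k, extNorm a m (fun x => ‖dX k u x‖) :=
          (extNorm_add_le a m hh (continuous_finsetSum _ fun k _ => hc (dX k u))).trans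
            (add_le_add le_rfl (extNorm_sum_le Finset.univ a m fun k => hc (dX k u)))
      _ ≤ X + ∑ _k : Fin 3, ENNReal.ofReal C₁ * X := add_le_add hhX (Finset.sum_le_sum fun k _ => h1 u k)
      _ = _ := by
          rw [Finset.sum_const, Finset.card_univ, Fintype.card_fin, nsmul_eq_mul, ENNReal.ofReal_add one_pos.le (by positivity),
            ENNReal.ofReal_mul (by norm_num)]
          simp
          ring
  have hu : extNorm a m (fun x => ‖u x‖) ≤ X := (extNorm_anti (by linarith) _).trans
    (extNorm_le_extNorm (fun x => norm_nonneg _) fun x => le_add_of_nonneg_left (norm_nonneg _))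
  have hl : extNorm a m (fun x => ‖lapS u x‖ + ‖u x‖) ≤ X := extNorm_anti (by linarith) _
  have hdd : ∀ i j, extNorm a r' (fun x => ‖dX i (dX j u) x‖) ≤ ENNReal.ofReal (C₂ * (1 + 3 * C₁)) * X := by
    intro i j
    refine (h2 u i j).trans ?_
    rw [ENNReal.ofReal_mul hC₂, mul_assoc]
    gcongr
    have := g1 m le_rfl _ ((hc (lapS u)).add (hc u)) hl
    refine this.trans' (le_of_eq ?_)
    rw [e1]
    simp only [Pi.add_apply, add_assoc]
  have e2 : wordSum 2 u = fun x => (‖u x‖ + ∑ k, ‖dX k u x‖) + ∑ k, ∑ j, ‖dX j (dX k u) x‖ := by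
    ext x
    simp only [wordSum, ← dX_coe, Finset.sum_add_distrib, add_assoc]
  rw [e2]
  calc _ ≤ extNorm a r' (fun x => ‖u x‖ + ∑ k, ‖dX k u x‖) + ∑ k, ∑ j, extNorm a r' (fun x => ‖dX j (dX k u) x‖) := by
        refine (extNorm_add_le a r' ((hc u).add (continuous_finsetSum _ fun k _ => hc (dX k u)))
          (continuous_finsetSum _ fun k _ => continuous_finsetSum _ fun j _ => hc (dX j (dX k u)))).trans
            (add_le_add le_rfl ?_)
        refine (extNorm_sum_le Finset.univ a r' fun k => continuous_finsetSum _ fun j _ => hc (dX j (dX k u))).trans ?_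
        exact Finset.sum_le_sum fun k _ => extNorm_sum_le Finset.univ a r' fun j => hc (dX j (dX k u))
    _ ≤ ENNReal.ofReal (1 + 3 * C₁) * X + ∑ _k : Fin 3, ∑ _j : Fin 3, ENNReal.ofReal (C₂ * (1 + 3 * C₁)) * X :=
        add_le_add (g1 r' (by linarith) _ (hc u) hu) (Finset.sum_le_sum fun k _ => Finset.sum_le_sum fun j _ => hdd j k)
    _ = _ := by
        rw [ENNReal.ofReal_add (p := 1 + 3 * C₁) (by positivity) (by positivity), ENNReal.ofReal_mul (p := 9) (by norm_num)]
        simp only [Finset.sum_const, Finset.card_univ, Fintype.card_fin, nsmul_eq_mul]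
        norm_num
        ring

/-- Partial derivatives commute with `Δ`, so the step applies the lower case to each `∂_k u`; no
further shrinking of the region is needed. -/
theorem exists_extNorm_wordSum_add_two_le (a : ℝ) {r r' : ℝ} (hr : 0 < r) (hrr : r < r') (n : ℕ) : ∃ C : ℝ, 0 ≤ C ∧
    ∀ u : 𝓢(E3, ℂ), extNorm a r' (wordSum (n + 2) u)
      ≤ ENNReal.ofReal C * (extNorm a r (wordSum n (lapS u)) + extNorm a r (wordSum n u)) := by
  induction n with
  | zero =>
    obtain ⟨C, hC, h⟩ := exists_extNorm_wordSum_two_le a hr hrr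
    refine ⟨C, hC, fun u => (h u).trans ?_⟩
    gcongr
    exact extNorm_add_le a r (lapS u).continuous.norm u.continuous.norm
  | succ n ih =>
    obtain ⟨C, hC, h⟩ := ih
    refine ⟨1 + 3 * C, by positivity, fun u => ?_⟩
    set X := extNorm a r (wordSum (n + 1) (lapS u)) + extNorm a r (wordSum (n + 1) u) with hX
    have e : wordSum (n + 3) u = fun x => ‖u x‖ + ∑ k, wordSum (n + 2) (dX k u) x := by
      ext x
      simp only [wordSum, ← dX_coe]
    have hk : ∀ k, extNorm a r' (wordSum (n + 2) (dX k u)) ≤ ENNReal.ofReal C * X := by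
      intro k
      refine (h (dX k u)).trans ?_
      rw [hX]
      gcongr
      · rw [← dX_lapS]
        exact extNorm_le_extNorm (wordSum_nonneg _ _) (wordSum_dX_le n k _)
      · exact extNorm_le_extNorm (wordSum_nonneg _ _) (wordSum_dX_le n k _)
    rw [show n + 1 + 2 = n + 3 from rfl, e]
    calc _ ≤ extNorm a r' (fun x => ‖u x‖) + ∑ k, extNorm a r' (wordSum (n + 2) (dX k u)) :=
          (extNorm_add_le a r' u.continuous.norm
            (continuous_finsetSum _ fun k _ => continuous_wordSum_schwartz (n + 2) (dX k u))).trans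
            (add_le_add le_rfl (extNorm_sum_le Finset.univ a r' fun k => continuous_wordSum_schwartz (n + 2) (dX k u)))
      _ ≤ X + ∑ _k : Fin 3, ENNReal.ofReal C * X := by
          refine add_le_add (((extNorm_anti hrr.le _).trans
            (extNorm_le_extNorm (fun _ => norm_nonneg _) fun x => norm_le_wordSum (n + 1) u x)).trans le_add_self)
            (Finset.sum_le_sum fun k _ => hk k)
      _ = _ := by
          rw [Finset.sum_const, Finset.card_univ, Fintype.card_fin, nsmul_eq_mul, ENNReal.ofReal_add one_pos.le (by positivity),
            ENNReal.ofReal_mul (by norm_num)]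
          simp
          ring

theorem exists_wordSum_le_of_eq_const (n : ℕ) {f : E3 → ℂ} (hf : ContDiff ℝ ∞ f) {r : ℝ} {c : ℂ}
    (h : ∀ x, r < ‖x‖ → f x = c) : ∃ C : ℝ, 0 < C ∧ ∀ x, wordSum n f x ≤ C := by
  obtain ⟨C, hC, h3⟩ := exists_norm_le_of_eq_const (continuous_wordSum n hf) (r := r) (c := ‖c‖) fun x hx => by
    have : f =ᶠ[𝓝 x] fun _ => c := by
      filter_upwards [continuous_norm.continuousAt.eventually (lt_mem_nhds hx)] with y hy using h y hy
    rw [wordSum_congr_nhds n this, wordSum_const]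
  exact ⟨C, hC, fun x => (le_abs_self _).trans (h3 x)⟩

theorem wordSum_sum_le {ι : Type*} (s : Finset ι) (n : ℕ) (v : ι → 𝓢(E3, ℂ)) (x : E3) :
    wordSum n (∑ i ∈ s, v i : 𝓢(E3, ℂ)) x ≤ ∑ i ∈ s, wordSum n (v i) x := by
  classical
  induction s using Finset.induction_on with
  | empty => exact (wordSum_zero_fun n x).le
  | insert i s hi ih =>
    rw [Finset.sum_insert hi, Finset.sum_insert hi]
    exact (wordSum_add_le n ((v i).smooth ⊤) ((∑ i ∈ s, v i : 𝓢(E3, ℂ)).smooth ⊤) x).trans (add_le_add le_rfl ih)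

/-! ### Exterior derivatives controlled by the Sobolev norms of `M` -/

namespace CompactPerturbation

variable {R₀ : ℝ} (M : CompactPerturbation R₀)

theorem wordSum_lapS_le_onePlusS (n : ℕ) (u : 𝓢(E3, ℂ)) {x : E3} (hx : R₀ < ‖x‖) :
    wordSum n (lapS u) x ≤ 2 * (wordSum n (M.onePlusS u) x + wordSum n u x) := by
  have e : ⇑(lapS u) =ᶠ[𝓝 x] fun y => (-2) * M.onePlusS u y + 2 * u y := by
    filter_upwards [continuous_norm.continuousAt.eventually (lt_mem_nhds hx)] with y hy
    rw [onePlusS_apply, add_apply, M.hamS_eq_lapS u hy]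
    ring
  have s1 : ContDiff ℝ ∞ (M.onePlusS u) := (M.onePlusS u).smooth ⊤
  have s2 : ContDiff ℝ ∞ u := u.smooth ⊤
  rw [wordSum_congr_nhds n e]
  refine (wordSum_add_le n (contDiff_const.mul s1) (contDiff_const.mul s2) x).trans_eq ?_
  rw [wordSum_const_mul n _ s1, wordSum_const_mul n _ s2, norm_neg, Complex.norm_two]
  ring

theorem sobolevNorm_zero_eq (l : ℝ) (u : 𝓢(E3, ℂ)) :
    M.sobolevNorm 0 l u = eLpNorm (fun x => weight 1 (l / 2) x * ‖u x‖) 2 M.vol := by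
  rw [sobolevNorm_eq]
  refine eLpNorm_congr_norm_ae (Eventually.of_forall fun x => ?_)
  rw [norm_mul, norm_mul, Complex.norm_real, norm_norm, japaneseBracket_rpow]
  rfl

theorem exists_eLpNorm_weight_le_sobolevNorm : ∃ C : ℝ, 0 ≤ C ∧ ∀ (l : ℝ) (u : 𝓢(E3, ℂ)),
    eLpNorm (fun x => weight 1 (l / 2) x * ‖u x‖) 2 volume ≤ ENNReal.ofReal C * M.sobolevNorm 0 l u := by
  obtain ⟨C, hC, h⟩ := M.exists_eLpNorm_le_vol
  refine ⟨C, hC.le, fun l u => ?_⟩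
  have := h fun x => ((weight 1 (l / 2) x * ‖u x‖ : ℝ) : ℂ)
  rw [sobolevNorm_zero_eq]
  have e : ∀ μ : Measure E3, eLpNorm (fun x => ((weight 1 (l / 2) x * ‖u x‖ : ℝ) : ℂ)) 2 μ
      = eLpNorm (fun x => weight 1 (l / 2) x * ‖u x‖) 2 μ := fun μ =>
    eLpNorm_congr_norm_ae (Eventually.of_forall fun x => Complex.norm_real _)
  rwa [e, e] at this

/-- Outside the ball of radius `R₀` one has `Δu = 2u - 2(1 + H)u`, so every two derivatives cost one
factor `1 + H`. Each step shrinks the region a little, which is why the induction covers all radii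
`r > R₀`. -/
theorem exists_extNorm_wordSum_le_sobolevNorm (hR₀ : 0 < R₀) {l : ℝ} (hl : 0 ≤ l) (m : ℕ) : ∀ {r : ℝ}, R₀ < r →
    ∃ C : ℝ, 0 ≤ C ∧ ∀ u : 𝓢(E3, ℂ), extNorm (l / 2) r (wordSum (2 * m) u) ≤ ENNReal.ofReal C * M.sobolevNorm m l u := by
  induction m with
  | zero =>
    intro r hr
    obtain ⟨C, hC, h⟩ := M.exists_eLpNorm_weight_le_sobolevNorm
    refine ⟨C, hC, fun u => (h l u).trans' ?_⟩
    exact eLpNorm_mono_measure _ Measure.restrict_le_self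
  | succ m ih =>
    intro r hr
    have hr' : R₀ < (R₀ + r) / 2 := by linarith
    obtain ⟨C, hC, h⟩ := ih hr'
    obtain ⟨C₁, hC₁, h1⟩ := exists_extNorm_wordSum_add_two_le (l / 2) (hR₀.trans hr') (show (R₀ + r) / 2 < r by linarith) (2 * m)
    obtain ⟨C₂, hC₂, h2⟩ := M.exists_sobolevNorm_le hl (Nat.le_succ m)
    set r' := (R₀ + r) / 2 with hr'def
    refine ⟨C₁ * (2 * (C + C * C₂) + C * C₂), by positivity, fun u => ?_⟩
    have hA : extNorm (l / 2) r' (wordSum (2 * m) (M.onePlusS u)) ≤ ENNReal.ofReal C * M.sobolevNorm (m + 1) l u := by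
      rw [sobolevNorm_succ]
      exact h _
    have hB : extNorm (l / 2) r' (wordSum (2 * m) u) ≤ ENNReal.ofReal (C * C₂) * M.sobolevNorm (m + 1) l u := by
      rw [ENNReal.ofReal_mul hC, mul_assoc]
      refine (h u).trans ?_
      gcongr
      exact h2 u
    have hL : extNorm (l / 2) r' (wordSum (2 * m) (lapS u))
        ≤ ENNReal.ofReal 2 * (extNorm (l / 2) r' (wordSum (2 * m) (M.onePlusS u)) + extNorm (l / 2) r' (wordSum (2 * m) u)) := by
      refine le_trans ?_ (mul_le_mul_right (extNorm_add_le _ _ (continuous_wordSum_schwartz _ _)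
        (continuous_wordSum_schwartz _ _)) _)
      refine extNorm_le_mul fun x hx => ?_
      have hx' : R₀ < ‖x‖ := hr'.trans_le hx
      rw [abs_of_nonneg (wordSum_nonneg _ _ _), abs_of_nonneg (add_nonneg (wordSum_nonneg _ _ _) (wordSum_nonneg _ _ _))]
      exact M.wordSum_lapS_le_onePlusS _ u hx'
    rw [show 2 * (m + 1) = 2 * m + 2 by ring]
    refine (h1 u).trans ?_
    rw [ENNReal.ofReal_mul hC₁, mul_assoc]
    gcongr
    calc _ ≤ ENNReal.ofReal 2 * (ENNReal.ofReal C * M.sobolevNorm (m + 1) l u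
          + ENNReal.ofReal (C * C₂) * M.sobolevNorm (m + 1) l u) + ENNReal.ofReal (C * C₂) * M.sobolevNorm (m + 1) l u := by
          refine add_le_add (hL.trans ?_) hB
          gcongr
      _ = _ := by
          rw [← add_mul, ← mul_assoc, ← add_mul, ← ENNReal.ofReal_add (by positivity) (by positivity),
            ← ENNReal.ofReal_mul (by norm_num), ← ENNReal.ofReal_add (by positivity) (by positivity)]

theorem exists_norm_onePlusS_le : ∃ C : ℝ, 0 ≤ C ∧ ∀ (u : 𝓢(E3, ℂ)) (x : E3), ‖M.onePlusS u x‖ ≤ C * wordSum 2 u x := by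
  obtain ⟨c, hc, hρ⟩ := M.exists_le_density
  obtain ⟨C₁, hC₁, h1⟩ := exists_wordSum_mul_le 1
  have hb : ∀ i j, ∃ C : ℝ, 0 < C ∧ ∀ x, wordSum 1 (fun x => (M.coeff i j x : ℂ)) x ≤ C := fun i j =>
    exists_wordSum_le_of_eq_const 1 (M.hasTemperateGrowth_coeff i j).1 (c := ((if i = j then 1 else 0 : ℝ) : ℂ))
      fun x hx => by rw [M.coeff_eq hx]
  choose B hB hb using hb
  have hB' := fun i j => (hB i j).le
  refine ⟨1 + 1 / 2 * (c⁻¹ * ∑ i, ∑ j, C₁ * B i j), by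
    have := Finset.sum_nonneg fun i (_ : i ∈ Finset.univ) => Finset.sum_nonneg fun j (_ : j ∈ Finset.univ) =>
      mul_nonneg hC₁ (hB' i j)
    positivity, fun u x => ?_⟩
  have hd : ‖M.divS u x‖ ≤ (∑ i, ∑ j, C₁ * B i j) * wordSum 2 u x := by
    rw [divS_apply, Finset.sum_mul, sum_apply]
    refine (norm_sum_le _ _).trans (Finset.sum_le_sum fun i _ => ?_)
    rw [Finset.sum_mul]
    refine (wordSum_dX_le 0 i _ x).trans ((wordSum_sum_le _ _ _ x).trans (Finset.sum_le_sum fun j _ => ?_))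
    have e : ⇑(mulS (fun x => (M.coeff i j x : ℂ)) (dX j u)) = fun y => (M.coeff i j y : ℂ) * dX j u y :=
      funext (mulS_apply (M.hasTemperateGrowth_coeff i j) _)
    rw [e]
    refine (h1 (M.hasTemperateGrowth_coeff i j).1 ((dX j u).smooth ⊤) x).trans ?_
    have := wordSum_nonneg 1 (dX j u) x
    have := hB' i j
    gcongr
    · exact hb i j x
    · exact wordSum_dX_le 1 j u x
  have hw := wordSum_nonneg 2 u x
  rw [onePlusS_apply, add_apply, hamS, smul_apply, ContinuousLinearMap.comp_apply, smul_apply,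
    mulS_apply M.hasTemperateGrowth_density_inv, smul_eq_mul, add_mul, one_mul]
  refine (norm_add_le _ _).trans (add_le_add (norm_le_wordSum 2 u x) ?_)
  rw [norm_mul, norm_mul, norm_inv, Complex.norm_real, Real.norm_of_nonneg (M.density_pos x).le, norm_neg]
  have h2 : ‖(1 / 2 : ℂ)‖ = 1 / 2 := by norm_num
  rw [h2, mul_assoc, mul_assoc]
  gcongr
  exact hρ x

end CompactPerturbation

/-! ### The exterior cutoff and the operator `(1 - φ) H²` -/

/-- Derivatives of positive order live on `|y| ≤ 2R`, where `|y|^n R^{-n} ≤ 2^n`. The constant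
depends on the `A n` only, hence it is uniform in `R` and `φ`. -/
theorem IsBump.exists_isSymbol (A : ℕ → ℝ) (N : ℕ) : ∃ B : ℝ, 0 ≤ B ∧ ∀ {R : ℝ} {φ : E3 → ℝ}, 0 < R → IsBump A R φ →
    IsSymbol 0 N B R (fun x => ((1 - φ x : ℝ) : ℂ)) := by
  refine ⟨1 + ∑ n ∈ Finset.range (N + 1), 2 ^ n * |A n|, by positivity, fun {R φ} hR hφ => ?_⟩
  have hB : ∀ n ≤ N, 2 ^ n * |A n| ≤ ∑ n ∈ Finset.range (N + 1), 2 ^ n * |A n| := fun n hn =>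
    Finset.single_le_sum (f := fun n => 2 ^ n * |A n|) (fun _ _ => by positivity) (Finset.mem_range.2 (by omega))
  have hs : ContDiff ℝ ∞ fun x => 1 - φ x := contDiff_const.sub hφ.smooth
  refine ⟨hasTemperateGrowth_of_eq_const (r := 2 * R) (c := 1) (Complex.ofRealCLM.contDiff.comp hs) fun x hx => by
    simp [hφ.eq_zero x hx], fun y hy => by simp [hφ.eq_one y hy.le], fun n hn y => ?_⟩
  have e0 : (fun x => ((1 - φ x : ℝ) : ℂ)) = Complex.ofRealLI ∘ fun x => 1 - φ x := rfl
  rw [add_zero, e0, LinearIsometry.norm_iteratedFDeriv_comp_left _ (hs.contDiffAt) (i := n) (by exact_mod_cast le_top)]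
  rcases Nat.eq_zero_or_pos n with rfl | hn0
  · rw [pow_zero, one_mul, norm_iteratedFDeriv_zero]
    have h1 := hφ.bound 0 y
    rw [norm_iteratedFDeriv_zero, pow_zero, mul_one] at h1
    have h2 := hB 0 hn
    rw [pow_zero, one_mul] at h2
    refine (norm_sub_le _ _).trans ?_
    rw [norm_one]
    linarith [le_abs_self (A 0)]
  · have e1 : iteratedFDeriv ℝ n (fun x => 1 - φ x) y = -iteratedFDeriv ℝ n φ y := by
      have h1 : (fun x => 1 - φ x) = (fun _ => (1 : ℝ)) - φ := rfl
      rw [h1, iteratedFDeriv_sub_apply contDiffAt_const (hφ.smooth.of_le (by exact_mod_cast le_top)).contDiffAt,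
        iteratedFDeriv_const_of_ne hn0.ne']
      simp
    rw [e1, norm_neg]
    by_cases hy : ‖y‖ ≤ 2 * R
    · calc ‖y‖ ^ n * ‖iteratedFDeriv ℝ n φ y‖ ≤ (2 * R) ^ n * (|A n| * R⁻¹ ^ n) := by
            gcongr
            exact (hφ.bound n y).trans (by gcongr; exact le_abs_self _)
        _ = 2 ^ n * |A n| := by
            rw [mul_pow, inv_pow]
            field_simp
        _ ≤ _ := (hB n hn).trans (le_add_of_nonneg_left zero_le_one)
    · have h : φ =ᶠ[𝓝 y] fun _ => 0 := by
        filter_upwards [continuous_norm.continuousAt.eventually (lt_mem_nhds (not_le.1 hy))] with x hx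
        exact hφ.eq_zero x hx
      rw [(h.iteratedFDeriv (𝕜 := ℝ) n).eq_of_nhds, iteratedFDeriv_fun_zero]
      simp
      positivity

namespace CompactPerturbation

variable {R₀ : ℝ} (M : CompactPerturbation R₀)

/-- The cutoff vanishes for `|x| < R`. At any other point `H = -½Δ` throughout a neighbourhood, so
the identity can be applied twice and yields `H² = ¼Δ²`. -/
theorem exteriorHSq_eq {N : ℕ} {B R : ℝ} {φ : E3 → ℝ} (hR : R₀ < R)
    (hφ : IsSymbol 0 N B R (fun x => ((1 - φ x : ℝ) : ℂ))) (u : 𝓢(E3, ℂ)) :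
    M.exteriorHSq φ u = ⇑((1 / 4 : ℂ) • mulS (fun x => ((1 - φ x : ℝ) : ℂ)) (lapS (lapS u))) := by
  ext x
  rw [smul_apply, mulS_apply hφ.temperate, smul_eq_mul, exteriorHSq, ← hamS_coe, ← hamS_coe]
  by_cases hx : ‖x‖ < R
  · rw [hφ.eq_zero x hx]; ring
  · have hx' : R₀ < ‖x‖ := hR.trans_le (not_lt.1 hx)
    have e : ⇑(M.hamS u) =ᶠ[𝓝 x] ⇑((-(1 / 2) : ℂ) • lapS u) := by
      filter_upwards [continuous_norm.continuousAt.eventually (lt_mem_nhds hx')] with y hy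
      rw [M.hamS_eq_lapS u hy]
      rfl
    have e2 : lapS (M.hamS u) x = lapS ((-(1 / 2) : ℂ) • lapS u) x := by
      rw [lapS_apply, lapS_apply, sum_apply, sum_apply]
      refine Finset.sum_congr rfl fun k _ => ?_
      rw [dX_coe, dX_coe, dX_coe, dX_coe]
      exact (partialDeriv_congr_nhds (partialDeriv_congr_nhds e k) k).eq_of_nhds
    rw [M.hamS_eq_lapS _ hx', e2, map_smul, smul_apply, smul_eq_mul]
    ring

/-- `Δ²` is a sum of words `∂_k∂_k∂_j∂_j`, and `1 + H` in the target norm is bounded by two more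
derivatives, six in all. The projection reaches only into `|z| ≥ R/4`, and `R/4 ≥ 2R₀` places this
region where the exterior regularity holds. -/
theorem exists_incoming_estimate (hR₀ : 0 < R₀) {w : ℝ → ℂ} (hw : IsSmoothWeight w) {B : ℝ} (hB : 0 ≤ B) :
    ∃ C : ℝ, 0 ≤ C ∧ ∀ (R s : ℝ) (φ : E3 → ℝ), 10 * R₀ ≤ R → 0 < s → IsSymbol 0 8 B R (fun x => ((1 - φ x : ℝ) : ℂ)) →
      ∀ f : 𝓢(E3, ℂ), M.sobolevNorm 1 (-8) (freeEvolution s (M.exteriorHSq φ (halfProj 1 hw f)))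
        ≤ ENNReal.ofReal (C * (R ^ 2 + s) ^ (-(9 / 8) : ℝ)) * M.sobolevNorm 10 0 f := by
  obtain ⟨C₁, hC₁, h1⟩ := M.exists_norm_onePlusS_le
  obtain ⟨C₂, hC₂, h2⟩ := M.exists_eLpNorm_vol_le
  have hinc := fun k j => exists_incoming_word_bound (show 0 < 10 * R₀ by positivity) 2 k [k, j, j] hw
  choose C₃ hC₃ h3 using hinc
  obtain ⟨C₄, hC₄, h4⟩ := M.exists_extNorm_wordSum_le_sobolevNorm hR₀ le_rfl 3 (show R₀ < 2 * R₀ by linarith)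
  obtain ⟨C₅, hC₅, h5⟩ := M.exists_sobolevNorm_le (l := 0) le_rfl (show 3 ≤ 10 by norm_num)
  have hS : 0 ≤ ∑ k, ∑ j, C₃ k j := Finset.sum_nonneg fun k _ => Finset.sum_nonneg fun j _ => hC₃ k j
  refine ⟨C₂ * (C₁ * ((∑ k, ∑ j, C₃ k j) * B)) * (C₄ * C₅), by positivity, fun R s φ hR hs hφ f => ?_⟩
  set a : E3 → ℂ := fun x => ((1 - φ x : ℝ) : ℂ) with ha
  set τ := (R ^ 2 + s) ^ (-(9 / 8) : ℝ) with hτ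
  have hτ0 : 0 ≤ τ := by positivity
  set W : Fin 3 → Fin 3 → 𝓢(E3, ℂ) := fun k j => freeEvolutionSchwartz s (mulS a (dWord (k :: [k, j, j]) (halfProj 1 hw f))) with hW
  set v : 𝓢(E3, ℂ) := (1 / 4 : ℂ) • mulS a (lapS (lapS (halfProj 1 hw f))) with hv
  have hvW : freeEvolutionSchwartz s v = (1 / 4 : ℂ) • ∑ k, ∑ j, W k j := by
    have e : lapS (lapS (halfProj 1 hw f)) = ∑ k, ∑ j, dWord (k :: [k, j, j]) (halfProj 1 hw f) := by
      rw [lapS_apply]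
      simp only [lapS_apply, map_sum]
      rfl
    rw [hv, map_smul, e]
    simp only [map_sum, hW]
  have hX : eLpNorm (wordSum 6 f) 2 (volume.restrict (ext (R / 4))) ≤ ENNReal.ofReal (C₄ * C₅) * M.sobolevNorm 10 0 f := by
    have e : extNorm (0 / 2) (2 * R₀) (wordSum 6 f) = eLpNorm (wordSum 6 f) 2 (volume.restrict (ext (2 * R₀))) := by
      simp [extNorm, weight]
    have h6 := h4 f
    rw [e] at h6
    refine (eLpNorm_mono_measure _ (Measure.restrict_mono (ext_mono (show 2 * R₀ ≤ R / 4 by linarith)) le_rfl)).trans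
      (h6.trans ?_)
    rw [ENNReal.ofReal_mul hC₄, mul_assoc]
    gcongr
    exact h5 f
  have hj : ∀ x, 0 < japaneseBracket x ^ (-8 : ℝ) := fun x => Real.rpow_pos_of_pos (japaneseBracket_pos x) _
  have hjc : Continuous fun x => japaneseBracket x ^ (-8 : ℝ) :=
    continuous_japaneseBracket.rpow_const fun x => Or.inl (japaneseBracket_pos x).ne'
  have hp : ∀ x, ‖((japaneseBracket x ^ (-8 : ℝ) : ℝ) : ℂ) * M.onePlusS (freeEvolutionSchwartz s v) x‖
      ≤ C₁ * ‖∑ k, ∑ j, japaneseBracket x ^ (-8 : ℝ) * wordSum 2 (W k j) x‖ := by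
    intro x
    have hn : 0 ≤ ∑ k, ∑ j, wordSum 2 (W k j) x := Finset.sum_nonneg fun k _ => Finset.sum_nonneg fun j _ => wordSum_nonneg _ _ _
    have e : wordSum 2 (freeEvolutionSchwartz s v) x ≤ ∑ k, ∑ j, wordSum 2 (W k j) x := by
      have e1 : ⇑(freeEvolutionSchwartz s v) = fun x => (1 / 4 : ℂ) * (∑ k, ∑ j, W k j : 𝓢(E3, ℂ)) x := by
        rw [hvW]; rfl
      have e2 : wordSum 2 (∑ k, ∑ j, W k j : 𝓢(E3, ℂ)) x ≤ ∑ k, ∑ j, wordSum 2 (W k j) x :=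
        (wordSum_sum_le _ _ _ x).trans (Finset.sum_le_sum fun k _ => wordSum_sum_le _ _ _ x)
      rw [e1, wordSum_const_mul 2 _ ((∑ k, ∑ j, W k j : 𝓢(E3, ℂ)).smooth ⊤)]
      have : ‖(1 / 4 : ℂ)‖ = 1 / 4 := by norm_num
      rw [this]
      linarith
    simp only [← Finset.mul_sum]
    rw [norm_mul, norm_mul, Complex.norm_real, Real.norm_of_nonneg (hj x).le, Real.norm_of_nonneg hn, mul_left_comm]
    have := hj x
    gcongr
    exact (h1 _ x).trans (by gcongr)
  have hWb : ∀ k j, eLpNorm (fun x => japaneseBracket x ^ (-8 : ℝ) * wordSum 2 (W k j) x) 2 volume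
      ≤ ENNReal.ofReal (C₃ k j * B * τ) * (ENNReal.ofReal (C₄ * C₅) * M.sobolevNorm 10 0 f) := fun k j =>
    (h3 k j B R s a hR hs hφ f).trans (by gcongr; exact hX)
  have hm : ∀ k j, AEStronglyMeasurable (fun x => japaneseBracket x ^ (-8 : ℝ) * wordSum 2 (W k j) x) volume := fun k j =>
    (hjc.mul (continuous_wordSum_schwartz 2 (W k j))).aestronglyMeasurable
  have hsum : eLpNorm (∑ k, ∑ j, fun x => japaneseBracket x ^ (-8 : ℝ) * wordSum 2 (W k j) x) 2 volume
      ≤ ENNReal.ofReal ((∑ k, ∑ j, C₃ k j) * B * τ) * (ENNReal.ofReal (C₄ * C₅) * M.sobolevNorm 10 0 f) := by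
    calc _ ≤ ∑ k, ∑ j, ENNReal.ofReal (C₃ k j * B * τ) * (ENNReal.ofReal (C₄ * C₅) * M.sobolevNorm 10 0 f) := by
          refine (eLpNorm_sum_le (fun k _ => Finset.aestronglyMeasurable_sum _ fun j _ => hm k j) (by norm_num)).trans ?_
          refine Finset.sum_le_sum fun k _ => (eLpNorm_sum_le (fun j _ => hm k j) (by norm_num)).trans ?_
          exact Finset.sum_le_sum fun j _ => hWb k j
      _ = _ := by
          simp only [← Finset.sum_mul]
          congr 1
          simp only [Finset.sum_mul]
          have hnn : ∀ k j, 0 ≤ C₃ k j * B * τ := fun k j => mul_nonneg (mul_nonneg (hC₃ k j) hB) hτ0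
          rw [ENNReal.ofReal_sum_of_nonneg fun k _ => Finset.sum_nonneg fun j _ => hnn k j]
          exact Finset.sum_congr rfl fun k _ => (ENNReal.ofReal_sum_of_nonneg fun j _ => hnn k j).symm
  rw [M.exteriorHSq_eq (by linarith) hφ, ← hv, ← freeEvolutionSchwartz_coe, sobolevNorm_eq]
  refine (h2 _).trans ?_
  calc _ ≤ ENNReal.ofReal C₂ * (ENNReal.ofReal C₁ *
        (ENNReal.ofReal ((∑ k, ∑ j, C₃ k j) * B * τ) * (ENNReal.ofReal (C₄ * C₅) * M.sobolevNorm 10 0 f))) := by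
        gcongr
        refine (eLpNorm_le_mul_eLpNorm_of_ae_le_mul (Eventually.of_forall fun x => ?_) 2).trans
          (mul_le_mul_right hsum (ENNReal.ofReal C₁))
        simp only [Finset.sum_apply]
        exact hp x
    _ = _ := by
        rw [show C₂ * (C₁ * ((∑ k, ∑ j, C₃ k j) * B)) * (C₄ * C₅) * τ
            = C₂ * (C₁ * (((∑ k, ∑ j, C₃ k j) * B * τ) * (C₄ * C₅))) by ring,
          ENNReal.ofReal_mul hC₂.le, ENNReal.ofReal_mul hC₁,
          ENNReal.ofReal_mul (q := C₄ * C₅) (mul_nonneg (mul_nonneg hS hB) hτ0)]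
        simp only [mul_assoc]

/-- As `3/2 + σ ≤ 2` and `|x| ≥ 10R₀` on the support of the cutoff, the weight is bounded by a
multiple of `|x|²`. The region `|z| ≥ 10R₀/8` from the far bound still lies outside the
perturbation. -/
theorem exists_outgoing_estimate (hR₀ : 0 < R₀) {w : ℝ → ℂ} (hw : IsSmoothWeight w) {B : ℝ} (hB : 0 ≤ B) :
    ∃ C : ℝ, 0 ≤ C ∧ ∀ (σ R s : ℝ) (φ : E3 → ℝ), σ ≤ 1 / 2 → 10 * R₀ ≤ R → 0 < s →
      IsSymbol 0 8 B R (fun x => ((1 - φ x : ℝ) : ℂ)) → ∀ f : 𝓢(E3, ℂ),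
      M.normL2 (fun x => ((japaneseBracket x ^ (3 / 2 + σ) : ℝ) : ℂ) *
          M.exteriorHSq φ (halfProj (-1) hw (freeEvolutionSchwartz s f)) x)
        ≤ ENNReal.ofReal (C * (R ^ 2 + s) ^ (-(9 / 8) : ℝ)) * M.sobolevNorm 9 11 f := by
  have hρ : 0 < 10 * R₀ := by positivity
  obtain ⟨C₁, hC₁, h1⟩ := exists_outgoing_bound hρ hw
  obtain ⟨C₂, hC₂, h2⟩ := M.exists_eLpNorm_vol_le
  obtain ⟨C₃, hC₃, h3⟩ := M.exists_eLpNorm_weight_le_sobolevNorm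
  obtain ⟨C₄, hC₄, h4⟩ := M.exists_extNorm_wordSum_le_sobolevNorm hR₀ (show (0 : ℝ) ≤ 11 by norm_num) 3
    (show R₀ < 10 * R₀ / 8 by linarith)
  obtain ⟨C₅, hC₅, h5⟩ := M.exists_sobolevNorm_le (l := 11) (by norm_num) (show 3 ≤ 9 by norm_num)
  obtain ⟨C₆, hC₆, h6⟩ := M.exists_sobolevNorm_le (l := 11) (by norm_num) (show 0 ≤ 9 by norm_num)
  set K := (1 + ((10 * R₀) ^ 2)⁻¹) * B with hK
  refine ⟨C₂ * K * C₁ * (C₃ * C₆ + C₄ * C₅), by positivity, fun σ R s φ hσ hR hs hφ f => ?_⟩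
  set τ := (R ^ 2 + s) ^ (-(9 / 8) : ℝ) with hτ
  have hτ0 : 0 ≤ τ := by positivity
  have hR0 : 0 < R := hρ.trans_le hR
  set u := halfProj (-1) hw (freeEvolutionSchwartz s f) with hu
  have hp : ∀ x, ‖((japaneseBracket x ^ (3 / 2 + σ) : ℝ) : ℂ) * M.exteriorHSq φ u x‖
      ≤ K * ‖(ext R).indicator (fun y => ((‖y‖ ^ 2 : ℝ) : ℂ) * lapS (lapS u) y) x‖ := by
    intro x
    rw [M.exteriorHSq_eq (by linarith) hφ, smul_apply, mulS_apply hφ.temperate, smul_eq_mul]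
    by_cases hx : x ∈ ext R
    · have hx' : R ≤ ‖x‖ := hx
      have hb := hφ.bound 0 (by norm_num) x
      rw [norm_iteratedFDeriv_zero, pow_zero, one_mul] at hb
      have n1 : ‖((japaneseBracket x ^ (3 / 2 + σ) : ℝ) : ℂ)‖ = japaneseBracket x ^ (3 / 2 + σ) := by
        rw [Complex.norm_real, Real.norm_of_nonneg (Real.rpow_nonneg (japaneseBracket_pos x).le _)]
      have n2 : ‖((‖x‖ ^ 2 : ℝ) : ℂ)‖ = ‖x‖ ^ 2 := by rw [Complex.norm_real, Real.norm_of_nonneg (by positivity)]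
      rw [Set.indicator_of_mem hx, norm_mul, norm_mul, norm_mul, norm_mul, n1, n2]
      have hq : ‖(1 / 4 : ℂ)‖ ≤ 1 := by norm_num
      have hjb : japaneseBracket x ^ (3 / 2 + σ) ≤ (1 + ((10 * R₀) ^ 2)⁻¹) * ‖x‖ ^ 2 := by
        calc japaneseBracket x ^ (3 / 2 + σ) ≤ japaneseBracket x ^ (2 : ℝ) :=
              Real.rpow_le_rpow_of_exponent_le (one_le_japaneseBracket x) (by linarith)
          _ = 1 + ‖x‖ ^ 2 := by
              rw [japaneseBracket_rpow, weight]; norm_num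
          _ ≤ _ := by
              have : 1 ≤ ((10 * R₀) ^ 2)⁻¹ * ‖x‖ ^ 2 := by
                rw [inv_mul_eq_div, one_le_div (by positivity)]
                exact pow_le_pow_left₀ hρ.le (hR.trans hx') 2
              linarith
      calc _ ≤ ((1 + ((10 * R₀) ^ 2)⁻¹) * ‖x‖ ^ 2) * (1 * (B * ‖lapS (lapS u) x‖)) := by gcongr
        _ = _ := by rw [hK]; ring
    · rw [hφ.eq_zero x (not_le.1 hx), zero_mul, mul_zero, mul_zero, norm_zero]
      positivity
  have hA : eLpNorm (fun z => japaneseBracket z ^ (11 : ℝ) * ‖f z‖) 2 volume ≤ ENNReal.ofReal (C₃ * C₆) * M.sobolevNorm 9 11 f := by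
    simp only [japaneseBracket_rpow]
    rw [ENNReal.ofReal_mul hC₃, mul_assoc]
    refine (h3 11 f).trans ?_
    gcongr
    exact h6 f
  have hE : eLpNorm (fun z => japaneseBracket z ^ (11 : ℝ) * wordSum 6 f z) 2 (volume.restrict (ext (10 * R₀ / 8)))
      ≤ ENNReal.ofReal (C₄ * C₅) * M.sobolevNorm 9 11 f := by
    simp only [japaneseBracket_rpow]
    rw [ENNReal.ofReal_mul hC₄, mul_assoc]
    refine (h4 f).trans ?_
    gcongr
    exact h5 f
  refine (h2 _).trans ?_
  calc _ ≤ ENNReal.ofReal C₂ * (ENNReal.ofReal K * (ENNReal.ofReal (C₁ * τ) *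
        (ENNReal.ofReal (C₃ * C₆) * M.sobolevNorm 9 11 f + ENNReal.ofReal (C₄ * C₅) * M.sobolevNorm 9 11 f))) := by
        gcongr
        refine (eLpNorm_le_mul_eLpNorm_of_ae_le_mul (Eventually.of_forall hp) 2).trans ?_
        rw [eLpNorm_indicator_eq_eLpNorm_restrict (measurableSet_ext R)]
        gcongr
        refine (h1 R s hR hs f).trans ?_
        gcongr
    _ = _ := by
        rw [← add_mul, ← ENNReal.ofReal_add (by positivity) (by positivity), ← mul_assoc, ← mul_assoc, ← mul_assoc,
          ← ENNReal.ofReal_mul hC₂.le, ← ENNReal.ofReal_mul (by positivity), ← ENNReal.ofReal_mul (by positivity)]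
        congr 2
        ring

end CompactPerturbation

/-! ### Choice of the window and conclusion -/

theorem exists_isSmoothWeight_eq_one : ∃ w : ℝ → ℂ, IsSmoothWeight w ∧ w 0 = 1 := by
  set β : ContDiffBump (0 : ℝ) := ⟨1 / 4, 1 / 2, by norm_num, by norm_num⟩ with hβ
  refine ⟨fun t => (β t : ℂ), ⟨Complex.ofRealCLM.contDiff.comp β.contDiff, fun t ht => ?_⟩, ?_⟩
  · rw [β.zero_of_le_dist (by rw [Real.dist_0_eq_abs]; exact ht.le), Complex.ofReal_zero]
  · have h : β 0 = 1 := β.one_of_mem_closedBall (by simp [hβ])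
    simp only [h, Complex.ofReal_one]

/-- The rate `9/8` exceeds `1 + σ` by `1/8 - σ ≥ 0`; the surplus power of `T` is bounded through the
lower bound `a`. -/
theorem rpow_neg_le_of_le {a T σ : ℝ} (ha : 0 < a) (haT : a ≤ T) (hσ : σ ≤ 1 / 8) :
    T ^ (-(9 / 8) : ℝ) ≤ a ^ (σ - 1 / 8) * T ^ (-1 - σ) := by
  have hT : 0 < T := ha.trans_le haT
  have e : T ^ (-(9 / 8) : ℝ) = T ^ (σ - 1 / 8) * T ^ (-1 - σ) := by
    rw [← Real.rpow_add hT]; congr 1; ring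
  rw [e]
  exact mul_le_mul_of_nonneg_right (Real.rpow_le_rpow_of_nonpos ha haT (by linarith)) (by positivity)

end

theorem proposition7p2 :
    ∃ σ₀ : ℝ, 0 < σ₀ ∧
    ∀ (R₀ : ℝ), 0 < R₀ → ∀ (M : CompactPerturbation R₀) (σ : ℝ), 0 < σ → σ < σ₀ →
    ∀ (A : ℕ → ℝ), ∃ C : ℝ, 0 < C ∧
    ∀ (R : ℝ), 10 * R₀ ≤ R → ∀ (φ : E3 → ℝ), IsBump A R φ →
    ∃ Pin Pout : 𝓢(E3, ℂ) →L[ℂ] 𝓢(E3, ℂ),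
      (∀ f : 𝓢(E3, ℂ),
        M.exteriorHSq φ f = M.exteriorHSq φ (Pin f) + M.exteriorHSq φ (Pout f)) ∧
      (∀ (s : ℝ), 0 < s → ∀ f : 𝓢(E3, ℂ),
        M.sobolevNorm 1 (-8) (freeEvolution s (M.exteriorHSq φ (Pin f))) ≤
          ENNReal.ofReal (C * (R ^ 2 + |s|) ^ (-1 - σ)) * M.sobolevNorm 10 0 f) ∧
      (∀ (s : ℝ), 0 < s → ∀ f : 𝓢(E3, ℂ),
        M.normL2 (fun x => ((japaneseBracket x ^ (3 / 2 + σ) : ℝ) : ℂ) *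
            M.exteriorHSq φ (Pout (freeEvolutionSchwartz s f)) x) ≤
          ENNReal.ofReal (C * (R ^ 2 + |s|) ^ (-1 - σ)) * M.sobolevNorm 9 11 f) := by
  -- The threshold `1/8` is the excess over `1` of the rate `9/8` obtained for both estimates.
  refine ⟨1 / 8, by norm_num, fun R₀ hR₀ M σ hσ hσ1 A => ?_⟩
  obtain ⟨w, hw, hw0⟩ := exists_isSmoothWeight_eq_one
  obtain ⟨B, hB, hsym⟩ := IsBump.exists_isSymbol A 8
  obtain ⟨C₁, hC₁, h1⟩ := M.exists_incoming_estimate hR₀ hw hB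
  obtain ⟨C₂, hC₂, h2⟩ := M.exists_outgoing_estimate hR₀ hw hB
  -- `κ` is the cost of lowering the rate from `9/8` to `1 + σ`, since `R² + s ≥ (10R₀)²`.
  set κ := ((10 * R₀) ^ 2) ^ (σ - 1 / 8) with hκ
  have hκ0 : 0 < κ := by positivity
  refine ⟨(C₁ + C₂ + 1) * κ, by positivity, fun R hR φ hφ => ?_⟩
  have hR0 : 0 < R := lt_of_lt_of_le (by positivity) hR
  have ha := hsym hR0 hφ
  have hrate : ∀ s : ℝ, 0 < s → ∀ c, 0 ≤ c → c ≤ C₁ + C₂ + 1 →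
      c * (R ^ 2 + s) ^ (-(9 / 8) : ℝ) ≤ (C₁ + C₂ + 1) * κ * (R ^ 2 + |s|) ^ (-1 - σ) := by
    intro s hs c hc hc1
    rw [abs_of_pos hs, mul_assoc]
    gcongr
    refine rpow_neg_le_of_le (by positivity) ?_ hσ1.le
    have := pow_le_pow_left₀ (by positivity) hR 2
    linarith
  refine ⟨halfProj 1 hw, halfProj (-1) hw, fun f => ?_, fun s hs f => ?_, fun s hs f => ?_⟩
  · have hsum := halfProj_add_halfProj hw hw0 f
    rw [M.exteriorHSq_eq (by linarith) ha, M.exteriorHSq_eq (by linarith) ha, M.exteriorHSq_eq (by linarith) ha]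
    conv_lhs => rw [← hsum]
    simp only [map_add, smul_add]
    rfl
  · refine (h1 R s φ hR hs ha f).trans ?_
    gcongr ENNReal.ofReal ?_ * _
    exact hrate s hs C₁ hC₁ (by linarith)
  · refine (h2 σ R s φ (by linarith) hR hs ha f).trans ?_
    gcongr ENNReal.ofReal ?_ * _
    exact hrate s hs C₂ hC₂ (by linarith)
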